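/- **Setting.** Let $(X,\mathcal O_X)$ be a topological space with a sheaf of commutative $\mathbb C$-algebras which locally has coordinates: every point has an open neighbourhood $V$ with functions $t_1,\dots,t_n$ and derivations $D_1,\dots,D_n\in\mathcal T_X(V)$, where $\mathcal T_X=\mathcal Der_{\mathbb C}(\mathcal O_X)$, such that $D_i(t_j)=\delta_{ij}$ and $\xi=\sum_i\xi(t_i)D_i$ for all local vector fields $\xi$ on $V$. (Smooth complex algebraic varieties, complex manifolds, and $C^\infty$-manifolds with complex-valued functions are examples.) Let $\Omega^1_X$ be the dual of $\mathcal T_X$, $\Omega^k_X$ the sheaf of $k$-forms, and $\Omega^{3,cl}_X\subset\Omega^3_X$ the closed 3-forms. A *vertex algebroid* is a sheaf of $\mathbb C$-vector spaces $\mathcal V$ with a $\mathbb C$-bilinear multiplication $f*v$ ($f\in\mathcal O_X$, $1*v=v$), a (left) Leibniz bracket $[\,,]$, a $\mathbb C$-linear morphism of Leibniz algebras $\pi:\mathcal V\to\mathcal T_X$, a symmetric $\mathbb C$-bilinear pairing $\langle\,,\rangle:\mathcal V\times\mathcal V\to\mathcal O_X$, and a $\mathbb C$-linear map $\partial:\mathcal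 O_X\to\mathcal V$ with $\pi\partial=0$, such that $$f*(g*v)-(fg)*v=\pi(v)(f)*\partial g+\pi(v)(g)*\partial f,\qquad [v_1,f*v_2]=\pi(v_1)(f)*v_2+f*[v_1,v_2],$$ $$[v_1,v_2]+[v_2,v_1]=\partial\langle v_1,v_2\rangle,\qquad \pi(f*v)=f\pi(v),\qquad \langle f*v_1,v_2\rangle=f\langle v_1,v_2\rangle-\pi(v_1)(\pi(v_2)(f)),$$ $$\pi(v)\langle v_1,v_2\rangle=\langle[v,v_1],v_2\rangle+\langle v_1,[v,v_2]\rangle,\qquad \partial(fg)=f*\partial g+g*\partial f,$$ $$[v,\partial f]=\partial(\pi(v)(f)),\qquad \langle v,\partial f\rangle=\pi(v)(f).$$ A *Courant algebroid* is an $\mathcal O_X$-module with the same kind of data, for which $\pi$ is $\mathcal O_X$-linear, $\langle\,,\rangle$ is $\mathcal O_X$-bilinear, $\partial$ is a derivation with $\pi\partial=0$, and $[q_1,fq_2]=f[q_1,q_2]+\pi(q_1)(f)q_2$, $\langle[q,q_1],q_2\rangle+\langle q_1,[q,q_2]\rangle=\pi(q)\langle q_1,q_2\rangle$, $[q,\partial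 f]=\partial(\pi(q)(f))$, $\langle q,\partial f\rangle=\pi(q)(f)$, $[q_1,q_2]+[q_2,q_1]=\partial\langle q_1,q_2\rangle$. In both cases $\partial$ is understood to induce a map $i:\Omega^1_X\to\mathcal V$, $i(f\,dg)=f*\partial g$ (automatic for algebraic varieties). Morphisms are $\mathbb C$-linear maps of sheaves preserving all the structure. Put $\Omega_{\mathcal V}=\mathcal O_X*\partial(\mathcal O_X)$, the subsheaf of local sums of sections $f*\partial g$. A *vertex* (resp. *Courant*) *extension* of a Lie $\mathcal O_X$-algebroid $\mathcal A$ is a vertex (resp. Courant) algebroid with an isomorphism of its quotient by $\Omega$ with $\mathcal A$, as Lie $\mathcal O_X$-algebroids; morphisms are those over $\mathcal A$. For $\mathcal A=\mathcal T_X$ one obtains the stack $\mathcal{EVA}$ of exact vertex algebroids (resp. $\mathcal{ECA}$, of exact Courant algebroids). If $\mathcal E$ is a vertex or Courant extension of $\mathcal A$ and $\mathcal Q\in\mathcal{ECA}$, then $\mathcal E+\mathcal Q$ is the push-out of $\mathcal E\times_{\mathcal T_X}\mathcal Q$ by $+:\Omega^1_X\times\Omega^1_X\to\Omega^1_X$,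 with the componentwise multiplication and bracket, $\langle(a_1,q_1),(a_2,q_2)\rangle=\langle a_1,a_2\rangle+\langle q_1,q_2\rangle$ and $\partial f=(\partial f,0)=(0,\partial f)$. The opposite $-\mathcal Q$ is $\mathcal Q$ with $-\langle\,,\rangle$ and $-\partial$. For a vertex extension $\widehat{\mathcal A}$ of $\mathcal A$ and $\mathcal V\in\mathcal{EVA}$, $\widehat{\mathcal A}-\mathcal V$ is the push-out of $\widehat{\mathcal A}\times_{\mathcal T_X}\mathcal V$ by $-:\Omega^1_X\times\Omega^1_X\to\Omega^1_X$, with the componentwise multiplication and bracket, $\langle(a_1,v_1),(a_2,v_2)\rangle=\langle a_1,a_2\rangle-\langle v_1,v_2\rangle$ and $\partial f=(\partial f,0)=(0,-\partial f)$. *Class of a torsor.* A stack in groupoids $\mathcal S$ of extensions of $\mathcal A$ on which $\mathcal{ECA}$ acts by $+$ is an $\mathcal{ECA}$-torsor if it is locally non-empty and, for each open $U$ and $s\in\mathcal S(U)$, $\mathcal Q\mapsto s+\mathcal Q$ is an equivalence from $\mathcal{ECA}(U)$ to $\mathcal S(U)$. $H^2(X;\Omega^2_X\to\Omega^{3,cl}_X)$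 is computed by cocycles $(B,H)$, $dB=\delta H$, $\delta B=0$, on hypercoverings $(U_i)$, $U_i\cap U_j=\bigcup_aV_{ij}^a$: choose $s_i\in\mathcal S(U_i)$, $\mathcal Q_a\in\mathcal{ECA}(V_{ij}^a)$ with $s_j=s_i+\mathcal Q_a$ on $V_{ij}^a$, and connections ($\mathcal O_X$-linear isotropic sections of the anchor) $\nabla_a$ on $\mathcal Q_a$. Then $H_a$ is the curvature $H_a(\xi_0,\xi_1,\xi_2)=\iota_{\xi_0}([\nabla_a\xi_1,\nabla_a\xi_2]-\nabla_a[\xi_1,\xi_2])$ of $\nabla_a$, and $B_{abc}$ (for $a,b,c$ over $ij,jk,ik$) is the 2-form with $\nabla_a+\nabla_b=\nabla_c+B_{abc}$ under $\mathcal Q_a+\mathcal Q_b=\mathcal Q_c$. **Statement.** Let $\mathcal A$ be a transitive Lie $\mathcal O_X$-algebroid (its anchor is surjective), locally free of finite rank over $\mathcal O_X$, and let $\widehat{\mathcal A}$ be a vertex extension of $\mathcal A$ on $X$. The pairing of $\widehat{\mathcal A}$ induces a unique $\mathcal O_X$-bilinear symmetric $\mathcal A$-invariant pairing $\langle\,,\rangle$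 on $\mathfrak g(\mathcal A)$, the kernel of the anchor of $\mathcal A$. Let $\mathcal{CEXT}(\mathcal A)_{\langle\,,\rangle}$ be the stack of Courant extensions of $\mathcal A$ which induce the pairing $\langle\,,\rangle$ on $\mathfrak g(\mathcal A)$. Then: 1. $\mathcal V\mapsto\widehat{\mathcal A}-\mathcal V$ defines a functor $\mathcal{EVA}(U)\to\mathcal{CEXT}(\mathcal A)_{\langle\,,\rangle}(U)$ for every open $U\subseteq X$, compatibly with restriction, and each of these functors is an equivalence of categories. Hence $\widehat{\mathcal A}-(\bullet)$ is an equivalence of stacks in groupoids $\mathcal{EVA}\to\mathcal{CEXT}(\mathcal A)_{\langle\,,\rangle}$. 2. It anti-commutes with the actions of $\mathcal{ECA}$: the formula $((a,v),q)\mapsto(a,v+q)$ defines an isomorphism $(\widehat{\mathcal A}-\mathcal V)+(-\mathcal Q)\cong\widehat{\mathcal A}-(\mathcal V+\mathcal Q)$ for $\mathcal V\in\mathcal{EVA}(U)$ and $\mathcal Q\in\mathcal{ECA}(U)$. 3. $\mathcal{EVA}$ and $\mathcal{CEXT}(\mathcal A)_{\langle\,,\rangle}$ are $\mathcal{ECA}$-torsors,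 and their classes in $H^2(X;\Omega^2_X\to\Omega^{3,cl}_X)$ are well defined and negatives of each other. -/

import Mathlib

open CategoryTheory TopologicalSpace Opposite

universe u

noncomputable section

namespace VertexAlgebroids

variable {X : TopCat.{u}}

/-! ### The structure sheaf, vector fields and differential forms -/

section Base

variable (O : TopCat.Sheaf (CommAlgCat.{u} ℂ) X)

/-- Sections of the structure sheaf over `V`. -/
abbrev Sec (V : Opens X) : Type u := O.presheaf.obj (op V)

/-- Restriction of functions. -/
def rs {V W : Opens X} (h : W ≤ V) : Sec O V →ₐ[ℂ] Sec O W :=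
  (O.presheaf.map (homOfLE h).op).hom

@[simp] lemma rs_rfl {V : Opens X} (h : V ≤ V) (f : Sec O V) : rs O h f = f := by
  simp [rs]

@[simp] lemma rs_rs {V W Z : Opens X} (h : W ≤ V) (h' : Z ≤ W) (f : Sec O V) :
    rs O h' (rs O h f) = rs O (h'.trans h) f := by
  have : (homOfLE (h'.trans h)).op = (homOfLE h).op ≫ (homOfLE h').op := rfl
  simp [rs, this]

/-- Sections over `V` of the tangent sheaf `𝒯_X = Der_ℂ(𝒪_X)`: derivations of the sheaf of
algebras `𝒪_X|_V`, as a `ℂ`-vector space. -/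
def vfSubmodule (V : Opens X) :
    Submodule ℂ (∀ W : Set.Iic V, Derivation ℂ (Sec O W.1) (Sec O W.1)) where
  carrier := {ξ | ∀ (W W' : Set.Iic V) (h : W'.1 ≤ W.1) (f : Sec O W.1),
    rs O h (ξ W f) = ξ W' (rs O h f)}
  add_mem' {a b} ha hb W W' h f := by simp [ha W W' h f, hb W W' h f]
  zero_mem' W W' h f := by simp
  smul_mem' c a ha W W' h f := by simp [ha W W' h f]

/-- Vector fields on `V`. -/
def VF (V : Opens X) : Type u := vfSubmodule O V

namespace VF

instance (V : Opens X) : AddCommGroup (VF O V) := inferInstanceAs (AddCommGroup (vfSubmodule O V))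

instance (V : Opens X) : Module ℂ (VF O V) := inferInstanceAs (Module ℂ (vfSubmodule O V))

variable {O}

/-- The derivation of `𝒪_X(W)` given by a vector field on `V ⊇ W`. -/
def at' {V : Opens X} (ξ : VF O V) (W : Opens X) (h : W ≤ V) :
    Derivation ℂ (Sec O W) (Sec O W) := ξ.1 ⟨W, h⟩

lemma rs_at {V : Opens X} (ξ : VF O V) {W W' : Opens X} (h : W ≤ V) (h' : W' ≤ W)
    (f : Sec O W) : rs O h' (ξ.at' W h f) = ξ.at' W' (h'.trans h) (rs O h' f) :=
  ξ.2 ⟨W, h⟩ ⟨W', h'.trans h⟩ h' f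

@[ext] lemma ext {V : Opens X} {ξ η : VF O V}
    (H : ∀ (W : Opens X) (h : W ≤ V) (f : Sec O W), ξ.at' W h f = η.at' W h f) : ξ = η := by
  apply Subtype.ext
  funext W
  exact Derivation.ext fun f => H W.1 W.2 f

/-- The function `ξ(f)`. -/
def app {V : Opens X} (ξ : VF O V) (f : Sec O V) : Sec O V := ξ.at' V le_rfl f

/-- The vector field with prescribed derivations. -/
def mk {V : Opens X} (d : ∀ W : Opens X, W ≤ V → Derivation ℂ (Sec O W) (Sec O W))
    (hd : ∀ (W W' : Opens X) (h : W ≤ V) (h' : W' ≤ W) (f : Sec O W),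
      rs O h' (d W h f) = d W' (h'.trans h) (rs O h' f)) : VF O V :=
  ⟨fun W => d W.1 W.2, fun W W' h f => hd W.1 W'.1 W.2 h f⟩

@[simp] lemma mk_at {V : Opens X} (d : ∀ W : Opens X, W ≤ V → Derivation ℂ (Sec O W) (Sec O W))
    (hd) (W : Opens X) (h : W ≤ V) : (mk (O := O) d hd).at' W h = d W h := rfl

@[simp] lemma add_at {V : Opens X} (ξ η : VF O V) (W : Opens X) (h : W ≤ V) :
    (ξ + η).at' W h = ξ.at' W h + η.at' W h := rfl

@[simp] lemma zero_at {V : Opens X} (W : Opens X) (h : W ≤ V) :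
    (0 : VF O V).at' W h = 0 := rfl

@[simp] lemma smulC_at {V : Opens X} (c : ℂ) (ξ : VF O V) (W : Opens X) (h : W ≤ V) :
    (c • ξ).at' W h = c • ξ.at' W h := rfl

/-- `𝒯_X(V)` is an `𝒪_X(V)`-module. -/
instance instSMul (V : Opens X) : SMul (Sec O V) (VF O V) :=
  ⟨fun f ξ => mk (fun W h => rs O h f • ξ.at' W h) (by
    intro W W' h h' g
    simp [rs_at])⟩

@[simp] lemma smul_at {V : Opens X} (f : Sec O V) (ξ : VF O V) (W : Opens X) (h : W ≤ V) :
    (f • ξ).at' W h = rs O h f • ξ.at' W h := rfl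

instance (V : Opens X) : Module (Sec O V) (VF O V) where
  one_smul ξ := by ext; simp
  mul_smul f g ξ := by ext; simp [mul_assoc]
  smul_zero f := by ext; simp
  smul_add f ξ η := by ext; simp
  add_smul f g ξ := by ext; simp [add_mul]
  zero_smul ξ := by ext; simp

/-- The commutator of vector fields. -/
instance (V : Opens X) : Bracket (VF O V) (VF O V) :=
  ⟨fun ξ η => mk (fun W h => ⁅ξ.at' W h, η.at' W h⁆) (by
    intro W W' h h' g
    simp [Derivation.commutator_apply, rs_at])⟩

@[simp] lemma bracket_at {V : Opens X} (ξ η : VF O V) (W : Opens X) (h : W ≤ V) :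
    ⁅ξ, η⁆.at' W h = ⁅ξ.at' W h, η.at' W h⁆ := rfl

/-- Restriction of vector fields. -/
def res {V W : Opens X} (h : W ≤ V) : VF O V →ₗ[ℂ] VF O W where
  toFun ξ := mk (fun Z hZ => ξ.at' Z (hZ.trans h)) (fun _ _ _ h' f => ξ.rs_at _ h' f)
  map_add' _ _ := rfl
  map_smul' _ _ := rfl

@[simp] lemma res_at {V W : Opens X} (h : W ≤ V) (ξ : VF O V) (Z : Opens X) (hZ : Z ≤ W) :
    (res h ξ).at' Z hZ = ξ.at' Z (hZ.trans h) := rfl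

end VF

/-- `X` is smooth: locally there are functions `t₁, …, tₙ` and vector fields `D₁, …, Dₙ` with
`Dᵢ(tⱼ) = δᵢⱼ` such that every vector field is `ξ = ∑ ξ(tᵢ) Dᵢ` (so that `𝒯_X` is locally free
with basis `Dᵢ`, and its dual `Ω¹_X` has basis `dtᵢ`). The number `n` may depend on the point. -/
def HasLocalCoordinates : Prop :=
  ∀ x : X, ∃ V : Opens X, x ∈ V ∧ ∃ (n : ℕ) (t : Fin n → Sec O V) (D : Fin n → VF O V),
    (∀ i j, (D i).app (t j) = if i = j then 1 else 0) ∧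
    ∀ (W : Opens X) (h : W ≤ V) (ξ : VF O W),
      ξ = ∑ i, ξ.app (rs O h (t i)) • VF.res h (D i)

/-- Alternating `𝒪`-multilinear forms in `k` vector fields, given compatibly on all open subsets
of `V`. -/
def formSubgroup (k : ℕ) (V : Opens X) :
    AddSubgroup (∀ W : Set.Iic V, (VF O W.1) [⋀^Fin k]→ₗ[Sec O W.1] (Sec O W.1)) where
  carrier := {ω | ∀ (W W' : Set.Iic V) (h : W'.1 ≤ W.1) (ξ : Fin k → VF O W.1),
    rs O h (ω W ξ) = ω W' (fun i => VF.res h (ξ i))}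
  add_mem' {a b} ha hb W W' h ξ := by simp [ha W W' h ξ, hb W W' h ξ]
  zero_mem' W W' h ξ := by simp
  neg_mem' {a} ha W W' h ξ := by simp [ha W W' h ξ]

/-- Differential `k`-forms on `V`, i.e. sections of `Ω^k_X`. -/
def Form (k : ℕ) (V : Opens X) : Type u := formSubgroup O k V

instance (k : ℕ) (V : Opens X) : AddCommGroup (Form O k V) :=
  inferInstanceAs (AddCommGroup (formSubgroup O k V))

variable {O}

/-- The value of a form on vector fields defined on `W ⊆ V`. -/
def Form.ev {k : ℕ} {V : Opens X} (ω : Form O k V) (W : Opens X) (h : W ≤ V)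
    (ξ : Fin k → VF O W) : Sec O W := ω.1 ⟨W, h⟩ ξ

@[simp] lemma Form.neg_ev {k : ℕ} {V : Opens X} (ω : Form O k V) (W : Opens X) (h : W ≤ V)
    (ξ : Fin k → VF O W) : (-ω).ev W h ξ = -ω.ev W h ξ := rfl

/-- The exterior derivative, evaluated on vector fields (Cartan's formula). In the second sum the
pair `(i, j)` with `i ≤ j` stands for the pair of positions `i < j + 1`. -/
def extD {n : ℕ} {V : Opens X} (ω : Form O (n + 1) V) (W : Opens X) (h : W ≤ V)
    (ξ : Fin (n + 2) → VF O W) : Sec O W :=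
  (∑ i : Fin (n + 2), (-1) ^ (i : ℕ) * (ξ i).app (ω.ev W h (i.removeNth ξ))) +
  ∑ i : Fin (n + 2), ∑ j : Fin (n + 1), if i ≤ j.castSucc then
    (-1) ^ ((i : ℕ) + (j : ℕ) + 1) *
      ω.ev W h (Fin.cons ⁅ξ i, ξ j.succ⁆ (j.removeNth (i.removeNth ξ)))
  else 0

lemma extD_neg {n : ℕ} {V : Opens X} (ω : Form O (n + 1) V) (W : Opens X) (h : W ≤ V)
    (ξ : Fin (n + 2) → VF O W) : extD (-ω) W h ξ = -extD ω W h ξ := by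
  simp only [extD, Form.neg_ev, VF.app, map_neg, mul_neg, Finset.sum_neg_distrib, neg_add]
  congr 1
  rw [← Finset.sum_neg_distrib]
  refine Finset.sum_congr rfl fun i _ => ?_
  rw [← Finset.sum_neg_distrib]
  refine Finset.sum_congr rfl fun j _ => ?_
  split_ifs <;> simp

/-- Closed forms. -/
def Form.IsClosed {n : ℕ} {V : Opens X} (ω : Form O (n + 1) V) : Prop :=
  ∀ (W : Opens X) (h : W ≤ V) (ξ : Fin (n + 2) → VF O W), extD ω W h ξ = 0

end Base

/-! ### Lie algebroids -/

/-- The data of a presheaf of `ℂ`-vector spaces with an action of `𝒪_X`, a bracket and an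
anchor. -/
structure LieAlgebroidData (O : TopCat.Sheaf (CommAlgCat.{u} ℂ) X) where
  sec : Opens X → Type u
  [addCommGroup : ∀ V, AddCommGroup (sec V)]
  [module : ∀ V, Module ℂ (sec V)]
  res : ∀ {V W : Opens X}, W ≤ V → (sec V →ₗ[ℂ] sec W)
  act : ∀ {V : Opens X}, Sec O V →ₗ[ℂ] sec V →ₗ[ℂ] sec V
  br : ∀ {V : Opens X}, sec V →ₗ[ℂ] sec V →ₗ[ℂ] sec V
  anchor : ∀ {V : Opens X}, sec V →ₗ[ℂ] VF O V
  res_rfl : ∀ {V : Opens X} (a : sec V), res le_rfl a = a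
  res_res : ∀ {V W Z : Opens X} (h : W ≤ V) (h' : Z ≤ W) (a : sec V),
    res h' (res h a) = res (h'.trans h) a
  res_act : ∀ {V W : Opens X} (h : W ≤ V) (f : Sec O V) (a : sec V),
    res h (act f a) = act (rs O h f) (res h a)
  res_br : ∀ {V W : Opens X} (h : W ≤ V) (a b : sec V), res h (br a b) = br (res h a) (res h b)
  res_anchor : ∀ {V W : Opens X} (h : W ≤ V) (a : sec V),
    VF.res h (anchor a) = anchor (res h a)

attribute [instance] LieAlgebroidData.addCommGroup LieAlgebroidData.module

namespace LieAlgebroidData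

variable {O : TopCat.Sheaf (CommAlgCat.{u} ℂ) X}

/-- A Lie `𝒪_X`-algebroid. -/
structure IsLieAlgebroid (A : LieAlgebroidData O) : Prop where
  /-- the sheaf condition -/
  glue : ∀ {ι : Type u} (V : ι → Opens X) (s : ∀ i, A.sec (V i)),
    (∀ i j, A.res (inf_le_left : V i ⊓ V j ≤ V i) (s i) =
      A.res (inf_le_right : V i ⊓ V j ≤ V j) (s j)) →
    ∃! t : A.sec (iSup V), ∀ i, A.res (le_iSup V i) t = s i
  one_act : ∀ {V : Opens X} (a : A.sec V), A.act 1 a = a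
  mul_act : ∀ {V : Opens X} (f g : Sec O V) (a : A.sec V), A.act (f * g) a = A.act f (A.act g a)
  br_self : ∀ {V : Opens X} (a : A.sec V), A.br a a = 0
  jacobi : ∀ {V : Opens X} (a b c : A.sec V),
    A.br a (A.br b c) = A.br (A.br a b) c + A.br b (A.br a c)
  anchor_act : ∀ {V : Opens X} (f : Sec O V) (a : A.sec V), A.anchor (A.act f a) = f • A.anchor a
  anchor_br : ∀ {V : Opens X} (a b : A.sec V), A.anchor (A.br a b) = ⁅A.anchor a, A.anchor b⁆
  br_act : ∀ {V : Opens X} (a b : A.sec V) (f : Sec O V),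
    A.br a (A.act f b) = A.act f (A.br a b) + A.act ((A.anchor a).app f) b

/-- The anchor is an epimorphism of sheaves. -/
def IsTransitive (A : LieAlgebroidData O) : Prop :=
  ∀ (V : Opens X) (ξ : VF O V) (x : X), x ∈ V →
    ∃ (W : Opens X) (h : W ≤ V) (a : A.sec W), x ∈ W ∧ A.anchor a = VF.res h ξ

/-- Locally free of finite rank over `𝒪_X`. -/
def IsLocallyFree (A : LieAlgebroidData O) : Prop :=
  ∀ x : X, ∃ V : Opens X, x ∈ V ∧ ∃ (n : ℕ) (e : Fin n → A.sec V),
    ∀ (W : Opens X) (h : W ≤ V) (a : A.sec W),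
      ∃! c : Fin n → Sec O W, a = ∑ i, A.act (c i) (A.res h (e i))

/-- An `𝒪_X`-bilinear symmetric `𝒜`-invariant pairing on `𝔤(𝒜)`, the kernel of the anchor. -/
structure InvPairing (A : LieAlgebroidData O) where
  toFun : ∀ {V : Opens X}, LinearMap.ker (A.anchor (V := V)) →ₗ[ℂ]
    LinearMap.ker (A.anchor (V := V)) →ₗ[ℂ] Sec O V
  res_toFun : ∀ {V W : Opens X} (h : W ≤ V) (b c : LinearMap.ker (A.anchor (V := V)))
    (b' c' : LinearMap.ker (A.anchor (V := W))), b'.1 = A.res h b.1 → c'.1 = A.res h c.1 →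
    rs O h (toFun b c) = toFun b' c'
  symm : ∀ {V : Opens X} (b c : LinearMap.ker (A.anchor (V := V))), toFun b c = toFun c b
  act_left : ∀ {V : Opens X} (f : Sec O V) (b b' c : LinearMap.ker (A.anchor (V := V))),
    b'.1 = A.act f b.1 → toFun b' c = f * toFun b c
  invariant : ∀ {V : Opens X} (a : A.sec V) (b c b' c' : LinearMap.ker (A.anchor (V := V))),
    b'.1 = A.br a b.1 → c'.1 = A.br a c.1 →
    (A.anchor a).app (toFun b c) = toFun b' c + toFun b c'

end LieAlgebroidData

/-- The tangent sheaf `𝒯_X` as a Lie algebroid (with the identity as its anchor). -/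
def tangent (O : TopCat.Sheaf (CommAlgCat.{u} ℂ) X) : LieAlgebroidData O where
  sec V := VF O V
  res h := VF.res h
  act {V} := LinearMap.mk₂ ℂ (fun f ξ => f • ξ) (fun _ _ _ => add_smul _ _ _)
    (fun c f ξ => by ext; simp) (fun _ _ _ => smul_add _ _ _)
    (fun c f ξ => by ext; simp)
  br {V} := LinearMap.mk₂ ℂ (fun ξ η => ⁅ξ, η⁆)
    (fun _ _ _ => by ext; simp) (fun _ _ _ => by ext; simp)
    (fun _ _ _ => by ext; simp) (fun _ _ _ => by ext; simp)
  anchor := LinearMap.id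
  res_rfl _ := rfl
  res_res _ _ _ := rfl
  res_act h f a := by ext; simp
  res_br h a b := by ext; simp
  res_anchor _ _ := rfl

/-! ### Courant and vertex algebroids -/

/-- The data underlying both Courant and vertex algebroids on an open set `U`: a sheaf of
`ℂ`-vector spaces on `U` (sections are indexed by the open `V ≤ U`) with a multiplication by
functions, a bracket, an anchor, a pairing, and a map `∂` from functions. -/
structure AlgebroidData (O : TopCat.Sheaf (CommAlgCat.{u} ℂ) X) (U : Opens X) where
  sec : ∀ V : Opens X, V ≤ U → Type u
  [addCommGroup : ∀ V hV, AddCommGroup (sec V hV)]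
  [module : ∀ V hV, Module ℂ (sec V hV)]
  res : ∀ {V W : Opens X} (hV : V ≤ U) (h : W ≤ V), sec V hV →ₗ[ℂ] sec W (h.trans hV)
  /-- `f * v` -/
  act : ∀ {V : Opens X} (hV : V ≤ U), Sec O V →ₗ[ℂ] sec V hV →ₗ[ℂ] sec V hV
  /-- `[v, w]` -/
  br : ∀ {V : Opens X} (hV : V ≤ U), sec V hV →ₗ[ℂ] sec V hV →ₗ[ℂ] sec V hV
  /-- `π` -/
  anchor : ∀ {V : Opens X} (hV : V ≤ U), sec V hV →ₗ[ℂ] VF O V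
  /-- `⟨v, w⟩` -/
  pair : ∀ {V : Opens X} (hV : V ≤ U), sec V hV →ₗ[ℂ] sec V hV →ₗ[ℂ] Sec O V
  /-- `∂` -/
  der : ∀ {V : Opens X} (hV : V ≤ U), Sec O V →ₗ[ℂ] sec V hV
  res_rfl : ∀ {V : Opens X} (hV : V ≤ U) (a : sec V hV), res hV le_rfl a = a
  res_res : ∀ {V W Z : Opens X} (hV : V ≤ U) (h : W ≤ V) (h' : Z ≤ W) (a : sec V hV),
    res (h.trans hV) h' (res hV h a) = res hV (h'.trans h) a
  glue : ∀ {ι : Type u} (V : ι → Opens X) (hV : ∀ i, V i ≤ U) (s : ∀ i, sec (V i) (hV i)),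
    (∀ i j, res (hV i) (inf_le_left : V i ⊓ V j ≤ V i) (s i) =
      res (hV j) (inf_le_right : V i ⊓ V j ≤ V j) (s j)) →
    ∃! t : sec (iSup V) (iSup_le hV), ∀ i, res (iSup_le hV) (le_iSup V i) t = s i
  res_act : ∀ {V W : Opens X} (hV : V ≤ U) (h : W ≤ V) (f : Sec O V) (a : sec V hV),
    res hV h (act hV f a) = act (h.trans hV) (rs O h f) (res hV h a)
  res_br : ∀ {V W : Opens X} (hV : V ≤ U) (h : W ≤ V) (a b : sec V hV),
    res hV h (br hV a b) = br (h.trans hV) (res hV h a) (res hV h b)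
  res_anchor : ∀ {V W : Opens X} (hV : V ≤ U) (h : W ≤ V) (a : sec V hV),
    VF.res h (anchor hV a) = anchor (h.trans hV) (res hV h a)
  res_pair : ∀ {V W : Opens X} (hV : V ≤ U) (h : W ≤ V) (a b : sec V hV),
    rs O h (pair hV a b) = pair (h.trans hV) (res hV h a) (res hV h b)
  res_der : ∀ {V W : Opens X} (hV : V ≤ U) (h : W ≤ V) (f : Sec O V),
    res hV h (der hV f) = der (h.trans hV) (rs O h f)

attribute [instance] AlgebroidData.addCommGroup AlgebroidData.module

namespace AlgebroidData

variable {O : TopCat.Sheaf (CommAlgCat.{u} ℂ) X} {U : Opens X}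

/-- The map `f dg ↦ f * ∂g` is well defined on `Ω¹_X`, i.e. `∂` induces a map from `Ω¹_X`, the
dual of `𝒯_X`: if `∑ fₖ dgₖ = 0` then `∑ fₖ * ∂gₖ = 0`. -/
def DerFactors (E : AlgebroidData O U) : Prop :=
  ∀ {V : Opens X} (hV : V ≤ U) (n : ℕ) (f g : Fin n → Sec O V),
    (∀ (W : Opens X) (h : W ≤ V) (ξ : VF O W),
      ∑ k, rs O h (f k) * ξ.app (rs O h (g k)) = 0) →
    ∑ k, E.act hV (f k) (E.der hV (g k)) = 0

/-- A Courant `𝒪`-algebroid on `U`. -/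
structure IsCourant (E : AlgebroidData O U) : Prop where
  one_act : ∀ {V : Opens X} (hV : V ≤ U) (a : E.sec V hV), E.act hV 1 a = a
  mul_act : ∀ {V : Opens X} (hV : V ≤ U) (f g : Sec O V) (a : E.sec V hV),
    E.act hV (f * g) a = E.act hV f (E.act hV g a)
  leibniz : ∀ {V : Opens X} (hV : V ≤ U) (a b c : E.sec V hV),
    E.br hV a (E.br hV b c) = E.br hV (E.br hV a b) c + E.br hV b (E.br hV a c)
  anchor_act : ∀ {V : Opens X} (hV : V ≤ U) (f : Sec O V) (a : E.sec V hV),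
    E.anchor hV (E.act hV f a) = f • E.anchor hV a
  anchor_br : ∀ {V : Opens X} (hV : V ≤ U) (a b : E.sec V hV),
    E.anchor hV (E.br hV a b) = ⁅E.anchor hV a, E.anchor hV b⁆
  pair_symm : ∀ {V : Opens X} (hV : V ≤ U) (a b : E.sec V hV), E.pair hV a b = E.pair hV b a
  pair_act : ∀ {V : Opens X} (hV : V ≤ U) (f : Sec O V) (a b : E.sec V hV),
    E.pair hV (E.act hV f a) b = f * E.pair hV a b
  der_mul : ∀ {V : Opens X} (hV : V ≤ U) (f g : Sec O V),
    E.der hV (f * g) = E.act hV f (E.der hV g) + E.act hV g (E.der hV f)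
  anchor_der : ∀ {V : Opens X} (hV : V ≤ U) (f : Sec O V), E.anchor hV (E.der hV f) = 0
  br_act : ∀ {V : Opens X} (hV : V ≤ U) (a b : E.sec V hV) (f : Sec O V),
    E.br hV a (E.act hV f b) = E.act hV f (E.br hV a b) + E.act hV ((E.anchor hV a).app f) b
  pair_inv : ∀ {V : Opens X} (hV : V ≤ U) (a b c : E.sec V hV),
    E.pair hV (E.br hV a b) c + E.pair hV b (E.br hV a c) = (E.anchor hV a).app (E.pair hV b c)
  br_der : ∀ {V : Opens X} (hV : V ≤ U) (a : E.sec V hV) (f : Sec O V),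
    E.br hV a (E.der hV f) = E.der hV ((E.anchor hV a).app f)
  pair_der : ∀ {V : Opens X} (hV : V ≤ U) (a : E.sec V hV) (f : Sec O V),
    E.pair hV a (E.der hV f) = (E.anchor hV a).app f
  br_symm : ∀ {V : Opens X} (hV : V ≤ U) (a b : E.sec V hV),
    E.br hV a b + E.br hV b a = E.der hV (E.pair hV a b)
  der_factors : E.DerFactors

/-- A vertex `𝒪`-algebroid on `U`. -/
structure IsVertex (E : AlgebroidData O U) : Prop where
  one_act : ∀ {V : Opens X} (hV : V ≤ U) (a : E.sec V hV), E.act hV 1 a = a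
  leibniz : ∀ {V : Opens X} (hV : V ≤ U) (a b c : E.sec V hV),
    E.br hV a (E.br hV b c) = E.br hV (E.br hV a b) c + E.br hV b (E.br hV a c)
  anchor_br : ∀ {V : Opens X} (hV : V ≤ U) (a b : E.sec V hV),
    E.anchor hV (E.br hV a b) = ⁅E.anchor hV a, E.anchor hV b⁆
  pair_symm : ∀ {V : Opens X} (hV : V ≤ U) (a b : E.sec V hV), E.pair hV a b = E.pair hV b a
  anchor_der : ∀ {V : Opens X} (hV : V ≤ U) (f : Sec O V), E.anchor hV (E.der hV f) = 0
  assoc : ∀ {V : Opens X} (hV : V ≤ U) (f g : Sec O V) (a : E.sec V hV),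
    E.act hV f (E.act hV g a) - E.act hV (f * g) a =
      E.act hV ((E.anchor hV a).app f) (E.der hV g) +
      E.act hV ((E.anchor hV a).app g) (E.der hV f)
  br_act : ∀ {V : Opens X} (hV : V ≤ U) (a b : E.sec V hV) (f : Sec O V),
    E.br hV a (E.act hV f b) = E.act hV ((E.anchor hV a).app f) b + E.act hV f (E.br hV a b)
  br_symm : ∀ {V : Opens X} (hV : V ≤ U) (a b : E.sec V hV),
    E.br hV a b + E.br hV b a = E.der hV (E.pair hV a b)
  anchor_act : ∀ {V : Opens X} (hV : V ≤ U) (f : Sec O V) (a : E.sec V hV),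
    E.anchor hV (E.act hV f a) = f • E.anchor hV a
  pair_act : ∀ {V : Opens X} (hV : V ≤ U) (f : Sec O V) (a b : E.sec V hV),
    E.pair hV (E.act hV f a) b =
      f * E.pair hV a b - (E.anchor hV a).app ((E.anchor hV b).app f)
  pair_inv : ∀ {V : Opens X} (hV : V ≤ U) (a b c : E.sec V hV),
    (E.anchor hV a).app (E.pair hV b c) = E.pair hV (E.br hV a b) c + E.pair hV b (E.br hV a c)
  der_mul : ∀ {V : Opens X} (hV : V ≤ U) (f g : Sec O V),
    E.der hV (f * g) = E.act hV f (E.der hV g) + E.act hV g (E.der hV f)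
  br_der : ∀ {V : Opens X} (hV : V ≤ U) (a : E.sec V hV) (f : Sec O V),
    E.br hV a (E.der hV f) = E.der hV ((E.anchor hV a).app f)
  pair_der : ∀ {V : Opens X} (hV : V ≤ U) (a : E.sec V hV) (f : Sec O V),
    E.pair hV a (E.der hV f) = (E.anchor hV a).app f
  der_factors : E.DerFactors

/-- `e` is a section of `Ω_E = 𝒪 * ∂(𝒪)`: locally a sum of sections `f * ∂g`. -/
def InOmega (E : AlgebroidData O U) {V : Opens X} (hV : V ≤ U) (e : E.sec V hV) : Prop :=
  ∀ x ∈ V, ∃ (W : Opens X) (h : W ≤ V), x ∈ W ∧ ∃ (n : ℕ) (f g : Fin n → Sec O W),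
    E.res hV h e = ∑ k, E.act (h.trans hV) (f k) (E.der (h.trans hV) (g k))

/-- `e = i(α)`, where `i` is the map `f dg ↦ f * ∂g` from 1-forms to `E` and `α` is a 1-form on
`V`, given by its values: locally `e = ∑ fₖ * ∂gₖ` and `α = ∑ fₖ dgₖ`. -/
def IsIncl (E : AlgebroidData O U) {V : Opens X} (hV : V ≤ U) (e : E.sec V hV)
    (α : ∀ W : Opens X, W ≤ V → VF O W → Sec O W) : Prop :=
  ∀ x ∈ V, ∃ (W : Opens X) (h : W ≤ V), x ∈ W ∧ ∃ (n : ℕ) (f g : Fin n → Sec O W),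
    E.res hV h e = ∑ k, E.act (h.trans hV) (f k) (E.der (h.trans hV) (g k)) ∧
    ∀ (Z : Opens X) (h' : Z ≤ W) (ξ : VF O Z),
      α Z (h'.trans h) ξ = ∑ k, rs O h' (f k) * ξ.app (rs O h' (g k))

/-- Restriction to a smaller open set. -/
abbrev restrict (E : AlgebroidData O U) {U' : Opens X} (hU : U' ≤ U) : AlgebroidData O U' where
  sec V hV := E.sec V (hV.trans hU)
  addCommGroup V hV := E.addCommGroup V (hV.trans hU)
  module V hV := E.module V (hV.trans hU)
  res hV h := E.res (hV.trans hU) h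
  act hV := E.act (hV.trans hU)
  br hV := E.br (hV.trans hU)
  anchor hV := E.anchor (hV.trans hU)
  pair hV := E.pair (hV.trans hU)
  der hV := E.der (hV.trans hU)
  res_rfl hV := E.res_rfl (hV.trans hU)
  res_res hV := E.res_res (hV.trans hU)
  glue V hV := E.glue V (fun i => (hV i).trans hU)
  res_act hV := E.res_act (hV.trans hU)
  res_br hV := E.res_br (hV.trans hU)
  res_anchor hV := E.res_anchor (hV.trans hU)
  res_pair hV := E.res_pair (hV.trans hU)
  res_der hV := E.res_der (hV.trans hU)

/-- The same sheaf with the same multiplication, bracket and anchor and with `-⟨ , ⟩` and `-∂`. -/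
abbrev neg (E : AlgebroidData O U) : AlgebroidData O U where
  sec := E.sec
  addCommGroup := E.addCommGroup
  module := E.module
  res := E.res
  act := E.act
  br := E.br
  anchor := E.anchor
  pair hV := -E.pair hV
  der hV := -E.der hV
  res_rfl := E.res_rfl
  res_res := E.res_res
  glue := E.glue
  res_act := E.res_act
  res_br := E.res_br
  res_anchor := E.res_anchor
  res_pair hV h a b := by simp [E.res_pair]
  res_der hV h f := by simp [E.res_der]

/-- A morphism of Courant or of vertex algebroids: a `ℂ`-linear map of sheaves which preserves
all of the structure. -/
@[ext] structure Hom (E F : AlgebroidData O U) where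
  app : ∀ (V : Opens X) (hV : V ≤ U), E.sec V hV →ₗ[ℂ] F.sec V hV
  app_res : ∀ {V W : Opens X} (hV : V ≤ U) (h : W ≤ V) (a : E.sec V hV),
    F.res hV h (app V hV a) = app W (h.trans hV) (E.res hV h a)
  app_act : ∀ {V : Opens X} (hV : V ≤ U) (f : Sec O V) (a : E.sec V hV),
    app V hV (E.act hV f a) = F.act hV f (app V hV a)
  app_br : ∀ {V : Opens X} (hV : V ≤ U) (a b : E.sec V hV),
    app V hV (E.br hV a b) = F.br hV (app V hV a) (app V hV b)
  anchor_app : ∀ {V : Opens X} (hV : V ≤ U) (a : E.sec V hV),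
    F.anchor hV (app V hV a) = E.anchor hV a
  pair_app : ∀ {V : Opens X} (hV : V ≤ U) (a b : E.sec V hV),
    F.pair hV (app V hV a) (app V hV b) = E.pair hV a b
  app_der : ∀ {V : Opens X} (hV : V ≤ U) (f : Sec O V), app V hV (E.der hV f) = F.der hV f

end AlgebroidData

/-! ### Extensions of Lie algebroids -/

variable {O : TopCat.Sheaf (CommAlgCat.{u} ℂ) X}

/-- Algebroid data `E` on `U` with a map `E → 𝒜|_U` which induces an isomorphism from the
quotient sheaf `E/Ω_E` to `𝒜|_U`, compatible with multiplication, brackets and anchors. -/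
structure Extension (A : LieAlgebroidData O) (U : Opens X) where
  E : AlgebroidData O U
  proj : ∀ {V : Opens X} (hV : V ≤ U), E.sec V hV →ₗ[ℂ] A.sec V
  proj_res : ∀ {V W : Opens X} (hV : V ≤ U) (h : W ≤ V) (e : E.sec V hV),
    A.res h (proj hV e) = proj (h.trans hV) (E.res hV h e)
  proj_act : ∀ {V : Opens X} (hV : V ≤ U) (f : Sec O V) (e : E.sec V hV),
    proj hV (E.act hV f e) = A.act f (proj hV e)
  proj_br : ∀ {V : Opens X} (hV : V ≤ U) (e e' : E.sec V hV),
    proj hV (E.br hV e e') = A.br (proj hV e) (proj hV e')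
  anchor_proj : ∀ {V : Opens X} (hV : V ≤ U) (e : E.sec V hV),
    A.anchor (proj hV e) = E.anchor hV e
  surj : ∀ {V : Opens X} (hV : V ≤ U) (a : A.sec V) (x : X), x ∈ V →
    ∃ (W : Opens X) (h : W ≤ V) (e : E.sec W (h.trans hV)), x ∈ W ∧
      proj (h.trans hV) e = A.res h a
  ker : ∀ {V : Opens X} (hV : V ≤ U) (e : E.sec V hV), proj hV e = 0 ↔ E.InOmega hV e

namespace Extension

variable {A : LieAlgebroidData O} {U : Opens X}

/-- A morphism of extensions of `𝒜`. -/
@[ext] structure Hom (E F : Extension A U) extends AlgebroidData.Hom E.E F.E where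
  proj_app : ∀ {V : Opens X} (hV : V ≤ U) (e : E.E.sec V hV), F.proj hV (app V hV e) = E.proj hV e

instance : Category (Extension A U) where
  Hom E F := Hom E F
  id E :=
    { app := fun _ _ => LinearMap.id
      app_res := fun _ _ _ => rfl
      app_act := fun _ _ _ => rfl
      app_br := fun _ _ _ => rfl
      anchor_app := fun _ _ => rfl
      pair_app := fun _ _ _ => rfl
      app_der := fun _ _ => rfl
      proj_app := fun _ _ => rfl }
  comp φ ψ :=
    { app := fun V hV => (ψ.app V hV).comp (φ.app V hV)
      app_res := fun hV h a => by simp [φ.app_res, ψ.app_res]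
      app_act := fun hV f a => by simp [φ.app_act, ψ.app_act]
      app_br := fun hV a b => by simp [φ.app_br, ψ.app_br]
      anchor_app := fun hV a => by simp [φ.anchor_app, ψ.anchor_app]
      pair_app := fun hV a b => by simp [φ.pair_app, ψ.pair_app]
      app_der := fun hV f => by simp [φ.app_der, ψ.app_der]
      proj_app := fun hV e => by simp [φ.proj_app, ψ.proj_app] }

/-- The map on sections over `V` given by a morphism of extensions. -/
def Hom.ap {E F : Extension A U} (φ : E ⟶ F) {V : Opens X} (hV : V ≤ U) (e : E.E.sec V hV) :
    F.E.sec V hV := AlgebroidData.Hom.app (Hom.toHom φ) V hV e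

/-- Restriction to a smaller open set. -/
abbrev restrict (E : Extension A U) {U' : Opens X} (hU : U' ≤ U) : Extension A U' where
  E := E.E.restrict hU
  proj hV := E.proj (hV.trans hU)
  proj_res hV := E.proj_res (hV.trans hU)
  proj_act hV := E.proj_act (hV.trans hU)
  proj_br hV := E.proj_br (hV.trans hU)
  anchor_proj hV := E.anchor_proj (hV.trans hU)
  surj hV := E.surj (hV.trans hU)
  ker hV := E.ker (hV.trans hU)

/-- Restriction as a functor. -/
def restrictFunctor (A : LieAlgebroidData O) {U U' : Opens X} (hU : U' ≤ U) :
    Extension A U ⥤ Extension A U' where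
  obj E := E.restrict hU
  map φ :=
    { app := fun V hV => φ.app V (hV.trans hU)
      app_res := fun hV => φ.app_res (hV.trans hU)
      app_act := fun hV => φ.app_act (hV.trans hU)
      app_br := fun hV => φ.app_br (hV.trans hU)
      anchor_app := fun hV => φ.anchor_app (hV.trans hU)
      pair_app := fun hV => φ.pair_app (hV.trans hU)
      app_der := fun hV => φ.app_der (hV.trans hU)
      proj_app := fun hV => φ.proj_app (hV.trans hU) }

/-- The opposite extension: the extension with `-⟨ , ⟩` and `-∂`. -/
abbrev neg (E : Extension A U) : Extension A U where
  E := E.E.neg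
  proj := E.proj
  proj_res := E.proj_res
  proj_act := E.proj_act
  proj_br := E.proj_br
  anchor_proj := E.anchor_proj
  surj := E.surj
  ker {V} hV e := by
    refine (E.ker hV e).trans ?_
    refine forall₂_congr fun x _ => exists₂_congr fun W h => and_congr_right fun _ =>
      exists_congr fun n => ?_
    constructor
    · rintro ⟨f, g, hfg⟩
      exact ⟨-f, g, by simpa [AlgebroidData.neg] using hfg⟩
    · rintro ⟨f, g, hfg⟩
      exact ⟨-f, g, by simpa [AlgebroidData.neg] using hfg⟩

/-- The pairing on `𝔤(𝒜)` induced by the pairing of the extension is `κ`. -/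
def Induces (E : Extension A U) (κ : A.InvPairing) : Prop :=
  ∀ {V : Opens X} (hV : V ≤ U) (e e' : E.E.sec V hV)
    (b b' : LinearMap.ker (A.anchor (V := V))), b.1 = E.proj hV e → b'.1 = E.proj hV e' →
    κ.toFun b b' = E.E.pair hV e e'

end Extension

/-! ### The stacks -/

/-- Exact Courant algebroids on `U`: Courant extensions of `𝒯_X`. -/
def isECA (O : TopCat.Sheaf (CommAlgCat.{u} ℂ) X) (U : Opens X) :
    ObjectProperty (Extension (tangent O) U) := fun E => E.E.IsCourant

/-- Exact vertex algebroids on `U`: vertex extensions of `𝒯_X`. -/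
def isEVA (O : TopCat.Sheaf (CommAlgCat.{u} ℂ) X) (U : Opens X) :
    ObjectProperty (Extension (tangent O) U) := fun E => E.E.IsVertex

/-- Courant extensions of `𝒜|_U` which induce the pairing `κ` on `𝔤(𝒜)`. -/
def isCEXT (A : LieAlgebroidData O) (κ : A.InvPairing) (U : Opens X) :
    ObjectProperty (Extension A U) := fun E => E.E.IsCourant ∧ E.Induces κ

/-- The category of exact vertex algebroids on `U`. -/
abbrev EVA (O : TopCat.Sheaf (CommAlgCat.{u} ℂ) X) (U : Opens X) := (isEVA O U).FullSubcategory

/-- The category of Courant extensions of `𝒜|_U` which induce `κ`. -/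
abbrev CEXT (A : LieAlgebroidData O) (κ : A.InvPairing) (U : Opens X) :=
  (isCEXT A κ U).FullSubcategory

lemma AlgebroidData.IsCourant.restrict {U U' : Opens X} {E : AlgebroidData O U}
    (hE : E.IsCourant) (hU : U' ≤ U) : (E.restrict hU).IsCourant where
  one_act hV := hE.one_act (hV.trans hU)
  mul_act hV := hE.mul_act (hV.trans hU)
  leibniz hV := hE.leibniz (hV.trans hU)
  anchor_act hV := hE.anchor_act (hV.trans hU)
  anchor_br hV := hE.anchor_br (hV.trans hU)
  pair_symm hV := hE.pair_symm (hV.trans hU)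
  pair_act hV := hE.pair_act (hV.trans hU)
  der_mul hV := hE.der_mul (hV.trans hU)
  anchor_der hV := hE.anchor_der (hV.trans hU)
  br_act hV := hE.br_act (hV.trans hU)
  pair_inv hV := hE.pair_inv (hV.trans hU)
  br_der hV := hE.br_der (hV.trans hU)
  pair_der hV := hE.pair_der (hV.trans hU)
  br_symm hV := hE.br_symm (hV.trans hU)
  der_factors hV := hE.der_factors (hV.trans hU)

lemma AlgebroidData.IsVertex.restrict {U U' : Opens X} {E : AlgebroidData O U}
    (hE : E.IsVertex) (hU : U' ≤ U) : (E.restrict hU).IsVertex where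
  one_act hV := hE.one_act (hV.trans hU)
  leibniz hV := hE.leibniz (hV.trans hU)
  anchor_br hV := hE.anchor_br (hV.trans hU)
  pair_symm hV := hE.pair_symm (hV.trans hU)
  anchor_der hV := hE.anchor_der (hV.trans hU)
  assoc hV := hE.assoc (hV.trans hU)
  br_act hV := hE.br_act (hV.trans hU)
  br_symm hV := hE.br_symm (hV.trans hU)
  anchor_act hV := hE.anchor_act (hV.trans hU)
  pair_act hV := hE.pair_act (hV.trans hU)
  pair_inv hV := hE.pair_inv (hV.trans hU)
  der_mul hV := hE.der_mul (hV.trans hU)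
  br_der hV := hE.br_der (hV.trans hU)
  pair_der hV := hE.pair_der (hV.trans hU)
  der_factors hV := hE.der_factors (hV.trans hU)

/-- The opposite of an exact Courant algebroid is one. -/
lemma AlgebroidData.IsCourant.neg {U : Opens X} {E : AlgebroidData O U} (hE : E.IsCourant) :
    E.neg.IsCourant where
  one_act := hE.one_act
  mul_act := hE.mul_act
  leibniz := hE.leibniz
  anchor_act := hE.anchor_act
  anchor_br := hE.anchor_br
  pair_symm hV a b := by simpa [AlgebroidData.neg] using hE.pair_symm hV a b
  pair_act hV f a b := by simpa [AlgebroidData.neg] using hE.pair_act hV f a b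
  der_mul hV f g := by
    simpa [AlgebroidData.neg, add_comm] using congrArg Neg.neg (hE.der_mul hV f g)
  anchor_der hV f := by simpa [AlgebroidData.neg] using hE.anchor_der hV f
  br_act := hE.br_act
  pair_inv hV a b c := by
    simpa [AlgebroidData.neg, VF.app, add_comm] using congrArg Neg.neg (hE.pair_inv hV a b c)
  br_der hV a f := by simpa [AlgebroidData.neg] using hE.br_der hV a f
  pair_der hV a f := by simpa [AlgebroidData.neg] using hE.pair_der hV a f
  br_symm hV a b := by simpa [AlgebroidData.neg] using hE.br_symm hV a b
  der_factors hV n f g hfg := by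
    simpa [AlgebroidData.neg] using congrArg Neg.neg (hE.der_factors hV n f g hfg)

/-- Restriction of exact vertex algebroids. -/
def EVA.res (O : TopCat.Sheaf (CommAlgCat.{u} ℂ) X) {U U' : Opens X} (hU : U' ≤ U) :
    EVA O U ⥤ EVA O U' :=
  (isEVA O U').lift ((isEVA O U).ι ⋙ Extension.restrictFunctor (tangent O) hU)
    (fun V => V.property.restrict hU)

/-- Restriction of Courant extensions. -/
def CEXT.res (A : LieAlgebroidData O) (κ : A.InvPairing) {U U' : Opens X} (hU : U' ≤ U) :
    CEXT A κ U ⥤ CEXT A κ U' :=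
  (isCEXT A κ U').lift ((isCEXT A κ U).ι ⋙ Extension.restrictFunctor A hU)
    (fun C => ⟨C.property.1.restrict hU, fun hV => C.property.2 (hV.trans hU)⟩)

/-! ### Sums and differences of extensions -/

/-- Sections over `V` of the fibre product `E₁ ×_{𝒯_X} E₂`. -/
def fib {U : Opens X} (E₁ E₂ : AlgebroidData O U) {V : Opens X} (hV : V ≤ U) :
    Submodule ℂ (E₁.sec V hV × E₂.sec V hV) :=
  LinearMap.eqLocus ((E₁.anchor hV).comp (LinearMap.fst ℂ _ _))
    ((E₂.anchor hV).comp (LinearMap.snd ℂ _ _))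

/-- A map `E₁ ×_{𝒯_X} E₂ → E₃` which exhibits the extension `E₃` as the push-out of
`E₁ ×_{𝒯_X} E₂` by the map `Ω¹ × Ω¹ → Ω¹`, `(α, β) ↦ α + ε β`, with the componentwise
multiplication and bracket, and with the pairing
`⟨(a₁, b₁), (a₂, b₂)⟩ = ⟨a₁, a₂⟩ + ε ⟨b₁, b₂⟩`.
For `ε = 1` this says that `E₃ = E₁ + E₂`, for `ε = -1` that `E₃ = E₁ - E₂`. -/
structure BaerMap (ε : ℤ) {A : LieAlgebroidData O} {U : Opens X} (E₁ : Extension A U)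
    (E₂ : Extension (tangent O) U) (E₃ : Extension A U) where
  toFun : ∀ {V : Opens X} (hV : V ≤ U), fib E₁.E E₂.E hV →ₗ[ℂ] E₃.E.sec V hV
  map_res : ∀ {V W : Opens X} (hV : V ≤ U) (h : W ≤ V) (x : fib E₁.E E₂.E hV)
    (y : fib E₁.E E₂.E (h.trans hV)),
    y.1 = (E₁.E.res hV h x.1.1, E₂.E.res hV h x.1.2) →
    E₃.E.res hV h (toFun hV x) = toFun (h.trans hV) y
  map_act : ∀ {V : Opens X} (hV : V ≤ U) (f : Sec O V) (x y : fib E₁.E E₂.E hV),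
    y.1 = (E₁.E.act hV f x.1.1, E₂.E.act hV f x.1.2) →
    toFun hV y = E₃.E.act hV f (toFun hV x)
  map_br : ∀ {V : Opens X} (hV : V ≤ U) (x y z : fib E₁.E E₂.E hV),
    z.1 = (E₁.E.br hV x.1.1 y.1.1, E₂.E.br hV x.1.2 y.1.2) →
    toFun hV z = E₃.E.br hV (toFun hV x) (toFun hV y)
  map_pair : ∀ {V : Opens X} (hV : V ≤ U) (x y : fib E₁.E E₂.E hV),
    E₃.E.pair hV (toFun hV x) (toFun hV y) =
      E₁.E.pair hV x.1.1 y.1.1 + ε • E₂.E.pair hV x.1.2 y.1.2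
  map_proj : ∀ {V : Opens X} (hV : V ≤ U) (x : fib E₁.E E₂.E hV),
    E₃.proj hV (toFun hV x) = E₁.proj hV x.1.1
  map_der_left : ∀ {V : Opens X} (hV : V ≤ U) (f : Sec O V) (x : fib E₁.E E₂.E hV),
    x.1 = (E₁.E.der hV f, 0) → toFun hV x = E₃.E.der hV f
  map_der_right : ∀ {V : Opens X} (hV : V ≤ U) (f : Sec O V) (x : fib E₁.E E₂.E hV),
    x.1 = (0, E₂.E.der hV f) → toFun hV x = ε • E₃.E.der hV f
  surj : ∀ {V : Opens X} (hV : V ≤ U) (e : E₃.E.sec V hV) (p : X), p ∈ V →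
    ∃ (W : Opens X) (h : W ≤ V) (x : fib E₁.E E₂.E (h.trans hV)), p ∈ W ∧
      toFun (h.trans hV) x = E₃.E.res hV h e
  ker : ∀ {V : Opens X} (hV : V ≤ U) (x : fib E₁.E E₂.E hV), toFun hV x = 0 ↔
    ∀ p ∈ V, ∃ (W : Opens X) (h : W ≤ V), p ∈ W ∧ ∃ (n : ℕ) (f g : Fin n → Sec O W),
      E₁.E.res hV h x.1.1 = ∑ k, E₁.E.act (h.trans hV) (f k) (E₁.E.der (h.trans hV) (g k)) ∧
      E₂.E.res hV h x.1.2 =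
        -(ε • ∑ k, E₂.E.act (h.trans hV) (f k) (E₂.E.der (h.trans hV) (g k)))

/-- `S` (given by a property of extensions of `𝒜` over every open set, with all morphisms of
extensions) is a torsor under the stack of exact Courant algebroids, which acts by
`(s, Q) ↦ s + Q`: `S` is a locally non-empty stack in groupoids, the action is defined, and for
every `s` in `S(U)` the functor `Q ↦ s + Q` from exact Courant algebroids on `U` to `S(U)` is
essentially surjective and fully faithful. -/
structure IsTorsor {A : LieAlgebroidData O} (S : ∀ U, ObjectProperty (Extension A U)) : Prop where
  locally_nonempty : ∀ x : X, ∃ (U : Opens X) (s : Extension A U), x ∈ U ∧ S U s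
  groupoid : ∀ (U : Opens X) (s s' : Extension A U), S U s → S U s' → ∀ φ : s ⟶ s', IsIso φ
  action : ∀ (U : Opens X) (s : Extension A U) (Q : Extension (tangent O) U), S U s →
    isECA O U Q → ∃ s' : Extension A U, S U s' ∧ Nonempty (BaerMap 1 s Q s')
  essSurj : ∀ (U : Opens X) (s s' : Extension A U), S U s → S U s' →
    ∃ Q : Extension (tangent O) U, isECA O U Q ∧ Nonempty (BaerMap 1 s Q s')
  fullyFaithful : ∀ (U : Opens X) (s s' s'' : Extension A U) (Q Q' : Extension (tangent O) U),
    S U s → S U s' → S U s'' → isECA O U Q → isECA O U Q' →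
    ∀ (σ : BaerMap 1 s Q s') (σ' : BaerMap 1 s Q' s'') (φ : s' ⟶ s''),
    ∃! ψ : Q ⟶ Q', ∀ {V : Opens X} (hV : V ≤ U) (x : fib s.E Q.E hV) (y : fib s.E Q'.E hV),
      y.1.1 = x.1.1 → y.1.2 = Extension.Hom.ap ψ hV x.1.2 →
      Extension.Hom.ap φ hV (σ.toFun hV x) = σ'.toFun hV y

/-- The functor `V ↦ Â - V` from exact vertex algebroids to Courant extensions of `𝒜` which
induce `κ`, over every open set: a functorial choice of the differences `Â|_U - V`. -/
structure DifferenceFunctor {A : LieAlgebroidData O} (Ahat : Extension A ⊤)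
    (κ : A.InvPairing) where
  F : ∀ U : Opens X, EVA O U ⥤ CEXT A κ U
  δ : ∀ {U : Opens X} (V : EVA O U),
    BaerMap (-1) (Ahat.restrict (le_top : U ≤ ⊤)) V.obj ((F U).obj V).obj
  natural : ∀ {U : Opens X} {V V' : EVA O U} (φ : V ⟶ V') {W : Opens X} (hW : W ≤ U)
    (x : fib (Ahat.restrict (le_top : U ≤ ⊤)).E V.obj.E hW)
    (y : fib (Ahat.restrict (le_top : U ≤ ⊤)).E V'.obj.E hW),
    y.1.1 = x.1.1 → y.1.2 = Extension.Hom.ap φ.hom hW x.1.2 →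
    Extension.Hom.ap ((F U).map φ).hom hW ((δ V).toFun hW x) = (δ V').toFun hW y

namespace DifferenceFunctor

variable {A : LieAlgebroidData O} {Ahat : Extension A ⊤} {κ : A.InvPairing}

/-- The functors over the various open sets commute with restriction, up to the natural
isomorphism `Â - V|_{U'} ≅ (Â - V)|_{U'}`, `(a, v) ↦ (a, v)`. -/
def CommutesWithRestriction (D : DifferenceFunctor Ahat κ) : Prop :=
  ∀ {U U' : Opens X} (hU : U' ≤ U),
    ∃! e : EVA.res O hU ⋙ D.F U' ≅ D.F U ⋙ CEXT.res A κ hU,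
      ∀ (V : EVA O U) {W : Opens X} (hW : W ≤ U')
        (x : fib (Ahat.restrict (le_top : U' ≤ ⊤)).E (V.obj.restrict hU).E hW)
        (y : fib (Ahat.restrict (le_top : U ≤ ⊤)).E V.obj.E (hW.trans hU)), y.1 = x.1 →
        Extension.Hom.ap (e.hom.app V).hom hW ((D.δ ((EVA.res O hU).obj V)).toFun hW x) =
          (D.δ V).toFun (hW.trans hU) y

/-- `Â - (V + Q) = (Â - V) - Q`: whenever `σ` exhibits `V'` as `V + Q`, the formula
`((a, v), q) ↦ (a, σ(v, q))` defines a map which exhibits `Â - V'` as `(Â - V) + (-Q)`. -/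
def AntiCommutes (D : DifferenceFunctor Ahat κ) : Prop :=
  ∀ {U : Opens X} (V V' : EVA O U) (Q : Extension (tangent O) U), isECA O U Q →
    ∀ σ : BaerMap 1 V.obj Q V'.obj,
    ∃! σ' : BaerMap 1 ((D.F U).obj V).obj Q.neg ((D.F U).obj V').obj,
      ∀ {W : Opens X} (hW : W ≤ U)
        (x : fib (Ahat.restrict (le_top : U ≤ ⊤)).E V.obj.E hW)
        (y : fib V.obj.E Q.E hW)
        (z : fib ((D.F U).obj V).obj.E Q.neg.E hW)
        (w : fib (Ahat.restrict (le_top : U ≤ ⊤)).E V'.obj.E hW),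
        y.1.1 = x.1.2 → z.1 = ((D.δ V).toFun hW x, y.1.2) →
        w.1 = (x.1.1, σ.toFun hW y) →
        σ'.toFun hW z = (D.δ V').toFun hW w

end DifferenceFunctor

/-! ### The cohomology group `H²(X; Ω² → Ω^{3,cl})` and the class of a torsor -/

/-- A covering of `X` by open sets `U i` together with coverings of all `U i ∩ U j` by open sets
`V a`, `a : J i j`, i.e. a (1-coskeletal) hypercovering of `X`. An ordinary covering is the case
where `J i j` has one element `a` and `V a = U i ∩ U j`. -/
structure Hypercover (X : TopCat.{u}) where
  I : Type u
  U : I → Opens X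
  cover : ∀ x : X, ∃ i, x ∈ U i
  J : I → I → Type u
  V : ∀ {i j : I}, J i j → Opens X
  V_le_left : ∀ {i j : I} (a : J i j), V a ≤ U i
  V_le_right : ∀ {i j : I} (a : J i j), V a ≤ U j
  cover₂ : ∀ (i j : I) (x : X), x ∈ U i → x ∈ U j → ∃ a : J i j, x ∈ V a

namespace Hypercover

/-- `𝒲` is a refinement of `𝒰`. -/
structure Refinement (𝒲 𝒰 : Hypercover X) where
  onI : 𝒲.I → 𝒰.I
  onJ : ∀ {i j : 𝒲.I}, 𝒲.J i j → 𝒰.J (onI i) (onI j)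
  U_le : ∀ i, 𝒲.U i ≤ 𝒰.U (onI i)
  V_le : ∀ {i j : 𝒲.I} (a : 𝒲.J i j), 𝒲.V a ≤ 𝒰.V (onJ a)

end Hypercover

/-- A 2-cocycle of `X` with coefficients in the complex `Ω² → Ω^{3,cl}`: closed 3-forms `H`
on the double and 2-forms `B` on the triple intersections of a hypercovering with `dB = δH` and
`δB = 0`. -/
structure Cocycle (O : TopCat.Sheaf (CommAlgCat.{u} ℂ) X) where
  cov : Hypercover X
  H : ∀ {i j : cov.I} (a : cov.J i j), Form O 3 (cov.V a)
  H_closed : ∀ {i j : cov.I} (a : cov.J i j), (H a).IsClosed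
  B : ∀ {i j k : cov.I} (a : cov.J i j) (b : cov.J j k) (c : cov.J i k),
    Form O 2 (cov.V a ⊓ cov.V b ⊓ cov.V c)
  dB : ∀ {i j k : cov.I} (a : cov.J i j) (b : cov.J j k) (c : cov.J i k) (W : Opens X)
    (ha : W ≤ cov.V a) (hb : W ≤ cov.V b) (hc : W ≤ cov.V c) (ξ : Fin 3 → VF O W),
    extD (B a b c) W (le_inf (le_inf ha hb) hc) ξ =
      (H b).ev W hb ξ - (H c).ev W hc ξ + (H a).ev W ha ξ
  δB : ∀ {i j k l : cov.I} (ij : cov.J i j) (ik : cov.J i k) (il : cov.J i l)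
    (jk : cov.J j k) (jl : cov.J j l) (kl : cov.J k l) (W : Opens X)
    (hij : W ≤ cov.V ij) (hik : W ≤ cov.V ik) (hil : W ≤ cov.V il)
    (hjk : W ≤ cov.V jk) (hjl : W ≤ cov.V jl) (hkl : W ≤ cov.V kl) (ξ : Fin 2 → VF O W),
    (B jk kl jl).ev W (le_inf (le_inf hjk hkl) hjl) ξ -
      (B ik kl il).ev W (le_inf (le_inf hik hkl) hil) ξ +
      (B ij jl il).ev W (le_inf (le_inf hij hjl) hil) ξ -
      (B ij jk ik).ev W (le_inf (le_inf hij hjk) hik) ξ = 0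

/-- The cocycles `c` and `c'` differ, on a common refinement of their hypercoverings, by the
coboundary of a 1-cochain `(b, h)`, that is, by `(δb, δh + db)`. -/
def Cohomologous (c c' : Cocycle O) : Prop :=
  ∃ (𝒲 : Hypercover X) (r : 𝒲.Refinement c.cov) (r' : 𝒲.Refinement c'.cov)
    (h : ∀ i : 𝒲.I, Form O 3 (𝒲.U i)) (b : ∀ (i j : 𝒲.I) (a : 𝒲.J i j), Form O 2 (𝒲.V a)),
    (∀ i, (h i).IsClosed) ∧
    (∀ (i j : 𝒲.I) (a : 𝒲.J i j) (W : Opens X) (hW : W ≤ 𝒲.V a) (ξ : Fin 3 → VF O W),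
      (c'.H (r'.onJ a)).ev W (hW.trans (r'.V_le a)) ξ - (c.H (r.onJ a)).ev W (hW.trans (r.V_le a)) ξ
        = (h j).ev W (hW.trans (𝒲.V_le_right a)) ξ - (h i).ev W (hW.trans (𝒲.V_le_left a)) ξ
          + extD (b i j a) W hW ξ) ∧
    (∀ (i j k : 𝒲.I) (ij : 𝒲.J i j) (jk : 𝒲.J j k) (ik : 𝒲.J i k) (W : Opens X)
      (hij : W ≤ 𝒲.V ij) (hjk : W ≤ 𝒲.V jk) (hik : W ≤ 𝒲.V ik) (ξ : Fin 2 → VF O W),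
      (c'.B (r'.onJ ij) (r'.onJ jk) (r'.onJ ik)).ev W (le_inf (le_inf (hij.trans (r'.V_le ij))
          (hjk.trans (r'.V_le jk))) (hik.trans (r'.V_le ik))) ξ -
        (c.B (r.onJ ij) (r.onJ jk) (r.onJ ik)).ev W (le_inf (le_inf (hij.trans (r.V_le ij))
          (hjk.trans (r.V_le jk))) (hik.trans (r.V_le ik))) ξ
        = (b j k jk).ev W hjk ξ - (b i k ik).ev W hik ξ + (b i j ij).ev W hij ξ)

/-- The negative of a cocycle. -/
def Cocycle.neg (c : Cocycle O) : Cocycle O where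
  cov := c.cov
  H a := -c.H a
  H_closed a W h ξ := by rw [extD_neg, c.H_closed a W h ξ, neg_zero]
  B a b d := -c.B a b d
  dB a b d W ha hb hc ξ := by
    rw [extD_neg, c.dB a b d W ha hb hc ξ]
    simp only [Form.neg_ev]
    ring
  δB ij ik il jk jl kl W hij hik hil hjk hjl hkl ξ := by
    have := c.δB ij ik il jk jl kl W hij hik hil hjk hjl hkl ξ
    simp only [Form.neg_ev]
    linear_combination -this

lemma Cohomologous.neg {c c' : Cocycle O} (hc : Cohomologous c c') :
    Cohomologous c.neg c'.neg := by
  obtain ⟨𝒲, r, r', h, b, hh, hH, hB⟩ := hc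
  refine ⟨𝒲, r, r', fun i => -h i, fun i j a => -b i j a, ?_, ?_, ?_⟩
  · intro i W hW ξ
    rw [extD_neg, hh i W hW ξ, neg_zero]
  · intro i j a W hW ξ
    have := hH i j a W hW ξ
    simp only [Form.neg_ev, extD_neg]
    change -(c'.H (r'.onJ a)).ev W _ ξ - -(c.H (r.onJ a)).ev W _ ξ = _
    linear_combination -this
  · intro i j k ij jk ik W hij hjk hik ξ
    have := hB i j k ij jk ik W hij hjk hik ξ
    simp only [Form.neg_ev]
    change -(c'.B (r'.onJ ij) (r'.onJ jk) (r'.onJ ik)).ev W _ ξ -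
      -(c.B (r.onJ ij) (r.onJ jk) (r.onJ ik)).ev W _ ξ = _
    linear_combination -this

/-- `H²(X; Ω² → Ω^{3,cl})`. -/
def H2 (O : TopCat.Sheaf (CommAlgCat.{u} ℂ) X) : Type (u + 1) :=
  Quot (Cohomologous : Cocycle O → Cocycle O → Prop)

/-- The negative of a cohomology class. -/
instance : Neg (H2 O) := ⟨Quot.map Cocycle.neg fun _ _ h => h.neg⟩

/-- A connection on an exact Courant algebroid: an `𝒪`-linear isotropic section of the anchor. -/
structure Connection {U : Opens X} (Q : Extension (tangent O) U) where
  toFun : ∀ {V : Opens X} (hV : V ≤ U), VF O V →ₗ[ℂ] Q.E.sec V hV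
  map_res : ∀ {V W : Opens X} (hV : V ≤ U) (h : W ≤ V) (ξ : VF O V),
    Q.E.res hV h (toFun hV ξ) = toFun (h.trans hV) (VF.res h ξ)
  map_smul : ∀ {V : Opens X} (hV : V ≤ U) (f : Sec O V) (ξ : VF O V),
    toFun hV (f • ξ) = Q.E.act hV f (toFun hV ξ)
  anchor_toFun : ∀ {V : Opens X} (hV : V ≤ U) (ξ : VF O V), Q.E.anchor hV (toFun hV ξ) = ξ
  isotropic : ∀ {V : Opens X} (hV : V ≤ U) (ξ η : VF O V),
    Q.E.pair hV (toFun hV ξ) (toFun hV η) = 0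

/-- `H` is the curvature of the connection:
`H(ξ₀, ξ₁, ξ₂) = ι_{ξ₀}([∇ξ₁, ∇ξ₂] - ∇[ξ₁, ξ₂])`. The contraction of `ξ₀` with a section of
`Ω¹ ⊆ Q` is the pairing with any lift of `ξ₀` to `Q`, here with `∇ξ₀`. -/
def Connection.HasCurvature {U : Opens X} {Q : Extension (tangent O) U} (D : Connection Q)
    (H : Form O 3 U) : Prop :=
  ∀ {V : Opens X} (hV : V ≤ U) (ξ : Fin 3 → VF O V),
    H.ev V hV ξ = Q.E.pair hV (D.toFun hV (ξ 0))
      (Q.E.br hV (D.toFun hV (ξ 1)) (D.toFun hV (ξ 2)) - D.toFun hV ⁅ξ 1, ξ 2⁆)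

/-- A choice of local objects `s i` of `S`, of exact Courant algebroids `Q a` with
`s j = s i + Q a` on `V a` for `a : J i j`, and of connections `∇ a` on `Q a`, which gives rise to
the cocycle `c`: the curvature of `∇ a` is `H a`, and on a triple intersection the connection
`∇ a + ∇ b` on `Q a + Q b` corresponds under the identification `Q a + Q b = Q c` to `∇ c + B`,
that is, `(x + ∇ a ξ) + ∇ b ξ = (x + ∇ c ξ) + ι_ξ B` for sections `x` of `s i` over `ξ`. -/
structure ClassData {A : LieAlgebroidData O} (S : ∀ U, ObjectProperty (Extension A U))
    (c : Cocycle O) where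
  s : ∀ i : c.cov.I, Extension A (c.cov.U i)
  hs : ∀ i, S _ (s i)
  Q : ∀ {i j : c.cov.I} (a : c.cov.J i j), Extension (tangent O) (c.cov.V a)
  hQ : ∀ {i j : c.cov.I} (a : c.cov.J i j), isECA O _ (Q a)
  σ : ∀ {i j : c.cov.I} (a : c.cov.J i j),
    BaerMap 1 ((s i).restrict (c.cov.V_le_left a)) (Q a) ((s j).restrict (c.cov.V_le_right a))
  conn : ∀ {i j : c.cov.I} (a : c.cov.J i j), Connection (Q a)
  curv : ∀ {i j : c.cov.I} (a : c.cov.J i j), (conn a).HasCurvature (c.H a)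
  comparison : ∀ {i j k : c.cov.I} (a : c.cov.J i j) (b : c.cov.J j k) (d : c.cov.J i k)
    (W : Opens X) (ha : W ≤ c.cov.V a) (hb : W ≤ c.cov.V b) (hd : W ≤ c.cov.V d) (ξ : VF O W)
    (x : fib ((s i).restrict (c.cov.V_le_left a)).E (Q a).E ha)
    (y : fib ((s j).restrict (c.cov.V_le_left b)).E (Q b).E hb)
    (z : fib ((s i).restrict (c.cov.V_le_left d)).E (Q d).E hd),
    x.1.2 = (conn a).toFun ha ξ →
    y.1 = ((σ a).toFun ha x, (conn b).toFun hb ξ) →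
    z.1 = (x.1.1, (conn d).toFun hd ξ) →
    (s k).E.IsIncl (hd.trans (c.cov.V_le_right d))
      (((σ b).toFun hb y : (s k).E.sec W _) - ((σ d).toFun hd z : (s k).E.sec W _))
      (fun Z hZ η => (c.B a b d).ev Z (hZ.trans (le_inf (le_inf ha hb) hd)) ![VF.res hZ ξ, η])

/-- The class of `S` in `H²(X; Ω² → Ω^{3,cl})` is `γ`. -/
def HasClass {A : LieAlgebroidData O} (S : ∀ U, ObjectProperty (Extension A U)) (γ : H2 O) :
    Prop :=
  ∃ c : Cocycle O, Nonempty (ClassData S c) ∧ Quot.mk _ c = γ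

end VertexAlgebroids

end

/-! Vertex and Courant algebroids are the cases c = 1 and c = 0 of one notion, `IsAlg c`, in which
the two anomalies (in the associativity of `*` and in ⟨f * v, w⟩) carry the factor c. The levels
behave additively: passing to −⟨ , ⟩ and −∂ turns level c into −c, and a fibre product of levels c₁
and c₂ has level c₁ + c₂. Hence Â − V is the sum of Â (level 1) and −V (level −1). It has level 0,
so it is Courant, and statements on differences become statements on sums and opposites (`negRight`,
`negAll`).

The main tool is that sections of Ω are detected by the pairing. If e = ∑ fₖ * ∂gₖ, then ⟨e, e'⟩ = ∑
fₖ π(e')(gₖ) is the value of the 1-form ∑ fₖ dgₖ on π(e'). If it vanishes for local lifts e' of all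
vector fields, then e = 0, because ∂ induces a map on Ω¹ (`eq_zero_of_pair`). There are two
consequences. A linear map compatible with projections, pairings and brackets also respects `*` and
∂ when the levels match, and it can be defined on local representatives (`exists_hom`,
`BaerMap.exists_of_epi`). Moreover, a push-out by Ω¹ × Ω¹ → Ω¹ can be described without Ω¹: it is
the quotient by the radical of the pairing inside the kernel of the projection. It therefore
suffices to have the axioms modulo this radical (`IsWeakAlg`); coordinates show that the kernel of
the quotient is then precisely Ω (`exists_sub_om_mem_rad`, `exists_reduction`).

This reduction is applied to s ×_𝒯 Q → 𝒜, which gives s + Q (`exists_sum`), and to s' ×_𝒜 (−s) → 𝒯,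
which gives a Q with s + Q = s' as soon as s and s' induce the same pairing on 𝔤(𝒜)
(`Extension.exists_difference`). A morphism φ : s + Q → s + Q' comes from a unique Q → Q': φ(e + q)
has the same projection as e, so it is locally e + q' for a unique q' (`exists_right_map`). These
three facts give both the torsor property of the two stacks and the equivalence V ↦ Â − V.
Anti-commutation is associativity of sums (`exists_assoc`) for Â, −V and −Q. Exact vertex algebroids
exist locally by an explicit construction on 𝒯 ⊕ Ω¹ in coordinates, and subtracting them from Â
gives local objects on the Courant side.

For the classes, an identification s' = s + Q together with a connection ∇ on Q is replaced by the
map x ↦ x + ∇π(x) from s to s', a `Twist`. It preserves projections and pairings, and fails to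
preserve brackets by the curvature of ∇ (`hasTorsion_ofBaer`). Two twists differ by a 2-form
(`Twist.exists_difference`) whose exterior derivative is the difference of their torsions
(`extD_eq`). Torsions add under composition, and differences are unchanged by composition with a
further twist. The equations dB = δH and δB = 0 and the independence of all choices are then
comparisons of composites computed in two ways. Under V ↦ Â − V the twists are carried along, and
all forms change sign because V enters the pairing of Â − V with a minus sign. -/

noncomputable section

namespace VertexAlgebroids

variable {X : TopCat.{u}}

section

/-! ### Gluing of functions -/

section Gluing

variable (O : TopCat.Sheaf (CommAlgCat.{u} ℂ) X)

/-- Functions on a union of open sets are glued from functions on the members. -/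
theorem sec_glue {ι : Type u} (V : ι → Opens X) (s : ∀ i, Sec O (V i))
    (hs : ∀ i j, rs O (inf_le_left : V i ⊓ V j ≤ V i) (s i) =
      rs O (inf_le_right : V i ⊓ V j ≤ V j) (s j)) :
    ∃! t : Sec O (iSup V), ∀ i, rs O (le_iSup V i) t = s i := by
  -- Algebra maps out of a polynomial ring in one variable are elements of the target, and the sheaf
  -- condition for presheaves of algebras is the one for all functors of maps out of a fixed
  -- algebra. For the polynomial ring it is gluing of functions; `ULift` only adjusts the universe.
  let E : CommAlgCat.{u} ℂ := CommAlgCat.of ℂ (ULift.{u} (Polynomial ℂ))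
  let F : TopCat.Presheaf (Type u) X := O.presheaf ⋙ coyoneda.obj (op E)
  have hF : F.IsSheaf := (isSheaf_iff_isSheaf_of_type _ _).2 (O.property E)
  let toHom : ∀ W : Opens X, Sec O W → (E ⟶ O.presheaf.obj (op W)) := fun W f =>
    CommAlgCat.ofHom ((Polynomial.aeval f).comp
      (ULift.algEquiv (R := ℂ) (A := Polynomial ℂ)).toAlgHom)
  have toHom_X : ∀ (W : Opens X) (f : Sec O W), (toHom W f).hom ⟨Polynomial.X⟩ = f := fun W f => by
    change Polynomial.aeval f Polynomial.X = f
    simp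
  have hom_ext : ∀ (W : Opens X) (a b : E ⟶ O.presheaf.obj (op W)),
      a.hom ⟨Polynomial.X⟩ = b.hom ⟨Polynomial.X⟩ → a = b := by
    intro W a b hab
    ext x
    have : (a.hom.comp (ULift.algEquiv (R := ℂ) (A := Polynomial ℂ)).symm.toAlgHom) =
        (b.hom.comp (ULift.algEquiv (R := ℂ) (A := Polynomial ℂ)).symm.toAlgHom) :=
      Polynomial.algHom_ext hab
    exact DFunLike.congr_fun this x.down
  have key := hF.isSheafUniqueGluing_types (fun i => toHom (V i) (s i)) (by
    intro i j
    refine hom_ext _ _ _ ?_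
    change rs O _ ((toHom (V i) (s i)).hom ⟨Polynomial.X⟩) =
      rs O _ ((toHom (V j) (s j)).hom ⟨Polynomial.X⟩)
    rw [toHom_X, toHom_X]
    exact hs i j)
  obtain ⟨t, ht, htu⟩ := key
  refine ⟨t.hom ⟨Polynomial.X⟩, fun i => ?_, fun y hy => ?_⟩
  · have h1 := ht i
    have h2 : (F.map (Opens.leSupr V i).op t).hom ⟨Polynomial.X⟩ =
      (toHom (V i) (s i)).hom ⟨Polynomial.X⟩ := by
        exact congrArg (fun a : E ⟶ O.presheaf.obj (op (V i)) => a.hom ⟨Polynomial.X⟩) h1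
    rw [toHom_X] at h2
    exact h2
  · have := htu (toHom _ y) (by
      intro i
      refine hom_ext _ _ _ ?_
      change rs O _ ((toHom _ y).hom ⟨Polynomial.X⟩) = (toHom _ (s i)).hom ⟨Polynomial.X⟩
      rw [toHom_X, toHom_X]
      exact hy i)
    rw [← this, toHom_X]

end Gluing

/-! ### Presheaves of vector spaces on the open subsets of an open set -/

/-- A presheaf of `ℂ`-vector spaces on `U`. -/
structure ModPsh (U : Opens X) where
  sec : ∀ V : Opens X, V ≤ U → Type u
  [addCommGroup : ∀ V hV, AddCommGroup (sec V hV)]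
  [module : ∀ V hV, Module ℂ (sec V hV)]
  res : ∀ {V W : Opens X} (hV : V ≤ U) (h : W ≤ V), sec V hV →ₗ[ℂ] sec W (h.trans hV)
  res_rfl : ∀ {V : Opens X} (hV : V ≤ U) (a : sec V hV), res hV le_rfl a = a
  res_res : ∀ {V W Z : Opens X} (hV : V ≤ U) (h : W ≤ V) (h' : Z ≤ W) (a : sec V hV),
    res (h.trans hV) h' (res hV h a) = res hV (h'.trans h) a

attribute [instance] ModPsh.addCommGroup ModPsh.module

namespace ModPsh

variable {U : Opens X}

/-- The sheaf condition. -/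
structure IsSheaf (F : ModPsh U) : Prop where
  glue : ∀ {ι : Type u} (V : ι → Opens X) (hV : ∀ i, V i ≤ U) (s : ∀ i, F.sec (V i) (hV i)),
    (∀ i j, F.res (hV i) (inf_le_left : V i ⊓ V j ≤ V i) (s i) =
      F.res (hV j) (inf_le_right : V i ⊓ V j ≤ V j) (s j)) →
    ∃! t : F.sec (iSup V) (iSup_le hV), ∀ i, F.res (iSup_le hV) (le_iSup V i) t = s i

variable {F : ModPsh U}

theorem IsSheaf.glue_cover (hF : F.IsSheaf) {V : Opens X} (hV : V ≤ U) {ι : Type u}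
    (W : ι → Opens X) (hW : ∀ i, W i ≤ V) (hc : ∀ p ∈ V, ∃ i, p ∈ W i)
    (s : ∀ i, F.sec (W i) ((hW i).trans hV))
    (hs : ∀ i j, F.res ((hW i).trans hV) (inf_le_left : W i ⊓ W j ≤ W i) (s i) =
      F.res ((hW j).trans hV) (inf_le_right : W i ⊓ W j ≤ W j) (s j)) :
    ∃! t : F.sec V hV, ∀ i, F.res hV (hW i) t = s i := by
  obtain rfl : V = iSup W := le_antisymm
    (fun p hp => by
      obtain ⟨i, hi⟩ := hc p hp
      exact Opens.mem_iSup.2 ⟨i, hi⟩) (iSup_le hW)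
  exact hF.glue W _ s hs

theorem IsSheaf.ext (hF : F.IsSheaf) {V : Opens X} (hV : V ≤ U) {s t : F.sec V hV}
    (h : ∀ p ∈ V, ∃ (W : Opens X) (hW : W ≤ V), p ∈ W ∧ F.res hV hW s = F.res hV hW t) :
    s = t := by
  choose W hW hp hs using fun p : V => h p.1 p.2
  refine (hF.glue_cover hV W hW (fun p hp' => ⟨⟨p, hp'⟩, hp _⟩)
    (fun i => F.res hV (hW i) t) ?_).unique hs fun _ => rfl
  intro i j
  rw [F.res_res, F.res_res]

/-- Sections of a sheaf may be constructed locally, if they are unique. -/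
theorem IsSheaf.descend (hF : F.IsSheaf) {V : Opens X} (hV : V ≤ U)
    (R : ∀ (W : Opens X) (h : W ≤ V), F.sec W (h.trans hV) → Prop)
    (hres : ∀ (W : Opens X) (h : W ≤ V) (W' : Opens X) (h' : W' ≤ W) (t : F.sec W (h.trans hV)),
      R W h t → R W' (h'.trans h) (F.res (h.trans hV) h' t))
    (huniq : ∀ (W : Opens X) (h : W ≤ V) (t t' : F.sec W (h.trans hV)), R W h t → R W h t' → t = t')
    (hex : ∀ p ∈ V, ∃ (W : Opens X) (h : W ≤ V) (t : F.sec W (h.trans hV)), p ∈ W ∧ R W h t) :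
    ∃! t : F.sec V hV, ∀ (W : Opens X) (h : W ≤ V) (s : F.sec W (h.trans hV)),
      R W h s → F.res hV h t = s := by
  choose W hW s hp hs using fun p : V => hex p.1 p.2
  obtain ⟨t, ht, htu⟩ := hF.glue_cover hV W hW (fun p hp' => ⟨⟨p, hp'⟩, hp _⟩) s (by
    intro i j
    exact huniq _ (inf_le_left.trans (hW i)) _ _ (hres _ _ _ _ _ (hs i)) (hres _ _ _ _ _ (hs j)))
  refine ⟨t, fun Z hZ z hz => ?_, fun y hy => htu y fun i => hy _ _ _ (hs i)⟩
  refine hF.ext _ fun p hpZ => ⟨Z ⊓ W ⟨p, hZ hpZ⟩, inf_le_left, ⟨hpZ, hp _⟩, ?_⟩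
  refine huniq _ (inf_le_left.trans hZ) _ _ ?_ (hres _ _ _ _ _ hz)
  have := hres _ (hW ⟨p, hZ hpZ⟩) _ (inf_le_right : Z ⊓ W ⟨p, hZ hpZ⟩ ≤ _) _ (hs ⟨p, hZ hpZ⟩)
  rw [← ht, F.res_res] at this
  rw [F.res_res]
  exact this

/-- A linear map into a sheaf is determined by a linear relation which is functional and locally
total. -/
theorem IsSheaf.exists_lift (hF : F.IsSheaf) (Q : ModPsh U)
    (R : ∀ {V : Opens X} (hV : V ≤ U), Q.sec V hV → F.sec V hV → Prop)
    (hadd : ∀ {V : Opens X} (hV : V ≤ U) {q t q' t'}, R hV q t → R hV q' t' →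
      R hV (q + q') (t + t'))
    (hsmul : ∀ {V : Opens X} (hV : V ≤ U) (c : ℂ) {q t}, R hV q t → R hV (c • q) (c • t))
    (hres : ∀ {V W : Opens X} (hV : V ≤ U) (h : W ≤ V) {q t}, R hV q t →
      R (h.trans hV) (Q.res hV h q) (F.res hV h t))
    (hzero : ∀ {V : Opens X} (hV : V ≤ U) {t}, R hV 0 t → t = 0)
    (hex : ∀ {V : Opens X} (hV : V ≤ U) (q : Q.sec V hV), ∀ p ∈ V,
      ∃ (W : Opens X) (h : W ≤ V) (t : F.sec W (h.trans hV)), p ∈ W ∧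
        R (h.trans hV) (Q.res hV h q) t) :
    ∃ L : ∀ {V : Opens X} (hV : V ≤ U), Q.sec V hV →ₗ[ℂ] F.sec V hV,
      (∀ {V W : Opens X} (hV : V ≤ U) (h : W ≤ V) (q : Q.sec V hV),
        F.res hV h (L hV q) = L (h.trans hV) (Q.res hV h q)) ∧
      ∀ {V : Opens X} (hV : V ≤ U) {q t}, R hV q t → L hV q = t := by
  have huniq : ∀ {V : Opens X} (hV : V ≤ U) {q t t'}, R hV q t → R hV q t' → t = t' := by
    intro V hV q t t' h h'
    have := hadd hV h (hsmul hV (-1) h')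
    simp only [neg_smul, one_smul, add_neg_cancel] at this
    exact eq_of_sub_eq_zero (by rw [sub_eq_add_neg]; exact hzero hV this)
  have key : ∀ {V : Opens X} (hV : V ≤ U) (q : Q.sec V hV), ∃ t : F.sec V hV,
      ∀ (W : Opens X) (h : W ≤ V) (s : F.sec W (h.trans hV)),
        R (h.trans hV) (Q.res hV h q) s → F.res hV h t = s := by
    intro V hV q
    refine (hF.descend hV (fun W h t => R (h.trans hV) (Q.res hV h q) t) ?_ ?_ ?_).exists
    · intro W h W' h' t ht
      have := hres (h.trans hV) h' ht
      rwa [Q.res_res] at this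
    · intro W h t t' ht ht'
      exact huniq _ ht ht'
    · exact hex hV q
  choose L hL using @key
  have hR : ∀ {V : Opens X} (hV : V ≤ U) (q : Q.sec V hV), ∀ p ∈ V,
      ∃ (W : Opens X) (h : W ≤ V), p ∈ W ∧ R (h.trans hV) (Q.res hV h q) (F.res hV h (L hV q)) := by
    intro V hV q p hp
    obtain ⟨W, h, t, hpW, ht⟩ := hex hV q p hp
    exact ⟨W, h, hpW, by rwa [hL hV q W h t ht]⟩
  have hL' : ∀ {V : Opens X} (hV : V ≤ U) {q t}, R hV q t → L hV q = t := by
    intro V hV q t ht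
    have := hL hV q V le_rfl t (by rwa [Q.res_rfl])
    rwa [F.res_rfl] at this
  refine ⟨fun {V} hV => { toFun := L hV, map_add' := fun a b => ?_, map_smul' := fun c a => ?_ },
    ?_, fun {V} hV => hL' hV⟩
  · refine hF.ext hV fun p hp => ?_
    obtain ⟨W, h, hpW, ha⟩ := hR hV a p hp
    obtain ⟨W', h', hpW', hb⟩ := hR hV b p hp
    refine ⟨W ⊓ W', inf_le_left.trans h, ⟨hpW, hpW'⟩, hL _ _ _ _ _ ?_⟩
    have ha' := hres _ (inf_le_left : W ⊓ W' ≤ W) ha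
    have hb' := hres _ (inf_le_right : W ⊓ W' ≤ W') hb
    rw [Q.res_res, F.res_res] at ha' hb'
    rw [map_add, map_add]
    exact hadd _ ha' hb'
  · refine hF.ext hV fun p hp => ?_
    obtain ⟨W, h, hpW, ha⟩ := hR hV a p hp
    refine ⟨W, h, hpW, hL _ _ _ _ _ ?_⟩
    rw [map_smul, map_smul]
    exact hsmul _ c ha
  · intro V W hV h q
    refine hF.ext _ fun p hp => ?_
    obtain ⟨W', h', hpW, ha⟩ := hR hV q p (h hp)
    have ha' := hres _ (inf_le_right : W ⊓ W' ≤ W') ha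
    rw [Q.res_res, F.res_res] at ha'
    refine ⟨W ⊓ W', inf_le_left, ⟨hp, hpW⟩, ?_⟩
    rw [F.res_res]
    refine (hL (h.trans hV) (Q.res hV h q) _ inf_le_left _ ?_).symm
    rwa [Q.res_res]

/-- A morphism of presheaves of vector spaces which is an epimorphism locally. -/
structure Epi (F Q : ModPsh U) where
  app : ∀ {V : Opens X} (hV : V ≤ U), F.sec V hV →ₗ[ℂ] Q.sec V hV
  app_res : ∀ {V W : Opens X} (hV : V ≤ U) (h : W ≤ V) (x : F.sec V hV),
    Q.res hV h (app hV x) = app (h.trans hV) (F.res hV h x)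
  surj : ∀ {V : Opens X} (hV : V ≤ U) (q : Q.sec V hV), ∀ p ∈ V,
    ∃ (W : Opens X) (h : W ≤ V) (x : F.sec W (h.trans hV)), p ∈ W ∧
      app (h.trans hV) x = Q.res hV h q

/-- The identity. -/
def Epi.id (F : ModPsh U) : Epi F F where
  app _ := LinearMap.id
  app_res _ _ _ := rfl
  surj {V} hV q _ hp := ⟨V, le_rfl, q, hp, (F.res_rfl hV q).symm⟩

/-- Linear maps into a sheaf descend along an epimorphism. -/
theorem IsSheaf.exists_desc (hF : F.IsSheaf) {P Q : ModPsh U} (π : Epi P Q)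
    (f : ∀ {V : Opens X} (hV : V ≤ U), P.sec V hV →ₗ[ℂ] F.sec V hV)
    (f_res : ∀ {V W : Opens X} (hV : V ≤ U) (h : W ≤ V) (x : P.sec V hV),
      F.res hV h (f hV x) = f (h.trans hV) (P.res hV h x))
    (hf : ∀ {V : Opens X} (hV : V ≤ U) (x : P.sec V hV), π.app hV x = 0 → f hV x = 0) :
    ∃ L : ∀ {V : Opens X} (hV : V ≤ U), Q.sec V hV →ₗ[ℂ] F.sec V hV,
      (∀ {V W : Opens X} (hV : V ≤ U) (h : W ≤ V) (q : Q.sec V hV),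
        F.res hV h (L hV q) = L (h.trans hV) (Q.res hV h q)) ∧
      ∀ {V : Opens X} (hV : V ≤ U) (x : P.sec V hV), L hV (π.app hV x) = f hV x := by
  obtain ⟨L, hL, hL'⟩ := hF.exists_lift Q (fun hV q t => ∃ x, π.app hV x = q ∧ f hV x = t)
    (by rintro V hV _ _ _ _ ⟨x, rfl, rfl⟩ ⟨y, rfl, rfl⟩; exact ⟨x + y, map_add _ _ _, map_add _ _ _⟩)
    (by rintro V hV c _ _ ⟨x, rfl, rfl⟩; exact ⟨c • x, map_smul _ _ _, map_smul _ _ _⟩)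
    (by rintro V W hV h _ _ ⟨x, rfl, rfl⟩; exact ⟨P.res hV h x, (π.app_res ..).symm, (f_res ..).symm⟩)
    (by rintro V hV _ ⟨x, hx, rfl⟩; exact hf hV x hx)
    (by
      intro V hV q p hp
      obtain ⟨W, h, x, hpW, hx⟩ := π.surj hV q p hp
      exact ⟨W, h, _, hpW, x, hx, rfl⟩)
  exact ⟨@L, @hL, fun hV x => hL' hV ⟨x, rfl, rfl⟩⟩

/-- Bilinear maps into a sheaf descend along epimorphisms. -/
theorem IsSheaf.exists_desc₂ (hF : F.IsSheaf) {P Q P' Q' : ModPsh U} (π : Epi P Q) (π' : Epi P' Q')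
    (f : ∀ {V : Opens X} (hV : V ≤ U), P.sec V hV →ₗ[ℂ] P'.sec V hV →ₗ[ℂ] F.sec V hV)
    (f_res : ∀ {V W : Opens X} (hV : V ≤ U) (h : W ≤ V) (x : P.sec V hV) (y : P'.sec V hV),
      F.res hV h (f hV x y) = f (h.trans hV) (P.res hV h x) (P'.res hV h y))
    (hf : ∀ {V : Opens X} (hV : V ≤ U) (x : P.sec V hV) (y : P'.sec V hV),
      π.app hV x = 0 → f hV x y = 0)
    (hf' : ∀ {V : Opens X} (hV : V ≤ U) (x : P.sec V hV) (y : P'.sec V hV),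
      π'.app hV y = 0 → f hV x y = 0) :
    ∃ L : ∀ {V : Opens X} (hV : V ≤ U), Q.sec V hV →ₗ[ℂ] Q'.sec V hV →ₗ[ℂ] F.sec V hV,
      (∀ {V W : Opens X} (hV : V ≤ U) (h : W ≤ V) (q : Q.sec V hV) (q' : Q'.sec V hV),
        F.res hV h (L hV q q') = L (h.trans hV) (Q.res hV h q) (Q'.res hV h q')) ∧
      ∀ {V : Opens X} (hV : V ≤ U) (x : P.sec V hV) (y : P'.sec V hV),
        L hV (π.app hV x) (π'.app hV y) = f hV x y := by
  have indep : ∀ {V : Opens X} (hV : V ≤ U) (x x' : P.sec V hV) (y y' : P'.sec V hV),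
      π.app hV x = π.app hV x' → π'.app hV y = π'.app hV y' → f hV x y = f hV x' y' := by
    intro V hV x x' y y' hx hy
    have h1 := hf hV (x - x') y (by rw [map_sub, hx, sub_self])
    have h2 := hf' hV x' (y - y') (by rw [map_sub, hy, sub_self])
    rw [map_sub, LinearMap.sub_apply, sub_eq_zero] at h1
    rw [map_sub, sub_eq_zero] at h2
    rw [h1, h2]
  -- Wherever both arguments lift, the value has to be `f` of the lifts. By `indep` the lifts do not
  -- matter, so these local values glue.
  have key : ∀ {V : Opens X} (hV : V ≤ U) (q : Q.sec V hV) (q' : Q'.sec V hV), ∃ t : F.sec V hV,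
      ∀ (W : Opens X) (h : W ≤ V) (x : P.sec W (h.trans hV)) (y : P'.sec W (h.trans hV)),
        π.app _ x = Q.res hV h q → π'.app _ y = Q'.res hV h q' → F.res hV h t = f _ x y := by
    intro V hV q q'
    obtain ⟨t, ht, -⟩ := hF.descend hV
      (fun W h t => ∃ x y, π.app (h.trans hV) x = Q.res hV h q ∧
        π'.app (h.trans hV) y = Q'.res hV h q' ∧ f _ x y = t) (by
      rintro W h W' h' _ ⟨x, y, hx, hy, rfl⟩
      exact ⟨P.res _ h' x, P'.res _ h' y, by rw [← π.app_res, hx, Q.res_res],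
        by rw [← π'.app_res, hy, Q'.res_res], (f_res ..).symm⟩) (by
      rintro W h _ _ ⟨x, y, hx, hy, rfl⟩ ⟨x', y', hx', hy', rfl⟩
      exact indep _ _ _ _ _ (hx.trans hx'.symm) (hy.trans hy'.symm)) (by
      intro p hp
      obtain ⟨W, h, x, hpW, hx⟩ := π.surj hV q p hp
      obtain ⟨W', h', y, hpW', hy⟩ := π'.surj hV q' p hp
      refine ⟨W ⊓ W', inf_le_left.trans h, _, ⟨hpW, hpW'⟩, P.res _ inf_le_left x,
        P'.res _ inf_le_right y, ?_, ?_, rfl⟩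
      · rw [← π.app_res, hx, Q.res_res]
      · rw [← π'.app_res, hy, Q'.res_res])
    exact ⟨t, fun W h x y hx hy => ht W h _ ⟨x, y, hx, hy, rfl⟩⟩
  choose L hL using @key
  have reps : ∀ {V : Opens X} (hV : V ≤ U) (q : Q.sec V hV) (q' : Q'.sec V hV), ∀ p ∈ V,
      ∃ (W : Opens X) (h : W ≤ V) (x : P.sec W (h.trans hV)) (y : P'.sec W (h.trans hV)),
        p ∈ W ∧ π.app _ x = Q.res hV h q ∧ π'.app _ y = Q'.res hV h q' := by
    intro V hV q q' p hp
    obtain ⟨W, h, x, hpW, hx⟩ := π.surj hV q p hp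
    obtain ⟨W', h', y, hpW', hy⟩ := π'.surj hV q' p hp
    refine ⟨W ⊓ W', inf_le_left.trans h, P.res _ inf_le_left x,
        P'.res _ inf_le_right y, ⟨hpW, hpW'⟩, ?_, ?_⟩
    · rw [← π.app_res, hx, Q.res_res]
    · rw [← π'.app_res, hy, Q'.res_res]
  refine ⟨fun {V} hV => LinearMap.mk₂ ℂ (L hV) ?_ ?_ ?_ ?_, ?_, ?_⟩
  · intro a b c
    refine hF.ext hV fun p hp => ?_
    obtain ⟨W, h, x, z, hpW, hx, hz⟩ := reps hV a c p hp
    obtain ⟨W', h', y, -, hpW', hy, -⟩ := reps hV b c p hp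
    refine ⟨W ⊓ W', inf_le_left.trans h, ⟨hpW, hpW'⟩, ?_⟩
    have hx' : π.app _ (P.res _ (inf_le_left : W ⊓ W' ≤ W) x) = Q.res hV (inf_le_left.trans h) a := by
      rw [← π.app_res, hx, Q.res_res]
    have hz' : π'.app _ (P'.res _ (inf_le_left : W ⊓ W' ≤ W) z) =
        Q'.res hV (inf_le_left.trans h) c := by
      rw [← π'.app_res, hz, Q'.res_res]
    have hy' : π.app _ (P.res _ (inf_le_right : W ⊓ W' ≤ W') y) =
        Q.res hV (inf_le_left.trans h) b := by
      rw [← π.app_res, hy, Q.res_res]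
    have hxy : π.app _ (P.res _ (inf_le_left : W ⊓ W' ≤ W) x +
        P.res _ (inf_le_right : W ⊓ W' ≤ W') y) = Q.res hV (inf_le_left.trans h) (a + b) := by
      rw [map_add, map_add, hx', hy']
    rw [map_add, hL hV a c _ _ _ _ hx' hz', hL hV b c _ _ _ _ hy' hz',
      hL hV (a + b) c _ _ _ _ hxy hz', map_add, LinearMap.add_apply]
  · intro r a c
    refine hF.ext hV fun p hp => ?_
    obtain ⟨W, h, x, z, hpW, hx, hz⟩ := reps hV a c p hp
    refine ⟨W, h, hpW, ?_⟩
    have hrx : π.app _ (r • x) = Q.res hV h (r • a) := by rw [map_smul, map_smul, hx]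
    rw [map_smul, hL hV a c _ _ _ _ hx hz, hL hV (r • a) c _ _ _ _ hrx hz, map_smul,
      LinearMap.smul_apply]
  · intro a b c
    refine hF.ext hV fun p hp => ?_
    obtain ⟨W, h, x, z, hpW, hx, hz⟩ := reps hV a b p hp
    obtain ⟨W', h', -, y, hpW', -, hy⟩ := reps hV a c p hp
    refine ⟨W ⊓ W', inf_le_left.trans h, ⟨hpW, hpW'⟩, ?_⟩
    have hx' : π.app _ (P.res _ (inf_le_left : W ⊓ W' ≤ W) x) = Q.res hV (inf_le_left.trans h) a := by
      rw [← π.app_res, hx, Q.res_res]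
    have hz' : π'.app _ (P'.res _ (inf_le_left : W ⊓ W' ≤ W) z) =
        Q'.res hV (inf_le_left.trans h) b := by
      rw [← π'.app_res, hz, Q'.res_res]
    have hy' : π'.app _ (P'.res _ (inf_le_right : W ⊓ W' ≤ W') y) =
        Q'.res hV (inf_le_left.trans h) c := by
      rw [← π'.app_res, hy, Q'.res_res]
    have hzy : π'.app _ (P'.res _ (inf_le_left : W ⊓ W' ≤ W) z +
        P'.res _ (inf_le_right : W ⊓ W' ≤ W') y) = Q'.res hV (inf_le_left.trans h) (b + c) := by
      rw [map_add, map_add, hz', hy']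
    rw [map_add, hL hV a b _ _ _ _ hx' hz', hL hV a c _ _ _ _ hx' hy',
      hL hV a (b + c) _ _ _ _ hx' hzy, map_add]
  · intro r a c
    refine hF.ext hV fun p hp => ?_
    obtain ⟨W, h, x, z, hpW, hx, hz⟩ := reps hV a c p hp
    refine ⟨W, h, hpW, ?_⟩
    have hrz : π'.app _ (r • z) = Q'.res hV h (r • c) := by rw [map_smul, map_smul, hz]
    rw [map_smul, hL hV a c _ _ _ _ hx hz, hL hV a (r • c) _ _ _ _ hx hrz, map_smul]
  · intro V W hV h q q'
    simp only [LinearMap.mk₂_apply]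
    refine hF.ext _ fun p hp => ?_
    obtain ⟨Z, hZ, x, z, hpZ, hx, hz⟩ := reps (h.trans hV) (Q.res hV h q) (Q'.res hV h q') p hp
    refine ⟨Z, hZ, hpZ, ?_⟩
    rw [F.res_res, hL _ _ _ _ _ _ _ hx hz, Q.res_res] at *
    rw [Q'.res_res] at hz
    exact hL hV q q' _ _ _ _ hx hz
  · intro V hV x y
    simp only [LinearMap.mk₂_apply]
    have := hL hV (π.app hV x) (π'.app hV y) V le_rfl x y (Q.res_rfl _ _).symm (Q'.res_rfl _ _).symm
    rwa [F.res_rfl] at this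

end ModPsh

end

/-! ### Quotients of sheaves by subsheaves, in terms of germs -/

section

namespace ModPsh

variable {U : Opens X}

section Quotient

variable (F : ModPsh U) (K : ∀ {V : Opens X} (hV : V ≤ U), Submodule ℂ (F.sec V hV))

/-- Open neighbourhoods of `x` in `U`. -/
abbrev Nbhd (x : U) : Type u := {W : Opens X // W ≤ U ∧ x.1 ∈ W}

/-- Families of sections near `x` which eventually belong to `K`. -/
def evZero (x : U) : Submodule ℂ (∀ W : Nbhd x, F.sec W.1 W.2.1) where
  carrier := {s | ∃ W₀ : Nbhd x, ∀ W : Nbhd x, W.1 ≤ W₀.1 → s W ∈ K W.2.1}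
  add_mem' := by
    rintro s t ⟨W, hW⟩ ⟨W', hW'⟩
    refine ⟨⟨W.1 ⊓ W'.1, inf_le_left.trans W.2.1, ⟨W.2.2, W'.2.2⟩⟩, fun Z hZ => ?_⟩
    exact add_mem (hW Z (hZ.trans inf_le_left)) (hW' Z (hZ.trans inf_le_right))
  zero_mem' := ⟨⟨U, le_rfl, x.2⟩, fun W _ => zero_mem _⟩
  smul_mem' := by
    rintro c s ⟨W, hW⟩
    exact ⟨W, fun Z hZ => Submodule.smul_mem _ _ (hW Z hZ)⟩

/-- A vector space which contains the stalk of `F/K` at `x`. -/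
abbrev Germ (x : U) : Type u := (∀ W : Nbhd x, F.sec W.1 W.2.1) ⧸ F.evZero K x

open Classical in
/-- The extension by zero of a section to all neighbourhoods of `x`. -/
def spread {V : Opens X} (hV : V ≤ U) (x : U) :
    F.sec V hV →ₗ[ℂ] ∀ W : Nbhd x, F.sec W.1 W.2.1 where
  toFun f W := if h : W.1 ≤ V then F.res hV h f else 0
  map_add' f g := by
    funext W
    by_cases h : W.1 ≤ V <;> simp [h]
  map_smul' c f := by
    funext W
    by_cases h : W.1 ≤ V <;> simp [h]

theorem spread_apply {V : Opens X} (hV : V ≤ U) (x : U) (f : F.sec V hV) (W : Nbhd x)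
    (h : W.1 ≤ V) : F.spread hV x f W = F.res hV h f := by
  simp [spread, h]

/-- The germ of a section of `F/K`. -/
def germ {V : Opens X} (hV : V ≤ U) (x : U) : F.sec V hV →ₗ[ℂ] F.Germ K x :=
  (F.evZero K x).mkQ.comp (F.spread hV x)

/-- The extension by zero is artificial only at neighbourhoods not contained in `V`, and membership
in `evZero` is insensitive to all but small neighbourhoods. So germs vanish exactly as in the stalk
of `F/K`, although the space `Germ` is larger than the stalk. -/
theorem germ_eq_zero (hres : ∀ {V W : Opens X} (hV : V ≤ U) (h : W ≤ V) (f : F.sec V hV),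
      f ∈ K hV → F.res hV h f ∈ K (h.trans hV)) {V : Opens X} (hV : V ≤ U) (x : U) (hx : x.1 ∈ V)
    (f : F.sec V hV) : F.germ K hV x f = 0 ↔
      ∃ (W : Opens X) (h : W ≤ V), x.1 ∈ W ∧ F.res hV h f ∈ K (h.trans hV) := by
  rw [germ, LinearMap.comp_apply, Submodule.mkQ_apply, Submodule.Quotient.mk_eq_zero]
  constructor
  · rintro ⟨W, hW⟩
    refine ⟨W.1 ⊓ V, inf_le_right, ⟨W.2.2, hx⟩, ?_⟩
    have := hW ⟨W.1 ⊓ V, inf_le_right.trans hV, ⟨W.2.2, hx⟩⟩ inf_le_left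
    rwa [F.spread_apply hV x f _ inf_le_right] at this
  · rintro ⟨W, h, hxW, hf⟩
    refine ⟨⟨W, h.trans hV, hxW⟩, fun Z hZ => ?_⟩
    rw [F.spread_apply hV x f _ (hZ.trans h), ← F.res_res hV h hZ]
    exact hres _ _ _ hf

theorem germ_res {V W : Opens X} (hV : V ≤ U) (h : W ≤ V) (x : U) (hx : x.1 ∈ W)
    (f : F.sec V hV) : F.germ K (h.trans hV) x (F.res hV h f) = F.germ K hV x f := by
  refine (Submodule.Quotient.eq _).2 ⟨⟨W, h.trans hV, hx⟩, fun Z hZ => ?_⟩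
  rw [Pi.sub_apply, F.spread_apply _ x _ _ hZ, F.spread_apply hV x f _ (hZ.trans h), F.res_res,
    sub_self]
  exact zero_mem _

/-- Sections of the quotient sheaf `F/K`, as families of germs. -/
def quotSec {V : Opens X} (hV : V ≤ U) :
    Submodule ℂ (∀ x : V, F.Germ K ⟨x.1, hV x.2⟩) where
  carrier := {s | ∀ x : V, ∃ (W : Opens X) (h : W ≤ V) (f : F.sec W (h.trans hV)), x.1 ∈ W ∧
    ∀ (y : X) (hy : y ∈ W), s ⟨y, h hy⟩ = F.germ K (h.trans hV) ⟨y, hV (h hy)⟩ f}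
  add_mem' := by
    intro s t hs ht x
    obtain ⟨W, h, f, hx, hf⟩ := hs x
    obtain ⟨W', h', g, hx', hg⟩ := ht x
    refine ⟨W ⊓ W', inf_le_left.trans h, F.res _ inf_le_left f + F.res _ inf_le_right g,
      ⟨hx, hx'⟩, fun y hy => ?_⟩
    rw [Pi.add_apply, hf y hy.1, hg y hy.2, map_add]
    rw [F.germ_res K _ inf_le_left ⟨y, hV (h hy.1)⟩ hy f]
    rw [F.germ_res K _ inf_le_right ⟨y, hV (h hy.1)⟩ hy g]
  zero_mem' := fun x => ⟨V, le_rfl, 0, x.2, fun y hy => by rw [map_zero]; rfl⟩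
  smul_mem' := by
    intro c s hs x
    obtain ⟨W, h, f, hx, hf⟩ := hs x
    refine ⟨W, h, c • f, hx, fun y hy => ?_⟩
    rw [Pi.smul_apply, hf y hy, map_smul]

/-- The quotient sheaf `F/K`. -/
def quot : ModPsh U where
  sec V hV := F.quotSec K hV
  res {V W} hV h :=
    { toFun := fun s => ⟨fun x => s.1 ⟨x.1, h x.2⟩, fun x => by
        obtain ⟨Z, hZ, f, hx, hf⟩ := s.2 ⟨x.1, h x.2⟩
        refine ⟨Z ⊓ W, inf_le_right, F.res _ inf_le_left f, ⟨hx, x.2⟩, fun y hy => ?_⟩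
        rw [F.germ_res K _ inf_le_left ⟨y, hV (h hy.2)⟩ hy f]
        exact hf y hy.1⟩
      map_add' := fun _ _ => rfl
      map_smul' := fun _ _ => rfl }
  res_rfl _ _ := rfl
  res_res _ _ _ _ := rfl

theorem quot_isSheaf : (F.quot K).IsSheaf := by
  refine ⟨fun {ι} V hV s hs => ?_⟩
  have hs' : ∀ (i j : ι) (y : X) (hi : y ∈ V i) (hj : y ∈ V j),
      (s i).1 ⟨y, hi⟩ = (s j).1 ⟨y, hj⟩ := fun i j y hi hj =>
    congrFun (congrArg Subtype.val (hs i j)) ⟨y, ⟨hi, hj⟩⟩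
  choose i hi using fun x : (iSup V : Opens X) => Opens.mem_iSup.1 x.2
  refine ⟨⟨fun x => (s (i x)).1 ⟨x.1, hi x⟩, fun x => ?_⟩, fun j => ?_, fun t ht => ?_⟩
  · obtain ⟨W, h, f, hx, hf⟩ := (s (i x)).2 ⟨x.1, hi x⟩
    refine ⟨W, h.trans (le_iSup V _), f, hx, fun y hy => ?_⟩
    exact (hs' (i ⟨y, le_iSup V _ (h hy)⟩) (i x) y (hi _) (h hy)).trans (hf y hy)
  · exact Subtype.ext (funext fun x => hs' _ _ _ _ _)
  · refine Subtype.ext (funext fun x => ?_)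
    have := congrFun (congrArg Subtype.val (ht (i x))) ⟨x.1, hi x⟩
    exact this

/-- The projection `F → F/K`. -/
def quotMk : Epi F (F.quot K) where
  app {V} hV :=
    { toFun := fun f => ⟨fun x => F.germ K hV ⟨x.1, hV x.2⟩ f,
        fun x => ⟨V, le_rfl, f, x.2, fun _ _ => rfl⟩⟩
      map_add' := fun f g => Subtype.ext (funext fun x => map_add _ f g)
      map_smul' := fun c f => Subtype.ext (funext fun x => map_smul _ c f) }
  app_res {V W} hV h f := Subtype.ext (funext fun x => by
    exact (F.germ_res K hV h ⟨x.1, hV (h x.2)⟩ x.2 f).symm)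
  surj {V} hV q p hp := by
    obtain ⟨W, h, f, hx, hf⟩ := q.2 ⟨p, hp⟩
    exact ⟨W, h, f, hx, Subtype.ext (funext fun y => (hf y.1 y.2).symm)⟩

/-- By `hres` and `hloc`, `K` is a subsheaf, so a section all of whose germs are zero already
belongs to it. -/
theorem quotMk_eq_zero (hres : ∀ {V W : Opens X} (hV : V ≤ U) (h : W ≤ V) (f : F.sec V hV),
      f ∈ K hV → F.res hV h f ∈ K (h.trans hV))
    (hloc : ∀ {V : Opens X} (hV : V ≤ U) (f : F.sec V hV),
      (∀ p ∈ V, ∃ (W : Opens X) (h : W ≤ V), p ∈ W ∧ F.res hV h f ∈ K (h.trans hV)) → f ∈ K hV)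
    {V : Opens X} (hV : V ≤ U) (f : F.sec V hV) :
    (F.quotMk K).app hV f = 0 ↔ f ∈ K hV := by
  constructor
  · intro hf
    refine hloc hV f fun p hp => ?_
    exact (F.germ_eq_zero K hres hV ⟨p, hV hp⟩ hp f).1
      (congrFun (congrArg Subtype.val hf) ⟨p, hp⟩)
  · intro hf
    refine Subtype.ext (funext fun x => ?_)
    exact (F.germ_eq_zero K hres hV ⟨x.1, hV x.2⟩ x.2 f).2 ⟨V, le_rfl, x.2, by rwa [F.res_rfl]⟩

end Quotient

end ModPsh

/-! ### The sheaves of functions, of vector fields and of sections of algebroids -/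

section Sheaves

variable (O : TopCat.Sheaf (CommAlgCat.{u} ℂ) X) (U : Opens X)

/-- The structure sheaf. -/
abbrev secPsh : ModPsh U where
  sec V _ := Sec O V
  res _ h := (rs O h).toLinearMap
  res_rfl _ _ := rs_rfl O _ _
  res_res _ _ _ _ := rs_rs O _ _ _

theorem secPsh_isSheaf : (secPsh O U).IsSheaf := ⟨fun V _ s hs => sec_glue O V s hs⟩

variable {O U} in
theorem sec_ext {V : Opens X} {f g : Sec O V}
    (h : ∀ p ∈ V, ∃ (W : Opens X) (hW : W ≤ V), p ∈ W ∧ rs O hW f = rs O hW g) : f = g :=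
  (secPsh_isSheaf O V).ext le_rfl h

/-- The tangent sheaf. -/
abbrev vfPsh : ModPsh U where
  sec V _ := VF O V
  res _ h := VF.res h
  res_rfl _ _ := rfl
  res_res _ _ _ _ := rfl

/-- A vector field consists of derivations on all smaller open sets, so gluing has to produce one
for every W ≤ ⋃ Vᵢ. Its value on f is glued from the values of the given fields on Vᵢ ⊓ W, and the
rules for derivations hold because they hold on these sets. -/
theorem vfPsh_isSheaf : (vfPsh O U).IsSheaf := by
  refine ⟨fun {ι} V hV s hs => ?_⟩
  have hs' : ∀ (i j : ι) (W : Opens X) (hi : W ≤ V i) (hj : W ≤ V j),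
      (s i).at' W hi = (s j).at' W hj := by
    intro i j W hi hj
    exact congrArg (fun ξ : VF O (V i ⊓ V j) => ξ.at' W (le_inf hi hj)) (hs i j)
  have cov : ∀ (W : Opens X), W ≤ iSup V → ∀ p ∈ W, ∃ i, p ∈ V i ⊓ W := fun W hW p hp => by
    obtain ⟨i, hi⟩ := Opens.mem_iSup.1 (hW hp)
    exact ⟨i, hi, hp⟩
  have key : ∀ (W : Opens X) (hW : W ≤ iSup V) (f : Sec O W), ∃! t : Sec O W,
      ∀ i, rs O inf_le_right t = (s i).at' (V i ⊓ W) inf_le_left (rs O inf_le_right f) := by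
    intro W hW f
    refine (secPsh_isSheaf O W).glue_cover le_rfl (fun i => V i ⊓ W) (fun i => inf_le_right)
      (cov W hW) (fun i => (s i).at' (V i ⊓ W) inf_le_left (rs O inf_le_right f)) ?_
    intro i j
    change rs O _ _ = rs O _ _
    rw [VF.rs_at, VF.rs_at, rs_rs, rs_rs, hs' i j]
  have hext : ∀ (W : Opens X), W ≤ iSup V → ∀ a b : Sec O W,
      (∀ i, rs O (inf_le_right : V i ⊓ W ≤ W) a = rs O inf_le_right b) → a = b := by
    intro W hW a b h
    refine sec_ext fun p hp => ?_
    obtain ⟨i, hi⟩ := cov W hW p hp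
    exact ⟨_, inf_le_right, hi, h i⟩
  choose d hd hdu using key
  let D : ∀ W : Opens X, W ≤ iSup V → Derivation ℂ (Sec O W) (Sec O W) := fun W hW =>
    { toFun := d W hW
      map_add' := fun a b => hext W hW _ _ fun i => by
        rw [map_add, hd, hd, hd, map_add, map_add]
      map_smul' := fun c a => hext W hW _ _ fun i => by
        rw [hd, map_smul, Derivation.map_smul, RingHom.id_apply, map_smul]
        exact congrArg _ (hd W hW a i).symm
      map_one_eq_zero' := hext W hW _ _ fun i => by
        change rs O _ (d W hW 1) = _
        rw [hd, map_one, Derivation.map_one_eq_zero, map_zero]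
      leibniz' := fun a b => hext W hW _ _ fun i => by
        change rs O _ (d W hW (a * b)) = rs O _ (a • d W hW b + b • d W hW a)
        rw [hd, map_mul, Derivation.leibniz, map_add, smul_eq_mul, smul_eq_mul, smul_eq_mul,
          smul_eq_mul, map_mul, map_mul, hd, hd] }
  have hD : ∀ (W : Opens X) (hW : W ≤ iSup V) (f : Sec O W) (Z : Opens X) (hZ : Z ≤ W) (i : ι)
      (hi : Z ≤ V i), rs O hZ (D W hW f) = (s i).at' Z hi (rs O hZ f) := by
    intro W hW f Z hZ i hi
    have := congrArg (rs O (le_inf hi hZ : Z ≤ V i ⊓ W)) (hd W hW f i)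
    rw [rs_rs, VF.rs_at, rs_rs] at this
    exact this
  refine ⟨VF.mk D ?_, ?_, ?_⟩
  · intro W W' h h' f
    refine hext W' (h'.trans h) _ _ fun i => ?_
    rw [rs_rs, hD _ _ _ _ _ i inf_le_left, hD _ _ _ _ _ i inf_le_left, rs_rs]
  · intro i
    refine VF.ext fun W hW f => ?_
    have := hD W (hW.trans (le_iSup V i)) f W le_rfl i hW
    rwa [rs_rfl, rs_rfl] at this
  · intro y hy
    refine VF.ext fun W hW f => hext W hW _ _ fun i => ?_
    rw [VF.rs_at, VF.mk_at, hD W hW f _ inf_le_right i inf_le_left, ← hy i]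
    rfl

variable {O U} in
theorem vf_ext {V : Opens X} {ξ η : VF O V}
    (h : ∀ p ∈ V, ∃ (W : Opens X) (hW : W ≤ V), p ∈ W ∧ VF.res hW ξ = VF.res hW η) : ξ = η :=
  (vfPsh_isSheaf O V).ext le_rfl h

variable {O}

/-- The presheaf underlying a Lie algebroid. -/
abbrev LieAlgebroidData.psh (A : LieAlgebroidData O) (U : Opens X) : ModPsh U where
  sec V _ := A.sec V
  res _ h := A.res h
  res_rfl _ := A.res_rfl
  res_res _ := A.res_res

theorem LieAlgebroidData.IsLieAlgebroid.isSheaf {A : LieAlgebroidData O} (hA : A.IsLieAlgebroid)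
    (U : Opens X) : (A.psh U).IsSheaf := ⟨fun V _ s hs => hA.glue V s hs⟩

theorem LieAlgebroidData.IsLieAlgebroid.ext {A : LieAlgebroidData O} (hA : A.IsLieAlgebroid)
    {V : Opens X} {a b : A.sec V}
    (h : ∀ p ∈ V, ∃ (W : Opens X) (hW : W ≤ V), p ∈ W ∧ A.res hW a = A.res hW b) : a = b :=
  (hA.isSheaf V).ext le_rfl h

variable {U}

/-- The presheaf underlying an algebroid. -/
abbrev AlgebroidData.psh (E : AlgebroidData O U) : ModPsh U where
  sec := E.sec
  res := E.res
  res_rfl := E.res_rfl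
  res_res := E.res_res

theorem AlgebroidData.isSheaf (E : AlgebroidData O U) : E.psh.IsSheaf := ⟨E.glue⟩

theorem AlgebroidData.ext_local (E : AlgebroidData O U) {V : Opens X} (hV : V ≤ U)
    {a b : E.sec V hV}
    (h : ∀ p ∈ V, ∃ (W : Opens X) (hW : W ≤ V), p ∈ W ∧ E.res hV hW a = E.res hV hW b) : a = b :=
  E.isSheaf.ext hV h

end Sheaves

namespace VF

variable {O : TopCat.Sheaf (CommAlgCat.{u} ℂ) X} {V : Opens X}

theorem bracket_self (ξ : VF O V) : ⁅ξ, ξ⁆ = 0 := by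
  ext W h f
  simp

theorem jacobi (ξ η ζ : VF O V) : ⁅ξ, ⁅η, ζ⁆⁆ = ⁅⁅ξ, η⁆, ζ⁆ + ⁅η, ⁅ξ, ζ⁆⁆ := by
  ext W h f
  simp only [VF.bracket_at, VF.add_at, Derivation.commutator_apply, Derivation.add_apply, map_sub]
  abel

theorem bracket_smul (ξ η : VF O V) (f : Sec O V) : ⁅ξ, f • η⁆ = f • ⁅ξ, η⁆ + ξ.app f • η := by
  ext W h g
  simp only [VF.bracket_at, VF.smul_at, VF.add_at, Derivation.commutator_apply,
    Derivation.add_apply, Derivation.smul_apply, smul_eq_mul, Derivation.leibniz, VF.app, VF.rs_at]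
  ring

end VF

/-- The tangent sheaf is a Lie algebroid. -/
theorem tangent_isLieAlgebroid (O : TopCat.Sheaf (CommAlgCat.{u} ℂ) X) :
    (tangent O).IsLieAlgebroid where
  glue V s hs := (vfPsh_isSheaf O ⊤).glue V (fun _ => le_top) s hs
  one_act {V} a := one_smul (Sec O V) (show VF O V from a)
  mul_act {V} f g a := mul_smul f g (show VF O V from a)
  br_self a := VF.bracket_self a
  jacobi a b c := VF.jacobi a b c
  anchor_act _ _ := rfl
  anchor_br _ _ := rfl
  br_act a b f := VF.bracket_smul a b f

theorem tangent_isTransitive (O : TopCat.Sheaf (CommAlgCat.{u} ℂ) X) :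
    (tangent O).IsTransitive := fun V ξ _ hx => ⟨V, le_rfl, ξ, hx, rfl⟩

end

section

variable {O : TopCat.Sheaf (CommAlgCat.{u} ℂ) X} {U : Opens X}

/-! ### Vector fields as operators, coordinates -/

namespace VF

variable {V W : Opens X}

theorem rs_app (h : W ≤ V) (ξ : VF O V) (f : Sec O V) :
    rs O h (ξ.app f) = (VF.res h ξ).app (rs O h f) := ξ.rs_at _ _ _

@[simp] theorem add_app (ξ η : VF O V) (f : Sec O V) : (ξ + η).app f = ξ.app f + η.app f := rfl

@[simp] theorem zero_app (f : Sec O V) : (0 : VF O V).app f = 0 := rfl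

@[simp] theorem smulC_app (c : ℂ) (ξ : VF O V) (f : Sec O V) : (c • ξ).app f = c • ξ.app f := rfl

@[simp] theorem neg_app (ξ : VF O V) (f : Sec O V) : (-ξ).app f = -ξ.app f := rfl

@[simp] theorem sub_app (ξ η : VF O V) (f : Sec O V) : (ξ - η).app f = ξ.app f - η.app f := rfl

@[simp] theorem smul_app (g : Sec O V) (ξ : VF O V) (f : Sec O V) :
    (g • ξ).app f = g * ξ.app f := by
  simp [app]

@[simp] theorem sum_app {ι : Type*} (s : Finset ι) (ξ : ι → VF O V) (f : Sec O V) :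
    (∑ i ∈ s, ξ i).app f = ∑ i ∈ s, (ξ i).app f := by
  classical
  induction s using Finset.induction_on with
  | empty => simp
  | insert a s ha ih => rw [Finset.sum_insert ha, Finset.sum_insert ha, add_app, ih]

@[simp] theorem bracket_app (ξ η : VF O V) (f : Sec O V) :
    ⁅ξ, η⁆.app f = ξ.app (η.app f) - η.app (ξ.app f) := by
  simp [app, Derivation.commutator_apply]

@[simp] theorem app_add (ξ : VF O V) (f g : Sec O V) : ξ.app (f + g) = ξ.app f + ξ.app g :=
  map_add _ _ _

@[simp] theorem app_sub (ξ : VF O V) (f g : Sec O V) : ξ.app (f - g) = ξ.app f - ξ.app g :=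
  map_sub _ _ _

@[simp] theorem app_neg (ξ : VF O V) (f : Sec O V) : ξ.app (-f) = -ξ.app f :=
  map_neg _ _

@[simp] theorem app_zero (ξ : VF O V) : ξ.app 0 = 0 := map_zero _

@[simp] theorem app_smulC (ξ : VF O V) (c : ℂ) (f : Sec O V) : ξ.app (c • f) = c • ξ.app f :=
  Derivation.map_smul _ _ _

@[simp] theorem app_sum {ι : Type*} (s : Finset ι) (ξ : VF O V) (f : ι → Sec O V) :
    ξ.app (∑ i ∈ s, f i) = ∑ i ∈ s, ξ.app (f i) := map_sum _ _ _

@[simp] theorem app_mul (ξ : VF O V) (f g : Sec O V) :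
    ξ.app (f * g) = f * ξ.app g + g * ξ.app f := Derivation.leibniz _ _ _

@[simp] theorem app_one (ξ : VF O V) : ξ.app 1 = 0 := Derivation.map_one_eq_zero _

@[simp] theorem res_rfl' (h : V ≤ V) (ξ : VF O V) : VF.res h ξ = ξ := rfl

@[simp] theorem res_res' {Z : Opens X} (h : W ≤ V) (h' : Z ≤ W) (ξ : VF O V) :
    VF.res h' (VF.res h ξ) = VF.res (h'.trans h) ξ := rfl

theorem res_smul (h : W ≤ V) (f : Sec O V) (ξ : VF O V) :
    VF.res h (f • ξ) = rs O h f • VF.res h ξ := by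
  ext Z hZ g
  simp

theorem res_bracket (h : W ≤ V) (ξ η : VF O V) :
    VF.res h ⁅ξ, η⁆ = ⁅VF.res h ξ, VF.res h η⁆ := rfl

end VF

/-- `t` and `D` are coordinates on `V`. -/
def IsChart {V : Opens X} {n : ℕ} (t : Fin n → Sec O V) (D : Fin n → VF O V) : Prop :=
  (∀ i j, (D i).app (t j) = if i = j then 1 else 0) ∧
    ∀ (W : Opens X) (h : W ≤ V) (ξ : VF O W),
      ξ = ∑ i, ξ.app (rs O h (t i)) • VF.res h (D i)

theorem IsChart.res {V W : Opens X} {n : ℕ} {t : Fin n → Sec O V} {D : Fin n → VF O V}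
    (h : IsChart t D) (hW : W ≤ V) :
    IsChart (fun i => rs O hW (t i)) (fun i => VF.res hW (D i)) := by
  refine ⟨fun i j => ?_, fun Z hZ ξ => ?_⟩
  · rw [← VF.rs_app, h.1 i j]
    split_ifs <;> simp
  · simpa using h.2 Z (hZ.trans hW) ξ

theorem HasLocalCoordinates.exists_chart (hX : HasLocalCoordinates O) (V : Opens X) (p : X)
    (hp : p ∈ V) : ∃ (W : Opens X) (_ : W ≤ V), p ∈ W ∧
      ∃ (n : ℕ) (t : Fin n → Sec O W) (D : Fin n → VF O W), IsChart t D := by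
  obtain ⟨Z, hpZ, n, t, D, h⟩ := hX p
  exact ⟨Z ⊓ V, inf_le_right, ⟨hpZ, hp⟩, n, _, _, IsChart.res (t := t) (D := D) h inf_le_left⟩

/-- `α` is a 1-form on `V`, given by its values on vector fields. -/
structure IsOneForm {V : Opens X} (α : ∀ W : Opens X, W ≤ V → VF O W → Sec O W) : Prop where
  map_add : ∀ (W : Opens X) (h : W ≤ V) (ξ η : VF O W), α W h (ξ + η) = α W h ξ + α W h η
  map_smul : ∀ (W : Opens X) (h : W ≤ V) (f : Sec O W) (ξ : VF O W),
    α W h (f • ξ) = f * α W h ξ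
  map_res : ∀ (W : Opens X) (h : W ≤ V) (Z : Opens X) (h' : Z ≤ W) (ξ : VF O W),
    rs O h' (α W h ξ) = α Z (h'.trans h) (VF.res h' ξ)

/-! ### A common generalization of Courant and vertex algebroids -/

namespace AlgebroidData

/-- The axioms of a vertex algebroid with the anomalies multiplied by `c`: for `c = 1` these are
vertex algebroids, for `c = 0` Courant algebroids. -/
structure IsAlg (c : ℂ) (E : AlgebroidData O U) : Prop where
  one_act : ∀ {V : Opens X} (hV : V ≤ U) (a : E.sec V hV), E.act hV 1 a = a
  assoc : ∀ {V : Opens X} (hV : V ≤ U) (f g : Sec O V) (a : E.sec V hV),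
    E.act hV f (E.act hV g a) - E.act hV (f * g) a =
      c • (E.act hV ((E.anchor hV a).app f) (E.der hV g) +
      E.act hV ((E.anchor hV a).app g) (E.der hV f))
  leibniz : ∀ {V : Opens X} (hV : V ≤ U) (a b c : E.sec V hV),
    E.br hV a (E.br hV b c) = E.br hV (E.br hV a b) c + E.br hV b (E.br hV a c)
  anchor_br : ∀ {V : Opens X} (hV : V ≤ U) (a b : E.sec V hV),
    E.anchor hV (E.br hV a b) = ⁅E.anchor hV a, E.anchor hV b⁆
  pair_symm : ∀ {V : Opens X} (hV : V ≤ U) (a b : E.sec V hV), E.pair hV a b = E.pair hV b a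
  anchor_der : ∀ {V : Opens X} (hV : V ≤ U) (f : Sec O V), E.anchor hV (E.der hV f) = 0
  br_act : ∀ {V : Opens X} (hV : V ≤ U) (a b : E.sec V hV) (f : Sec O V),
    E.br hV a (E.act hV f b) = E.act hV ((E.anchor hV a).app f) b + E.act hV f (E.br hV a b)
  br_symm : ∀ {V : Opens X} (hV : V ≤ U) (a b : E.sec V hV),
    E.br hV a b + E.br hV b a = E.der hV (E.pair hV a b)
  anchor_act : ∀ {V : Opens X} (hV : V ≤ U) (f : Sec O V) (a : E.sec V hV),
    E.anchor hV (E.act hV f a) = f • E.anchor hV a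
  pair_act : ∀ {V : Opens X} (hV : V ≤ U) (f : Sec O V) (a b : E.sec V hV),
    E.pair hV (E.act hV f a) b =
      f * E.pair hV a b - c • (E.anchor hV a).app ((E.anchor hV b).app f)
  pair_inv : ∀ {V : Opens X} (hV : V ≤ U) (a b c : E.sec V hV),
    (E.anchor hV a).app (E.pair hV b c) = E.pair hV (E.br hV a b) c + E.pair hV b (E.br hV a c)
  der_mul : ∀ {V : Opens X} (hV : V ≤ U) (f g : Sec O V),
    E.der hV (f * g) = E.act hV f (E.der hV g) + E.act hV g (E.der hV f)
  br_der : ∀ {V : Opens X} (hV : V ≤ U) (a : E.sec V hV) (f : Sec O V),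
    E.br hV a (E.der hV f) = E.der hV ((E.anchor hV a).app f)
  pair_der : ∀ {V : Opens X} (hV : V ≤ U) (a : E.sec V hV) (f : Sec O V),
    E.pair hV a (E.der hV f) = (E.anchor hV a).app f
  der_factors : E.DerFactors

variable {E : AlgebroidData O U} {c : ℂ}

theorem isAlg_zero_iff : E.IsAlg 0 ↔ E.IsCourant := by
  constructor
  · intro h
    exact
      { one_act := h.one_act
        mul_act := fun hV f g a => by
          have := h.assoc hV f g a
          rw [zero_smul, sub_eq_zero] at this
          exact this.symm
        leibniz := h.leibniz
        anchor_act := h.anchor_act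
        anchor_br := h.anchor_br
        pair_symm := h.pair_symm
        pair_act := fun hV f a b => by simpa using h.pair_act hV f a b
        der_mul := h.der_mul
        anchor_der := h.anchor_der
        br_act := fun hV a b f => by rw [h.br_act, add_comm]
        pair_inv := fun hV a b c => (h.pair_inv hV a b c).symm
        br_der := h.br_der
        pair_der := h.pair_der
        br_symm := h.br_symm
        der_factors := h.der_factors }
  · intro h
    exact
      { one_act := h.one_act
        assoc := fun hV f g a => by rw [zero_smul, h.mul_act, sub_self]
        leibniz := h.leibniz
        anchor_act := h.anchor_act
        anchor_br := h.anchor_br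
        pair_symm := h.pair_symm
        pair_act := fun hV f a b => by simpa using h.pair_act hV f a b
        der_mul := h.der_mul
        anchor_der := h.anchor_der
        br_act := fun hV a b f => by rw [h.br_act, add_comm]
        pair_inv := fun hV a b c => (h.pair_inv hV a b c).symm
        br_der := h.br_der
        pair_der := h.pair_der
        br_symm := h.br_symm
        der_factors := h.der_factors }

theorem isAlg_one_iff : E.IsAlg 1 ↔ E.IsVertex := by
  constructor
  · intro h
    exact
      { one_act := h.one_act
        assoc := fun hV f g a => by rw [h.assoc, one_smul]
        leibniz := h.leibniz
        anchor_act := h.anchor_act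
        anchor_br := h.anchor_br
        pair_symm := h.pair_symm
        pair_act := fun hV f a b => by rw [h.pair_act, one_smul]
        der_mul := h.der_mul
        anchor_der := h.anchor_der
        br_act := h.br_act
        pair_inv := h.pair_inv
        br_der := h.br_der
        pair_der := h.pair_der
        br_symm := h.br_symm
        der_factors := h.der_factors }
  · intro h
    exact
      { one_act := h.one_act
        assoc := fun hV f g a => by rw [h.assoc, one_smul]
        leibniz := h.leibniz
        anchor_act := h.anchor_act
        anchor_br := h.anchor_br
        pair_symm := h.pair_symm
        pair_act := fun hV f a b => by rw [h.pair_act, one_smul]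
        der_mul := h.der_mul
        anchor_der := h.anchor_der
        br_act := h.br_act
        pair_inv := h.pair_inv
        br_der := h.br_der
        pair_der := h.pair_der
        br_symm := h.br_symm
        der_factors := h.der_factors }

theorem IsAlg.restrict (h : E.IsAlg c) {U' : Opens X} (hU : U' ≤ U) :
    (E.restrict hU).IsAlg c where
  one_act hV := h.one_act (hV.trans hU)
  assoc hV := h.assoc (hV.trans hU)
  leibniz hV := h.leibniz (hV.trans hU)
  anchor_act hV := h.anchor_act (hV.trans hU)
  anchor_br hV := h.anchor_br (hV.trans hU)
  pair_symm hV := h.pair_symm (hV.trans hU)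
  pair_act hV := h.pair_act (hV.trans hU)
  der_mul hV := h.der_mul (hV.trans hU)
  anchor_der hV := h.anchor_der (hV.trans hU)
  br_act hV := h.br_act (hV.trans hU)
  pair_inv hV := h.pair_inv (hV.trans hU)
  br_der hV := h.br_der (hV.trans hU)
  pair_der hV := h.pair_der (hV.trans hU)
  br_symm hV := h.br_symm (hV.trans hU)
  der_factors hV := h.der_factors (hV.trans hU)

/-- The associativity anomaly is linear in ∂, and the anomaly in ⟨f * v, w⟩ does not involve the
pairing, so the changes of sign are absorbed by c. In particular the opposite of a vertex algebroid
has level −1, which is what cancels the level of `Ahat` in a difference. -/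
theorem IsAlg.neg (h : E.IsAlg c) : E.neg.IsAlg (-c) where
  one_act := h.one_act
  assoc hV f g a := by
    rw [h.assoc hV f g a]
    simp only [LinearMap.neg_apply, map_neg]
    module
  leibniz := h.leibniz
  anchor_act := h.anchor_act
  anchor_br := h.anchor_br
  pair_symm hV a b := by simp [h.pair_symm hV a b]
  pair_act hV f a b := by
    simp only [LinearMap.neg_apply, h.pair_act hV f a b, neg_smul]
    ring
  der_mul hV f g := by
    simp only [LinearMap.neg_apply, h.der_mul hV f g, map_neg]
    abel
  anchor_der hV f := by simp [h.anchor_der hV f]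
  br_act := h.br_act
  pair_inv hV a b c := by
    simp only [LinearMap.neg_apply, VF.app_neg, h.pair_inv hV a b c]
    abel
  br_der hV a f := by simp [h.br_der hV a f]
  pair_der hV a f := by simp [h.pair_der hV a f]
  br_symm hV a b := by simp [h.br_symm hV a b]
  der_factors hV n f g hfg := by
    simpa using congrArg Neg.neg (h.der_factors hV n f g hfg)

variable {V : Opens X} {hV : V ≤ U}

theorem IsAlg.pair_der_left (h : E.IsAlg c) (f : Sec O V) (a : E.sec V hV) :
    E.pair hV (E.der hV f) a = (E.anchor hV a).app f := by
  rw [h.pair_symm, h.pair_der]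

/-- The anomaly of the pairing contains π(∂g) = 0, so the pairing with sections of Ω is 𝒪-linear
whatever the level. -/
theorem IsAlg.pair_act_der (h : E.IsAlg c) (f g : Sec O V) (a : E.sec V hV) :
    E.pair hV (E.act hV f (E.der hV g)) a = f * (E.anchor hV a).app g := by
  rw [h.pair_act, h.anchor_der, h.pair_der_left]
  simp

theorem IsAlg.anchor_act_der (h : E.IsAlg c) (f g : Sec O V) :
    E.anchor hV (E.act hV f (E.der hV g)) = 0 := by
  rw [h.anchor_act, h.anchor_der, smul_zero]

/-- The section `∑ fₖ * ∂gₖ`. -/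
def om (E : AlgebroidData O U) {V : Opens X} (hV : V ≤ U) {n : ℕ} (f g : Fin n → Sec O V) :
    E.sec V hV := ∑ k, E.act hV (f k) (E.der hV (g k))

theorem res_om (E : AlgebroidData O U) (hV : V ≤ U) {W : Opens X} (h : W ≤ V) {n : ℕ}
    (f g : Fin n → Sec O V) :
    E.res hV h (E.om hV f g) = E.om (h.trans hV) (fun k => rs O h (f k)) (fun k => rs O h (g k)) := by
  simp only [om, map_sum, E.res_act, E.res_der]

theorem IsAlg.pair_om (h : E.IsAlg c) {n : ℕ} (f g : Fin n → Sec O V) (a : E.sec V hV) :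
    E.pair hV (E.om hV f g) a = ∑ k, f k * (E.anchor hV a).app (g k) := by
  simp only [om, map_sum, LinearMap.sum_apply, h.pair_act_der]

theorem IsAlg.anchor_om (h : E.IsAlg c) {n : ℕ} (f g : Fin n → Sec O V) :
    E.anchor hV (E.om hV f g) = 0 := by
  simp only [om, map_sum, h.anchor_act_der, Finset.sum_const_zero]

end AlgebroidData

/-! ### Sections of `Ω¹` in an extension -/

namespace Extension

open AlgebroidData

variable {A : LieAlgebroidData O} {E : Extension A U} {c : ℂ} {V : Opens X} {hV : V ≤ U}

theorem proj_om (_h : E.E.IsAlg c) {n : ℕ} (f g : Fin n → Sec O V) :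
    E.proj hV (E.E.om hV f g) = 0 := by
  refine (E.ker hV _).2 fun x hx => ⟨V, le_rfl, hx, n, f, g, ?_⟩
  rw [E.E.res_rfl]
  rfl

theorem proj_der (h : E.E.IsAlg c) (f : Sec O V) : E.proj hV (E.E.der hV f) = 0 := by
  refine (E.ker hV _).2 fun x hx => ⟨V, le_rfl, hx, 1, fun _ => 1, fun _ => f, ?_⟩
  rw [E.E.res_rfl]
  simp [h.one_act]

theorem anchor_eq_zero (e : E.E.sec V hV) (he : E.proj hV e = 0) : E.E.anchor hV e = 0 := by
  rw [← E.anchor_proj, he, map_zero]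

theorem exists_om (e : E.E.sec V hV) (he : E.proj hV e = 0) (p : X) (hp : p ∈ V) :
    ∃ (W : Opens X) (h : W ≤ V), p ∈ W ∧ ∃ (n : ℕ) (f g : Fin n → Sec O W),
      E.E.res hV h e = E.E.om (h.trans hV) f g := (E.ker hV e).1 he p hp

theorem exists_lift (htrans : A.IsTransitive) (E : Extension A U) (hV : V ≤ U) (ξ : VF O V) (p : X)
    (hp : p ∈ V) : ∃ (W : Opens X) (h : W ≤ V) (e : E.E.sec W (h.trans hV)), p ∈ W ∧
      E.E.anchor _ e = VF.res h ξ := by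
  obtain ⟨W, h, a, hpW, ha⟩ := htrans V ξ p hp
  obtain ⟨Z, h', e, hpZ, he⟩ := E.surj (h.trans hV) a p hpW
  refine ⟨Z, h'.trans h, e, hpZ, ?_⟩
  rw [← E.anchor_proj, he, ← A.res_anchor, ha, VF.res_res']

/-- Locally e = ∑ fₖ * ∂gₖ, and its pairing with e' only sees π(e'). Thus Ω is orthogonal to the
kernel of the anchor; this is why the pairing descends to 𝔤(𝒜), and why pairings with sections of Ω
depend only on anchors. -/
theorem pair_eq_zero (h : E.E.IsAlg c) (e e' : E.E.sec V hV) (he : E.proj hV e = 0)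
    (he' : E.E.anchor hV e' = 0) : E.E.pair hV e e' = 0 := by
  refine sec_ext fun p hp => ?_
  obtain ⟨W, hW, hpW, n, f, g, hfg⟩ := exists_om e he p hp
  refine ⟨W, hW, hpW, ?_⟩
  rw [E.E.res_pair hV, hfg, h.pair_om, ← E.E.res_anchor, he']
  simp

theorem pair_congr (h : E.E.IsAlg c) (e e₁ e₂ : E.E.sec V hV) (he : E.E.anchor hV e = 0)
    (he' : E.proj hV e₁ = E.proj hV e₂) : E.E.pair hV e e₁ = E.E.pair hV e e₂ := by
  rw [← sub_eq_zero, ← map_sub, h.pair_symm]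
  exact pair_eq_zero h _ _ (by rw [map_sub, he', sub_self]) he

theorem pair_congr' (h : E.E.IsAlg c) (e e₁ e₂ : E.E.sec V hV) (he : E.proj hV e = 0)
    (he' : E.E.anchor hV e₁ = E.E.anchor hV e₂) : E.E.pair hV e e₁ = E.E.pair hV e e₂ := by
  rw [← sub_eq_zero, ← map_sub]
  exact pair_eq_zero h _ _ he (by rw [map_sub, he', sub_self])

/-- `e` is the image in `E` of the 1-form `α`. -/
def IsOm (E : Extension A U) {V : Opens X} (hV : V ≤ U) (e : E.E.sec V hV)
    (α : ∀ W : Opens X, W ≤ V → VF O W → Sec O W) : Prop :=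
  E.proj hV e = 0 ∧ ∀ (W : Opens X) (h : W ≤ V) (e' : E.E.sec W (h.trans hV)),
    E.E.pair _ (E.E.res hV h e) e' = α W h (E.E.anchor _ e')

theorem IsOm.congr {e : E.E.sec V hV} {α β : ∀ W : Opens X, W ≤ V → VF O W → Sec O W}
    (he : E.IsOm hV e α) (h : ∀ W h ξ, α W h ξ = β W h ξ) : E.IsOm hV e β :=
  ⟨he.1, fun W hW e' => (he.2 W hW e').trans (h _ _ _)⟩

/-- A section of `Ω¹ ⊆ E` vanishes if its pairings vanish. -/
theorem eq_zero_of_pair (htrans : A.IsTransitive) (h : E.E.IsAlg c) (e : E.E.sec V hV)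
    (he : E.proj hV e = 0) (he' : ∀ (W : Opens X) (h : W ≤ V) (e' : E.E.sec W (h.trans hV)),
      E.E.pair _ (E.E.res hV h e) e' = 0) : e = 0 := by
  refine E.E.ext_local hV fun p hp => ?_
  obtain ⟨W, hW, hpW, n, f, g, hfg⟩ := exists_om e he p hp
  refine ⟨W, hW, hpW, ?_⟩
  rw [hfg, map_zero]
  -- It remains to see that ∑ fₖ dgₖ vanishes on every vector field ξ. Locally ξ is the anchor of
  -- some e', and the value is then ⟨e, e'⟩.
  refine h.der_factors _ n f g fun Z hZ ξ => sec_ext fun q hq => ?_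
  obtain ⟨Y, hY, e', hqY, hξ⟩ := E.exists_lift htrans (hZ.trans (hW.trans hV)) ξ q hq
  refine ⟨Y, hY, hqY, ?_⟩
  have := he' Y (hY.trans (hZ.trans hW)) e'
  rw [← E.E.res_res hV hW (hY.trans hZ), hfg, E.E.res_om, h.pair_om, hξ] at this
  simp only [map_sum, map_mul, VF.rs_app, rs_rs, map_zero]
  exact this

theorem isOm_om (h : E.E.IsAlg c) {n : ℕ} (f g : Fin n → Sec O V) :
    E.IsOm hV (E.E.om hV f g) fun _ hW ξ => ∑ k, rs O hW (f k) * ξ.app (rs O hW (g k)) :=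
  ⟨proj_om h f g, fun W hW e' => by rw [E.E.res_om, h.pair_om]⟩

theorem isOm_of_local (hA : A.IsLieAlgebroid) {e : E.E.sec V hV}
    {α : ∀ W : Opens X, W ≤ V → VF O W → Sec O W}
    (hα : ∀ (W : Opens X) (h : W ≤ V) (Z : Opens X) (h' : Z ≤ W) (ξ : VF O W),
      rs O h' (α W h ξ) = α Z (h'.trans h) (VF.res h' ξ))
    (H : ∀ p ∈ V, ∃ (W : Opens X) (h : W ≤ V), p ∈ W ∧
      E.IsOm (h.trans hV) (E.E.res hV h e) fun Z hZ ξ => α Z (hZ.trans h) ξ) : E.IsOm hV e α := by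
  refine ⟨hA.ext fun p hp => ?_, fun W hW e' => sec_ext fun p hp => ?_⟩
  · obtain ⟨W, h, hpW, hW⟩ := H p hp
    exact ⟨W, h, hpW, by rw [E.proj_res hV, hW.1, map_zero]⟩
  · obtain ⟨Z, h, hpZ, hZ⟩ := H p (hW hp)
    refine ⟨W ⊓ Z, inf_le_left, ⟨hp, hpZ⟩, ?_⟩
    rw [hα, E.E.res_pair (hW.trans hV), E.E.res_res, E.E.res_anchor (hW.trans hV)]
    have := hZ.2 (W ⊓ Z) inf_le_right (E.E.res _ inf_le_left e')
    rwa [E.E.res_res] at this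

/-- Passes from local expressions ∑ fₖ * ∂gₖ to conditions on pairings, which are the ones that can
be transported along maps. In the harder direction the local expression comes from the description
of the kernel of the projection, and lifts of vector fields show that ∑ fₖ dgₖ is the given form. -/
theorem isIncl_iff_isOm (hA : A.IsLieAlgebroid) (htrans : A.IsTransitive) (h : E.E.IsAlg c)
    {α : ∀ W : Opens X, W ≤ V → VF O W → Sec O W} (hα : IsOneForm α) (e : E.E.sec V hV) :
    E.E.IsIncl hV e α ↔ E.IsOm hV e α := by
  constructor
  · intro he
    refine isOm_of_local hA hα.map_res fun p hp => ?_
    obtain ⟨W, hW, hpW, n, f, g, hfg, hα'⟩ := he p hp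
    refine ⟨W, hW, hpW, ?_⟩
    rw [hfg]
    exact (isOm_om h f g).congr fun Z hZ ξ => (hα' Z hZ ξ).symm
  · intro he p hp
    obtain ⟨W, hW, hpW, n, f, g, hfg⟩ := exists_om e he.1 p hp
    refine ⟨W, hW, hpW, n, f, g, hfg, fun Z hZ ξ => sec_ext fun q hq => ?_⟩
    obtain ⟨Y, hY, e', hqY, hξ⟩ := E.exists_lift htrans (hZ.trans (hW.trans hV)) ξ q hq
    refine ⟨Y, hY, hqY, ?_⟩
    have := he.2 Y (hY.trans (hZ.trans hW)) e'
    rw [← E.E.res_res hV hW (hY.trans hZ), hfg] at this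
    change E.E.pair _ (E.E.res _ _ (E.E.om _ f g)) e' = _ at this
    rw [E.E.res_om, h.pair_om, hξ] at this
    rw [hα.map_res, ← this]
    simp only [map_sum, map_mul, VF.rs_app, rs_rs]

end Extension

end

section

variable {O : TopCat.Sheaf (CommAlgCat.{u} ℂ) X} {U : Opens X}

/-! ### Quotients of algebroids -/

namespace ModPsh.Epi

variable {F Q : ModPsh U} (π : Epi F Q) {V : Opens X} (hV : V ≤ U)

theorem surj₂ (q q' : Q.sec V hV) (p : X) (hp : p ∈ V) :
    ∃ (W : Opens X) (h : W ≤ V) (x y : F.sec W (h.trans hV)), p ∈ W ∧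
      Q.res hV h q = π.app (h.trans hV) x ∧ Q.res hV h q' = π.app (h.trans hV) y := by
  obtain ⟨W, h, x, hpW, hx⟩ := π.surj hV q p hp
  obtain ⟨W', h', y, hpW', hy⟩ := π.surj hV q' p hp
  refine ⟨W ⊓ W', inf_le_left.trans h, F.res _ inf_le_left x, F.res _ inf_le_right y,
    ⟨hpW, hpW'⟩, ?_, ?_⟩
  · rw [← π.app_res, hx, Q.res_res]
  · rw [← π.app_res, hy, Q.res_res]

theorem surj₃ (q q' q'' : Q.sec V hV) (p : X) (hp : p ∈ V) :
    ∃ (W : Opens X) (h : W ≤ V) (x y z : F.sec W (h.trans hV)), p ∈ W ∧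
      Q.res hV h q = π.app (h.trans hV) x ∧ Q.res hV h q' = π.app (h.trans hV) y ∧
      Q.res hV h q'' = π.app (h.trans hV) z := by
  obtain ⟨W, h, x, y, hpW, hx, hy⟩ := π.surj₂ hV q q' p hp
  obtain ⟨W', h', z, hpW', hz⟩ := π.surj hV q'' p hp
  refine ⟨W ⊓ W', inf_le_left.trans h, F.res _ inf_le_left x, F.res _ inf_le_left y,
    F.res _ inf_le_right z, ⟨hpW, hpW'⟩, ?_, ?_, ?_⟩
  · rw [← π.app_res, ← hx, Q.res_res]
  · rw [← π.app_res, ← hy, Q.res_res]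
  · rw [← π.app_res, hz, Q.res_res]

end ModPsh.Epi

namespace AlgebroidData

/-- The data of the quotient of `M` by the subsheaf `K`. -/
structure QuotData (M : AlgebroidData O U)
    (K : ∀ {V : Opens X} (hV : V ≤ U), Submodule ℂ (M.sec V hV)) where
  E : AlgebroidData O U
  pj : ModPsh.Epi M.psh E.psh
  pj_act : ∀ {V : Opens X} (hV : V ≤ U) (f : Sec O V) (x : M.sec V hV),
    E.act hV f (pj.app hV x) = pj.app hV (M.act hV f x)
  pj_br : ∀ {V : Opens X} (hV : V ≤ U) (x y : M.sec V hV),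
    E.br hV (pj.app hV x) (pj.app hV y) = pj.app hV (M.br hV x y)
  anchor_pj : ∀ {V : Opens X} (hV : V ≤ U) (x : M.sec V hV),
    E.anchor hV (pj.app hV x) = M.anchor hV x
  pair_pj : ∀ {V : Opens X} (hV : V ≤ U) (x y : M.sec V hV),
    E.pair hV (pj.app hV x) (pj.app hV y) = M.pair hV x y
  pj_der : ∀ {V : Opens X} (hV : V ≤ U) (f : Sec O V), E.der hV f = pj.app hV (M.der hV f)
  pj_eq_zero : ∀ {V : Opens X} (hV : V ≤ U) (x : M.sec V hV), pj.app hV x = 0 ↔ x ∈ K hV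

/-- Each operation is computed on local representatives, and the hypotheses say that it does not
depend on them. No algebroid axiom is involved. In the multiplication only the second argument is a
class, whence the identity epimorphism on functions. -/
theorem exists_quot (M : AlgebroidData O U)
    (K : ∀ {V : Opens X} (hV : V ≤ U), Submodule ℂ (M.sec V hV))
    (hres : ∀ {V W : Opens X} (hV : V ≤ U) (h : W ≤ V) (x : M.sec V hV),
      x ∈ K hV → M.res hV h x ∈ K (h.trans hV))
    (hloc : ∀ {V : Opens X} (hV : V ≤ U) (x : M.sec V hV),
      (∀ p ∈ V, ∃ (W : Opens X) (h : W ≤ V), p ∈ W ∧ M.res hV h x ∈ K (h.trans hV)) → x ∈ K hV)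
    (hact : ∀ {V : Opens X} (hV : V ≤ U) (f : Sec O V) (x : M.sec V hV), x ∈ K hV →
      M.act hV f x ∈ K hV)
    (hbr : ∀ {V : Opens X} (hV : V ≤ U) (x y : M.sec V hV), x ∈ K hV → M.br hV x y ∈ K hV)
    (hbr' : ∀ {V : Opens X} (hV : V ≤ U) (x y : M.sec V hV), y ∈ K hV → M.br hV x y ∈ K hV)
    (hanchor : ∀ {V : Opens X} (hV : V ≤ U) (x : M.sec V hV), x ∈ K hV → M.anchor hV x = 0)
    (hpair : ∀ {V : Opens X} (hV : V ≤ U) (x y : M.sec V hV), x ∈ K hV → M.pair hV x y = 0)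
    (hpair' : ∀ {V : Opens X} (hV : V ≤ U) (x y : M.sec V hV), y ∈ K hV → M.pair hV x y = 0) :
    Nonempty (QuotData M K) := by
  let Q := M.psh.quot K
  let mk : ModPsh.Epi M.psh Q := M.psh.quotMk K
  have hQ : Q.IsSheaf := M.psh.quot_isSheaf K
  have hmk : ∀ {V : Opens X} (hV : V ≤ U) (x : M.sec V hV), mk.app hV x = 0 ↔ x ∈ K hV :=
    fun hV x => M.psh.quotMk_eq_zero K hres hloc hV x
  have mk_res : ∀ {V W : Opens X} (hV : V ≤ U) (h : W ≤ V) (x : M.sec V hV),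
    Q.res hV h (mk.app hV x) = mk.app (h.trans hV) (M.res hV h x) := mk.app_res
  obtain ⟨act, act_res, act_mk⟩ := hQ.exists_desc₂ (ModPsh.Epi.id (secPsh O U)) mk
    (fun hV => (M.act hV).compr₂ (mk.app hV))
    (fun hV h f x => by
      simp only [LinearMap.compr₂_apply]
      rw [mk_res, M.res_act]
      rfl)
    (fun hV f x hf => by
      have : f = 0 := hf
      rw [this, map_zero, LinearMap.zero_apply])
    (fun hV f x hx => (hmk hV _).2 (hact hV f x ((hmk hV x).1 hx)))
  obtain ⟨br, br_res, br_mk⟩ := hQ.exists_desc₂ mk mk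
    (fun hV => (M.br hV).compr₂ (mk.app hV))
    (fun hV h f x => by
      simp only [LinearMap.compr₂_apply]
      rw [mk_res, M.res_br])
    (fun hV x y hx => (hmk hV _).2 (hbr hV x y ((hmk hV x).1 hx)))
    (fun hV x y hx => (hmk hV _).2 (hbr' hV x y ((hmk hV y).1 hx)))
  obtain ⟨pair, pair_res, pair_mk⟩ := (secPsh_isSheaf O U).exists_desc₂ mk mk
    (fun hV => M.pair hV)
    (fun hV h x y => M.res_pair hV h x y)
    (fun hV x y hx => hpair hV x y ((hmk hV x).1 hx))
    (fun hV x y hx => hpair' hV x y ((hmk hV y).1 hx))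
  obtain ⟨anchor, anchor_res, anchor_mk⟩ := (vfPsh_isSheaf O U).exists_desc mk
    (fun hV => M.anchor hV)
    (fun hV h x => M.res_anchor hV h x)
    (fun hV x hx => hanchor hV x ((hmk hV x).1 hx))
  let E : AlgebroidData O U :=
    { sec := Q.sec
      addCommGroup := Q.addCommGroup
      module := Q.module
      res := Q.res
      act := act
      br := br
      anchor := anchor
      pair := pair
      der := fun hV => (mk.app hV).comp (M.der hV)
      res_rfl := Q.res_rfl
      res_res := Q.res_res
      glue := hQ.glue
      res_act := act_res
      res_br := br_res
      res_anchor := anchor_res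
      res_pair := pair_res
      res_der := fun hV h f => by
        simp only [LinearMap.comp_apply]
        rw [mk_res, M.res_der] }
  exact ⟨⟨E, mk, fun hV f x => act_mk hV f x, fun hV x y => br_mk hV x y, anchor_mk, pair_mk,
    fun _ _ => rfl, hmk⟩⟩

end AlgebroidData

/-- Finitely many conditions which are satisfied on small neighbourhoods of a point are satisfied
on a common neighbourhood. -/
theorem exists_common_nhd {V : Opens X} {p : X} (hp : p ∈ V) {n : ℕ} (P : Fin n → Opens X → Prop)
    (mono : ∀ i (W Z : Opens X), Z ≤ W → P i W → P i Z)
    (h : ∀ i, ∃ W : Opens X, W ≤ V ∧ p ∈ W ∧ P i W) :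
    ∃ W : Opens X, W ≤ V ∧ p ∈ W ∧ ∀ i, P i W := by
  induction n with
  | zero => exact ⟨V, le_rfl, hp, fun i => i.elim0⟩
  | succ n ih =>
    obtain ⟨W, hW, hpW, hP⟩ := ih (fun i => P i.castSucc) (fun i => mono _) (fun i => h _)
    obtain ⟨Z, hZ, hpZ, hP'⟩ := h (Fin.last n)
    refine ⟨W ⊓ Z, inf_le_left.trans hW, ⟨hpW, hpZ⟩, fun i => ?_⟩
    refine Fin.lastCases ?_ (fun i => ?_) i
    · exact mono _ _ _ inf_le_right hP'
    · exact mono _ _ _ inf_le_left (hP i)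

/-! ### Reduction -/

/-- An algebroid `M` over `B`, which satisfies the axioms of an extension of `B` up to elements of
the radical of the pairing on the kernel of `M → B`. -/
structure PreExtension (B : LieAlgebroidData O) (U : Opens X) where
  M : AlgebroidData O U
  pr : ∀ {V : Opens X} (hV : V ≤ U), M.sec V hV →ₗ[ℂ] B.sec V
  pr_res : ∀ {V W : Opens X} (hV : V ≤ U) (h : W ≤ V) (x : M.sec V hV),
    B.res h (pr hV x) = pr (h.trans hV) (M.res hV h x)
  pr_act : ∀ {V : Opens X} (hV : V ≤ U) (f : Sec O V) (x : M.sec V hV),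
    pr hV (M.act hV f x) = B.act f (pr hV x)
  pr_br : ∀ {V : Opens X} (hV : V ≤ U) (x y : M.sec V hV),
    pr hV (M.br hV x y) = B.br (pr hV x) (pr hV y)
  anchor_pr : ∀ {V : Opens X} (hV : V ≤ U) (x : M.sec V hV),
    B.anchor (pr hV x) = M.anchor hV x
  surj : ∀ {V : Opens X} (hV : V ≤ U) (b : B.sec V) (p : X), p ∈ V →
    ∃ (W : Opens X) (h : W ≤ V) (x : M.sec W (h.trans hV)), p ∈ W ∧
      pr (h.trans hV) x = B.res h b

namespace PreExtension

variable {B : LieAlgebroidData O}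

/-- The radical of the pairing on the kernel of `M → B`. -/
def rad (P : PreExtension B U) {V : Opens X} (hV : V ≤ U) : Submodule ℂ (P.M.sec V hV) where
  carrier := {x | P.pr hV x = 0 ∧ ∀ (W : Opens X) (h : W ≤ V) (y : P.M.sec W (h.trans hV)),
    P.M.pair (h.trans hV) (P.M.res hV h x) y = 0}
  add_mem' := by
    rintro x y ⟨hx, hx'⟩ ⟨hy, hy'⟩
    refine ⟨by rw [map_add, hx, hy, add_zero], fun W h z => ?_⟩
    rw [map_add, map_add, LinearMap.add_apply, hx', hy', add_zero]
  zero_mem' := ⟨map_zero _, fun W h y => by rw [map_zero, map_zero, LinearMap.zero_apply]⟩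
  smul_mem' := by
    rintro c x ⟨hx, hx'⟩
    refine ⟨by rw [map_smul, hx, smul_zero], fun W h z => ?_⟩
    rw [map_smul, map_smul, LinearMap.smul_apply, hx', smul_zero]

/-- The axioms of an extension, up to the radical. -/
structure IsWeakAlg (c : ℂ) (P : PreExtension B U) : Prop where
  one_act : ∀ {V : Opens X} (hV : V ≤ U) (a : P.M.sec V hV), P.M.act hV 1 a = a
  assoc : ∀ {V : Opens X} (hV : V ≤ U) (f g : Sec O V) (a : P.M.sec V hV),
    P.M.act hV f (P.M.act hV g a) - P.M.act hV (f * g) a -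
      c • (P.M.act hV ((P.M.anchor hV a).app f) (P.M.der hV g) +
      P.M.act hV ((P.M.anchor hV a).app g) (P.M.der hV f)) ∈ P.rad hV
  leibniz : ∀ {V : Opens X} (hV : V ≤ U) (a b c : P.M.sec V hV),
    P.M.br hV a (P.M.br hV b c) = P.M.br hV (P.M.br hV a b) c + P.M.br hV b (P.M.br hV a c)
  anchor_br : ∀ {V : Opens X} (hV : V ≤ U) (a b : P.M.sec V hV),
    P.M.anchor hV (P.M.br hV a b) = ⁅P.M.anchor hV a, P.M.anchor hV b⁆
  pair_symm : ∀ {V : Opens X} (hV : V ≤ U) (a b : P.M.sec V hV),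
    P.M.pair hV a b = P.M.pair hV b a
  br_act : ∀ {V : Opens X} (hV : V ≤ U) (a b : P.M.sec V hV) (f : Sec O V),
    P.M.br hV a (P.M.act hV f b) =
      P.M.act hV ((P.M.anchor hV a).app f) b + P.M.act hV f (P.M.br hV a b)
  br_symm : ∀ {V : Opens X} (hV : V ≤ U) (a b : P.M.sec V hV),
    P.M.br hV a b + P.M.br hV b a - P.M.der hV (P.M.pair hV a b) ∈ P.rad hV
  anchor_act : ∀ {V : Opens X} (hV : V ≤ U) (f : Sec O V) (a : P.M.sec V hV),
    P.M.anchor hV (P.M.act hV f a) = f • P.M.anchor hV a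
  pair_act : ∀ {V : Opens X} (hV : V ≤ U) (f : Sec O V) (a b : P.M.sec V hV),
    P.M.pair hV (P.M.act hV f a) b =
      f * P.M.pair hV a b - c • (P.M.anchor hV a).app ((P.M.anchor hV b).app f)
  pair_inv : ∀ {V : Opens X} (hV : V ≤ U) (a b c : P.M.sec V hV),
    (P.M.anchor hV a).app (P.M.pair hV b c) =
      P.M.pair hV (P.M.br hV a b) c + P.M.pair hV b (P.M.br hV a c)
  der_mul : ∀ {V : Opens X} (hV : V ≤ U) (f g : Sec O V),
    P.M.der hV (f * g) = P.M.act hV f (P.M.der hV g) + P.M.act hV g (P.M.der hV f)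
  br_der : ∀ {V : Opens X} (hV : V ≤ U) (a : P.M.sec V hV) (f : Sec O V),
    P.M.br hV a (P.M.der hV f) = P.M.der hV ((P.M.anchor hV a).app f)
  pair_der : ∀ {V : Opens X} (hV : V ≤ U) (a : P.M.sec V hV) (f : Sec O V),
    P.M.pair hV a (P.M.der hV f) = (P.M.anchor hV a).app f
  der_factors : P.M.DerFactors
  pr_der : ∀ {V : Opens X} (hV : V ≤ U) (f : Sec O V), P.pr hV (P.M.der hV f) = 0
  pair_ker : ∀ {V : Opens X} (hV : V ≤ U) (x y : P.M.sec V hV), P.pr hV x = 0 →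
    P.M.anchor hV y = 0 → P.M.pair hV x y = 0

variable {P : PreExtension B U} {c : ℂ}

theorem IsWeakAlg.anchor_der (h : P.IsWeakAlg c) {V : Opens X} (hV : V ≤ U) (f : Sec O V) :
    P.M.anchor hV (P.M.der hV f) = 0 := by
  rw [← P.anchor_pr, h.pr_der, map_zero]

theorem anchor_rad {V : Opens X} {hV : V ≤ U} {x : P.M.sec V hV} (hx : P.pr hV x = 0) :
    P.M.anchor hV x = 0 := by
  rw [← P.anchor_pr, hx, map_zero]

/-- A reduction of a pre-extension: an extension which is the quotient by the radical. -/
structure Reduction (c : ℂ) (P : PreExtension B U) where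
  E : Extension B U
  isAlg : E.E.IsAlg c
  pj : ModPsh.Epi P.M.psh E.E.psh
  pj_act : ∀ {V : Opens X} (hV : V ≤ U) (f : Sec O V) (x : P.M.sec V hV),
    E.E.act hV f (pj.app hV x) = pj.app hV (P.M.act hV f x)
  pj_br : ∀ {V : Opens X} (hV : V ≤ U) (x y : P.M.sec V hV),
    E.E.br hV (pj.app hV x) (pj.app hV y) = pj.app hV (P.M.br hV x y)
  anchor_pj : ∀ {V : Opens X} (hV : V ≤ U) (x : P.M.sec V hV),
    E.E.anchor hV (pj.app hV x) = P.M.anchor hV x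
  pair_pj : ∀ {V : Opens X} (hV : V ≤ U) (x y : P.M.sec V hV),
    E.E.pair hV (pj.app hV x) (pj.app hV y) = P.M.pair hV x y
  pj_der : ∀ {V : Opens X} (hV : V ≤ U) (f : Sec O V), E.E.der hV f = pj.app hV (P.M.der hV f)
  pj_eq_zero : ∀ {V : Opens X} (hV : V ≤ U) (x : P.M.sec V hV),
    pj.app hV x = 0 ↔ x ∈ P.rad hV
  proj_pj : ∀ {V : Opens X} (hV : V ≤ U) (x : P.M.sec V hV), E.proj hV (pj.app hV x) = P.pr hV x

/-- The radical is a two-sided ideal: invariance of the pairing gives stability under brackets from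
the left. Stability under multiplication holds because the anomaly of the pairing is zero on
elements without anchor. -/
theorem IsWeakAlg.exists_quot (hB : B.IsLieAlgebroid) (h : P.IsWeakAlg c) :
    Nonempty (AlgebroidData.QuotData P.M (fun hV => P.rad hV)) := by
  have hbr' : ∀ {V : Opens X} (hV : V ≤ U) (x y : P.M.sec V hV), y ∈ P.rad hV →
      P.M.br hV x y ∈ P.rad hV := by
    rintro V hV x y ⟨hy, hy'⟩
    refine ⟨by rw [P.pr_br, hy, map_zero], fun W hW z => ?_⟩
    have := h.pair_inv _ (P.M.res hV hW x) (P.M.res hV hW y) z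
    rw [hy', hy', VF.app_zero, add_zero] at this
    rw [P.M.res_br, this]
  have hanchor : ∀ {V : Opens X} (hV : V ≤ U) (x : P.M.sec V hV), x ∈ P.rad hV →
      P.M.anchor hV x = 0 := fun hV x hx => anchor_rad hx.1
  have hpair : ∀ {V : Opens X} (hV : V ≤ U) (x y : P.M.sec V hV), x ∈ P.rad hV →
      P.M.pair hV x y = 0 := fun {V} hV x y hx => by
    have := hx.2 V le_rfl y
    rwa [P.M.res_rfl] at this
  refine P.M.exists_quot _ ?_ ?_ ?_ ?_ @hbr' @hanchor @hpair ?_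
  · rintro V W hV hW x ⟨hx, hx'⟩
    refine ⟨by rw [← P.pr_res, hx, map_zero], fun Z hZ y => ?_⟩
    rw [P.M.res_res]
    exact hx' Z _ y
  · intro V hV x hx
    refine ⟨hB.ext fun p hp => ?_, fun W hW y => sec_ext fun p hp => ?_⟩
    · obtain ⟨W, hW, hpW, hx'⟩ := hx p hp
      exact ⟨W, hW, hpW, by rw [P.pr_res hV, hx'.1, map_zero]⟩
    · obtain ⟨Z, hZ, hpZ, hx'⟩ := hx p (hW hp)
      refine ⟨W ⊓ Z, inf_le_left, ⟨hp, hpZ⟩, ?_⟩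
      have := hx'.2 (W ⊓ Z) inf_le_right (P.M.res _ inf_le_left y)
      rw [P.M.res_res] at this
      rw [P.M.res_pair (hW.trans hV), P.M.res_res, map_zero, this]
  · rintro V hV f x ⟨hx, hx'⟩
    refine ⟨by rw [P.pr_act, hx, map_zero], fun W hW y => ?_⟩
    rw [P.M.res_act, h.pair_act, hx', ← P.M.res_anchor, anchor_rad hx]
    simp
  · intro V hV x y hx
    -- Up to the radical [x, y] = −[y, x] + ∂⟨x, y⟩, and ⟨x, y⟩ = 0 for x in the radical, so
    -- brackets from the right reduce to those from the left.
    have h1 := sub_mem (h.br_symm hV x y) (hbr' hV y x hx)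
    rw [hpair hV x y hx, map_zero, sub_zero, add_sub_cancel_right] at h1
    exact h1
  · intro V hV x y hy
    rw [h.pair_symm]
    exact hpair hV y x hy

/-- Every vector field lifts locally to a pre-extension of a transitive Lie algebroid. -/
theorem exists_lift (htrans : B.IsTransitive) (P : PreExtension B U) {V : Opens X} (hV : V ≤ U)
    (ξ : VF O V) (p : X) (hp : p ∈ V) :
    ∃ (W : Opens X) (h : W ≤ V) (e : P.M.sec W (h.trans hV)), p ∈ W ∧
      P.M.anchor _ e = VF.res h ξ := by
  obtain ⟨W, h, a, hpW, ha⟩ := htrans V ξ p hp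
  obtain ⟨Z, h', e, hpZ, he⟩ := P.surj (h.trans hV) a p hpW
  refine ⟨Z, h'.trans h, e, hpZ, ?_⟩
  rw [← P.anchor_pr, he, ← B.res_anchor, ha, VF.res_res']

/-- A section of the kernel is locally a combination of exact sections, up to the radical. -/
theorem IsWeakAlg.exists_sub_om_mem_rad (hX : HasLocalCoordinates O) (htrans : B.IsTransitive)
    (h : P.IsWeakAlg c) {V : Opens X} (hV : V ≤ U) (x : P.M.sec V hV) (hx : P.pr hV x = 0) (p : X)
    (hp : p ∈ V) : ∃ (W : Opens X) (hW : W ≤ V), p ∈ W ∧ ∃ (n : ℕ) (f g : Fin n → Sec O W),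
      P.M.res hV hW x - P.M.om (hW.trans hV) f g ∈ P.rad (hW.trans hV) := by
  obtain ⟨Y, hY, hpY, n, t, D, ht⟩ := hX.exists_chart V p hp
  obtain ⟨W, hWY, hpW, hd⟩ := exists_common_nhd hpY (fun i (W : Opens X) => ∃ (hW : W ≤ Y)
    (d : P.M.sec W (hW.trans (hY.trans hV))), P.M.anchor _ d = VF.res hW (D i))
    (by
      rintro i W Z hZ ⟨hW, d, hd⟩
      exact ⟨hZ.trans hW, P.M.res _ hZ d, by rw [← P.M.res_anchor, hd, VF.res_res']⟩)
    (fun i => by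
      obtain ⟨W, hW, d, hpW, hd⟩ := P.exists_lift htrans (hY.trans hV) (D i) p hpY
      exact ⟨W, hW, hpW, hW, d, hd⟩)
  choose hW d hd using hd
  have hWV : W ≤ V := hWY.trans hY
  -- By `pair_ker`, ⟨x, ·⟩ factors through the anchor and so behaves as a 1-form. Its coefficient at
  -- dtᵢ is its value at Dᵢ, that is ⟨x, dᵢ⟩ for the lift dᵢ of Dᵢ.
  refine ⟨W, hWV, hpW, n, fun i => P.M.pair _ (P.M.res hV hWV x) (d i),
    fun i => rs O hWY (t i), ?_, fun Z hZ y => ?_⟩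
  · rw [map_sub, ← P.pr_res, hx, map_zero, AlgebroidData.om, map_sum]
    simp only [P.pr_act, h.pr_der, map_zero, Finset.sum_const_zero, sub_zero]
  -- `y` and ∑ π(y)(tᵢ) * dᵢ have the same anchor, so they have the same pairing with `x`.
  · have hπ : P.M.anchor _ y = P.M.anchor _ (∑ i, P.M.act (hZ.trans (hWV.trans hV))
        ((P.M.anchor _ y).app (rs O (hZ.trans hWY) (t i))) (P.M.res _ hZ (d i))) := by
      rw [map_sum]
      conv_lhs => rw [ht.2 Z (hZ.trans hWY) (P.M.anchor _ y)]
      refine Finset.sum_congr rfl fun i _ => ?_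
      rw [h.anchor_act, ← P.M.res_anchor, hd, VF.res_res']
    have hx0 : P.pr (hZ.trans (hWV.trans hV)) (P.M.res hV (hZ.trans hWV) x) = 0 := by
      rw [← P.pr_res, hx, map_zero]
    have h1 := h.pair_ker _ _ (y - ∑ i, P.M.act (hZ.trans (hWV.trans hV))
        ((P.M.anchor _ y).app (rs O (hZ.trans hWY) (t i))) (P.M.res _ hZ (d i))) hx0
        (by rw [map_sub, ← hπ, sub_self])
    rw [map_sub, sub_eq_zero] at h1
    rw [map_sub, P.M.res_res, P.M.res_om, map_sub, LinearMap.sub_apply, h1, map_sum,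
      AlgebroidData.om, map_sum, LinearMap.sum_apply, sub_eq_zero]
    refine Finset.sum_congr rfl fun i _ => ?_
    rw [h.pair_symm, h.pair_act, anchor_rad hx0, h.pair_act, h.anchor_der, h.pair_symm _ (P.M.der _ _),
      h.pair_der, P.M.res_pair, h.pair_symm, P.M.res_res, rs_rs]
    simp only [VF.zero_app, VF.app_zero, smul_zero, sub_zero]
    ring

/-- Identities in the quotient are checked on local representatives, where they hold modulo the
radical. The point that needs coordinates is that the kernel of the induced projection is no larger
than Ω; it is supplied by `exists_sub_om_mem_rad`. -/
theorem IsWeakAlg.exists_reduction (hX : HasLocalCoordinates O) (hB : B.IsLieAlgebroid)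
    (htrans : B.IsTransitive) (h : P.IsWeakAlg c) : Nonempty (Reduction c P) := by
  obtain ⟨q⟩ := h.exists_quot hB
  have E_ext : ∀ {V : Opens X} (hV : V ≤ U) {a b : q.E.sec V hV},
    (∀ p ∈ V, ∃ (W : Opens X) (hW : W ≤ V), p ∈ W ∧ q.E.res hV hW a = q.E.res hV hW b) → a = b :=
    fun hV _ _ => q.E.ext_local hV
  have pj_eq : ∀ {V : Opens X} (hV : V ≤ U) {x y : P.M.sec V hV}, x - y ∈ P.rad hV →
      q.pj.app hV x = q.pj.app hV y := fun hV x y hxy => by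
    rw [← sub_eq_zero, ← map_sub]
    exact (q.pj_eq_zero hV _).2 hxy
  have pj_om : ∀ {V : Opens X} (hV : V ≤ U) {n : ℕ} (f g : Fin n → Sec O V),
      q.pj.app hV (P.M.om hV f g) = q.E.om hV f g := fun hV n f g => by
    simp only [AlgebroidData.om, map_sum, q.pj_der, q.pj_act]
  obtain ⟨proj, proj_res, proj_pj⟩ := (hB.isSheaf U).exists_desc q.pj (fun hV => P.pr hV)
    (fun hV hW x => P.pr_res hV hW x) (fun hV x hx => ((q.pj_eq_zero hV x).1 hx).1)
  have isAlg : q.E.IsAlg c := by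
    constructor
    · intro V hV a
      refine E_ext hV fun p hp => ?_
      obtain ⟨W, hW, x, hpW, hx⟩ := q.pj.surj hV a p hp
      refine ⟨W, hW, hpW, ?_⟩
      simp only [q.E.res_act, ← hx, map_one, q.pj_act, h.one_act]
    · intro V hV f g a
      refine E_ext hV fun p hp => ?_
      obtain ⟨W, hW, x, hpW, hx⟩ := q.pj.surj hV a p hp
      refine ⟨W, hW, hpW, ?_⟩
      simp only [map_sub, map_smul, map_add, q.E.res_act, q.E.res_der, VF.rs_app, q.E.res_anchor,
        ← hx, map_mul, q.anchor_pj]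
      simp only [q.pj_act, q.pj_der]
      simp only [← map_sub, ← map_smul, ← map_add]
      exact pj_eq _ (h.assoc _ _ _ _)
    · intro V hV a b c
      refine E_ext hV fun p hp => ?_
      obtain ⟨W, hW, x, y, z, hpW, hx, hy, hz⟩ := q.pj.surj₃ hV a b c p hp
      refine ⟨W, hW, hpW, ?_⟩
      simp only [map_add, q.E.res_br, hx, hy, hz, q.pj_br]
      rw [h.leibniz, map_add]
    · intro V hV a b
      refine vf_ext fun p hp => ?_
      obtain ⟨W, hW, x, y, hpW, hx, hy⟩ := q.pj.surj₂ hV a b p hp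
      refine ⟨W, hW, hpW, ?_⟩
      rw [VF.res_bracket, q.E.res_anchor, q.E.res_anchor, q.E.res_anchor, q.E.res_br, hx, hy,
        q.pj_br, q.anchor_pj, q.anchor_pj, q.anchor_pj, h.anchor_br]
    · intro V hV a b
      refine sec_ext fun p hp => ?_
      obtain ⟨W, hW, x, y, hpW, hx, hy⟩ := q.pj.surj₂ hV a b p hp
      refine ⟨W, hW, hpW, ?_⟩
      rw [q.E.res_pair, q.E.res_pair, hx, hy, q.pair_pj, q.pair_pj, h.pair_symm]
    · intro V hV f
      rw [q.pj_der, q.anchor_pj, h.anchor_der]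
    · intro V hV a b f
      refine E_ext hV fun p hp => ?_
      obtain ⟨W, hW, x, y, hpW, hx, hy⟩ := q.pj.surj₂ hV a b p hp
      refine ⟨W, hW, hpW, ?_⟩
      simp only [map_add, q.E.res_br, q.E.res_act, hx, hy, VF.rs_app, q.E.res_anchor, q.pj_act,
        q.pj_br, q.anchor_pj, h.br_act]
    · intro V hV a b
      refine E_ext hV fun p hp => ?_
      obtain ⟨W, hW, x, y, hpW, hx, hy⟩ := q.pj.surj₂ hV a b p hp
      refine ⟨W, hW, hpW, ?_⟩
      simp only [map_add, q.E.res_br, q.E.res_der, q.E.res_pair, hx, hy, q.pj_br, q.pair_pj]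
      rw [q.pj_der, ← map_add]
      exact pj_eq _ (h.br_symm _ _ _)
    · intro V hV f a
      refine vf_ext fun p hp => ?_
      obtain ⟨W, hW, x, hpW, hx⟩ := q.pj.surj hV a p hp
      refine ⟨W, hW, hpW, ?_⟩
      rw [VF.res_smul, q.E.res_anchor, q.E.res_anchor, q.E.res_act, ← hx, q.pj_act,
        q.anchor_pj, q.anchor_pj, h.anchor_act]
    · intro V hV f a b
      refine sec_ext fun p hp => ?_
      obtain ⟨W, hW, x, y, hpW, hx, hy⟩ := q.pj.surj₂ hV a b p hp
      refine ⟨W, hW, hpW, ?_⟩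
      simp only [map_sub, map_smul, map_mul, VF.rs_app, q.E.res_anchor, q.E.res_pair, q.E.res_act,
        hx, hy, q.pj_act, q.pair_pj, q.anchor_pj, h.pair_act]
    · intro V hV a b c
      refine sec_ext fun p hp => ?_
      obtain ⟨W, hW, x, y, z, hpW, hx, hy, hz⟩ := q.pj.surj₃ hV a b c p hp
      refine ⟨W, hW, hpW, ?_⟩
      simp only [map_add, VF.rs_app, q.E.res_anchor, q.E.res_pair, q.E.res_br, hx, hy, hz, q.pj_br,
        q.pair_pj, q.anchor_pj, h.pair_inv]
    · intro V hV f g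
      rw [q.pj_der, q.pj_der, q.pj_der, q.pj_act, q.pj_act, h.der_mul, map_add]
    · intro V hV a f
      refine E_ext hV fun p hp => ?_
      obtain ⟨W, hW, x, hpW, hx⟩ := q.pj.surj hV a p hp
      refine ⟨W, hW, hpW, ?_⟩
      simp only [q.E.res_br, q.E.res_der, VF.rs_app, q.E.res_anchor, ← hx,
        q.anchor_pj]
      rw [q.pj_der, q.pj_br, h.br_der, q.pj_der]
    · intro V hV a f
      refine sec_ext fun p hp => ?_
      obtain ⟨W, hW, x, hpW, hx⟩ := q.pj.surj hV a p hp
      refine ⟨W, hW, hpW, ?_⟩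
      simp only [q.E.res_pair, q.E.res_der, VF.rs_app, q.E.res_anchor, ← hx,
        q.anchor_pj]
      rw [q.pj_der, q.pair_pj, h.pair_der]
    · intro V hV n f g hfg
      have := congrArg (q.pj.app hV) (h.der_factors hV n f g hfg)
      rw [map_zero] at this
      exact (pj_om hV f g).symm.trans this
  have ker : ∀ {V : Opens X} (hV : V ≤ U) (e : q.E.sec V hV),
      proj hV e = 0 ↔ q.E.InOmega hV e := by
    intro V hV e
    constructor
    · intro he p hp
      obtain ⟨W, hW, x, hpW, hx⟩ := q.pj.surj hV e p hp
      have hx0 : P.pr (hW.trans hV) x = 0 := by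
        rw [← proj_pj, hx, ← proj_res, he, map_zero]
      obtain ⟨Z, hZ, hpZ, n, f, g, hfg⟩ := h.exists_sub_om_mem_rad hX htrans _ x hx0 p hpW
      refine ⟨Z, hZ.trans hW, hpZ, n, f, g, ?_⟩
      rw [← q.E.res_res hV hW hZ]
      change q.E.psh.res _ _ (q.E.psh.res _ _ e) = _
      rw [← hx, q.pj.app_res]
      exact (pj_eq _ hfg).trans (pj_om _ f g)
    · intro he
      refine hB.ext fun p hp => ?_
      obtain ⟨W, hW, hpW, n, f, g, hfg⟩ := he p hp
      refine ⟨W, hW, hpW, ?_⟩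
      have : q.E.res hV hW e = q.pj.app _ (P.M.om _ f g) := hfg.trans (pj_om _ f g).symm
      rw [proj_res hV, map_zero]
      change proj _ (q.E.res hV hW e) = 0
      rw [this, proj_pj, AlgebroidData.om, map_sum]
      simp only [P.pr_act, h.pr_der, map_zero, Finset.sum_const_zero]
  let E : Extension B U :=
    { E := q.E
      proj := proj
      proj_res := proj_res
      proj_act := fun hV f e => hB.ext fun p hp => by
        obtain ⟨W, hW, x, hpW, hx⟩ := q.pj.surj hV e p hp
        have hx' : q.E.res hV hW e = q.pj.app _ x := hx.symm
        refine ⟨W, hW, hpW, ?_⟩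
        have h1 : B.res hW (proj hV (q.E.act hV f e)) = proj _ (q.E.res hV hW (q.E.act hV f e)) :=
          proj_res hV hW _
        have h2 : B.res hW (proj hV e) = proj _ (q.E.res hV hW e) := proj_res hV hW _
        rw [h1, B.res_act, h2, q.E.res_act, hx', q.pj_act]
        exact (proj_pj _ _).trans ((P.pr_act _ _ _).trans (by rw [← proj_pj]))
      proj_br := fun hV e e' => hB.ext fun p hp => by
        obtain ⟨W, hW, x, y, hpW, hx, hy⟩ := q.pj.surj₂ hV e e' p hp
        have hx' : q.E.res hV hW e = q.pj.app _ x := hx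
        have hy' : q.E.res hV hW e' = q.pj.app _ y := hy
        refine ⟨W, hW, hpW, ?_⟩
        have h1 : B.res hW (proj hV (q.E.br hV e e')) = proj _ (q.E.res hV hW (q.E.br hV e e')) :=
          proj_res hV hW _
        have h2 : ∀ e, B.res hW (proj hV e) = proj _ (q.E.res hV hW e) := proj_res hV hW
        rw [h1, B.res_br, h2, h2, q.E.res_br, hx', hy', q.pj_br]
        exact (proj_pj _ _).trans ((P.pr_br _ _ _).trans (by rw [← proj_pj, ← proj_pj]))
      anchor_proj := fun hV e => vf_ext fun p hp => by
        obtain ⟨W, hW, x, hpW, hx⟩ := q.pj.surj hV e p hp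
        have hx' : q.E.res hV hW e = q.pj.app _ x := hx.symm
        refine ⟨W, hW, hpW, ?_⟩
        have h2 : B.res hW (proj hV e) = proj _ (q.E.res hV hW e) := proj_res hV hW _
        rw [B.res_anchor, h2, q.E.res_anchor, hx', q.anchor_pj, ← P.anchor_pr]
        exact congrArg _ (proj_pj _ _)
      surj := fun {V} hV b p hp => by
        obtain ⟨W, hW, x, hpW, hx⟩ := P.surj hV b p hp
        exact ⟨W, hW, q.pj.app _ x, hpW, (proj_pj _ _).trans hx⟩
      ker := ker }
  exact ⟨⟨E, isAlg, q.pj, q.pj_act, q.pj_br, q.anchor_pj, q.pair_pj, q.pj_der, q.pj_eq_zero,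
    proj_pj⟩⟩

end PreExtension

end

section

variable {O : TopCat.Sheaf (CommAlgCat.{u} ℂ) X} {U : Opens X}

/-! ### Algebroids in products -/

/-- A subsheaf of `E₁ × E₂` over `𝒯_X`, closed under the operations. -/
structure SubProd (E₁ E₂ : AlgebroidData O U) where
  N : ∀ {V : Opens X} (hV : V ≤ U), Submodule ℂ (E₁.sec V hV × E₂.sec V hV)
  anchor_eq : ∀ {V : Opens X} (hV : V ≤ U) {x}, x ∈ N hV → E₁.anchor hV x.1 = E₂.anchor hV x.2
  mem_res : ∀ {V W : Opens X} (hV : V ≤ U) (h : W ≤ V) {x}, x ∈ N hV →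
    (E₁.res hV h x.1, E₂.res hV h x.2) ∈ N (h.trans hV)
  mem_local : ∀ {V : Opens X} (hV : V ≤ U) {x : E₁.sec V hV × E₂.sec V hV},
    (∀ p ∈ V, ∃ (W : Opens X) (h : W ≤ V), p ∈ W ∧
      (E₁.res hV h x.1, E₂.res hV h x.2) ∈ N (h.trans hV)) → x ∈ N hV
  mem_act : ∀ {V : Opens X} (hV : V ≤ U) (f : Sec O V) {x}, x ∈ N hV →
    (E₁.act hV f x.1, E₂.act hV f x.2) ∈ N hV
  mem_br : ∀ {V : Opens X} (hV : V ≤ U) {x y}, x ∈ N hV → y ∈ N hV →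
    (E₁.br hV x.1 y.1, E₂.br hV x.2 y.2) ∈ N hV
  mem_der : ∀ {V : Opens X} (hV : V ≤ U) (f : Sec O V), (E₁.der hV f, 0) ∈ N hV
  mem_der' : ∀ {V : Opens X} (hV : V ≤ U) (f : Sec O V), (0, E₂.der hV f) ∈ N hV

namespace SubProd

variable {E₁ E₂ : AlgebroidData O U} (S : SubProd E₁ E₂)

/-- The algebroid data with the componentwise multiplication and bracket, with the sum of the
pairings, and with `∂f = (∂f, 0)`. -/
abbrev data : AlgebroidData O U where
  sec V hV := S.N hV
  res {V W} hV h :=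
    { toFun := fun x => ⟨(E₁.res hV h x.1.1, E₂.res hV h x.1.2), S.mem_res hV h x.2⟩
      map_add' := fun x y => Subtype.ext (Prod.ext (map_add _ _ _) (map_add _ _ _))
      map_smul' := fun c x => Subtype.ext (Prod.ext (map_smul _ _ _) (map_smul _ _ _)) }
  act {V} hV := LinearMap.mk₂ ℂ
    (fun f x => ⟨(E₁.act hV f x.1.1, E₂.act hV f x.1.2), S.mem_act hV f x.2⟩)
    (fun f g x => Subtype.ext (Prod.ext (LinearMap.map_add₂ _ _ _ _) (LinearMap.map_add₂ _ _ _ _)))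
    (fun c f x => Subtype.ext (Prod.ext (LinearMap.map_smul₂ _ _ _ _)
      (LinearMap.map_smul₂ _ _ _ _)))
    (fun f x y => Subtype.ext (Prod.ext (map_add _ _ _) (map_add _ _ _)))
    (fun c f x => Subtype.ext (Prod.ext (map_smul _ _ _) (map_smul _ _ _)))
  br {V} hV := LinearMap.mk₂ ℂ
    (fun x y => ⟨(E₁.br hV x.1.1 y.1.1, E₂.br hV x.1.2 y.1.2), S.mem_br hV x.2 y.2⟩)
    (fun f g x => Subtype.ext (Prod.ext (LinearMap.map_add₂ _ _ _ _) (LinearMap.map_add₂ _ _ _ _)))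
    (fun c f x => Subtype.ext (Prod.ext (LinearMap.map_smul₂ _ _ _ _)
      (LinearMap.map_smul₂ _ _ _ _)))
    (fun f x y => Subtype.ext (Prod.ext (map_add _ _ _) (map_add _ _ _)))
    (fun c f x => Subtype.ext (Prod.ext (map_smul _ _ _) (map_smul _ _ _)))
  anchor {V} hV := (E₁.anchor hV).comp ((LinearMap.fst ℂ _ _).comp (S.N hV).subtype)
  pair {V} hV := LinearMap.mk₂ ℂ
    (fun x y => E₁.pair hV x.1.1 y.1.1 + E₂.pair hV x.1.2 y.1.2)
    (fun x y z => by
      simp only [Submodule.coe_add, Prod.fst_add, Prod.snd_add, map_add, LinearMap.add_apply]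
      abel)
    (fun c x y => by
      simp only [Submodule.coe_smul, Prod.smul_fst, Prod.smul_snd, map_smul, LinearMap.smul_apply,
        smul_add])
    (fun x y z => by
      simp only [Submodule.coe_add, Prod.fst_add, Prod.snd_add, map_add]
      abel)
    (fun c x y => by
      simp only [Submodule.coe_smul, Prod.smul_fst, Prod.smul_snd, map_smul, smul_add])
  der {V} hV :=
    { toFun := fun f => ⟨(E₁.der hV f, 0), S.mem_der hV f⟩
      map_add' := fun f g => Subtype.ext (Prod.ext (map_add _ _ _) (add_zero _).symm)
      map_smul' := fun c f => Subtype.ext (Prod.ext (map_smul _ _ _) (smul_zero _).symm) }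
  res_rfl hV x := Subtype.ext (Prod.ext (E₁.res_rfl _ _) (E₂.res_rfl _ _))
  res_res hV h h' x := Subtype.ext (Prod.ext (E₁.res_res _ _ _ _) (E₂.res_res _ _ _ _))
  glue V hV s hs := by
    obtain ⟨a, ha, hau⟩ := E₁.glue V hV (fun i => (s i).1.1)
      (fun i j => congrArg (fun z => z.1.1) (hs i j))
    obtain ⟨b, hb, hbu⟩ := E₂.glue V hV (fun i => (s i).1.2)
      (fun i j => congrArg (fun z => z.1.2) (hs i j))
    refine ⟨⟨(a, b), S.mem_local _ fun p hp => ?_⟩, fun i => ?_, fun y hy => ?_⟩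
    · obtain ⟨i, hi⟩ := Opens.mem_iSup.1 hp
      refine ⟨V i, le_iSup V i, hi, ?_⟩
      rw [ha i, hb i]
      exact (s i).2
    · exact Subtype.ext (Prod.ext (ha i) (hb i))
    · exact Subtype.ext (Prod.ext (hau _ fun i => congrArg (fun z => z.1.1) (hy i))
        (hbu _ fun i => congrArg (fun z => z.1.2) (hy i)))
  res_act hV h f x := Subtype.ext (Prod.ext (E₁.res_act _ _ _ _) (E₂.res_act _ _ _ _))
  res_br hV h x y := Subtype.ext (Prod.ext (E₁.res_br _ _ _ _) (E₂.res_br _ _ _ _))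
  res_anchor hV h x := E₁.res_anchor _ _ _
  res_pair hV h x y := by
    simp only [LinearMap.mk₂_apply, map_add, E₁.res_pair hV, E₂.res_pair hV]
    rfl
  res_der hV h f := Subtype.ext (Prod.ext (E₁.res_der _ _ _) (map_zero _))

variable {V : Opens X} {hV : V ≤ U}

theorem val_res {W : Opens X} (h : W ≤ V) (x : S.data.sec V hV) :
    (S.data.res hV h x).1 = (E₁.res hV h x.1.1, E₂.res hV h x.1.2) := rfl

theorem val_act (f : Sec O V) (x : S.data.sec V hV) :
    (S.data.act hV f x).1 = (E₁.act hV f x.1.1, E₂.act hV f x.1.2) := rfl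

theorem val_br (x y : S.data.sec V hV) :
    (S.data.br hV x y).1 = (E₁.br hV x.1.1 y.1.1, E₂.br hV x.1.2 y.1.2) := rfl

theorem val_der (f : Sec O V) : (S.data.der hV f).1 = (E₁.der hV f, 0) := rfl

theorem anchor_val (x : S.data.sec V hV) : S.data.anchor hV x = E₁.anchor hV x.1.1 := rfl

theorem anchor_val' (x : S.data.sec V hV) : S.data.anchor hV x = E₂.anchor hV x.1.2 :=
  S.anchor_eq hV x.2

theorem pair_val (x y : S.data.sec V hV) :
    S.data.pair hV x y = E₁.pair hV x.1.1 y.1.1 + E₂.pair hV x.1.2 y.1.2 := rfl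

/-- The section `(0, ∂f)`. -/
def der₂ (S : SubProd E₁ E₂) (hV : V ≤ U) (f : Sec O V) : S.data.sec V hV :=
  ⟨(0, E₂.der hV f), S.mem_der' hV f⟩

theorem val_der₂ (f : Sec O V) : (S.der₂ hV f).1 = (0, E₂.der hV f) := rfl

theorem val_om {n : ℕ} (f g : Fin n → Sec O V) :
    (S.data.om hV f g).1 = (E₁.om hV f g, 0) := by
  have hsum : ∀ s : Finset (Fin n),
      (∑ k ∈ s, S.data.act hV (f k) (S.data.der hV (g k)) : S.data.sec V hV).1 =
      (∑ k ∈ s, E₁.act hV (f k) (E₁.der hV (g k)), 0) := by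
    classical
    intro s
    induction s using Finset.induction_on with
    | empty => rfl
    | insert a s ha ih =>
      rw [Finset.sum_insert ha, Finset.sum_insert ha]
      refine (congrArg₂ (· + ·) (S.val_act _ _) ih).trans ?_
      rw [S.val_der, map_zero, Prod.mk_add_mk, add_zero]
  exact hsum _

theorem val_add (x y : S.data.sec V hV) : (x + y).1 = x.1 + y.1 := rfl

theorem val_sub (x y : S.data.sec V hV) : (x - y).1 = x.1 - y.1 := rfl

theorem val_smul (c : ℂ) (x : S.data.sec V hV) : (c • x).1 = c • x.1 := rfl

theorem val_neg (x : S.data.sec V hV) : (-x).1 = -x.1 := rfl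

theorem ext_val {x y : S.data.sec V hV} (h₁ : x.1.1 = y.1.1) (h₂ : x.1.2 = y.1.2) : x = y :=
  Subtype.ext (Prod.ext h₁ h₂)

end SubProd

/-- A `SubProd` with a projection to a Lie algebroid. -/
structure SubProdOver (B : LieAlgebroidData O) (E₁ E₂ : AlgebroidData O U) extends
    SubProd E₁ E₂ where
  pr : ∀ {V : Opens X} (hV : V ≤ U), toSubProd.data.sec V hV →ₗ[ℂ] B.sec V
  pr_res : ∀ {V W : Opens X} (hV : V ≤ U) (h : W ≤ V) (x : toSubProd.data.sec V hV),
    B.res h (pr hV x) = pr (h.trans hV) (toSubProd.data.res hV h x)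
  pr_act : ∀ {V : Opens X} (hV : V ≤ U) (f : Sec O V) (x : toSubProd.data.sec V hV),
    pr hV (toSubProd.data.act hV f x) = B.act f (pr hV x)
  pr_br : ∀ {V : Opens X} (hV : V ≤ U) (x y : toSubProd.data.sec V hV),
    pr hV (toSubProd.data.br hV x y) = B.br (pr hV x) (pr hV y)
  anchor_pr : ∀ {V : Opens X} (hV : V ≤ U) (x : toSubProd.data.sec V hV),
    B.anchor (pr hV x) = toSubProd.data.anchor hV x
  surj : ∀ {V : Opens X} (hV : V ≤ U) (b : B.sec V) (p : X), p ∈ V →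
    ∃ (W : Opens X) (h : W ≤ V) (x : toSubProd.data.sec W (h.trans hV)), p ∈ W ∧
      pr (h.trans hV) x = B.res h b
  pr_der : ∀ {V : Opens X} (hV : V ≤ U) (f : Sec O V), pr hV (toSubProd.data.der hV f) = 0
  pr_der₂ : ∀ {V : Opens X} (hV : V ≤ U) (f : Sec O V), pr hV (toSubProd.der₂ hV f) = 0
  pair_ker : ∀ {V : Opens X} (hV : V ≤ U) (x y : toSubProd.data.sec V hV), pr hV x = 0 →
    toSubProd.data.anchor hV y = 0 → toSubProd.data.pair hV x y = 0

namespace SubProdOver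

variable {B : LieAlgebroidData O} {E₁ E₂ : AlgebroidData O U} (S : SubProdOver B E₁ E₂)

/-- The pre-extension defined by `S`. -/
abbrev pre : PreExtension B U where
  M := S.data
  pr := S.pr
  pr_res := S.pr_res
  pr_act := S.pr_act
  pr_br := S.pr_br
  anchor_pr := S.anchor_pr
  surj := S.surj

variable {c₁ c₂ : ℂ} {V : Opens X} {hV : V ≤ U}

/-- In the push-out (∂g, 0) and (0, ∂g) must coincide. Their pairings with y are π(y₁)(g) and
π(y₂)(g), which agree because both components lie over the same vector field. So the radical makes
the identification that defines the push-out. -/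
theorem der_sub_der₂_mem_rad (h₁ : E₁.IsAlg c₁) (h₂ : E₂.IsAlg c₂) (f g : Sec O V) :
    S.data.act hV f (S.data.der hV g - S.der₂ hV g) ∈ S.pre.rad hV := by
  refine ⟨?_, fun W h (y : S.data.sec W _) => ?_⟩
  · change S.pr hV _ = 0
    rw [S.pr_act, map_sub, S.pr_der, S.pr_der₂, sub_zero, map_zero]
  · change S.data.pair _ (S.data.res hV h _) y = 0
    have hy := S.anchor_eq _ y.2
    simp only [S.pair_val, S.val_res, S.val_act, S.val_sub, S.val_der, S.val_der₂,
      Prod.mk_sub_mk, sub_zero, zero_sub, map_neg, LinearMap.neg_apply, E₁.res_act,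
      E₂.res_act, E₁.res_der, E₂.res_der, h₁.pair_act_der, h₂.pair_act_der, hy, add_neg_cancel]

/-- Both pairing anomalies are expressed through the common anchor, so they add up. In the axioms
whose right-hand side contains ∂, the second component produces a term (0, ∂h), whereas the data use
(∂h, 0). The exchange costs an element of the radical, which is the reason for weakening `assoc` and
`br_symm`. -/
theorem isWeakAlg (h₁ : E₁.IsAlg c₁) (h₂ : E₂.IsAlg c₂) : S.pre.IsWeakAlg (c₁ + c₂) where
  one_act := fun {V} hV (a : S.data.sec V hV) => S.ext_val (h₁.one_act _ _) (h₂.one_act _ _)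
  assoc := fun {V} hV f g (a : S.data.sec V hV) => by
    change S.data.act hV f (S.data.act hV g a) - S.data.act hV (f * g) a -
      (c₁ + c₂) • (S.data.act hV ((S.data.anchor hV a).app f) (S.data.der hV g) +
      S.data.act hV ((S.data.anchor hV a).app g) (S.data.der hV f)) ∈ _
    have e1 := h₁.assoc hV f g a.1.1
    have e2 := h₂.assoc hV f g a.1.2
    have ha := S.anchor_eq hV a.2
    rw [← ha] at e2
    -- The part of the anomaly with factor c₂ sits in the second component; this is the cost of
    -- moving it to the first.
    have := neg_mem (Submodule.smul_mem _ c₂ (add_mem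
      (S.der_sub_der₂_mem_rad (hV := hV) h₁ h₂ ((S.data.anchor hV a).app f) g)
      (S.der_sub_der₂_mem_rad (hV := hV) h₁ h₂ ((S.data.anchor hV a).app g) f)))
    convert! this using 1
    refine S.ext_val ?_ ?_
    · simp only [S.val_sub, S.val_add, S.val_neg, S.val_smul, S.val_act, S.val_der, S.val_der₂,
        Prod.fst_sub, Prod.fst_add, Prod.smul_fst, Prod.fst_neg, S.anchor_val, e1, map_sub,
        map_zero]
      module
    · simp only [S.val_sub, S.val_add, S.val_neg, S.val_smul, S.val_act, S.val_der, S.val_der₂,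
        Prod.snd_sub, Prod.snd_add, Prod.smul_snd, Prod.snd_neg, S.anchor_val, e2, map_sub,
        map_zero]
      module
  leibniz := fun {V} hV (a b c : S.data.sec V hV) => S.ext_val (h₁.leibniz _ _ _ _) (h₂.leibniz _ _ _ _)
  anchor_br := fun {V} hV (a b : S.data.sec V hV) => h₁.anchor_br _ _ _
  pair_symm := fun {V} hV (a b : S.data.sec V hV) => congrArg₂ (· + ·) (h₁.pair_symm _ _ _) (h₂.pair_symm _ _ _)
  br_act := fun {V} hV (a b : S.data.sec V hV) f => by
    refine S.ext_val (h₁.br_act _ _ _ _) ?_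
    have := h₂.br_act hV a.1.2 b.1.2 f
    rw [← S.anchor_eq hV a.2] at this
    exact this
  br_symm := fun {V} hV (a b : S.data.sec V hV) => by
    change S.data.br hV a b + S.data.br hV b a - S.data.der hV (S.data.pair hV a b) ∈ _
    have := neg_mem (S.der_sub_der₂_mem_rad (hV := hV) h₁ h₂ 1 (E₂.pair hV a.1.2 b.1.2))
    convert! this using 1
    have e1 := h₁.br_symm hV a.1.1 b.1.1
    have e2 := h₂.br_symm hV a.1.2 b.1.2
    refine S.ext_val ?_ ?_
    · simp only [S.val_sub, S.val_add, S.val_neg, S.val_br, S.val_act, S.val_der, S.val_der₂,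
        Prod.fst_sub, Prod.fst_add, Prod.fst_neg, S.pair_val, e1, h₁.one_act, map_add]
      abel
    · simp only [S.val_sub, S.val_add, S.val_neg, S.val_br, S.val_act, S.val_der, S.val_der₂,
        Prod.snd_sub, Prod.snd_add, Prod.snd_neg, S.pair_val, e2, h₂.one_act]
      abel
  anchor_act := fun {V} hV f (a : S.data.sec V hV) => h₁.anchor_act _ _ _
  pair_act := fun {V} hV f (a b : S.data.sec V hV) => by
    change S.data.pair hV (S.data.act hV f a) b = f * S.data.pair hV a b -
      (c₁ + c₂) • (S.data.anchor hV a).app ((S.data.anchor hV b).app f)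
    rw [S.pair_val, S.pair_val, S.val_act, h₁.pair_act, h₂.pair_act, ← S.anchor_val',
      ← S.anchor_val', ← S.anchor_val, ← S.anchor_val, mul_add, add_smul]
    abel
  pair_inv := fun {V} hV (a b c : S.data.sec V hV) => by
    change (S.data.anchor hV a).app (S.data.pair hV b c) =
      S.data.pair hV (S.data.br hV a b) c + S.data.pair hV b (S.data.br hV a c)
    have e1 := h₁.pair_inv hV a.1.1 b.1.1 c.1.1
    have e2 := h₂.pair_inv hV a.1.2 b.1.2 c.1.2
    rw [← S.anchor_val'] at e2
    rw [← S.anchor_val] at e1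
    simp only [S.pair_val, S.val_br, VF.app_add, e1, e2]
    abel
  der_mul {V} hV f g := by
    refine S.ext_val (h₁.der_mul _ _ _) ?_
    change (0 : E₂.sec V hV) = E₂.act hV f 0 + E₂.act hV g 0
    rw [map_zero, map_zero, add_zero]
  br_der := fun {V} hV (a : S.data.sec V hV) f => by
    refine S.ext_val (h₁.br_der _ _ _) ?_
    change E₂.br hV a.1.2 0 = 0
    rw [map_zero]
  pair_der := fun {V} hV (a : S.data.sec V hV) f => by
    change E₁.pair hV a.1.1 (E₁.der hV f) + E₂.pair hV a.1.2 0 = (E₁.anchor hV a.1.1).app f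
    rw [h₁.pair_der, map_zero, add_zero]
  der_factors {V} hV n f g hfg := by
    have h := h₁.der_factors hV n f g hfg
    exact Subtype.ext ((S.val_om _ _).trans (Prod.ext h rfl))
  pr_der := S.pr_der
  pair_ker := S.pair_ker

end SubProdOver

end

section

variable {O : TopCat.Sheaf (CommAlgCat.{u} ℂ) X} {U : Opens X} {A : LieAlgebroidData O}

/-! ### Maps which preserve the pairing -/

namespace Extension

variable {E F : Extension A U} {c : ℂ}

/-- Once the projection of `e` is zero, its pairings depend only on the anchor of the other
argument. Hence one local lift of each vector field suffices, and that lift may be chosen of a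
convenient shape, for instance in the image of a given map. -/
theorem isOm_of_local_pair {V : Opens X} {hV : V ≤ U} (h : E.E.IsAlg c) (e : E.E.sec V hV)
    (he : E.proj hV e = 0) {α : ∀ W : Opens X, W ≤ V → VF O W → Sec O W}
    (hα : ∀ (W : Opens X) (h : W ≤ V) (Z : Opens X) (h' : Z ≤ W) (ξ : VF O W),
      rs O h' (α W h ξ) = α Z (h'.trans h) (VF.res h' ξ))
    (H : ∀ (W : Opens X) (hW : W ≤ V) (ξ : VF O W), ∀ p ∈ W, ∃ (Z : Opens X) (hZ : Z ≤ W)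
      (e' : E.E.sec Z ((hZ.trans hW).trans hV)), p ∈ Z ∧ E.E.anchor _ e' = VF.res hZ ξ ∧
      E.E.pair _ (E.E.res hV (hZ.trans hW) e) e' = α Z (hZ.trans hW) (E.E.anchor _ e')) :
    E.IsOm hV e α := by
  refine ⟨he, fun W hW e' => ?_⟩
  apply sec_ext
  intro p hp
  obtain ⟨Z, hZ, e'', hpZ, h1, h2⟩ := H W hW (E.E.anchor _ e') p hp
  refine ⟨Z, hZ, hpZ, ?_⟩
  rw [E.E.res_pair, E.E.res_res, hα, ← h1, ← h2]
  refine pair_congr' h _ _ _ ?_ ?_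
  · rw [← E.proj_res, he, map_zero]
  · rw [h1, E.E.res_anchor]

theorem eq_zero_of_local_pair (htrans : A.IsTransitive) {V : Opens X} {hV : V ≤ U}
    (h : E.E.IsAlg c) (e : E.E.sec V hV) (he : E.proj hV e = 0)
    (H : ∀ (W : Opens X) (hW : W ≤ V) (ξ : VF O W), ∀ p ∈ W, ∃ (Z : Opens X) (hZ : Z ≤ W)
      (e' : E.E.sec Z ((hZ.trans hW).trans hV)), p ∈ Z ∧ E.E.anchor _ e' = VF.res hZ ξ ∧
      E.E.pair _ (E.E.res hV (hZ.trans hW) e) e' = 0) : e = 0 :=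
  eq_zero_of_pair htrans h e he (isOm_of_local_pair (α := fun _ _ _ => 0) h e he
    (fun _ _ _ _ _ => map_zero _) H).2

theorem eq_of_local_pair (htrans : A.IsTransitive) {V : Opens X} {hV : V ≤ U}
    (h : E.E.IsAlg c) (e₁ e₂ : E.E.sec V hV) (he : E.proj hV e₁ = E.proj hV e₂)
    (H : ∀ (W : Opens X) (hW : W ≤ V) (ξ : VF O W), ∀ p ∈ W, ∃ (Z : Opens X) (hZ : Z ≤ W)
      (e' : E.E.sec Z ((hZ.trans hW).trans hV)), p ∈ Z ∧ E.E.anchor _ e' = VF.res hZ ξ ∧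
      E.E.pair _ (E.E.res hV (hZ.trans hW) e₁) e' = E.E.pair _ (E.E.res hV (hZ.trans hW) e₂) e') :
    e₁ = e₂ := by
  rw [← sub_eq_zero]
  refine eq_zero_of_local_pair htrans h _ (by rw [map_sub, he, sub_self]) fun W hW ξ p hp => ?_
  obtain ⟨Z, hZ, e', h1, h2, h3⟩ := H W hW ξ p hp
  refine ⟨Z, hZ, e', h1, h2, ?_⟩
  rw [map_sub, map_sub, LinearMap.sub_apply, h3, sub_self]

section Hom

variable {G : Extension A U} {V : Opens X} (hV : V ≤ U) (φ : E ⟶ F)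

theorem hom_ext {φ ψ : E ⟶ F} (h : ∀ {V : Opens X} (hV : V ≤ U) (e : E.E.sec V hV),
    φ.ap hV e = ψ.ap hV e) : φ = ψ := by
  apply Extension.Hom.ext
  funext V hV
  exact LinearMap.ext fun e => h hV e

theorem ap_res {W : Opens X} (h : W ≤ V) (e : E.E.sec V hV) :
    F.E.res hV h (φ.ap hV e) = φ.ap (h.trans hV) (E.E.res hV h e) := φ.app_res hV h e

theorem ap_add (e e' : E.E.sec V hV) : φ.ap hV (e + e') = φ.ap hV e + φ.ap hV e' :=
  map_add (φ.app V hV) e e'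

theorem ap_br (e e' : E.E.sec V hV) :
    φ.ap hV (E.E.br hV e e') = F.E.br hV (φ.ap hV e) (φ.ap hV e') := φ.app_br hV e e'

theorem anchor_ap (e : E.E.sec V hV) : F.E.anchor hV (φ.ap hV e) = E.E.anchor hV e :=
  φ.anchor_app hV e

theorem pair_ap (e e' : E.E.sec V hV) :
    F.E.pair hV (φ.ap hV e) (φ.ap hV e') = E.E.pair hV e e' := φ.pair_app hV e e'

theorem proj_ap (e : E.E.sec V hV) : F.proj hV (φ.ap hV e) = E.proj hV e := φ.proj_app hV e

end Hom

/-- A map which preserves the projection to `A`, the pairing and the bracket is a morphism. -/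
theorem exists_hom_of_pair (htrans : A.IsTransitive) (hE : E.E.IsAlg c) (hF : F.E.IsAlg c)
    (f : ∀ {V : Opens X} (hV : V ≤ U), E.E.sec V hV →ₗ[ℂ] F.E.sec V hV)
    (f_res : ∀ {V W : Opens X} (hV : V ≤ U) (h : W ≤ V) (x : E.E.sec V hV),
      F.E.res hV h (f hV x) = f (h.trans hV) (E.E.res hV h x))
    (f_proj : ∀ {V : Opens X} (hV : V ≤ U) (x : E.E.sec V hV), F.proj hV (f hV x) = E.proj hV x)
    (f_pair : ∀ {V : Opens X} (hV : V ≤ U) (x y : E.E.sec V hV),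
      F.E.pair hV (f hV x) (f hV y) = E.E.pair hV x y)
    (f_br : ∀ {V : Opens X} (hV : V ≤ U) (x y : E.E.sec V hV),
      f hV (E.E.br hV x y) = F.E.br hV (f hV x) (f hV y)) :
    ∃ φ : E ⟶ F, ∀ {V : Opens X} (hV : V ≤ U) (x : E.E.sec V hV), φ.ap hV x = f hV x := by
  have f_anchor : ∀ {V : Opens X} (hV : V ≤ U) (x : E.E.sec V hV),
      F.E.anchor hV (f hV x) = E.E.anchor hV x := fun hV x => by
    rw [← F.anchor_proj, f_proj, E.anchor_proj]
  -- Sections with equal projections and equal pairings against the image of `f` agree. For f(g * x)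
  -- and g * f(x), and likewise for f(∂g) and ∂g, both are dictated by the axioms, which are the
  -- same for E and F because the level c is the same.
  have key : ∀ {V : Opens X} (hV : V ≤ U) (x : E.E.sec V hV) (y : F.E.sec V hV),
      F.proj hV y = E.proj hV x →
      (∀ (W : Opens X) (h : W ≤ V) (z : E.E.sec W (h.trans hV)),
        F.E.pair _ (F.E.res hV h y) (f _ z) = E.E.pair _ (E.E.res hV h x) z) → f hV x = y := by
    intro V hV x y h1 h2
    refine eq_of_local_pair htrans hF _ _ (by rw [f_proj, h1]) fun W hW ξ p hp => ?_
    obtain ⟨Z, hZ, e, hpZ, he⟩ := exists_lift htrans E (hW.trans hV) ξ p hp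
    refine ⟨Z, hZ, f _ e, hpZ, by rw [f_anchor, he], ?_⟩
    rw [h2, f_res, f_pair]
  exact ⟨{
    app := fun V hV => f hV
    app_res := f_res
    app_act := fun hV g x => by
      refine key hV _ _ (by rw [F.proj_act, f_proj, E.proj_act]) fun W h z => ?_
      rw [F.E.res_act, E.E.res_act, f_res, hF.pair_act, hE.pair_act, f_pair, f_anchor, f_anchor]
    app_br := f_br
    anchor_app := f_anchor
    pair_app := f_pair
    app_der := fun hV g => by
      refine key hV _ _ (by rw [proj_der hF, proj_der hE]) fun W h z => ?_
      rw [F.E.res_der, E.E.res_der, hF.pair_der_left, hE.pair_der_left, f_anchor]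
    proj_app := f_proj }, fun hV x => rfl⟩

/-- Morphisms are usually given by a formula on representatives. That `τ` kills the kernel of `σ`
need not be assumed: if σ(x) = 0, then τ(x) has projection zero and pairs to zero with τ(y) for
lifts σ(y) of all vector fields. Since P carries no bracket, compatibility with brackets is stated
through a representative z of the bracket. -/
theorem exists_hom (hA : A.IsLieAlgebroid) (htrans : A.IsTransitive) (hE : E.E.IsAlg c) (hF : F.E.IsAlg c)
    {P : ModPsh U} (σ : ModPsh.Epi P E.E.psh)
    (τ : ∀ {V : Opens X} (hV : V ≤ U), P.sec V hV →ₗ[ℂ] F.E.sec V hV)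
    (τ_res : ∀ {V W : Opens X} (hV : V ≤ U) (h : W ≤ V) (x : P.sec V hV),
      F.E.res hV h (τ hV x) = τ (h.trans hV) (P.res hV h x))
    (τ_proj : ∀ {V : Opens X} (hV : V ≤ U) (x : P.sec V hV),
      F.proj hV (τ hV x) = E.proj hV (σ.app hV x))
    (τ_pair : ∀ {V : Opens X} (hV : V ≤ U) (x y : P.sec V hV),
      F.E.pair hV (τ hV x) (τ hV y) = E.E.pair hV (σ.app hV x) (σ.app hV y))
    (τ_br : ∀ {V : Opens X} (hV : V ≤ U) (x y : P.sec V hV), ∃ z : P.sec V hV,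
      σ.app hV z = E.E.br hV (σ.app hV x) (σ.app hV y) ∧
      τ hV z = F.E.br hV (τ hV x) (τ hV y)) :
    ∃! φ : E ⟶ F, ∀ {V : Opens X} (hV : V ≤ U) (x : P.sec V hV),
      φ.ap hV (σ.app hV x) = τ hV x := by
  have τ_anchor : ∀ {V : Opens X} (hV : V ≤ U) (x : P.sec V hV),
      F.E.anchor hV (τ hV x) = E.E.anchor hV (σ.app hV x) := fun hV x => by
    rw [← F.anchor_proj, τ_proj, E.anchor_proj]
  obtain ⟨f, f_res, hf⟩ := F.E.isSheaf.exists_desc σ τ τ_res (fun {V} hV x hx => by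
    refine eq_zero_of_local_pair htrans hF _ (by rw [τ_proj, hx, map_zero]) fun W hW ξ p hp => ?_
    obtain ⟨Z, hZ, e, hpZ, he⟩ := exists_lift htrans E (hW.trans hV) ξ p hp
    obtain ⟨Y, hY, y, hpY, hy⟩ := σ.surj _ e p hpZ
    refine ⟨Y, hY.trans hZ, τ _ y, hpY, ?_, ?_⟩
    · rw [τ_anchor, hy]
      change E.E.anchor _ (E.E.res _ _ e) = _
      rw [← E.E.res_anchor, he]
      rfl
    · rw [τ_res hV, τ_pair, ← σ.app_res hV, hx, map_zero, map_zero, LinearMap.zero_apply])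
  obtain ⟨φ, hφ⟩ := exists_hom_of_pair htrans hE hF f f_res
    (fun {V} hV x => by
      refine hA.ext fun p hp => ?_
      obtain ⟨W, h, y, hpW, hy⟩ := σ.surj hV x p hp
      refine ⟨W, h, hpW, ?_⟩
      rw [F.proj_res, f_res, ← hy, hf, τ_proj, hy, E.proj_res])
    (fun {V} hV x y => by
      refine sec_ext fun p hp => ?_
      obtain ⟨W, h, x', y', hpW, hx, hy⟩ := σ.surj₂ hV x y p hp
      refine ⟨W, h, hpW, ?_⟩
      rw [F.E.res_pair, f_res, f_res, E.E.res_pair, hx, hy, hf, hf, τ_pair])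
    (fun {V} hV x y => by
      refine F.E.ext_local hV fun p hp => ?_
      obtain ⟨W, h, x', y', hpW, hx, hy⟩ := σ.surj₂ hV x y p hp
      obtain ⟨z, hz, hz'⟩ := τ_br (h.trans hV) x' y'
      refine ⟨W, h, hpW, ?_⟩
      rw [F.E.res_br, f_res, f_res, f_res, E.E.res_br, hx, hy, ← hz, hf, hf, hf, hz'])
  refine ⟨φ, fun hV x => by rw [hφ, hf], fun φ' hφ' => hom_ext fun {V} hV x => ?_⟩
  refine F.E.ext_local hV fun p hp => ?_
  obtain ⟨W, h, y, hpW, hy⟩ := σ.surj hV x p hp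
  refine ⟨W, h, hpW, ?_⟩
  rw [ap_res, ap_res, ← hy, hφ', hφ, hf]

/-- A morphism is locally surjective: it hits lifts of all sections of A, and all sections f * ∂g.
The identity of E then descends along it to an inverse, injectivity being contained in the
preservation of the pairing. -/
theorem isIso (hA : A.IsLieAlgebroid) (htrans : A.IsTransitive)
    (hE : E.E.IsAlg c) (hF : F.E.IsAlg c) (φ : E ⟶ F) : IsIso φ := by
  let σ : ModPsh.Epi E.E.psh F.E.psh :=
    { app := fun hV => φ.app _ hV
      app_res := fun hV h x => φ.app_res hV h x
      surj := fun {V} hV y p hp => by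
        obtain ⟨W, h, x, hpW, hx⟩ := E.surj hV (F.proj hV y) p hp
        have h0 : F.proj _ (F.E.res hV h y - φ.ap _ x) = 0 := by
          rw [map_sub, proj_ap, hx, F.proj_res, sub_self]
        obtain ⟨Z, hZ, hpZ, n, f, g, hfg⟩ := exists_om _ h0 p hpW
        refine ⟨Z, hZ.trans h, E.E.res _ hZ x + E.E.om _ f g, hpZ, ?_⟩
        change φ.ap _ _ = F.E.res _ _ _
        have hom : φ.ap ((hZ.trans h).trans hV) (E.E.om _ f g) = F.E.om _ f g := by
          rw [AlgebroidData.om, AlgebroidData.om]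
          refine (map_sum (φ.app _ _) _ _).trans (Finset.sum_congr rfl fun k _ => ?_)
          exact (φ.app_act _ _ _).trans (congrArg _ (φ.app_der _ _))
        rw [ap_add, hom, ← hfg, ← ap_res, map_sub, F.E.res_res]
        abel }
  obtain ⟨ψ, hψ, -⟩ := exists_hom hA htrans hF hE σ (fun _ => LinearMap.id) (fun _ _ _ => rfl)
    (fun hV x => (proj_ap hV φ x).symm) (fun hV x y => (pair_ap hV φ x y).symm)
    (fun hV x y => ⟨E.E.br hV x y, ap_br hV φ x y, rfl⟩)
  have h1 : φ ≫ ψ = 𝟙 E := hom_ext fun hV e => hψ hV e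
  refine ⟨ψ, h1, hom_ext fun {V} hV e => ?_⟩
  refine F.E.ext_local hV fun p hp => ?_
  obtain ⟨W, h, y, hpW, hy⟩ := σ.surj hV e p hp
  refine ⟨W, h, hpW, ?_⟩
  rw [ap_res, ap_res]
  change _ = F.E.res _ _ _
  change _ = F.E.res _ _ _ at hy
  rw [← hy]
  change φ.ap _ (ψ.ap _ (σ.app _ y)) = _
  rw [hψ]
  rfl

end Extension

end

section

variable {O : TopCat.Sheaf (CommAlgCat.{u} ℂ) X} {U : Opens X} {A : LieAlgebroidData O}

/-! ### Fibre products over the tangent sheaf and sums of extensions -/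

section Fib

variable {E₁ E₂ : AlgebroidData O U} {V : Opens X} {hV : V ≤ U}

theorem mem_fib {x : E₁.sec V hV × E₂.sec V hV} :
    x ∈ fib E₁ E₂ hV ↔ E₁.anchor hV x.1 = E₂.anchor hV x.2 := Iff.rfl

theorem fib_res_mem {W : Opens X} (h : W ≤ V) {x : E₁.sec V hV × E₂.sec V hV}
    (hx : x ∈ fib E₁ E₂ hV) : (E₁.res hV h x.1, E₂.res hV h x.2) ∈ fib E₁ E₂ (h.trans hV) := by
  rw [mem_fib] at *
  rw [← E₁.res_anchor, ← E₂.res_anchor, hx]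

/-- The presheaf of sections of the fibre product. -/
abbrev fibPsh (E₁ E₂ : AlgebroidData O U) : ModPsh U where
  sec _ hV := fib E₁ E₂ hV
  res {_ _} hV h :=
    { toFun := fun x => ⟨(E₁.res hV h x.1.1, E₂.res hV h x.1.2), fib_res_mem h x.2⟩
      map_add' := fun _ _ => Subtype.ext (Prod.ext (map_add _ _ _) (map_add _ _ _))
      map_smul' := fun _ _ => Subtype.ext (Prod.ext (map_smul _ _ _) (map_smul _ _ _)) }
  res_rfl _ _ := Subtype.ext (Prod.ext (E₁.res_rfl _ _) (E₂.res_rfl _ _))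
  res_res _ _ _ _ := Subtype.ext (Prod.ext (E₁.res_res _ _ _ _) (E₂.res_res _ _ _ _))

theorem fibPsh_res_val {W : Opens X} (h : W ≤ V) (x : fib E₁ E₂ hV) :
    ((fibPsh E₁ E₂).res hV h x).1 = (E₁.res hV h x.1.1, E₂.res hV h x.1.2) := rfl

theorem exists_fib_lift (htrans : A.IsTransitive) (E₁ : Extension A U)
    (E₂ : Extension (tangent O) U) (hV : V ≤ U) (ξ : VF O V) (p : X) (hp : p ∈ V) :
    ∃ (W : Opens X) (h : W ≤ V) (x : fib E₁.E E₂.E (h.trans hV)), p ∈ W ∧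
      E₁.E.anchor _ x.1.1 = VF.res h ξ := by
  obtain ⟨W, h, e, hp, he⟩ := Extension.exists_lift htrans E₁ hV ξ p hp
  obtain ⟨Z, h', e', hp, he'⟩ := Extension.exists_lift (tangent_isTransitive O) E₂
    (h.trans hV) (E₁.E.anchor _ e) p hp
  refine ⟨Z, h'.trans h, ⟨(E₁.E.res _ h' e, e'), ?_⟩, hp, ?_⟩
  · rw [mem_fib, ← E₁.E.res_anchor, he']
  · rw [← E₁.E.res_anchor, he]
    rfl

end Fib

namespace Extension

variable {E₂ : Extension (tangent O) U} {V : Opens X} {hV : V ≤ U}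

theorem proj_tangent (e : E₂.E.sec V hV) : (E₂.proj hV e : VF O V) = E₂.E.anchor hV e :=
  E₂.anchor_proj hV e

end Extension

namespace BaerMap

variable {E₁ E₃ : Extension A U} {E₂ : Extension (tangent O) U} {ε : ℤ}

theorem ext_toFun {σ τ : BaerMap ε E₁ E₂ E₃}
    (h : ∀ {V : Opens X} (hV : V ≤ U) (x : fib E₁.E E₂.E hV), σ.toFun hV x = τ.toFun hV x) :
    σ = τ := by
  have : @σ.toFun = @τ.toFun := by
    funext V hV
    exact LinearMap.ext (h hV)
  cases σ
  cases τ
  cases this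
  rfl

theorem res_toFun (σ : BaerMap ε E₁ E₂ E₃) {V W : Opens X} (hV : V ≤ U) (h : W ≤ V)
    (x : fib E₁.E E₂.E hV) :
    E₃.E.res hV h (σ.toFun hV x) = σ.toFun (h.trans hV) ((fibPsh E₁.E E₂.E).res hV h x) :=
  σ.map_res hV h x _ rfl

/-- A Baer map as an epimorphism of presheaves. -/
def epi (σ : BaerMap ε E₁ E₂ E₃) : ModPsh.Epi (fibPsh E₁.E E₂.E) E₃.E.psh where
  app := σ.toFun
  app_res := σ.res_toFun
  surj := σ.surj

theorem anchor_toFun (σ : BaerMap ε E₁ E₂ E₃) {V : Opens X} (hV : V ≤ U)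
    (x : fib E₁.E E₂.E hV) : E₃.E.anchor hV (σ.toFun hV x) = E₁.E.anchor hV x.1.1 := by
  rw [← E₃.anchor_proj, σ.map_proj, E₁.anchor_proj]

variable {c₁ c₂ : ℂ}

/-- As for morphisms, everything except the bracket is forced by projections and pairings: `key`
identifies f(x) with any section having the right projection and the right pairings with the image
of `f`. Compatibility with `*` uses that the level of E₃ is the sum of the two levels. -/
theorem exists_of_pair (htrans : A.IsTransitive) (h₁ : E₁.E.IsAlg c₁) (h₂ : E₂.E.IsAlg c₂)
    (h₃ : E₃.E.IsAlg (c₁ + c₂))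
    (f : ∀ {V : Opens X} (hV : V ≤ U), fib E₁.E E₂.E hV →ₗ[ℂ] E₃.E.sec V hV)
    (f_res : ∀ {V W : Opens X} (hV : V ≤ U) (h : W ≤ V) (x : fib E₁.E E₂.E hV),
      E₃.E.res hV h (f hV x) = f (h.trans hV) ((fibPsh E₁.E E₂.E).res hV h x))
    (f_proj : ∀ {V : Opens X} (hV : V ≤ U) (x : fib E₁.E E₂.E hV),
      E₃.proj hV (f hV x) = E₁.proj hV x.1.1)
    (f_pair : ∀ {V : Opens X} (hV : V ≤ U) (x y : fib E₁.E E₂.E hV),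
      E₃.E.pair hV (f hV x) (f hV y) = E₁.E.pair hV x.1.1 y.1.1 + E₂.E.pair hV x.1.2 y.1.2)
    (f_br : ∀ {V : Opens X} (hV : V ≤ U) (x y z : fib E₁.E E₂.E hV),
      z.1 = (E₁.E.br hV x.1.1 y.1.1, E₂.E.br hV x.1.2 y.1.2) →
      f hV z = E₃.E.br hV (f hV x) (f hV y)) :
    ∃ σ : BaerMap 1 E₁ E₂ E₃, ∀ {V : Opens X} (hV : V ≤ U) (x : fib E₁.E E₂.E hV),
      σ.toFun hV x = f hV x := by
  have f_anchor : ∀ {V : Opens X} (hV : V ≤ U) (x : fib E₁.E E₂.E hV),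
      E₃.E.anchor hV (f hV x) = E₁.E.anchor hV x.1.1 := fun hV x => by
    rw [← E₃.anchor_proj, f_proj, E₁.anchor_proj]
  have key : ∀ {V : Opens X} (hV : V ≤ U) (x : fib E₁.E E₂.E hV) (y : E₃.E.sec V hV),
      E₃.proj hV y = E₁.proj hV x.1.1 →
      (∀ (W : Opens X) (h : W ≤ V) (z : fib E₁.E E₂.E (h.trans hV)),
        E₃.E.pair _ (E₃.E.res hV h y) (f _ z) = E₁.E.pair _ (E₁.E.res hV h x.1.1) z.1.1 +
          E₂.E.pair _ (E₂.E.res hV h x.1.2) z.1.2) → f hV x = y := by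
    intro V hV x y h1 h2
    refine Extension.eq_of_local_pair htrans h₃ _ _ (by rw [f_proj, h1]) fun W hW ξ p hp => ?_
    obtain ⟨Z, hZ, e, hpZ, he⟩ := exists_fib_lift htrans E₁ E₂ (hW.trans hV) ξ p hp
    refine ⟨Z, hZ, f _ e, hpZ, by rw [f_anchor, he], ?_⟩
    rw [h2, f_res hV, f_pair, fibPsh_res_val]
  have f_om : ∀ {V : Opens X} (hV : V ≤ U) (x : fib E₁.E E₂.E hV) (n : ℕ) (a b : Fin n → Sec O V),
      x.1 = (E₁.E.om hV a b, 0) → f hV x = E₃.E.om hV a b := by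
    intro V hV x n a b hx
    refine key hV _ _ (by rw [hx, Extension.proj_om h₃, Extension.proj_om h₁]) fun W h z => ?_
    rw [hx, E₃.E.res_om, E₁.E.res_om, h₃.pair_om, h₁.pair_om, map_zero, map_zero,
      LinearMap.zero_apply, add_zero, f_anchor]
  exact ⟨{
    toFun := f
    map_res := fun hV h x y hy => by
      rw [f_res hV h]
      congr 1
      exact Subtype.ext hy.symm
    map_act := fun hV g x y hy => by
      refine key hV _ _ (by rw [E₃.proj_act, f_proj, hy, E₁.proj_act]) fun W h z => ?_
      have hx := x.2
      have hz := z.2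
      rw [mem_fib] at hx hz
      rw [hy, E₃.E.res_act, E₁.E.res_act, E₂.E.res_act, f_res hV, h₃.pair_act, h₁.pair_act,
        h₂.pair_act, f_pair, f_anchor, f_anchor, ← hz, ← E₂.E.res_anchor, ← hx, E₁.E.res_anchor,
        fibPsh_res_val, add_smul]
      ring
    map_br := f_br
    map_pair := fun hV x y => by rw [f_pair, one_smul]
    map_proj := f_proj
    map_der_left := fun hV g x hx => by
      refine key hV _ _ (by rw [hx, Extension.proj_der h₃, Extension.proj_der h₁]) fun W h z => ?_
      rw [hx, E₃.E.res_der, E₁.E.res_der, h₃.pair_der_left, h₁.pair_der_left, map_zero, map_zero,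
        LinearMap.zero_apply, add_zero, f_anchor]
    map_der_right := fun hV g x hx => by
      rw [one_smul]
      refine key hV _ _ (by rw [hx, Extension.proj_der h₃, map_zero]) fun W h z => ?_
      have hz := z.2
      rw [mem_fib] at hz
      rw [hx, E₃.E.res_der, E₂.E.res_der, h₃.pair_der_left, h₂.pair_der_left, map_zero, map_zero,
        LinearMap.zero_apply, zero_add, f_anchor, hz]
    surj := fun {V} hV e p hp => by
      obtain ⟨W, h, e₁, hpW, he₁⟩ := E₁.surj hV (E₃.proj hV e) p hp
      obtain ⟨W', h', e₂, hpW', he₂⟩ := Extension.exists_lift (tangent_isTransitive O) E₂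
        (h.trans hV) (E₁.E.anchor _ e₁) p hpW
      have hx : (E₁.E.res _ h' e₁, e₂) ∈ fib E₁.E E₂.E ((h'.trans h).trans hV) := by
        rw [mem_fib, he₂, E₁.E.res_anchor]
      -- A pair over the projection of `e` hits `e` up to a section of Ω, which locally is the image
      -- of some (∑ a * ∂b, 0).
      have h0 : E₃.proj _ (E₃.E.res hV (h'.trans h) e - f _ ⟨_, hx⟩) = 0 := by
        rw [map_sub, f_proj, ← E₁.proj_res, he₁, ← E₃.proj_res, A.res_res, sub_self]
      obtain ⟨Z, hZ, hpZ, n, a, b, hab⟩ := Extension.exists_om _ h0 p hpW'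
      have hy : (E₁.E.om ((hZ.trans (h'.trans h)).trans hV) a b, 0) ∈ fib E₁.E E₂.E _ := by
        rw [mem_fib, h₁.anchor_om, map_zero]
      refine ⟨Z, hZ.trans (h'.trans h), (fibPsh E₁.E E₂.E).res _ hZ ⟨_, hx⟩ + ⟨_, hy⟩, hpZ, ?_⟩
      rw [map_add, f_om _ ⟨_, hy⟩ n a b rfl, ← hab, map_sub, E₃.E.res_res, ← f_res]
      abel
    ker := fun {V} hV x => by
      have hx := x.2
      rw [mem_fib] at hx
      constructor
      · intro h0 p hp
        -- The first component is thus locally ∑ a * ∂b. As f(x) = 0 is orthogonal to every f(z),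
        -- the second component has the pairings of −∑ a * ∂b, and its projection vanishes because
        -- the two anchors agree.
        have hx1 : E₁.proj hV x.1.1 = 0 := by rw [← f_proj, h0, map_zero]
        obtain ⟨W, h, hpW, n, a, b, hab⟩ := Extension.exists_om _ hx1 p hp
        refine ⟨W, h, hpW, n, a, b, hab, ?_⟩
        rw [one_smul]
        refine (Extension.eq_of_local_pair (tangent_isTransitive O) h₂ _ (-E₂.E.om _ a b) ?_
          fun W' hW' ξ p hp => ?_)
        · rw [map_neg, Extension.proj_om h₂, neg_zero]
          rw [Extension.proj_tangent, ← E₂.E.res_anchor, ← hx,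
            Extension.anchor_eq_zero _ hx1, map_zero]
          rfl
        · obtain ⟨Z, hZ, z, hpZ, hz⟩ := exists_fib_lift htrans E₁ E₂ ((hW'.trans h).trans hV) ξ p hp
          have hz2 := z.2
          rw [mem_fib] at hz2
          refine ⟨Z, hZ, z.1.2, hpZ, by rw [← hz2, hz], ?_⟩
          have := f_pair _ ((fibPsh E₁.E E₂.E).res hV ((hZ.trans hW').trans h) x) z
          rw [← f_res hV, h0, map_zero, map_zero, LinearMap.zero_apply, fibPsh_res_val] at this
          rw [E₂.E.res_res, map_neg, E₂.E.res_om, map_neg, LinearMap.neg_apply, h₂.pair_om,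
            eq_neg_iff_add_eq_zero, add_comm, this]
          dsimp only
          rw [← E₁.E.res_res _ h, hab, E₁.E.res_om, h₁.pair_om, hz2]
      · intro H
        refine E₃.E.ext_local hV fun p hp => ?_
        obtain ⟨W, h, hpW, n, a, b, hab1, hab2⟩ := H p hp
        refine ⟨W, h, hpW, ?_⟩
        rw [map_zero, f_res hV]
        refine key _ _ _ ?_ fun W' h' z => ?_
        · rw [map_zero, fibPsh_res_val]
          change 0 = E₁.proj _ (E₁.E.res _ _ _)
          rw [hab1]
          exact (Extension.proj_om h₁ a b).symm
        · have hz := z.2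
          rw [mem_fib] at hz
          rw [fibPsh_res_val]
          change _ = E₁.E.pair _ (E₁.E.res _ _ (E₁.E.res _ _ _)) _ +
            E₂.E.pair _ (E₂.E.res _ _ (E₂.E.res _ _ _)) _
          rw [hab1, hab2, one_smul]
          change _ = E₁.E.pair _ (E₁.E.res _ _ (E₁.E.om _ a b)) _ +
            E₂.E.pair _ (E₂.E.res _ _ (-E₂.E.om _ a b)) _
          rw [map_neg, E₁.E.res_om, E₂.E.res_om, map_neg, LinearMap.neg_apply, h₁.pair_om,
            h₂.pair_om, hz, map_zero, map_zero, LinearMap.zero_apply, add_neg_cancel] },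
    fun hV x => rfl⟩

/-- For a map whose formula lives on a presheaf that only locally surjects onto the fibre product.
That it descends follows again from the pairing. -/
theorem exists_of_epi (hA : A.IsLieAlgebroid) (htrans : A.IsTransitive) (h₁ : E₁.E.IsAlg c₁)
    (h₂ : E₂.E.IsAlg c₂) (h₃ : E₃.E.IsAlg (c₁ + c₂)) {P : ModPsh U}
    (π : ModPsh.Epi P (fibPsh E₁.E E₂.E))
    (τ : ∀ {V : Opens X} (hV : V ≤ U), P.sec V hV →ₗ[ℂ] E₃.E.sec V hV)
    (τ_res : ∀ {V W : Opens X} (hV : V ≤ U) (h : W ≤ V) (x : P.sec V hV),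
      E₃.E.res hV h (τ hV x) = τ (h.trans hV) (P.res hV h x))
    (τ_proj : ∀ {V : Opens X} (hV : V ≤ U) (x : P.sec V hV),
      E₃.proj hV (τ hV x) = E₁.proj hV (π.app hV x).1.1)
    (τ_pair : ∀ {V : Opens X} (hV : V ≤ U) (x y : P.sec V hV),
      E₃.E.pair hV (τ hV x) (τ hV y) = E₁.E.pair hV (π.app hV x).1.1 (π.app hV y).1.1 +
        E₂.E.pair hV (π.app hV x).1.2 (π.app hV y).1.2)
    (τ_br : ∀ {V : Opens X} (hV : V ≤ U) (x y : P.sec V hV), ∃ z : P.sec V hV,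
      (π.app hV z).1 = (E₁.E.br hV (π.app hV x).1.1 (π.app hV y).1.1,
        E₂.E.br hV (π.app hV x).1.2 (π.app hV y).1.2) ∧
      τ hV z = E₃.E.br hV (τ hV x) (τ hV y)) :
    ∃ σ : BaerMap 1 E₁ E₂ E₃, ∀ {V : Opens X} (hV : V ≤ U) (x : P.sec V hV),
      σ.toFun hV (π.app hV x) = τ hV x := by
  have τ_anchor : ∀ {V : Opens X} (hV : V ≤ U) (x : P.sec V hV),
      E₃.E.anchor hV (τ hV x) = E₁.E.anchor hV (π.app hV x).1.1 := fun hV x => by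
    rw [← E₃.anchor_proj, τ_proj, E₁.anchor_proj]
  obtain ⟨f, f_res, hf⟩ := E₃.E.isSheaf.exists_desc π τ τ_res (fun {V} hV x hx => by
    refine Extension.eq_zero_of_local_pair htrans h₃ _ (by rw [τ_proj, hx]; exact map_zero _)
      fun W hW ξ p hp => ?_
    obtain ⟨Z, hZ, e, hpZ, he⟩ := exists_fib_lift htrans E₁ E₂ (hW.trans hV) ξ p hp
    obtain ⟨Y, hY, y, hpY, hy⟩ := π.surj _ e p hpZ
    refine ⟨Y, hY.trans hZ, τ _ y, hpY, ?_, ?_⟩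
    · rw [τ_anchor, hy, fibPsh_res_val]
      change E₁.E.anchor _ (E₁.E.res _ _ _) = _
      rw [← E₁.E.res_anchor, he]
      rfl
    · rw [τ_res hV, τ_pair, ← π.app_res hV, hx, map_zero]
      change E₁.E.pair _ 0 _ + E₂.E.pair _ 0 _ = 0
      rw [map_zero, map_zero, LinearMap.zero_apply, LinearMap.zero_apply, add_zero])
  obtain ⟨σ, hσ⟩ := exists_of_pair htrans h₁ h₂ h₃ f f_res
    (fun {V} hV x => by
      refine hA.ext fun p hp => ?_
      obtain ⟨W, h, y, hpW, hy⟩ := π.surj hV x p hp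
      refine ⟨W, h, hpW, ?_⟩
      rw [E₃.proj_res, f_res, ← hy, hf, τ_proj, hy, E₁.proj_res]
      rfl)
    (fun {V} hV x y => by
      refine sec_ext fun p hp => ?_
      obtain ⟨W, h, x', y', hpW, hx, hy⟩ := π.surj₂ hV x y p hp
      refine ⟨W, h, hpW, ?_⟩
      rw [E₃.E.res_pair, f_res, f_res, map_add, E₁.E.res_pair, E₂.E.res_pair, hx, hy, hf, hf,
        τ_pair, ← hx, ← hy]
      rfl)
    (fun {V} hV x y z hz => by
      refine E₃.E.ext_local hV fun p hp => ?_
      obtain ⟨W, h, x', y', hpW, hx, hy⟩ := π.surj₂ hV x y p hp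
      obtain ⟨z', hz', hz''⟩ := τ_br (h.trans hV) x' y'
      refine ⟨W, h, hpW, ?_⟩
      have : (fibPsh E₁.E E₂.E).res hV h z = π.app _ z' := by
        refine Subtype.ext ?_
        rw [hz', fibPsh_res_val, hz, ← hx, ← hy]
        exact Prod.ext (E₁.E.res_br _ _ _ _) (E₂.E.res_br _ _ _ _)
      rw [E₃.E.res_br, f_res, f_res, f_res, this, hx, hy, hf, hf, hf, hz''])
  exact ⟨σ, fun hV x => by rw [hσ, hf]⟩

theorem ext_of_epi {P : ModPsh U} (π : ModPsh.Epi P (fibPsh E₁.E E₂.E))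
    {σ τ : BaerMap ε E₁ E₂ E₃} (h : ∀ {V : Opens X} (hV : V ≤ U) (x : P.sec V hV),
      σ.toFun hV (π.app hV x) = τ.toFun hV (π.app hV x)) : σ = τ := by
  refine ext_toFun fun {V} hV x => E₃.E.ext_local hV fun p hp => ?_
  obtain ⟨W, h', y, hpW, hy⟩ := π.surj hV x p hp
  refine ⟨W, h', hpW, ?_⟩
  rw [res_toFun, res_toFun, ← hy, h]

end BaerMap

end

section

variable {O : TopCat.Sheaf (CommAlgCat.{u} ℂ) X} {U : Opens X} {A : LieAlgebroidData O}

/-! ### Existence of sums and of differences -/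

namespace Extension

variable {c d : ℂ}

theorem proj_tangent_eq_zero {E : Extension (tangent O) U} {V : Opens X} {hV : V ≤ U}
    {e : E.E.sec V hV} (he : E.E.anchor hV e = 0) : E.proj hV e = 0 :=
  (proj_tangent e).trans he

/-- The fibre product over `𝒯_X`. -/
abbrev fibProd (s : Extension A U) (Q : Extension (tangent O) U) (hs : s.E.IsAlg c)
    (hQ : Q.E.IsAlg d) : SubProd s.E Q.E where
  N hV := fib s.E Q.E hV
  anchor_eq _ _ h := h
  mem_res _ h _ hx := fib_res_mem h hx
  mem_local {V} hV x H := by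
    refine vf_ext fun p hp => ?_
    obtain ⟨W, h, hpW, hx⟩ := H p hp
    refine ⟨W, h, hpW, ?_⟩
    rw [mem_fib] at hx
    change VF.res h (s.E.anchor hV x.1) = VF.res h (Q.E.anchor hV x.2)
    rw [s.E.res_anchor, Q.E.res_anchor, hx]
  mem_act hV f x hx := by
    rw [mem_fib] at *
    rw [hs.anchor_act, hQ.anchor_act, hx]
  mem_br hV x y hx hy := by
    rw [mem_fib] at *
    rw [hs.anchor_br, hQ.anchor_br, hx, hy]
  mem_der hV f := by rw [mem_fib, hs.anchor_der, map_zero]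
  mem_der' hV f := by rw [mem_fib, hQ.anchor_der, map_zero]

/-- The fibre product with its projection to `A`. -/
abbrev fibProdOver (s : Extension A U) (Q : Extension (tangent O) U)
    (hs : s.E.IsAlg c) (hQ : Q.E.IsAlg d) : SubProdOver A s.E Q.E where
  toSubProd := fibProd s Q hs hQ
  pr hV := (s.proj hV).comp ((LinearMap.fst ℂ _ _).comp (fib s.E Q.E hV).subtype)
  pr_res hV h x := s.proj_res _ _ _
  pr_act hV f x := s.proj_act _ _ _
  pr_br hV x y := s.proj_br _ _ _
  anchor_pr hV x := s.anchor_proj _ _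
  surj {V} hV b p hp := by
    obtain ⟨W, h, e, hpW, he⟩ := s.surj hV b p hp
    obtain ⟨W', h', e', hpW', he'⟩ := exists_lift (tangent_isTransitive O) Q
      (h.trans hV) (s.E.anchor _ e) p hpW
    refine ⟨W', h'.trans h, ⟨(s.E.res _ h' e, e'), ?_⟩, hpW', ?_⟩
    · change _ ∈ fib s.E Q.E _
      rw [mem_fib, he', s.E.res_anchor]
    · change s.proj _ (s.E.res _ h' e) = _
      rw [← s.proj_res, he, A.res_res]
  pr_der hV f := proj_der hs f
  pr_der₂ hV f := map_zero (s.proj hV)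
  pair_ker {V} hV x y hx hy := by
    have hxa := SubProd.anchor_val' _ x
    have hya := SubProd.anchor_val' _ y
    change s.E.pair hV x.1.1 y.1.1 + Q.E.pair hV x.1.2 y.1.2 = 0
    have hx1 : s.proj hV x.1.1 = 0 := hx
    have h1 : s.E.pair hV x.1.1 y.1.1 = 0 := pair_eq_zero hs _ _ hx1 hy
    have h2 : Q.E.pair hV x.1.2 y.1.2 = 0 := pair_eq_zero hQ _ _ (proj_tangent_eq_zero
      (hxa.symm.trans (anchor_eq_zero _ hx1))) (hya.symm.trans hy)
    rw [h1, h2, add_zero]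

/-- The sum is the reduction of the fibre product, and the quotient map is the required Baer map;
its kernel is described correctly by `exists_of_pair`, without reference to the radical. -/
theorem exists_sum (hX : HasLocalCoordinates O) (hA : A.IsLieAlgebroid) (htrans : A.IsTransitive)
    (s : Extension A U) (Q : Extension (tangent O) U) (hs : s.E.IsAlg c) (hQ : Q.E.IsAlg d) :
    ∃ s' : Extension A U, s'.E.IsAlg (c + d) ∧ Nonempty (BaerMap 1 s Q s') := by
  obtain ⟨R⟩ := ((fibProdOver s Q hs hQ).isWeakAlg hs hQ).exists_reduction hX hA htrans
  obtain ⟨σ, -⟩ := BaerMap.exists_of_pair (E₃ := R.E) htrans hs hQ R.isAlg (fun hV => R.pj.app hV)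
    (fun hV h x => R.pj.app_res hV h x) (fun hV x => R.proj_pj hV x)
    (fun hV x y => R.pair_pj hV x y) (fun hV x y z hz => by
      have := R.pj_br hV x y
      refine Eq.trans ?_ this.symm
      congr 1
      exact Subtype.ext hz)
  exact ⟨R.E, R.isAlg, ⟨σ⟩⟩

/-- The extensions induce the same pairing on the kernel of the anchor of `A`. -/
def SamePairing (s s' : Extension A U) : Prop :=
  ∀ {V : Opens X} (hV : V ≤ U) (a b : s.E.sec V hV) (a' b' : s'.E.sec V hV),
    s'.proj hV a' = s.proj hV a → s'.proj hV b' = s.proj hV b → s.E.anchor hV a = 0 →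
    s.E.anchor hV b = 0 → s'.E.pair hV a' b' = s.E.pair hV a b

theorem anchor_congr {s s' : Extension A U} {V : Opens X} {hV : V ≤ U} {a : s.E.sec V hV}
    {a' : s'.E.sec V hV} (h : s'.proj hV a' = s.proj hV a) :
    s'.E.anchor hV a' = s.E.anchor hV a := by
  rw [← s'.anchor_proj, h, s.anchor_proj]

/-- The fibre product over `A`. -/
abbrev diffProd (hA : A.IsLieAlgebroid) (s s' : Extension A U) (hs : s.E.IsAlg c)
    (hs' : s'.E.IsAlg d) : SubProd s'.E s.neg.E where
  N hV := LinearMap.eqLocus ((s'.proj hV).comp (LinearMap.fst ℂ _ _))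
    ((s.neg.proj hV).comp (LinearMap.snd ℂ _ _))
  anchor_eq hV _ hx := anchor_congr hx
  mem_res {V W} hV h x hx := by
    change s'.proj _ (s'.E.res _ _ _) = s.proj _ (s.E.res _ _ _)
    have : s'.proj _ x.1 = s.proj _ x.2 := hx
    rw [← s'.proj_res, ← s.proj_res, this]
  mem_local {V} hV x H := by
    refine hA.ext fun p hp => ?_
    obtain ⟨W, h, hpW, hx⟩ := H p hp
    refine ⟨W, h, hpW, ?_⟩
    change A.res h (s'.proj hV x.1) = A.res h (s.proj hV x.2)
    rw [s'.proj_res, s.proj_res]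
    exact hx
  mem_act hV f x hx := by
    change s'.proj _ (s'.E.act _ _ _) = s.proj _ (s.E.act _ _ _)
    have : s'.proj _ x.1 = s.proj _ x.2 := hx
    rw [s'.proj_act, s.proj_act, this]
  mem_br hV x y hx hy := by
    change s'.proj _ (s'.E.br _ _ _) = s.proj _ (s.E.br _ _ _)
    have hx : s'.proj _ x.1 = s.proj _ x.2 := hx
    have hy : s'.proj _ y.1 = s.proj _ y.2 := hy
    rw [s'.proj_br, s.proj_br, hx, hy]
  mem_der hV f := by
    change s'.proj _ (s'.E.der _ _) = s.proj _ 0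
    rw [proj_der hs', map_zero]
  mem_der' hV f := by
    change s'.proj _ 0 = s.proj _ (-(s.E.der _ _))
    rw [map_neg, proj_der hs, map_zero, neg_zero]

/-- The fibre product over `A` with its projection to `𝒯_X`. -/
abbrev diffProdOver (hA : A.IsLieAlgebroid) (htrans : A.IsTransitive) (s s' : Extension A U)
    (hs : s.E.IsAlg c) (hs' : s'.E.IsAlg d) (H : SamePairing s s') :
    SubProdOver (tangent O) s'.E s.neg.E where
  toSubProd := diffProd hA s s' hs hs'
  pr hV := (diffProd hA s s' hs hs').data.anchor hV
  pr_res hV h x := (diffProd hA s s' hs hs').data.res_anchor _ _ _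
  pr_act hV f x := hs'.anchor_act _ _ _
  pr_br hV x y := hs'.anchor_br _ _ _
  anchor_pr hV x := rfl
  surj {V} hV ξ p hp := by
    obtain ⟨W, h, e, hpW, he⟩ := exists_lift htrans s hV ξ p hp
    obtain ⟨W', h', e', hpW', he'⟩ := s'.surj (h.trans hV) (s.proj _ e) p hpW
    have : s'.proj _ e' = s.proj _ (s.E.res _ h' e) := by rw [he', s.proj_res]
    refine ⟨W', h'.trans h, ⟨(e', s.E.res _ h' e), this⟩, hpW', ?_⟩
    change s'.E.anchor _ e' = _
    rw [anchor_congr this, ← s.E.res_anchor, he]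
    rfl
  pr_der hV f := hs'.anchor_der _ _
  pr_der₂ hV f := map_zero (s'.E.anchor hV)
  pair_ker {V} hV x y hx hy := by
    -- Here the two extensions have to induce the same pairing: on sections without anchor over the
    -- same elements of A, the pairings of s' and s cancel.
    have h1 := H hV x.1.2 y.1.2 x.1.1 y.1.1 x.2 y.2
      ((SubProd.anchor_val' _ x).symm.trans hx) ((SubProd.anchor_val' _ y).symm.trans hy)
    change s'.E.pair hV x.1.1 y.1.1 + -(s.E.pair hV x.1.2 y.1.2) = 0
    rw [h1, add_neg_cancel]

/-- Q is the reduction of s' ×_A (−s), viewed over 𝒯_X by its anchor. The identity s + (s' − s) = s'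
is realized by the first projection: a pair (a', a) represents both the element (a, [(a', a)]) of s
×_𝒯 Q and its image a'. What has to be shown is that such elements exhaust the fibre product
locally. -/
theorem exists_difference (hX : HasLocalCoordinates O) (hA : A.IsLieAlgebroid)
    (htrans : A.IsTransitive) (s s' : Extension A U) (hs : s.E.IsAlg c) (hs' : s'.E.IsAlg d)
    (H : SamePairing s s') :
    ∃ Q : Extension (tangent O) U, Q.E.IsAlg (d - c) ∧ Nonempty (BaerMap 1 s Q s') := by
  let S := diffProdOver hA htrans s s' hs hs' H
  have hS := S.isWeakAlg hs' hs.neg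
  obtain ⟨R⟩ := hS.exists_reduction hX (tangent_isLieAlgebroid O) (tangent_isTransitive O)
  have hR : R.E.E.IsAlg (d - c) := by
    rw [sub_eq_add_neg]
    exact R.isAlg
  let π : ModPsh.Epi S.data.psh (fibPsh s.E R.E.E) :=
    { app := fun {V} hV =>
        { toFun := fun x => ⟨(x.1.2, R.pj.app hV x), by
            rw [mem_fib, R.anchor_pj]
            exact (SubProd.anchor_val' _ x).symm⟩
          map_add' := fun x y => Subtype.ext (Prod.ext rfl (map_add _ _ _))
          map_smul' := fun k x => Subtype.ext (Prod.ext rfl (map_smul _ _ _)) }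
      app_res := fun hV h x => Subtype.ext (Prod.ext rfl (R.pj.app_res hV h x))
      surj := fun {V} hV q p hp => by
        obtain ⟨W, h, x, hpW, hx⟩ := R.pj.surj hV q.1.2 p hp
        have hx' : R.E.E.anchor _ (R.pj.app _ x) = s.E.anchor _ (s.E.res hV h q.1.1) := by
          rw [hx]
          change R.E.E.anchor _ (R.E.E.res _ _ _) = _
          rw [← R.E.E.res_anchor, ← s.E.res_anchor, mem_fib.1 q.2]
        -- `x` represents the component in Q, but its s-component may differ from the prescribed one
        -- by a section without anchor. The pair `y` corrects this. Its class lies in Ω, so it is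
        -- locally ∑ f * ∂g, and subtracting this combination leaves the s-component unchanged
        -- because ∂f = (∂f, 0).
        obtain ⟨W', h', b, hpW', hb⟩ := s'.surj (h.trans hV)
          (s.proj _ (s.E.res hV h q.1.1 - x.1.2)) p hpW
        rw [s.proj_res] at hb
        let y : S.data.sec W' ((h'.trans h).trans hV) := ⟨(b, _), hb⟩
        have hy : R.E.proj _ (R.pj.app _ y) = 0 := by
          refine proj_tangent_eq_zero ?_
          rw [R.anchor_pj]
          refine (SubProd.anchor_val' _ y).trans ?_
          change s.E.anchor _ (s.E.res _ _ _) = 0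
          rw [← s.E.res_anchor, map_sub, ← hx', R.anchor_pj]
          have : S.pre.M.anchor _ x = s.E.anchor _ x.1.2 := SubProd.anchor_val' _ x
          rw [this, sub_self, map_zero]
        obtain ⟨Z, hZ, hpZ, n, f, g, hfg⟩ := exists_om _ hy p hpW'
        have hpj : R.pj.app _ (S.data.om ((hZ.trans (h'.trans h)).trans hV) f g) =
            R.E.E.om _ f g := by
          refine (map_sum (R.pj.app _) _ _).trans (Finset.sum_congr rfl fun k _ => ?_)
          exact (R.pj_act _ _ _).symm.trans (congrArg _ (R.pj_der _ _).symm)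
        let z := S.data.res _ hZ (S.data.res _ h' x + y) -
          S.data.om ((hZ.trans (h'.trans h)).trans hV) f g
        refine ⟨Z, hZ.trans (h'.trans h), z, hpZ, Subtype.ext (Prod.ext ?_ ?_)⟩
        · change s.E.res _ hZ (s.E.res _ h' x.1.2 + s.E.res _ h' _) -
            (S.data.om ((hZ.trans (h'.trans h)).trans hV) f g).1.2 = s.E.res _ _ _
          rw [S.val_om, map_add, s.E.res_res, s.E.res_res, map_sub, s.E.res_res]
          change _ - 0 = _
          abel
        · change R.pj.app _ z = R.E.E.res _ _ _
          have h1 := R.pj.app_res _ hZ (S.data.res _ h' x + y)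
          have h2 := R.pj.app_res _ h' x
          change R.E.E.res _ _ _ = _ at h1 h2
          rw [map_sub, hpj, ← hfg, ← h1, map_add, map_add, ← h2, hx]
          change R.E.E.res _ _ (R.E.E.res _ _ (R.E.E.res _ _ _)) + _ - _ = _
          rw [add_sub_cancel_right, R.E.E.res_res, R.E.E.res_res] }
  obtain ⟨σ, -⟩ := BaerMap.exists_of_epi (E₃ := s') hA htrans hs hR
    (by rwa [add_sub_cancel]) π
    (fun hV => (LinearMap.fst ℂ _ _).comp (S.N hV).subtype)
    (fun hV h x => rfl) (fun hV (x : S.data.sec _ hV) => x.2) (fun {V} hV x y => by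
      change s'.E.pair hV x.1.1 y.1.1 = s.E.pair hV x.1.2 y.1.2 +
        R.E.E.pair hV (R.pj.app hV x) (R.pj.app hV y)
      rw [R.pair_pj]
      change _ = _ + (s'.E.pair hV x.1.1 y.1.1 + -(s.E.pair hV x.1.2 y.1.2))
      abel)
    (fun {V} hV x y => ⟨S.data.br hV x y, Prod.ext rfl (R.pj_br hV x y).symm, rfl⟩)
  exact ⟨R.E, hR, ⟨σ⟩⟩

end Extension

end

section

variable {O : TopCat.Sheaf (CommAlgCat.{u} ℂ) X} {U : Opens X} {A : LieAlgebroidData O}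

/-! ### The pairing induced on the kernel of the anchor -/

namespace Extension

variable {c d : ℂ} {s s' s'' : Extension A U}

theorem samePairing_of_induces {κ : A.InvPairing} (h : s.Induces κ) (h' : s'.Induces κ) :
    SamePairing s s' := by
  intro V hV a b a' b' ha hb ha0 hb0
  have ha1 : A.anchor (s.proj hV a) = 0 := by rw [s.anchor_proj, ha0]
  have hb1 : A.anchor (s.proj hV b) = 0 := by rw [s.anchor_proj, hb0]
  rw [← h hV a b ⟨_, ha1⟩ ⟨_, hb1⟩ rfl rfl, ← h' hV a' b' ⟨_, ha1⟩ ⟨_, hb1⟩ ha.symm hb.symm]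

theorem exists_lift₂ (s : Extension A U) {V : Opens X} (hV : V ≤ U) (a b : A.sec V) (p : X)
    (hp : p ∈ V) : ∃ (W : Opens X) (h : W ≤ V) (e e' : s.E.sec W (h.trans hV)), p ∈ W ∧
      s.proj _ e = A.res h a ∧ s.proj _ e' = A.res h b := by
  obtain ⟨W, h, e, hpW, he⟩ := s.surj hV a p hp
  obtain ⟨W', h', e', hpW', he'⟩ := s.surj (h.trans hV) (A.res h b) p hpW
  refine ⟨W', h'.trans h, s.E.res _ h' e, e', hpW', ?_, ?_⟩
  · rw [← s.proj_res, he, A.res_res]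
  · rw [he', A.res_res]

theorem induces_of_samePairing {κ : A.InvPairing} (h : s.Induces κ) (H : SamePairing s s') :
    s'.Induces κ := by
  intro V hV a' b' b c hb hc
  refine sec_ext fun p hp => ?_
  obtain ⟨W, hW, e, e', hpW, he, he'⟩ := s.exists_lift₂ hV b.1 c.1 p hp
  refine ⟨W, hW, hpW, ?_⟩
  have hb0 : A.anchor (A.res hW b.1) = 0 := by rw [← A.res_anchor, b.2, map_zero]
  have hc0 : A.anchor (A.res hW c.1) = 0 := by rw [← A.res_anchor, c.2, map_zero]
  rw [κ.res_toFun hW b c ⟨_, hb0⟩ ⟨_, hc0⟩ rfl rfl, s'.E.res_pair,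
    h (hW.trans hV) e e' ⟨_, hb0⟩ ⟨_, hc0⟩ he.symm he'.symm]
  refine (H _ e e' _ _ ?_ ?_ ?_ ?_).symm
  · rw [← s'.proj_res, he, hb]
  · rw [← s'.proj_res, he', hc]
  · rw [← s.anchor_proj, he, hb0]
  · rw [← s.anchor_proj, he', hc0]

/-- Over 𝒯_X a section without anchor lies in Ω, and Ω is isotropic, so for exact algebroids the
condition on pairings is empty. -/
theorem samePairing_tangent {s s' : Extension (tangent O) U} (hs : s.E.IsAlg c)
    (hs' : s'.E.IsAlg d) : SamePairing s s' := by
  intro V hV a b a' b' ha hb ha0 hb0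
  rw [pair_eq_zero hs a b (proj_tangent_eq_zero ha0) hb0,
    pair_eq_zero hs' a' b' (ha.trans (proj_tangent_eq_zero ha0)) ((anchor_congr hb).trans hb0)]

end Extension

namespace BaerMap

open Extension

variable {E₁ E₃ E₃' : Extension A U} {E₂ E₂' : Extension (tangent O) U} {ε : ℤ} {c c₁ c₂ : ℂ}

/-- For a without anchor, (a, 0) lies in the fibre product and its pairings receive no contribution
from E₂. So adding or subtracting an exact algebroid does not change the pairing on 𝔤. -/
theorem samePairing (σ : BaerMap ε E₁ E₂ E₃) (h₃ : E₃.E.IsAlg c) : SamePairing E₁ E₃ := by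
  intro V hV a b a' b' ha hb ha0 hb0
  let x : fib E₁.E E₂.E hV := ⟨(a, 0), by rw [mem_fib, ha0, map_zero]⟩
  let y : fib E₁.E E₂.E hV := ⟨(b, 0), by rw [mem_fib, hb0, map_zero]⟩
  have h1 : E₃.proj hV b' = E₃.proj hV (σ.toFun hV y) := by rw [hb, σ.map_proj]
  have h2 : E₃.proj hV a' = E₃.proj hV (σ.toFun hV x) := by rw [ha, σ.map_proj]
  rw [pair_congr h₃ _ _ _ ((anchor_congr ha).trans ha0) h1, h₃.pair_symm,
    pair_congr h₃ _ _ _ (by rw [σ.anchor_toFun]; exact hb0) h2, h₃.pair_symm, σ.map_pair]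
  change _ + ε • E₂.E.pair hV 0 0 = _
  rw [map_zero, smul_zero, add_zero]

theorem toFun_eq (σ : BaerMap ε E₁ E₂ E₃) {V : Opens X} {hV : V ≤ U} {x y : fib E₁.E E₂.E hV}
    (h₁ : x.1.1 = y.1.1) (h₂ : x.1.2 = y.1.2) : σ.toFun hV x = σ.toFun hV y := by
  congr 1
  exact Subtype.ext (Prod.ext h₁ h₂)

theorem toFun_om_right (σ : BaerMap ε E₁ E₂ E₃) (h₂ : E₂.E.IsAlg c₂) {V : Opens X} {hV : V ≤ U}
    {n : ℕ} (f g : Fin n → Sec O V) (x : fib E₁.E E₂.E hV) (hx : x.1 = (0, E₂.E.om hV f g)) :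
    σ.toFun hV x = ε • E₃.E.om hV f g := by
  let d (k : Fin n) : fib E₁.E E₂.E hV :=
    ⟨(0, E₂.E.der hV (g k)), by rw [mem_fib, h₂.anchor_der, map_zero]⟩
  let y (k : Fin n) : fib E₁.E E₂.E hV := ⟨(0, E₂.E.act hV (f k) (E₂.E.der hV (g k))), by
    rw [mem_fib, h₂.anchor_act_der, map_zero]⟩
  have : x = ∑ k, y k := by
    refine Subtype.ext ?_
    rw [hx, Submodule.coe_sum]
    exact Prod.ext (by rw [Prod.fst_sum, Finset.sum_const_zero]) (by rw [Prod.snd_sum]; rfl)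
  rw [this, map_sum, AlgebroidData.om, Finset.smul_sum]
  refine Finset.sum_congr rfl fun k _ => ?_
  rw [σ.map_act hV (f k) (d k) (y k) (Prod.ext (map_zero _).symm rfl),
    σ.map_der_right hV (g k) (d k) rfl, map_zsmul]

/-- Locally, a section `u` of `E₃` with the same projection as the section `e` of `E₁` comes from
`(e, q)` for some `q`. -/
theorem exists_right (hε : ε * ε = 1) (σ : BaerMap ε E₁ E₂ E₃) (h₂ : E₂.E.IsAlg c₂)
    {V : Opens X} (hV : V ≤ U) (e : E₁.E.sec V hV) (u : E₃.E.sec V hV)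
    (hu : E₃.proj hV u = E₁.proj hV e) (p : X) (hp : p ∈ V) :
    ∃ (W : Opens X) (h : W ≤ V) (x : fib E₁.E E₂.E (h.trans hV)), p ∈ W ∧
      x.1.1 = E₁.E.res hV h e ∧ σ.toFun _ x = E₃.E.res hV h u := by
  obtain ⟨W, h, q, hpW, hq⟩ := exists_lift (tangent_isTransitive O) E₂ hV
    (E₁.E.anchor _ e) p hp
  let x : fib E₁.E E₂.E (h.trans hV) := ⟨(E₁.E.res hV h e, q), by
    rw [mem_fib, hq, E₁.E.res_anchor]⟩
  have h0 : E₃.proj _ (E₃.E.res hV h u - σ.toFun _ x) = 0 := by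
    rw [map_sub, σ.map_proj, ← E₃.proj_res, hu, E₁.proj_res, sub_self]
  obtain ⟨Z, hZ, hpZ, n, f, g, hfg⟩ := exists_om _ h0 p hpW
  let y : fib E₁.E E₂.E ((hZ.trans h).trans hV) := ⟨(0, E₂.E.om _ f g), by
    rw [mem_fib, h₂.anchor_om, map_zero]⟩
  -- A section ω of Ω in the second factor is mapped to ε ω, so the correction has to be ε ω, by ε²
  -- = 1.
  refine ⟨Z, hZ.trans h, (fibPsh E₁.E E₂.E).res _ hZ x + ε • y, hpZ, ?_, ?_⟩
  · change E₁.E.res _ _ (E₁.E.res _ _ _) + ε • 0 = _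
    rw [smul_zero, add_zero, E₁.E.res_res]
  · rw [map_add, map_zsmul, σ.toFun_om_right h₂ f g y rfl, smul_smul, hε, one_smul, ← hfg,
      ← σ.res_toFun, map_sub, E₃.E.res_res]
    abel

/-- The difference of `x` and `y` is (0, q) with q in Ω. Its image is zero, so ε ⟨q, w⟩ = 0 for all
w, and ε is invertible. -/
theorem inj_right (hε : ε * ε = 1) (htrans : A.IsTransitive) (σ : BaerMap ε E₁ E₂ E₃)
    (h₂ : E₂.E.IsAlg c₂) {V : Opens X} {hV : V ≤ U} {x y : fib E₁.E E₂.E hV}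
    (h : σ.toFun hV x = σ.toFun hV y) (hxy : x.1.1 = y.1.1) : x = y := by
  rw [← sub_eq_zero] at h ⊢
  rw [← map_sub] at h
  refine Subtype.ext (Prod.ext (sub_eq_zero.2 hxy) ?_)
  have h11 : (x - y).1.1 = 0 := sub_eq_zero.2 hxy
  change (x - y).1.2 = 0
  generalize x - y = z at h h11 ⊢
  have hz := mem_fib.1 z.2
  rw [h11, map_zero] at hz
  refine eq_zero_of_local_pair (tangent_isTransitive O) h₂ _ (proj_tangent_eq_zero hz.symm)
    fun W hW ξ p hp => ?_
  obtain ⟨Z, hZ, w, hpZ, hw⟩ := exists_fib_lift htrans E₁ E₂ (hW.trans hV) ξ p hp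
  refine ⟨Z, hZ, w.1.2, hpZ, (mem_fib.1 w.2).symm.trans hw, ?_⟩
  have h1 := σ.map_pair _ ((fibPsh E₁.E E₂.E).res hV (hZ.trans hW) z) w
  rw [← σ.res_toFun, h, map_zero, map_zero, LinearMap.zero_apply, fibPsh_res_val, h11, map_zero,
    map_zero, LinearMap.zero_apply, zero_add] at h1
  have h2 := congrArg (fun t => ε • t) h1
  dsimp only at h2
  rw [smul_smul, hε, one_smul, smul_zero] at h2
  exact h2.symm

/-- The map (e, q) ↦ (e, ψ(q)) preserves projections, pairings and brackets componentwise;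
`exists_hom` does the rest. The uniqueness makes sums and differences functorial. -/
theorem exists_map (hA : A.IsLieAlgebroid) (htrans : A.IsTransitive) (h₁ : E₁.E.IsAlg c₁)
    (h₂ : E₂.E.IsAlg c₂) (h₃ : E₃.E.IsAlg c)
    (h₃' : E₃'.E.IsAlg c) (σ : BaerMap ε E₁ E₂ E₃) (σ' : BaerMap ε E₁ E₂' E₃') (ψ : E₂ ⟶ E₂') :
    ∃! φ : E₃ ⟶ E₃', ∀ {V : Opens X} (hV : V ≤ U) (x : fib E₁.E E₂.E hV) (y : fib E₁.E E₂'.E hV),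
      y.1.1 = x.1.1 → y.1.2 = ψ.ap hV x.1.2 → φ.ap hV (σ.toFun hV x) = σ'.toFun hV y := by
  let m : ∀ {V : Opens X} (hV : V ≤ U), fib E₁.E E₂.E hV →ₗ[ℂ] fib E₁.E E₂'.E hV := fun {V} hV =>
    { toFun := fun x => ⟨(x.1.1, ψ.ap hV x.1.2), by rw [mem_fib, anchor_ap]; exact x.2⟩
      map_add' := fun x y => Subtype.ext (Prod.ext rfl (map_add (ψ.app V hV) _ _))
      map_smul' := fun k x => Subtype.ext (Prod.ext rfl (map_smul (ψ.app V hV) _ _)) }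
  have hbr : ∀ {V : Opens X} (hV : V ≤ U) (x y : fib E₁.E E₂.E hV),
      (E₁.E.br hV x.1.1 y.1.1, E₂.E.br hV x.1.2 y.1.2) ∈ fib E₁.E E₂.E hV := fun hV x y => by
    rw [mem_fib, h₁.anchor_br, h₂.anchor_br, mem_fib.1 x.2, mem_fib.1 y.2]
  obtain ⟨φ, hφ, hu⟩ := exists_hom hA htrans h₃ h₃' σ.epi (fun hV => (σ'.toFun hV).comp (m hV))
    (fun hV h x => (σ'.res_toFun hV h _).trans (σ'.toFun_eq rfl (ap_res hV ψ h _)))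
    (fun hV x => (σ'.map_proj hV _).trans (σ.map_proj hV _).symm)
    (fun hV x y => by
      refine (σ'.map_pair hV _ _).trans ((σ.map_pair hV _ _).trans ?_).symm
      change _ = _ + ε • E₂'.E.pair hV (ψ.ap hV _) (ψ.ap hV _)
      rw [pair_ap]
      rfl)
    (fun hV x y => ⟨⟨_, hbr hV x y⟩, σ.map_br hV x y _ rfl,
      σ'.map_br hV _ _ _ (Prod.ext rfl (ap_br hV ψ _ _))⟩)
  refine ⟨φ, fun hV x y hxy hxy' => (hφ hV x).trans (σ'.toFun_eq hxy.symm hxy'.symm),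
    fun φ' hφ' => hu φ' fun hV x => hφ' hV x _ rfl rfl⟩

/-- The pairs of a section of `E₁ ×_{𝒯_X} E₂` and one of `E₁ ×_{𝒯_X} E₂'` over the same section of
`E₁` whose images in `E₃'` agree. -/
def mapGraph (σ : BaerMap ε E₁ E₂ E₃) (σ' : BaerMap ε E₁ E₂' E₃') (φ : E₃ ⟶ E₃') {V : Opens X}
    (hV : V ≤ U) : Submodule ℂ (fib E₁.E E₂.E hV × fib E₁.E E₂'.E hV) where
  carrier := {z | z.1.1.1 = z.2.1.1 ∧ φ.ap hV (σ.toFun hV z.1) = σ'.toFun hV z.2}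
  add_mem' := by
    rintro x y ⟨h1, h2⟩ ⟨h1', h2'⟩
    refine ⟨congrArg₂ (· + ·) h1 h1', ?_⟩
    change φ.ap hV (σ.toFun hV (x.1 + y.1)) = σ'.toFun hV (x.2 + y.2)
    rw [map_add, map_add, ap_add, h2, h2']
  zero_mem' := ⟨rfl, by
    change φ.ap hV (σ.toFun hV 0) = σ'.toFun hV 0
    rw [map_zero, map_zero]
    exact map_zero (φ.app V hV)⟩
  smul_mem' := by
    rintro k x ⟨h1, h2⟩
    refine ⟨congrArg (k • ·) h1, ?_⟩
    change φ.ap hV (σ.toFun hV (k • x.1)) = σ'.toFun hV (k • x.2)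
    rw [map_smul, map_smul, ← h2]
    exact map_smul (φ.app V hV) _ _

theorem mapGraph_res (σ : BaerMap ε E₁ E₂ E₃) (σ' : BaerMap ε E₁ E₂' E₃') (φ : E₃ ⟶ E₃')
    {V W : Opens X} (hV : V ≤ U) (h : W ≤ V) (z : mapGraph σ σ' φ hV) :
    ((fibPsh E₁.E E₂.E).res hV h z.1.1, (fibPsh E₁.E E₂'.E).res hV h z.1.2) ∈
      mapGraph σ σ' φ (h.trans hV) := by
  refine ⟨congrArg (E₁.E.res hV h) z.2.1, ?_⟩
  dsimp only
  rw [← σ.res_toFun, ← σ'.res_toFun, ← ap_res, z.2.2]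

/-- The presheaf of sections of the graph of a map of sums. -/
abbrev mapGraphPsh (σ : BaerMap ε E₁ E₂ E₃) (σ' : BaerMap ε E₁ E₂' E₃') (φ : E₃ ⟶ E₃') :
    ModPsh U where
  sec _ hV := mapGraph σ σ' φ hV
  res {_ _} hV h :=
    { toFun := fun z => ⟨_, mapGraph_res σ σ' φ hV h z⟩
      map_add' := fun _ _ => Subtype.ext (Prod.ext (map_add _ _ _) (map_add _ _ _))
      map_smul' := fun _ _ => Subtype.ext (Prod.ext (map_smul _ _ _) (map_smul _ _ _)) }
  res_rfl _ _ := Subtype.ext (Prod.ext ((fibPsh E₁.E E₂.E).res_rfl _ _)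
    ((fibPsh E₁.E E₂'.E).res_rfl _ _))
  res_res _ _ _ _ := Subtype.ext (Prod.ext ((fibPsh E₁.E E₂.E).res_res _ _ _ _)
    ((fibPsh E₁.E E₂'.E).res_res _ _ _ _))

/-- This is full faithfulness of Q ↦ E₁ + ε Q. For q choose e over the same vector field. Then
φ(σ(e, q)) has the projection of e, so it is locally σ'(e, q') by `exists_right`, with q' unique by
`inj_right`. The triples (e, q, q') form `mapGraph`, which maps onto E₂. On it the pairings of q and
q' agree, because φ preserves pairings and the contributions of e cancel, so q ↦ q' is a morphism.
-/
theorem exists_right_map (hε : ε * ε = 1) (htrans : A.IsTransitive) (h₁ : E₁.E.IsAlg c₁)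
    (h₂ : E₂.E.IsAlg c₂) (h₂' : E₂'.E.IsAlg c₂) (σ : BaerMap ε E₁ E₂ E₃) (σ' : BaerMap ε E₁ E₂' E₃')
    (φ : E₃ ⟶ E₃') :
    ∃! ψ : E₂ ⟶ E₂', ∀ {V : Opens X} (hV : V ≤ U) (x : fib E₁.E E₂.E hV) (y : fib E₁.E E₂'.E hV),
      y.1.1 = x.1.1 → y.1.2 = ψ.ap hV x.1.2 → φ.ap hV (σ.toFun hV x) = σ'.toFun hV y := by
  have hP : ∀ {V : Opens X} (hV : V ≤ U) (x : fib E₁.E E₂.E hV) (p : X), p ∈ V →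
      ∃ (W : Opens X) (h : W ≤ V) (z : mapGraph σ σ' φ (h.trans hV)), p ∈ W ∧
        z.1.1 = (fibPsh E₁.E E₂.E).res hV h x := by
    intro V hV x p hp
    obtain ⟨W, h, y, hpW, hy, hy'⟩ := σ'.exists_right hε h₂' hV x.1.1 (φ.ap hV (σ.toFun hV x))
      (by rw [proj_ap, σ.map_proj]) p hp
    refine ⟨W, h, ⟨(_, y), hy.symm, ?_⟩, hpW, rfl⟩
    rw [hy', ← σ.res_toFun, ap_res]
  let π : ModPsh.Epi (mapGraphPsh σ σ' φ) E₂.E.psh :=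
    { app := fun {V} hV => (LinearMap.snd ℂ _ _).comp ((fib E₁.E E₂.E hV).subtype.comp
        ((LinearMap.fst ℂ _ _).comp (mapGraph σ σ' φ hV).subtype))
      app_res := fun hV h x => rfl
      surj := fun {V} hV q p hp => by
        obtain ⟨W, h, e, hpW, he⟩ := exists_lift htrans E₁ hV (E₂.E.anchor _ q) p hp
        obtain ⟨W', h', z, hpW', hz⟩ := hP (h.trans hV) ⟨(e, E₂.E.res hV h q), by
          rw [mem_fib, he, E₂.E.res_anchor]⟩ p hpW
        refine ⟨W', h'.trans h, z, hpW', ?_⟩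
        change z.1.1.1.2 = E₂.E.res _ _ _
        rw [hz, fibPsh_res_val]
        exact E₂.E.res_res _ _ _ _ }
  have hanchor : ∀ {V : Opens X} (hV : V ≤ U) (z : mapGraph σ σ' φ hV),
      E₂'.E.anchor hV z.1.2.1.2 = E₂.E.anchor hV z.1.1.1.2 := fun hV z => by
    rw [← mem_fib.1 z.1.2.2, ← mem_fib.1 z.1.1.2, z.2.1]
  have hbr : ∀ {V : Opens X} (hV : V ≤ U) (x y : fib E₁.E E₂.E hV),
      (E₁.E.br hV x.1.1 y.1.1, E₂.E.br hV x.1.2 y.1.2) ∈ fib E₁.E E₂.E hV := fun hV x y => by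
    rw [mem_fib, h₁.anchor_br, h₂.anchor_br, mem_fib.1 x.2, mem_fib.1 y.2]
  have hbr' : ∀ {V : Opens X} (hV : V ≤ U) (x y : fib E₁.E E₂'.E hV),
      (E₁.E.br hV x.1.1 y.1.1, E₂'.E.br hV x.1.2 y.1.2) ∈ fib E₁.E E₂'.E hV := fun hV x y => by
    rw [mem_fib, h₁.anchor_br, h₂'.anchor_br, mem_fib.1 x.2, mem_fib.1 y.2]
  obtain ⟨ψ, hψ, hu⟩ := exists_hom (tangent_isLieAlgebroid O) (tangent_isTransitive O) h₂ h₂' π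
    (fun {V} hV => (LinearMap.snd ℂ _ _).comp ((fib E₁.E E₂'.E hV).subtype.comp
        ((LinearMap.snd ℂ _ _).comp (mapGraph σ σ' φ hV).subtype)))
    (fun hV h x => rfl)
    (fun hV z => (proj_tangent _).trans ((hanchor hV z).trans (proj_tangent _).symm))
    (fun hV z w => by
      change E₂'.E.pair hV z.1.2.1.2 w.1.2.1.2 = E₂.E.pair hV z.1.1.1.2 w.1.1.1.2
      have h1 := σ.map_pair hV z.1.1 w.1.1
      have h2 := σ'.map_pair hV z.1.2 w.1.2
      rw [← z.2.2, ← w.2.2, pair_ap, h1, z.2.1, w.2.1] at h2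
      have h3 := congrArg (fun t => ε • t) (add_left_cancel h2)
      rw [smul_smul, smul_smul, hε, one_smul, one_smul] at h3
      exact h3.symm)
    (fun hV z w => ⟨⟨(⟨_, hbr hV z.1.1 w.1.1⟩, ⟨_, hbr' hV z.1.2 w.1.2⟩), by
        change E₁.E.br hV _ _ = E₁.E.br hV _ _
        rw [z.2.1, w.2.1], by
        dsimp only
        rw [σ.map_br hV z.1.1 w.1.1 _ rfl, σ'.map_br hV z.1.2 w.1.2 _ rfl, ap_br, z.2.2, w.2.2]⟩,
      rfl, rfl⟩)
  refine ⟨ψ, fun {V} hV x y hxy hxy' => ?_, fun ψ' hψ' => hu ψ' fun {V} hV z => ?_⟩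
  · refine E₃'.E.ext_local hV fun p hp => ?_
    obtain ⟨W, h, z, hpW, hz⟩ := hP hV x p hp
    refine ⟨W, h, hpW, ?_⟩
    rw [ap_res, σ.res_toFun, ← hz, z.2.2, σ'.res_toFun]
    refine σ'.toFun_eq ?_ ?_
    · rw [← z.2.1, hz, fibPsh_res_val, fibPsh_res_val, hxy]
    · have h1 := hψ (h.trans hV) z
      change ψ.ap _ z.1.1.1.2 = z.1.2.1.2 at h1
      rw [← h1, hz, fibPsh_res_val, fibPsh_res_val, hxy', ap_res]
  · have h1 := hψ' hV z.1.1 ⟨(z.1.1.1.1, ψ'.ap hV z.1.1.1.2), by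
      rw [mem_fib, anchor_ap]; exact z.1.1.2⟩ rfl rfl
    rw [z.2.2] at h1
    have h2 := σ'.inj_right hε htrans h₂' h1 z.2.1.symm
    exact (congrArg (fun t => t.1.2) h2).symm

end BaerMap

end

section

variable {O : TopCat.Sheaf (CommAlgCat.{u} ℂ) X} {U : Opens X} {A : LieAlgebroidData O}

/-! ### Opposites, restriction and associativity of sums -/

namespace Extension

theorem neg_neg_data (E : AlgebroidData O U) : E.neg.neg = E := by
  rcases E
  dsimp only [AlgebroidData.neg]
  congr 1
  · funext V hV
    exact LinearMap.ext fun a => LinearMap.ext fun b => neg_neg (_ : Sec O V)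
  · funext V hV
    exact LinearMap.ext fun a => neg_neg _

theorem neg_neg_eq (E : Extension A U) : E.neg.neg = E := by
  have h := neg_neg_data E.E
  rcases E
  dsimp only [neg] at h ⊢
  congr 1
  exact proof_irrel_heq _ _

end Extension

namespace BaerMap

open Extension

variable {E₁ E₃ E₃' : Extension A U} {E₂ E₂' : Extension (tangent O) U} {ε : ℤ} {c c₁ c₂ : ℂ}

/-- `E₁ + ε E₂ = E₁ - ε (-E₂)`. -/
def negRight (σ : BaerMap ε E₁ E₂ E₃) : BaerMap (-ε) E₁ E₂.neg E₃ where
  toFun := σ.toFun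
  map_res := σ.map_res
  map_act := σ.map_act
  map_br := σ.map_br
  map_pair := fun hV (x y : fib E₁.E E₂.E hV) => by
    refine (σ.map_pair hV x y).trans ?_
    change _ = _ + (-ε) • (-(E₂.E.pair hV x.1.2 y.1.2))
    rw [neg_smul_neg]
  map_proj := σ.map_proj
  map_der_left := σ.map_der_left
  map_der_right := fun {V} hV f (x : fib E₁.E E₂.E hV) hx => by
    -- The derivation of the opposite is −∂, so the hypothesis on `x` is the old hypothesis on `-x`.
    have hx' : (-x).1 = (0, E₂.E.der hV f) := by
      change -x.1 = _
      rw [hx]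
      exact Prod.ext neg_zero (neg_neg _)
    have h := σ.map_der_right hV f (-x) hx'
    rw [map_neg] at h
    rw [neg_smul, ← h, neg_neg]
    rfl
  surj := σ.surj
  ker {V} hV x := by
    refine (σ.ker hV x).trans ?_
    refine forall₂_congr fun p _ => exists₂_congr fun W h => and_congr_right fun _ =>
      exists_congr fun n => exists₂_congr fun f g => and_congr_right fun _ => ?_
    have : ∑ k, E₂.neg.E.act (h.trans hV) (f k) (E₂.neg.E.der (h.trans hV) (g k)) =
        -∑ k, E₂.E.act (h.trans hV) (f k) (E₂.E.der (h.trans hV) (g k)) := by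
      rw [← Finset.sum_neg_distrib]
      exact Finset.sum_congr rfl fun k _ => map_neg _ _
    rw [this, neg_smul_neg]

/-- `(-E₁) + ε (-E₂) = -(E₁ + ε E₂)`. -/
def negAll (σ : BaerMap ε E₁ E₂ E₃) : BaerMap ε E₁.neg E₂.neg E₃.neg where
  toFun := σ.toFun
  map_res := σ.map_res
  map_act := σ.map_act
  map_br := σ.map_br
  map_pair := fun hV (x y : fib E₁.E E₂.E hV) => by
    refine (congrArg Neg.neg (σ.map_pair hV x y)).trans ?_
    change _ = -(E₁.E.pair hV _ _) + ε • (-(E₂.E.pair hV x.1.2 y.1.2))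
    rw [smul_neg, neg_add]
  map_proj := σ.map_proj
  map_der_left := fun {V} hV f (x : fib E₁.E E₂.E hV) hx => by
    have hx' : (-x).1 = (E₁.E.der hV f, 0) := by
      change -x.1 = _
      rw [hx]
      exact Prod.ext (neg_neg _) neg_zero
    change _ = -(E₃.E.der hV f)
    have h := σ.map_der_left hV f (-x) hx'
    rw [map_neg] at h
    rw [← h, neg_neg]
    rfl
  map_der_right := fun {V} hV f (x : fib E₁.E E₂.E hV) hx => by
    have hx' : (-x).1 = (0, E₂.E.der hV f) := by
      change -x.1 = _
      rw [hx]
      exact Prod.ext neg_zero (neg_neg _)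
    change _ = ε • (-(E₃.E.der hV f))
    have h := σ.map_der_right hV f (-x) hx'
    rw [map_neg] at h
    rw [smul_neg, ← h, neg_neg]
    rfl
  surj := σ.surj
  ker {V} hV x := by
    refine (σ.ker hV x).trans ?_
    refine forall₂_congr fun p _ => exists₂_congr fun W h => and_congr_right fun _ =>
      exists_congr fun n => ?_
    constructor
    · rintro ⟨f, g, h1, h2⟩
      exact ⟨-f, g, by simpa [AlgebroidData.neg] using h1, by simpa [AlgebroidData.neg] using h2⟩
    · rintro ⟨f, g, h1, h2⟩
      exact ⟨-f, g, by simpa [AlgebroidData.neg] using h1, by simpa [AlgebroidData.neg] using h2⟩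

/-- Restriction to a smaller open set. -/
def restrict (σ : BaerMap ε E₁ E₂ E₃) {U' : Opens X} (hU : U' ≤ U) :
    BaerMap ε (E₁.restrict hU) (E₂.restrict hU) (E₃.restrict hU) where
  toFun hV := σ.toFun (hV.trans hU)
  map_res hV := σ.map_res (hV.trans hU)
  map_act hV := σ.map_act (hV.trans hU)
  map_br hV := σ.map_br (hV.trans hU)
  map_pair hV := σ.map_pair (hV.trans hU)
  map_proj hV := σ.map_proj (hV.trans hU)
  map_der_left hV := σ.map_der_left (hV.trans hU)
  map_der_right hV := σ.map_der_right (hV.trans hU)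
  surj hV := σ.surj (hV.trans hU)
  ker hV := σ.ker (hV.trans hU)

section Assoc

variable {E D D' : Extension A U} {Q₁ Q₂ Q₃ : Extension (tangent O) U} {d₁ d₂ : ℂ}

/-- The triple fibre product over `𝒯_X`. -/
abbrev fibTriple (E : Extension A U) (Q₁ Q₂ : Extension (tangent O) U) {V : Opens X} (hV : V ≤ U) :
    Submodule ℂ (fib E.E Q₁.E hV × fib Q₁.E Q₂.E hV) :=
  LinearMap.eqLocus ((LinearMap.snd ℂ _ _).comp ((fib E.E Q₁.E hV).subtype.comp
      (LinearMap.fst ℂ _ _)))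
    ((LinearMap.fst ℂ _ _).comp ((fib Q₁.E Q₂.E hV).subtype.comp (LinearMap.snd ℂ _ _)))

theorem fibTriple_res {V W : Opens X} (hV : V ≤ U) (h : W ≤ V) (z : fibTriple E Q₁ Q₂ hV) :
    ((fibPsh E.E Q₁.E).res hV h z.1.1, (fibPsh Q₁.E Q₂.E).res hV h z.1.2) ∈
      fibTriple E Q₁ Q₂ (h.trans hV) :=
  congrArg (Q₁.E.res hV h) z.2

/-- The presheaf of sections of the triple fibre product. -/
abbrev fibTriplePsh (E : Extension A U) (Q₁ Q₂ : Extension (tangent O) U) : ModPsh U where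
  sec _ hV := fibTriple E Q₁ Q₂ hV
  res {_ _} hV h :=
    { toFun := fun z => ⟨_, fibTriple_res hV h z⟩
      map_add' := fun _ _ => Subtype.ext (Prod.ext (map_add _ _ _) (map_add _ _ _))
      map_smul' := fun _ _ => Subtype.ext (Prod.ext (map_smul _ _ _) (map_smul _ _ _)) }
  res_rfl _ _ := Subtype.ext (Prod.ext ((fibPsh E.E Q₁.E).res_rfl _ _)
    ((fibPsh Q₁.E Q₂.E).res_rfl _ _))
  res_res _ _ _ _ := Subtype.ext (Prod.ext ((fibPsh E.E Q₁.E).res_res _ _ _ _)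
    ((fibPsh Q₁.E Q₂.E).res_res _ _ _ _))

theorem triple_mem (σ₁ : BaerMap 1 E Q₁ D) {V : Opens X} {hV : V ≤ U} (z : fibTriple E Q₁ Q₂ hV) :
    (σ₁.toFun hV z.1.1, z.1.2.1.2) ∈ fib D.E Q₂.E hV := by
  have h : z.1.1.1.2 = z.1.2.1.1 := z.2
  rw [mem_fib, σ₁.anchor_toFun, mem_fib.1 z.1.1.2, h, mem_fib.1 z.1.2.2]

theorem triple_mem' (σ₂ : BaerMap 1 Q₁ Q₂ Q₃) {V : Opens X} {hV : V ≤ U}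
    (z : fibTriple E Q₁ Q₂ hV) : (z.1.1.1.1, σ₂.toFun hV z.1.2) ∈ fib E.E Q₃.E hV := by
  have h : z.1.1.1.2 = z.1.2.1.1 := z.2
  rw [mem_fib, σ₂.anchor_toFun, mem_fib.1 z.1.1.2, h]

/-- The map `(e, q₁, q₂) ↦ (e, q₁ + q₂)`. -/
def tripleMap (σ₂ : BaerMap 1 Q₁ Q₂ Q₃) {V : Opens X} (hV : V ≤ U) :
    fibTriple E Q₁ Q₂ hV →ₗ[ℂ] fib E.E Q₃.E hV where
  toFun z := ⟨_, triple_mem' σ₂ z⟩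
  map_add' _ _ := Subtype.ext (Prod.ext rfl (map_add (σ₂.toFun hV) _ _))
  map_smul' _ _ := Subtype.ext (Prod.ext rfl (map_smul (σ₂.toFun hV) _ _))

/-- The projection `(e, q₁, q₂) ↦ (e + q₁, q₂)`. -/
def tripleEpi (σ₁ : BaerMap 1 E Q₁ D) (Q₂ : Extension (tangent O) U) :
    ModPsh.Epi (fibTriplePsh E Q₁ Q₂) (fibPsh D.E Q₂.E) where
  app {V} hV :=
    { toFun := fun z => ⟨_, triple_mem σ₁ z⟩
      map_add' := fun x y => Subtype.ext (Prod.ext (map_add (σ₁.toFun hV) _ _) rfl)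
      map_smul' := fun k x => Subtype.ext (Prod.ext (map_smul (σ₁.toFun hV) _ _) rfl) }
  app_res hV h z := Subtype.ext (Prod.ext (σ₁.res_toFun hV h _) rfl)
  surj {V} hV q p hp := by
    obtain ⟨W, h, x, hpW, hx⟩ := σ₁.surj hV q.1.1 p hp
    have hq : x.1.2 ∈ (⊤ : Submodule ℂ (Q₁.E.sec W (h.trans hV))) := trivial
    have hy : (x.1.2, Q₂.E.res hV h q.1.2) ∈ fib Q₁.E Q₂.E (h.trans hV) := by
      rw [mem_fib, ← mem_fib.1 x.2, ← Q₂.E.res_anchor, ← mem_fib.1 q.2, D.E.res_anchor, ← hx,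
        σ₁.anchor_toFun]
    exact ⟨W, h, ⟨(x, ⟨_, hy⟩), rfl⟩, hpW, Subtype.ext (Prod.ext hx rfl)⟩

/-- On triples (e, q₁, q₂) over one vector field the formula (e + q₁) + q₂ ↦ e + (q₁ + q₂) makes
sense, and such triples map locally onto D ×_𝒯 Q₂. Pairings agree since both are the sum of the
three pairings. -/
theorem exists_assoc (hA : A.IsLieAlgebroid) (htrans : A.IsTransitive) (hE : E.E.IsAlg c)
    (h₁ : Q₁.E.IsAlg d₁) (h₂ : Q₂.E.IsAlg d₂) (hD : D.E.IsAlg (c + d₁))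
    (hD' : D'.E.IsAlg (c + d₁ + d₂)) (σ₁ : BaerMap 1 E Q₁ D) (σ₂ : BaerMap 1 Q₁ Q₂ Q₃)
    (σ₃ : BaerMap 1 E Q₃ D') :
    ∃! σ : BaerMap 1 D Q₂ D', ∀ {V : Opens X} (hV : V ≤ U) (x : fib E.E Q₁.E hV)
      (y : fib Q₁.E Q₂.E hV) (z : fib D.E Q₂.E hV) (w : fib E.E Q₃.E hV),
      y.1.1 = x.1.2 → z.1 = (σ₁.toFun hV x, y.1.2) → w.1 = (x.1.1, σ₂.toFun hV y) →
      σ.toFun hV z = σ₃.toFun hV w := by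
  have hbr : ∀ {V : Opens X} (hV : V ≤ U) (x y : fib E.E Q₁.E hV),
      (E.E.br hV x.1.1 y.1.1, Q₁.E.br hV x.1.2 y.1.2) ∈ fib E.E Q₁.E hV := fun hV x y => by
    rw [mem_fib, hE.anchor_br, h₁.anchor_br, mem_fib.1 x.2, mem_fib.1 y.2]
  have hbr' : ∀ {V : Opens X} (hV : V ≤ U) (x y : fib Q₁.E Q₂.E hV),
      (Q₁.E.br hV x.1.1 y.1.1, Q₂.E.br hV x.1.2 y.1.2) ∈ fib Q₁.E Q₂.E hV := fun hV x y => by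
    rw [mem_fib, h₁.anchor_br, h₂.anchor_br, mem_fib.1 x.2, mem_fib.1 y.2]
  obtain ⟨σ, hσ⟩ := exists_of_epi hA htrans hD h₂ hD' (tripleEpi σ₁ Q₂)
    (fun {V} hV => (σ₃.toFun hV).comp (tripleMap σ₂ hV))
    (fun hV h z => (σ₃.res_toFun hV h _).trans (σ₃.toFun_eq rfl (σ₂.res_toFun hV h _)))
    (fun hV z => (σ₃.map_proj hV _).trans (σ₁.map_proj hV _).symm)
    (fun hV z w => by
      refine (σ₃.map_pair hV _ _).trans ?_
      change _ + (1 : ℤ) • Q₃.E.pair hV (σ₂.toFun hV _) (σ₂.toFun hV _) =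
        D.E.pair hV (σ₁.toFun hV _) (σ₁.toFun hV _) + _
      have hz : z.1.1.1.2 = z.1.2.1.1 := z.2
      have hw : w.1.1.1.2 = w.1.2.1.1 := w.2
      rw [σ₁.map_pair, σ₂.map_pair, hz, hw, one_smul, one_smul, one_smul, add_assoc]
      rfl)
    (fun hV z w => by
      refine ⟨⟨(⟨_, hbr hV z.1.1 w.1.1⟩, ⟨_, hbr' hV z.1.2 w.1.2⟩), ?_⟩,
        Prod.ext (σ₁.map_br hV _ _ _ rfl) rfl,
        σ₃.map_br hV _ _ _ (Prod.ext rfl (σ₂.map_br hV _ _ _ rfl))⟩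
      have hz : z.1.1.1.2 = z.1.2.1.1 := z.2
      have hw : w.1.1.1.2 = w.1.2.1.1 := w.2
      exact congrArg₂ (fun a b => Q₁.E.br hV a b) hz hw)
  refine ⟨σ, fun hV x y z w hxy hz hw => ?_, fun σ' hσ' => ext_of_epi (tripleEpi σ₁ Q₂)
    fun hV t => (hσ' hV t.1.1 t.1.2 _ ⟨_, triple_mem' σ₂ t⟩ (Eq.symm t.2) rfl rfl).trans
      (hσ hV t).symm⟩
  refine Eq.trans ?_ ((hσ hV ⟨(x, y), hxy.symm⟩).trans ?_)
  · exact σ.toFun_eq (congrArg Prod.fst hz) (congrArg Prod.snd hz)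
  · exact σ₃.toFun_eq (congrArg Prod.fst hw).symm (congrArg Prod.snd hw).symm

end Assoc

end BaerMap

end

section

variable {O : TopCat.Sheaf (CommAlgCat.{u} ℂ) X} {U : Opens X} {A : LieAlgebroidData O}

open AlgebroidData Extension

/-! ### The induced pairing -/

section InducedPairing

/-- The kernel of the anchor of `A`. -/
abbrev kerPsh (A : LieAlgebroidData O) : ModPsh (⊤ : Opens X) where
  sec V _ := LinearMap.ker (A.anchor (V := V))
  res {V W} _ h := (A.res h).restrict fun a ha => by
    rw [LinearMap.mem_ker] at ha ⊢
    rw [← A.res_anchor, ha, map_zero]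
  res_rfl _ a := Subtype.ext (A.res_rfl _)
  res_res _ _ _ a := Subtype.ext (A.res_res _ _ _)

/-- The kernel of the anchor of an extension. -/
abbrev kerAnchorPsh (E : AlgebroidData O U) : ModPsh U where
  sec V hV := LinearMap.ker (E.anchor hV)
  res {V W} hV h := (E.res hV h).restrict fun a ha => by
    rw [LinearMap.mem_ker] at ha ⊢
    rw [← E.res_anchor, ha, map_zero]
  res_rfl _ a := Subtype.ext (E.res_rfl _ _)
  res_res _ _ _ a := Subtype.ext (E.res_res _ _ _ _)

/-- The projection from the kernel of the anchor of `E` to the kernel of the anchor of `A`. -/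
def kerEpi (E : Extension A ⊤) : ModPsh.Epi (kerAnchorPsh E.E) (kerPsh A) where
  app {V} hV := (E.proj hV).restrict fun a ha => by
    rw [LinearMap.mem_ker] at ha ⊢
    rw [E.anchor_proj, ha]
  app_res hV h x := Subtype.ext (E.proj_res _ _ _)
  surj {V} hV q p hp := by
    obtain ⟨W, h, e, hpW, he⟩ := E.surj hV q.1 p hp
    refine ⟨W, h, ⟨e, ?_⟩, hpW, Subtype.ext he⟩
    rw [LinearMap.mem_ker, ← E.anchor_proj, he, ← A.res_anchor, q.2, map_zero]

theorem InvPairing.ext' {κ κ' : A.InvPairing} (h : ∀ {V : Opens X}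
    (b c : LinearMap.ker (A.anchor (V := V))), κ.toFun b c = κ'.toFun b c) : κ = κ' := by
  have : @κ.toFun = @κ'.toFun := by
    funext V
    exact LinearMap.ext fun b => LinearMap.ext fun c => h b c
  cases κ
  cases κ'
  cases this
  rfl

/-- On the kernel of the anchor, Ω is in the radical, so the pairing descends to 𝔤(A). It becomes
𝒪-bilinear because the anomaly contains anchors. Uniqueness holds since sections of 𝔤(A) lift
locally. -/
theorem existsUnique_induces {k : ℂ} (E : Extension A ⊤)
    (h : E.E.IsAlg k) : ∃! κ : A.InvPairing, E.Induces κ := by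
  obtain ⟨L, L_res, hL⟩ := (secPsh_isSheaf O ⊤).exists_desc₂ (kerEpi E) (kerEpi E)
    (fun {V} hV => (E.E.pair hV).domRestrict₁₂ (LinearMap.ker (E.E.anchor hV))
      (LinearMap.ker (E.E.anchor hV)))
    (fun hV h x y => E.E.res_pair hV h x.1 y.1)
    (fun {V} hV x y hx => pair_eq_zero h _ _ (congrArg Subtype.val hx) y.2)
    (fun {V} hV x y hy => (h.pair_symm _ _ _).trans
      (pair_eq_zero h _ _ (congrArg Subtype.val hy) x.2))
  let κ : ∀ {V : Opens X}, LinearMap.ker (A.anchor (V := V)) →ₗ[ℂ]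
    LinearMap.ker (A.anchor (V := V)) →ₗ[ℂ] Sec O V := L le_top
  have κ_res : ∀ {V W : Opens X} (h : W ≤ V) (b c : LinearMap.ker (A.anchor (V := V))),
      rs O h (κ b c) = κ ((kerPsh A).res le_top h b) ((kerPsh A).res le_top h c) :=
    fun h b c => L_res le_top h b c
  have hκ : ∀ {V : Opens X} (x y : LinearMap.ker (E.E.anchor (le_top : V ≤ ⊤))),
      κ ((kerEpi E).app le_top x) ((kerEpi E).app le_top y) = E.E.pair _ x.1 y.1 :=
    fun x y => hL le_top x y
  let K : A.InvPairing :=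
    { toFun := κ
      res_toFun := fun {V W} h b c b' c' hb hc => by
        rw [κ_res]
        congr 1
        · congr 1
          exact Subtype.ext hb.symm
        · exact Subtype.ext hc.symm
      symm := fun {V} b c => by
        refine sec_ext fun p hp => ?_
        obtain ⟨W, hW, x, y, hpW, hx, hy⟩ := (kerEpi E).surj₂ le_top b c p hp
        refine ⟨W, hW, hpW, ?_⟩
        rw [κ_res, κ_res, hx, hy, hκ, hκ, h.pair_symm]
      act_left := fun {V} f b b' c hb => by
        refine sec_ext fun p hp => ?_
        obtain ⟨W, hW, x, y, hpW, hx, hy⟩ := (kerEpi E).surj₂ le_top b c p hp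
        refine ⟨W, hW, hpW, ?_⟩
        let x' : LinearMap.ker (E.E.anchor (le_top : W ≤ ⊤)) := ⟨E.E.act _ (rs O hW f) x.1, by
          rw [LinearMap.mem_ker, h.anchor_act, x.2, smul_zero]⟩
        have hx' : (kerPsh A).res le_top hW b' = (kerEpi E).app le_top x' := by
          refine Subtype.ext ?_
          change A.res hW b'.1 = E.proj _ (E.E.act _ _ _)
          rw [hb, A.res_act, E.proj_act]
          exact congrArg _ (congrArg Subtype.val hx)
        rw [κ_res, map_mul, κ_res, hx, hy, hx', hκ, hκ, h.pair_act, x.2]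
        change _ - k • (0 : VF O W).app _ = _
        simp [VF.app]
      invariant := fun {V} a b c b' c' hb hc => by
        refine sec_ext fun p hp => ?_
        obtain ⟨W', hW', x, y, hpW', hx, hy⟩ := (kerEpi E).surj₂ le_top b c p hp
        -- With `e` a lift of `a`, the bracket [e, ·] preserves the kernel of the anchor and covers
        -- [a, ·]. So invariance on A is invariance on E.
        obtain ⟨W, hW, e, hpW, he⟩ := E.surj le_top (A.res hW' a) p hpW'
        refine ⟨W, hW.trans hW', hpW, ?_⟩
        have hx := congrArg ((kerPsh A).res le_top hW) hx
        have hy := congrArg ((kerPsh A).res le_top hW) hy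
        rw [(kerPsh A).res_res, (kerEpi E).app_res] at hx hy
        generalize (kerAnchorPsh E.E).res _ hW x = x at hx
        generalize (kerAnchorPsh E.E).res _ hW y = y at hy
        rw [A.res_res] at he
        let m (z : LinearMap.ker (E.E.anchor (le_top : W ≤ ⊤))) :
            LinearMap.ker (E.E.anchor (le_top : W ≤ ⊤)) := ⟨E.E.br _ e z.1, by
          rw [LinearMap.mem_ker, h.anchor_br, z.2]
          ext
          simp⟩
        have hm : ∀ (d d' : LinearMap.ker (A.anchor (V := V))) (z), d'.1 = A.br a d.1 →
            (kerPsh A).res le_top (hW.trans hW') d = (kerEpi E).app le_top z →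
            (kerPsh A).res le_top (hW.trans hW') d' = (kerEpi E).app le_top (m z) := by
          intro d d' z hd hz
          refine Subtype.ext ?_
          change A.res _ d'.1 = E.proj _ (E.E.br _ _ _)
          rw [hd, A.res_br, E.proj_br, he]
          exact congrArg _ (congrArg Subtype.val hz)
        rw [VF.rs_app, map_add, κ_res, κ_res, κ_res, hx, hy, hm b b' x hb hx, hm c c' y hc hy,
          hκ, hκ, hκ, A.res_anchor, ← he, E.anchor_proj, h.pair_inv] }
  refine ⟨K, fun {V} hV e e' b b' hb hb' => ?_, fun κ' hκ' => InvPairing.ext' fun {V} b b' => ?_⟩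
  · have he : e ∈ LinearMap.ker (E.E.anchor hV) := by
      rw [LinearMap.mem_ker, ← E.anchor_proj, ← hb, b.2]
    have he' : e' ∈ LinearMap.ker (E.E.anchor hV) := by
      rw [LinearMap.mem_ker, ← E.anchor_proj, ← hb', b'.2]
    have := hκ ⟨e, he⟩ ⟨e', he'⟩
    rw [← this]
    congr 1
    · congr 1
      exact Subtype.ext hb
    · exact Subtype.ext hb'
  · refine sec_ext fun p hp => ?_
    obtain ⟨W, hW, x, y, hpW, hx, hy⟩ := (kerEpi E).surj₂ le_top b b' p hp
    refine ⟨W, hW, hpW, ?_⟩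
    rw [κ'.res_toFun hW b b' ((kerPsh A).res le_top hW b) ((kerPsh A).res le_top hW b') rfl rfl,
      hκ' le_top x.1 y.1 _ _ (congrArg Subtype.val hx) (congrArg Subtype.val hy)]
    change _ = rs O hW (κ b b')
    rw [κ_res, hx, hy, hκ]

end InducedPairing

/-! ### Torsors -/

theorem isAlg_of_isEVA {s : Extension (tangent O) U} (h : isEVA O U s) : s.E.IsAlg 1 :=
  isAlg_one_iff.2 h

theorem isAlg_of_isECA {s : Extension (tangent O) U} (h : isECA O U s) : s.E.IsAlg 0 :=
  isAlg_zero_iff.2 h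

/-- Covers both stacks: all that matters is that the objects have a fixed level, induce a common
pairing on 𝔤, and are characterized by these two properties. Since Courant algebroids have level 0,
neither sums nor differences leave the stack. -/
theorem isTorsor_of {c : ℂ} (hX : HasLocalCoordinates O) (hA : A.IsLieAlgebroid)
    (htrans : A.IsTransitive) (S : ∀ U, ObjectProperty (Extension A U))
    (hS : ∀ {U s}, S U s → s.E.IsAlg c)
    (hS' : ∀ {U} {s s' : Extension A U}, S U s → S U s' → SamePairing s s')
    (hS'' : ∀ {U} {s s' : Extension A U}, S U s → s'.E.IsAlg c → SamePairing s s' → S U s')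
    (hloc : ∀ x : X, ∃ (U : Opens X) (s : Extension A U), x ∈ U ∧ S U s) : IsTorsor S where
  locally_nonempty := hloc
  groupoid U s s' hs hs' φ := isIso hA htrans (hS hs) (hS hs') φ
  action U s Q hs hQ := by
    obtain ⟨s', h, ⟨σ⟩⟩ := exists_sum hX hA htrans s Q (hS hs) (isAlg_of_isECA hQ)
    rw [add_zero] at h
    exact ⟨s', hS'' hs h (σ.samePairing h), ⟨σ⟩⟩
  essSurj U s s' hs hs' := by
    obtain ⟨Q, hQ, h⟩ := exists_difference hX hA htrans s s' (hS hs) (hS hs') (hS' hs hs')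
    rw [sub_self] at hQ
    exact ⟨Q, isAlg_zero_iff.1 hQ, h⟩
  fullyFaithful U s s' s'' Q Q' hs hs' hs'' hQ hQ' σ σ' φ :=
    σ.exists_right_map (by norm_num) htrans (hS hs) (isAlg_of_isECA hQ) (isAlg_of_isECA hQ') σ' φ

end

section

variable {O : TopCat.Sheaf (CommAlgCat.{u} ℂ) X} {U : Opens X} {A : LieAlgebroidData O}

open AlgebroidData Extension

/-! ### The difference functor -/

/-- The difference is s + (−V), of level 1 + (−1) = 0; as a push-out it is rewritten as s − (−(−V))
= s − V. -/
theorem exists_baer_neg (hX : HasLocalCoordinates O) (hA : A.IsLieAlgebroid)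
    (htrans : A.IsTransitive) {s : Extension A U} (hs : s.E.IsAlg 1) {κ : A.InvPairing}
    (hκ : s.Induces κ) {V : Extension (tangent O) U} (hV : isEVA O U V) :
    ∃ D : Extension A U, isCEXT A κ U D ∧ Nonempty (BaerMap (-1) s V D) := by
  obtain ⟨D, hD, ⟨σ⟩⟩ := exists_sum hX hA htrans s V.neg hs (isAlg_of_isEVA hV).neg
  rw [add_neg_cancel] at hD
  have σ' := σ.negRight
  rw [neg_neg_eq] at σ'
  exact ⟨D, ⟨isAlg_zero_iff.1 hD, induces_of_samePairing hκ (σ.samePairing hD)⟩, ⟨σ'⟩⟩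

variable {Ahat : Extension A ⊤} {κ : A.InvPairing}

theorem Extension.Induces.restrict {s : Extension A U} (h : s.Induces κ) {U' : Opens X}
    (hU : U' ≤ U) : (s.restrict hU).Induces κ :=
  fun hV => h (hV.trans hU)

theorem isAlg_of_cext (C : CEXT A κ U) : C.obj.E.IsAlg 0 := isAlg_zero_iff.2 C.property.1

theorem isAlg_of_eva (V : EVA O U) : V.obj.E.IsAlg 1 := isAlg_one_iff.2 V.property

/-- Differences are chosen object by object; morphisms, identities and composites are then provided
by the existence and uniqueness in `exists_map`. -/
theorem exists_differenceFunctor (hX : HasLocalCoordinates O) (hA : A.IsLieAlgebroid)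
    (htrans : A.IsTransitive) (hAhat : Ahat.E.IsAlg 1) (hκ : Ahat.Induces κ) :
    Nonempty (DifferenceFunctor Ahat κ) := by
  have hex : ∀ (U : Opens X) (V : EVA O U), ∃ D : CEXT A κ U,
      Nonempty (BaerMap (-1) (Ahat.restrict (le_top : U ≤ ⊤)) V.obj D.obj) := fun U V => by
    obtain ⟨D, hD, h⟩ := exists_baer_neg hX hA htrans (hAhat.restrict (le_top : U ≤ ⊤))
      (hκ.restrict _) V.property
    exact ⟨⟨D, hD⟩, h⟩
  choose D hD using hex
  let δ : ∀ (U : Opens X) (V : EVA O U),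
      BaerMap (-1) (Ahat.restrict (le_top : U ≤ ⊤)) V.obj (D U V).obj :=
    fun U V => (hD U V).some
  have hmap : ∀ (U : Opens X) (V V' : EVA O U) (ψ : V ⟶ V'), _ := fun U V V' ψ =>
    BaerMap.exists_map hA htrans (hAhat.restrict (le_top : U ≤ ⊤)) (isAlg_of_eva V)
      (isAlg_of_cext (D U V)) (isAlg_of_cext (D U V')) (δ U V) (δ U V') ψ.hom
  choose m hm hu using hmap
  refine ⟨⟨fun U => ⟨D U, fun {V V'} ψ => ObjectProperty.homMk (m U V V' ψ), fun V => ?_,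
    fun {V V' V''} ψ ψ' => ?_⟩, fun V => δ _ V, fun {U V V'} φ {W} hW x y hxy hxy' =>
      hm U V V' φ hW x y hxy hxy'⟩⟩
  · refine ObjectProperty.hom_ext _ (hu U V V (𝟙 V) _ fun hW x y hxy hxy' => ?_).symm
    exact (δ U V).toFun_eq hxy.symm hxy'.symm
  · refine ObjectProperty.hom_ext _ (hu U V V'' (ψ ≫ ψ') _ fun {W} hW x y hxy hxy' => ?_).symm
    let z : fib (Ahat.restrict (le_top : U ≤ ⊤)).E V'.obj.E hW :=
      ⟨(x.1.1, Hom.ap ψ.hom hW x.1.2), by rw [mem_fib, anchor_ap]; exact x.2⟩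
    refine (congrArg (Hom.ap (m U V' V'' ψ') hW) (hm U V V' ψ hW x z rfl rfl)).trans ?_
    exact hm U V' V'' ψ' hW z y hxy hxy'

namespace DifferenceFunctor

variable (D : DifferenceFunctor Ahat κ)

/-- Full faithfulness is `exists_right_map` for ε = −1. Essential surjectivity comes from
subtracting `Ahat` from a given Courant extension, which is possible because the induced pairings
coincide. -/
theorem isEquivalence (hX : HasLocalCoordinates O) (hA : A.IsLieAlgebroid)
    (htrans : A.IsTransitive) (hAhat : Ahat.E.IsAlg 1) (hκ : Ahat.Induces κ) (U : Opens X) :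
    (D.F U).IsEquivalence := by
  have hU := hAhat.restrict (le_top : U ≤ ⊤)
  have hmap (V V' : EVA O U) (φ : ((D.F U).obj V).obj ⟶ ((D.F U).obj V').obj) :=
    (D.δ V).exists_right_map (by norm_num) htrans hU (isAlg_of_eva V) (isAlg_of_eva V') (D.δ V') φ
  refine { faithful := ⟨fun {V V'} φ φ' h => ?_⟩, full := ⟨fun {V V'} χ => ?_⟩,
           essSurj := ⟨fun C => ?_⟩ }
  · refine ObjectProperty.hom_ext _ ((hmap V V' ((D.F U).map φ).hom).unique
      (fun hW x y hxy hxy' => D.natural φ hW x y hxy hxy') (fun hW x y hxy hxy' => ?_))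
    rw [h]
    exact D.natural φ' hW x y hxy hxy'
  · obtain ⟨ψ, hψ, -⟩ := hmap V V' χ.hom
    refine ⟨ObjectProperty.homMk ψ, ObjectProperty.hom_ext _ ?_⟩
    exact (BaerMap.exists_map hA htrans hU (isAlg_of_eva V) (isAlg_of_cext _) (isAlg_of_cext _)
      (D.δ V) (D.δ V') ψ).unique
      (fun hW x y hxy hxy' => D.natural (ObjectProperty.homMk ψ) hW x y hxy hxy') hψ
  -- Here C = Â + Q with Q of level 0 − 1 = −1. Hence −Q has level 1, is an exact vertex algebroid,
  -- and C = Â − (−Q).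
  · obtain ⟨Q, hQ, ⟨σ⟩⟩ := exists_difference hX hA htrans _ C.obj hU (isAlg_of_cext C)
      (samePairing_of_induces (hκ.restrict _) C.property.2)
    have hQ' := hQ.neg
    rw [zero_sub, neg_neg] at hQ'
    let V : EVA O U := ⟨Q.neg, isAlg_one_iff.1 hQ'⟩
    obtain ⟨φ, -⟩ := BaerMap.exists_map hA htrans hU (isAlg_of_eva V) (isAlg_of_cext _)
      (isAlg_of_cext C) (D.δ V) σ.negRight (𝟙 _)
    have := isIso hA htrans (isAlg_of_cext _) (isAlg_of_cext C) φ
    exact ⟨V, ⟨ObjectProperty.isoMk _ (asIso φ)⟩⟩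

/-- Restricting the difference over U, or forming it over U', gives two push-outs of the same fibre
product; `exists_map` for the identity compares them. Naturality and uniqueness hold because a
morphism out of a push-out is determined on pairs. -/
theorem commutesWithRestriction (hA : A.IsLieAlgebroid) (htrans : A.IsTransitive)
    (hAhat : Ahat.E.IsAlg 1) : D.CommutesWithRestriction := by
  intro U U' hU
  have hmap (V : EVA O U) := BaerMap.exists_map hA htrans
    (hAhat.restrict (le_top : U' ≤ ⊤)) ((isAlg_of_eva V).restrict hU)
    (isAlg_of_cext ((D.F U').obj ((EVA.res O hU).obj V)))
    ((isAlg_of_cext ((D.F U).obj V)).restrict hU) (D.δ ((EVA.res O hU).obj V))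
    ((D.δ V).restrict hU) (𝟙 _)
  choose m hm hu using hmap
  have hiso (V : EVA O U) : IsIso (m V) := isIso hA htrans
    (isAlg_of_cext ((D.F U').obj ((EVA.res O hU).obj V)))
    ((isAlg_of_cext ((D.F U).obj V)).restrict hU) _
  let e : EVA.res O hU ⋙ D.F U' ≅ D.F U ⋙ CEXT.res A κ hU :=
    NatIso.ofComponents (fun V => ObjectProperty.isoMk _ (@asIso _ _ _ _ (m V) (hiso V))) (by
      intro V V' ψ
      refine ObjectProperty.hom_ext _ ?_
      refine (BaerMap.exists_map hA htrans (hAhat.restrict (le_top : U' ≤ ⊤))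
        ((isAlg_of_eva V).restrict hU) (isAlg_of_cext ((D.F U').obj ((EVA.res O hU).obj V)))
        ((isAlg_of_cext ((D.F U).obj V')).restrict hU) (D.δ ((EVA.res O hU).obj V))
        ((D.δ V').restrict hU) ((EVA.res O hU).map ψ).hom).unique
        (fun {W} hW x y hxy hxy' => ?_) (fun {W} hW x y hxy hxy' => ?_)
      · have h1 := D.natural ((EVA.res O hU).map ψ) hW x y hxy hxy'
        refine (congrArg (Hom.ap (m V') hW) h1).trans ?_
        exact hm V' hW y y rfl rfl
      · have h1 := hm V hW x x rfl rfl
        refine (congrArg (Hom.ap ((CEXT.res A κ hU).map ((D.F U).map ψ)).hom hW) h1).trans ?_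
        exact D.natural ψ (hW.trans hU) x y hxy hxy')
  refine ⟨e, fun V {W} hW x y hxy => ?_, fun e' he' => ?_⟩
  · exact hm V hW x y (congrArg Prod.fst hxy) (congrArg Prod.snd hxy)
  · ext V : 3
    refine ObjectProperty.hom_ext _ (hu V _ fun {W} hW x y hxy hxy' => ?_)
    exact he' V hW x y (Prod.ext hxy hxy')

/-- This is associativity for Â, −V and −Q: the sum (Â + (−V)) + (−Q) is Â + ((−V) + (−Q)), where
(−V) + (−Q) = −(V + Q) by `negAll`. -/
theorem antiCommutes (hA : A.IsLieAlgebroid) (htrans : A.IsTransitive)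
    (hAhat : Ahat.E.IsAlg 1) : D.AntiCommutes := by
  intro U V V' Q hQ σ
  have h1 : ((D.F U).obj V).obj.E.IsAlg (1 + -1) := by
    rw [add_neg_cancel]
    exact isAlg_of_cext _
  have h2 : ((D.F U).obj V').obj.E.IsAlg (1 + -1 + -0) := by
    rw [add_neg_cancel, neg_zero, add_zero]
    exact isAlg_of_cext _
  exact BaerMap.exists_assoc hA htrans (hAhat.restrict (le_top : U ≤ ⊤)) (isAlg_of_eva V).neg
    (isAlg_of_isECA hQ).neg h1 h2 (D.δ V).negRight σ.negAll (D.δ V').negRight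

end DifferenceFunctor

end

section

variable {O : TopCat.Sheaf (CommAlgCat.{u} ℂ) X} {U : Opens X}

open AlgebroidData

/-! ### The vertex algebroid of a coordinate system -/

namespace IsChart

variable {V : Opens X} {n : ℕ} {t : Fin n → Sec O V} {D : Fin n → VF O V}

theorem app_eq (h : IsChart t D) (ξ : VF O V) (f : Sec O V) : ξ.app f = ∑ i, ξ.app (t i) * (D i).app f := by
  conv_lhs => rw [h.2 V le_rfl ξ]
  simp

theorem app_const (h : IsChart t D) (ξ : VF O V) (i j : Fin n) : ξ.app ((D i).app (t j)) = 0 := by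
  rw [h.1]
  split_ifs <;> simp

theorem ext_app (h : IsChart t D) {ξ η : VF O V} (H : ∀ i, ξ.app (t i) = η.app (t i)) : ξ = η := by
  rw [h.2 V le_rfl ξ, h.2 V le_rfl η]
  simp [H]

theorem comm (h : IsChart t D) (i j : Fin n) : ⁅D i, D j⁆ = 0 :=
  h.ext_app fun k => by simp [h.app_const]

theorem comm_app (h : IsChart t D) (i j : Fin n) (f : Sec O V) : (D i).app ((D j).app f) = (D j).app ((D i).app f) := by
  have := congrArg (fun ξ : VF O V => ξ.app f) (h.comm i j)
  simpa [sub_eq_zero] using this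

end IsChart

namespace Chart

variable {V : Opens X} {n : ℕ} (t : Fin n → Sec O V) (D : Fin n → VF O V)

/-- The value of the 1-form with components `w` on a vector field. -/
def ev (w : Fin n → Sec O V) (ξ : VF O V) : Sec O V := ∑ k, w k * ξ.app (t k)

/-- The contraction of the Jacobian matrices of two vector fields. -/
def tr (ξ η : VF O V) : Sec O V := ∑ i, ∑ j, (D j).app (ξ.app (t i)) * (D i).app (η.app (t j))

/-- The components of the 1-form in the bracket. -/
def brForm (a b : VF O V × (Fin n → Sec O V)) (j : Fin n) : Sec O V :=
  -- For a = (ξ, α) and b = (η, β), all terms but the last are the value at Dⱼ of L_ξ β − ι_η dα, as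
  -- in the standard Courant algebroid. The last is the vertex correction, minus the trace of
  -- Dⱼ(J_ξ) J_η with J the Jacobian matrix.
  a.1.app (b.2 j) + ev t b.2 ⁅D j, a.1⁆ - b.1.app (a.2 j) + (D j).app (ev t a.2 b.1) -
    ev t a.2 ⁅D j, b.1⁆ - ∑ k, ⁅D j, ⁅D k, a.1⁆⁆.app (b.1.app (t k))

variable {t D}

theorem ev_add (w w' : Fin n → Sec O V) (ξ : VF O V) :
    ev t (w + w') ξ = ev t w ξ + ev t w' ξ := by
  simp [ev, add_mul, Finset.sum_add_distrib]

theorem ev_smul (c : ℂ) (w : Fin n → Sec O V) (ξ : VF O V) : ev t (c • w) ξ = c • ev t w ξ := by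
  simp [ev, Finset.smul_sum]

theorem ev_mul (f : Sec O V) (w : Fin n → Sec O V) (ξ : VF O V) :
    ev t (fun j => f * w j) ξ = f * ev t w ξ := by
  simp [ev, Finset.mul_sum, mul_assoc]

theorem ev_sub (w w' : Fin n → Sec O V) (ξ : VF O V) :
    ev t (fun j => w j - w' j) ξ = ev t w ξ - ev t w' ξ := by
  simp [ev, sub_mul, Finset.sum_sub_distrib]

theorem ev_zero (ξ : VF O V) : ev t (0 : Fin n → Sec O V) ξ = 0 := by simp [ev]

theorem ev_add_right (w : Fin n → Sec O V) (ξ η : VF O V) :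
    ev t w (ξ + η) = ev t w ξ + ev t w η := by
  simp [ev, mul_add, Finset.sum_add_distrib]

theorem ev_smulC_right (w : Fin n → Sec O V) (c : ℂ) (ξ : VF O V) :
    ev t w (c • ξ) = c • ev t w ξ := by
  simp [ev, Finset.smul_sum]

theorem ev_smul_right (w : Fin n → Sec O V) (f : Sec O V) (ξ : VF O V) :
    ev t w (f • ξ) = f * ev t w ξ := by
  simp [ev, Finset.mul_sum, mul_left_comm]

theorem ev_zero_right (w : Fin n → Sec O V) : ev t w (0 : VF O V) = 0 := by simp [ev]

theorem ev_der (h : IsChart t D) (f : Sec O V) (ξ : VF O V) :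
    ev t (fun j => (D j).app f) ξ = ξ.app f := by
  rw [h.app_eq ξ f, ev]
  exact Finset.sum_congr rfl fun _ _ => mul_comm _ _

theorem ev_basis (h : IsChart t D) (w : Fin n → Sec O V) (j : Fin n) : ev t w (D j) = w j := by
  simp [ev, h.1]

theorem tr_comm (ξ η : VF O V) : tr t D ξ η = tr t D η ξ := by
  rw [tr, tr, Finset.sum_comm]
  exact Finset.sum_congr rfl fun i _ => Finset.sum_congr rfl fun j _ => mul_comm _ _

theorem tr_add (ξ ξ' η : VF O V) : tr t D (ξ + ξ') η = tr t D ξ η + tr t D ξ' η := by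
  simp [tr, add_mul, Finset.sum_add_distrib]

theorem tr_smulC (c : ℂ) (ξ η : VF O V) : tr t D (c • ξ) η = c • tr t D ξ η := by
  simp [tr, Finset.smul_sum]

theorem tr_zero (η : VF O V) : tr t D 0 η = 0 := by simp [tr]

theorem tr_basis (h : IsChart t D) (i : Fin n) (η : VF O V) : tr t D (D i) η = 0 := by
  simp [tr, h.app_const]

theorem tr_eq (h : IsChart t D) (ξ η : VF O V) :
    tr t D ξ η = ∑ j, ⁅D j, ξ⁆.app (η.app (t j)) := by
  rw [tr, Finset.sum_comm]
  refine Finset.sum_congr rfl fun j _ => ?_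
  rw [h.app_eq ⁅D j, ξ⁆]
  simp [h.app_const]

theorem tr_smul (h : IsChart t D) (f : Sec O V) (ξ η : VF O V) :
    tr t D (f • ξ) η = f * tr t D ξ η + ∑ j, (D j).app f * ξ.app (η.app (t j)) := by
  rw [tr_eq h, tr_eq h, Finset.mul_sum, ← Finset.sum_add_distrib]
  refine Finset.sum_congr rfl fun j _ => ?_
  rw [VF.bracket_smul]
  simp

theorem bracket_bracket_app (h : IsChart t D) (i j k : Fin n) (ξ : VF O V) :
    ⁅D j, ⁅D k, ξ⁆⁆.app (t i) = (D j).app ((D k).app (ξ.app (t i))) := by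
  simp only [VF.bracket_app, h.app_const, sub_zero]

/-- The product rule for the trace of J_ξ J_η, written so that each summand is the correction term
of one of the two brackets. This is what makes the symmetrized bracket exact in `brForm_symm`. -/
theorem app_tr (h : IsChart t D) (j : Fin n) (ξ η : VF O V) :
    (D j).app (tr t D ξ η) = ∑ k, ⁅D j, ⁅D k, ξ⁆⁆.app (η.app (t k)) +
      ∑ k, ⁅D j, ⁅D k, η⁆⁆.app (ξ.app (t k)) := by
  have key : ∀ ξ η : VF O V, ∑ k, ⁅D j, ⁅D k, ξ⁆⁆.app (η.app (t k)) =
      ∑ i, ∑ k, (D j).app ((D k).app (ξ.app (t i))) * (D i).app (η.app (t k)) := by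
    intro ξ η
    rw [Finset.sum_comm]
    refine Finset.sum_congr rfl fun k _ => ?_
    rw [h.app_eq]
    exact Finset.sum_congr rfl fun i _ => by rw [bracket_bracket_app h]
  rw [key, key, tr, Finset.sum_comm (f := fun i k => (D j).app ((D k).app (η.app (t i))) * _),
    ← Finset.sum_add_distrib, VF.app_sum]
  refine Finset.sum_congr rfl fun i _ => ?_
  rw [← Finset.sum_add_distrib, VF.app_sum]
  refine Finset.sum_congr rfl fun k _ => ?_
  rw [VF.app_mul]
  ring

theorem brForm_symm (h : IsChart t D) (a b : VF O V × (Fin n → Sec O V)) (j : Fin n) :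
    brForm t D a b j + brForm t D b a j =
      (D j).app (ev t a.2 b.1 + ev t b.2 a.1 - tr t D a.1 b.1) := by
  simp only [brForm, VF.app_sub, VF.app_add, app_tr h]
  ring

/-- Apart from the usual Leibniz rule, second derivatives of f appear from two sources: the
correction in f * b and the trace correction of the bracket. They balance by `h1`. -/
theorem brForm_act (h : IsChart t D) (a b : VF O V × (Fin n → Sec O V)) (f : Sec O V) (j : Fin n) :
    brForm t D a (f • b.1, fun j => f * b.2 j - b.1.app ((D j).app f)) j =
      a.1.app f * b.2 j - b.1.app ((D j).app (a.1.app f)) +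
      (f * brForm t D a b j - ⁅a.1, b.1⁆.app ((D j).app f)) := by
  -- This is the product rule for b.1 applied to [Dⱼ, a.1](f) = ∑ᵢ [Dⱼ, a.1](tᵢ) Dᵢ(f). The
  -- derivatives of Dᵢ(f) form the first summand; those of the coefficients form the second, after
  -- the commuting Dⱼ and Dₖ are interchanged.
  have h1 : ev t (fun j => b.1.app ((D j).app f)) ⁅D j, a.1⁆ +
      ∑ k, b.1.app (t k) * ⁅D j, ⁅D k, a.1⁆⁆.app f = b.1.app (⁅D j, a.1⁆.app f) := by
    have h2 : ∑ k, b.1.app (t k) * ⁅D j, ⁅D k, a.1⁆⁆.app f =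
        ∑ k, b.1.app (⁅D j, a.1⁆.app (t k)) * (D k).app f := by
      have h3 : ∀ k, ⁅D j, ⁅D k, a.1⁆⁆.app f =
          ∑ i, (D k).app (⁅D j, a.1⁆.app (t i)) * (D i).app f := by
        intro k
        rw [h.app_eq]
        refine Finset.sum_congr rfl fun i _ => ?_
        rw [bracket_bracket_app h, h.comm_app]
        simp [h.app_const]
      simp only [h3, Finset.mul_sum]
      rw [Finset.sum_comm]
      refine Finset.sum_congr rfl fun i _ => ?_
      rw [h.app_eq b.1, Finset.sum_mul]
      exact Finset.sum_congr rfl fun k _ => (mul_assoc _ _ _).symm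
    rw [h2, h.app_eq ⁅D j, a.1⁆ f, VF.app_sum, ev, ← Finset.sum_add_distrib]
    refine Finset.sum_congr rfl fun k _ => ?_
    rw [VF.app_mul]
    ring
  have h4 : ∑ k, ⁅D j, ⁅D k, a.1⁆⁆.app (f * b.1.app (t k)) =
      f * ∑ k, ⁅D j, ⁅D k, a.1⁆⁆.app (b.1.app (t k)) +
      ∑ k, b.1.app (t k) * ⁅D j, ⁅D k, a.1⁆⁆.app f := by
    rw [Finset.mul_sum, ← Finset.sum_add_distrib]
    exact Finset.sum_congr rfl fun k _ => VF.app_mul _ _ _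
  rw [VF.bracket_app (D j) a.1 f] at h1
  simp only [brForm, VF.smul_app]
  rw [h4]
  simp only [ev_sub, ev_mul, VF.bracket_smul, ev_add_right,
    ev_smul_right, VF.app_sub, VF.app_mul, VF.bracket_app a.1 b.1, VF.app_sub] at h1 ⊢
  linear_combination -h1

/-- The multiplication by functions. -/
def actMap (D : Fin n → VF O V) :
    Sec O V →ₗ[ℂ] VF O V × (Fin n → Sec O V) →ₗ[ℂ] VF O V × (Fin n → Sec O V) :=
  -- The operator f ↦ ξ(Dⱼ(f)) has second order, and its failure to obey the product rule is ξ(f)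
  -- Dⱼ(g) + ξ(g) Dⱼ(f). This is exactly the required associativity anomaly.
  LinearMap.mk₂ ℂ (fun f a => (f • a.1, fun j => f * a.2 j - a.1.app ((D j).app f)))
    (fun f g a => Prod.ext (add_smul _ _ _) (by
      funext j
      simp [add_mul]
      ring))
    (fun c f a => Prod.ext (by ext; simp) (by
      funext j
      simp [smul_sub]))
    (fun f a b => Prod.ext (smul_add _ _ _) (by
      funext j
      simp [mul_add]
      ring))
    (fun c f a => Prod.ext (by ext; simp) (by
      funext j
      simp [smul_sub]))

/-- The bracket. -/
def brMap (t : Fin n → Sec O V) (D : Fin n → VF O V) :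
    VF O V × (Fin n → Sec O V) →ₗ[ℂ] VF O V × (Fin n → Sec O V) →ₗ[ℂ]
      VF O V × (Fin n → Sec O V) :=
  LinearMap.mk₂ ℂ (fun a b => (⁅a.1, b.1⁆, brForm t D a b))
    (fun a a' b => Prod.ext (by ext; simp) (by
      have (j : Fin n) : ⁅D j, a.1 + a'.1⁆ = ⁅D j, a.1⁆ + ⁅D j, a'.1⁆ := by ext; simp
      funext j
      simp only [brForm, Prod.fst_add, Prod.snd_add, Pi.add_apply, this, ev_add, ev_add_right,
        VF.add_app, VF.app_add, VF.bracket_app, VF.app_sub, VF.sub_app, Finset.sum_sub_distrib,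
        Finset.sum_add_distrib]
      ring))
    (fun c a b => Prod.ext (by ext; simp) (by
      have (j : Fin n) (ξ : VF O V) : ⁅D j, c • ξ⁆ = c • ⁅D j, ξ⁆ := by ext; simp
      funext j
      simp only [brForm, Prod.smul_fst, Prod.smul_snd, Pi.smul_apply, this, ev_smul,
        ev_smulC_right, VF.smulC_app, VF.app_smulC, smul_add, smul_sub, Finset.smul_sum]))
    (fun a b b' => Prod.ext (by ext; simp) (by
      have (j : Fin n) : ⁅D j, b.1 + b'.1⁆ = ⁅D j, b.1⁆ + ⁅D j, b'.1⁆ := by ext; simp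
      funext j
      simp only [brForm, Prod.fst_add, Prod.snd_add, Pi.add_apply, this, ev_add, ev_add_right,
        VF.add_app, VF.app_add, Finset.sum_add_distrib]
      ring))
    (fun c a b => Prod.ext (by ext; simp) (by
      have (j : Fin n) : ⁅D j, c • b.1⁆ = c • ⁅D j, b.1⁆ := by ext; simp
      funext j
      simp only [brForm, Prod.smul_fst, Prod.smul_snd, Pi.smul_apply, this, ev_smul,
        ev_smulC_right, VF.smulC_app, VF.app_smulC, smul_add, smul_sub, Finset.smul_sum]))

/-- The pairing. -/
def pairMap (t : Fin n → Sec O V) (D : Fin n → VF O V) :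
    VF O V × (Fin n → Sec O V) →ₗ[ℂ] VF O V × (Fin n → Sec O V) →ₗ[ℂ] Sec O V :=
  -- The trace term vanishes on the coordinate fields, which are therefore orthogonal; elsewhere it
  -- accounts for the anomaly of ⟨f * v, w⟩.
  LinearMap.mk₂ ℂ (fun a b => ev t a.2 b.1 + ev t b.2 a.1 - tr t D a.1 b.1)
    (fun a a' b => by
      simp only [Prod.fst_add, Prod.snd_add, ev_add, ev_add_right, tr_add]
      ring)
    (fun c a b => by
      simp only [Prod.smul_fst, Prod.smul_snd, ev_smul, ev_smulC_right, tr_smulC, smul_add,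
        smul_sub])
    (fun a b b' => by
      simp only [Prod.fst_add, Prod.snd_add, ev_add, ev_add_right, tr_comm a.1, tr_add]
      ring)
    (fun c a b => by
      simp only [Prod.smul_fst, Prod.smul_snd, ev_smul, ev_smulC_right, tr_comm a.1, tr_smulC,
        smul_add, smul_sub])

/-- The map `f ↦ df`. -/
def derMap (D : Fin n → VF O V) : Sec O V →ₗ[ℂ] VF O V × (Fin n → Sec O V) where
  toFun f := (0, fun j => (D j).app f)
  map_add' f g := Prod.ext (add_zero _).symm (by funext j; simp)
  map_smul' c f := Prod.ext (smul_zero _).symm (by funext j; simp)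

section Restriction

variable {W : Opens X} (h : W ≤ V)

theorem rs_ev (w : Fin n → Sec O V) (ξ : VF O V) :
    rs O h (ev t w ξ) = ev (fun i => rs O h (t i)) (fun i => rs O h (w i)) (VF.res h ξ) := by
  simp [ev, VF.rs_app]

theorem rs_tr (ξ η : VF O V) : rs O h (tr t D ξ η) =
    tr (fun i => rs O h (t i)) (fun i => VF.res h (D i)) (VF.res h ξ) (VF.res h η) := by
  simp [tr, VF.rs_app]

theorem rs_brForm (a b : VF O V × (Fin n → Sec O V)) (j : Fin n) : rs O h (brForm t D a b j) =
    brForm (fun i => rs O h (t i)) (fun i => VF.res h (D i)) (VF.res h a.1, fun i => rs O h (a.2 i))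
      (VF.res h b.1, fun i => rs O h (b.2 i)) j := by
  simp [brForm, VF.rs_app, rs_ev, VF.res_bracket]

end Restriction

end Chart

end

/-! ### The axioms of the vertex algebroid of a coordinate system -/

section

variable {O : TopCat.Sheaf (CommAlgCat.{u} ℂ) X} {U : Opens X}

open AlgebroidData

namespace Chart

variable {V : Opens X} {n : ℕ} {t : Fin n → Sec O V} {D : Fin n → VF O V}

theorem actMap_apply (f : Sec O V) (a : VF O V × (Fin n → Sec O V)) :
    actMap D f a = (f • a.1, fun j => f * a.2 j - a.1.app ((D j).app f)) := rfl

theorem brMap_apply (a b : VF O V × (Fin n → Sec O V)) :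
    brMap t D a b = (⁅a.1, b.1⁆, brForm t D a b) := rfl

theorem pairMap_apply (a b : VF O V × (Fin n → Sec O V)) :
    pairMap t D a b = ev t a.2 b.1 + ev t b.2 a.1 - tr t D a.1 b.1 := rfl

theorem derMap_apply (f : Sec O V) :
    (derMap D f : VF O V × (Fin n → Sec O V)) = (0, fun j => (D j).app f) := rfl

theorem actMap_derMap (f g : Sec O V) :
    actMap D f (derMap D g) = (0, fun j => f * (D j).app g) :=
  Prod.ext (smul_zero _) (by funext j; simp [actMap_apply, derMap_apply])

theorem one_act (a : VF O V × (Fin n → Sec O V)) : actMap D 1 a = a :=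
  Prod.ext (one_smul _ _) (by funext j; simp [actMap_apply])

theorem assoc (f g : Sec O V) (a : VF O V × (Fin n → Sec O V)) :
    actMap D f (actMap D g a) - actMap D (f * g) a =
      actMap D (a.1.app f) (derMap D g) + actMap D (a.1.app g) (derMap D f) := by
  rw [actMap_derMap, actMap_derMap]
  refine Prod.ext ?_ ?_
  · simp [actMap_apply, mul_smul]
  · funext j
    simp [actMap_apply, VF.app_mul, VF.app_add]
    ring

theorem br_act (h : IsChart t D) (a b : VF O V × (Fin n → Sec O V)) (f : Sec O V) :
    brMap t D a (actMap D f b) = actMap D (a.1.app f) b + actMap D f (brMap t D a b) := by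
  refine Prod.ext ?_ ?_
  · simp [actMap_apply, brMap_apply, VF.bracket_smul]
    try abel
  · funext j
    exact brForm_act h a b f j

theorem br_symm (h : IsChart t D) (a b : VF O V × (Fin n → Sec O V)) :
    brMap t D a b + brMap t D b a = derMap D (pairMap t D a b) := by
  refine Prod.ext ?_ ?_
  · change ⁅a.1, b.1⁆ + ⁅b.1, a.1⁆ = 0
    ext
    simp [Derivation.commutator_apply]
  · funext j
    exact brForm_symm h a b j

theorem pair_symm (a b : VF O V × (Fin n → Sec O V)) : pairMap t D a b = pairMap t D b a := by
  rw [pairMap_apply, pairMap_apply, tr_comm, add_comm (ev t a.2 b.1)]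

theorem pair_act (h : IsChart t D) (f : Sec O V) (a b : VF O V × (Fin n → Sec O V)) :
    pairMap t D (actMap D f a) b = f * pairMap t D a b - a.1.app (b.1.app f) := by
  have : a.1.app (b.1.app f) = ev t (fun j => a.1.app ((D j).app f)) b.1 +
      ∑ j, (D j).app f * a.1.app (b.1.app (t j)) := by
    rw [h.app_eq b.1 f, VF.app_sum, ev, ← Finset.sum_add_distrib]
    refine Finset.sum_congr rfl fun k _ => ?_
    rw [VF.app_mul]
    ring
  rw [this]
  simp only [pairMap_apply, actMap_apply, ev_sub, ev_mul, ev_smul_right, tr_smul h]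
  ring

theorem pair_der (h : IsChart t D) (a : VF O V × (Fin n → Sec O V)) (f : Sec O V) :
    pairMap t D a (derMap D f) = a.1.app f := by
  rw [pair_symm]
  simp [pairMap_apply, derMap_apply, ev_der h, ev_zero_right, tr_zero]

theorem br_der (h : IsChart t D) (a : VF O V × (Fin n → Sec O V)) (f : Sec O V) :
    brMap t D a (derMap D f) = derMap D (a.1.app f) := by
  refine Prod.ext ?_ ?_
  · change ⁅a.1, (0 : VF O V)⁆ = 0
    ext
    simp
  · funext j
    have h0 : ⁅D j, (0 : VF O V)⁆ = 0 := by ext; simp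
    change brForm t D a (0, fun j => (D j).app f) j = (D j).app (a.1.app f)
    simp [brForm, h0, ev_zero_right, ev_der h]

theorem br_der_left (h : IsChart t D) (f : Sec O V) (a : VF O V × (Fin n → Sec O V)) :
    brMap t D (derMap D f) a = 0 := by
  have := br_symm h a (derMap D f)
  rwa [br_der h, pair_der h, add_eq_left] at this

theorem der_mul (f g : Sec O V) : (derMap D (f * g) : VF O V × (Fin n → Sec O V)) =
    actMap D f (derMap D g) + actMap D g (derMap D f) := by
  rw [actMap_derMap, actMap_derMap]
  refine Prod.ext (add_zero _).symm ?_
  funext j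
  exact VF.app_mul _ _ _

/-- The coordinate fields and the exact sections generate under sums and `*`. Forms are ∑ wₖ * ∂tₖ,
and (ξ, α) differs from ∑ ξ(tₖ) * (Dₖ, 0) by a form, because f * (Dₖ, 0) has the first component f
Dₖ. -/
theorem induction (h : IsChart t D) {p : VF O V × (Fin n → Sec O V) → Prop}
    (hadd : ∀ a b, p a → p b → p (a + b)) (hact : ∀ f a, p a → p (actMap D f a))
    (hbasis : ∀ i, p (D i, 0)) (hder : ∀ f, p (derMap D f)) (a : VF O V × (Fin n → Sec O V)) :
    p a := by
  have h0 : p 0 := by simpa using hder 0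
  have hform : ∀ w : Fin n → Sec O V, p (0, w) := by
    intro w
    have : ((0, w) : VF O V × (Fin n → Sec O V)) = ∑ k, actMap D (w k) (derMap D (t k)) := by
      simp only [actMap_derMap]
      refine Prod.ext (by simp [Prod.fst_sum]) ?_
      funext j
      simp [Prod.snd_sum, h.1]
    rw [this]
    exact Finset.sum_induction _ p hadd h0 fun k _ => hact _ _ (hder _)
  have h1 : p (∑ k, actMap D (a.1.app (t k)) (D k, 0)) :=
    Finset.sum_induction _ p hadd h0 fun k _ => hact _ _ (hbasis k)
  have h2 : a = ∑ k, actMap D (a.1.app (t k)) (D k, 0) +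
      (0, a.2 - (∑ k, actMap D (a.1.app (t k)) (D k, (0 : Fin n → Sec O V))).2) := by
    refine Prod.ext ?_ ?_
    · rw [Prod.fst_add, add_zero, Prod.fst_sum]
      refine (h.2 V le_rfl a.1).trans (Finset.sum_congr rfl fun k _ => ?_)
      rw [rs_rfl]
      rfl
    · simp
  rw [h2]
  exact hadd _ _ h1 (hform _)

theorem br_basis (h : IsChart t D) (i j : Fin n) : brMap t D (D i, 0) (D j, 0) = 0 := by
  refine Prod.ext (h.comm i j) ?_
  funext k
  simp [brMap_apply, brForm, ev_zero, h.comm, h.app_const]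

theorem pair_br_basis (h : IsChart t D) (a : VF O V × (Fin n → Sec O V)) (i k : Fin n) :
    pairMap t D (brMap t D a (D i, 0)) (D k, 0) = (D k).app (a.2 i) - (D i).app (a.2 k) := by
  simp only [pairMap_apply, brMap_apply, ev_basis h, ev_zero, tr_comm _ (D k), tr_basis h]
  simp [brForm, ev_zero, ev_basis h, h.comm, h.app_const, ev_zero_right]
  ring

theorem pair_inv_act (h : IsChart t D) (a b c : VF O V × (Fin n → Sec O V)) (f : Sec O V)
    (H : a.1.app (pairMap t D b c) =
      pairMap t D (brMap t D a b) c + pairMap t D b (brMap t D a c)) :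
    a.1.app (pairMap t D (actMap D f b) c) = pairMap t D (brMap t D a (actMap D f b)) c +
      pairMap t D (actMap D f b) (brMap t D a c) := by
  rw [br_act h, map_add, LinearMap.add_apply, pair_act h, pair_act h, pair_act h, pair_act h,
    VF.app_sub, VF.app_mul, H]
  simp only [brMap_apply, VF.bracket_app, VF.app_sub]
  ring

/-- The identity is stable under `*` in b by `pair_inv_act`, under sums and under exchanging b and
c, and it holds for exact sections. So b and c may be coordinate fields; their pairing is zero, and
the two terms on the right are opposite by `pair_br_basis`. -/
theorem pair_inv (h : IsChart t D) (a b c : VF O V × (Fin n → Sec O V)) :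
    a.1.app (pairMap t D b c) =
      pairMap t D (brMap t D a b) c + pairMap t D b (brMap t D a c) := by
  have hd : ∀ f c, a.1.app (pairMap t D (derMap D f) c) =
      pairMap t D (brMap t D a (derMap D f)) c + pairMap t D (derMap D f) (brMap t D a c) := by
    intro f c
    rw [br_der h, pair_symm, pair_der h, pair_symm, pair_der h, pair_symm (derMap D f),
      pair_der h]
    simp [brMap_apply]
  have hs : ∀ b c, a.1.app (pairMap t D b c) =
      pairMap t D (brMap t D a b) c + pairMap t D b (brMap t D a c) →
      a.1.app (pairMap t D c b) =
      pairMap t D (brMap t D a c) b + pairMap t D c (brMap t D a b) := by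
    intro b c H
    rw [pair_symm c, H, pair_symm _ c, pair_symm b, add_comm]
  have hadd : ∀ c b b', a.1.app (pairMap t D b c) =
      pairMap t D (brMap t D a b) c + pairMap t D b (brMap t D a c) →
      a.1.app (pairMap t D b' c) =
      pairMap t D (brMap t D a b') c + pairMap t D b' (brMap t D a c) →
      a.1.app (pairMap t D (b + b') c) =
      pairMap t D (brMap t D a (b + b')) c + pairMap t D (b + b') (brMap t D a c) := by
    intro c b b' H H'
    simp only [map_add, LinearMap.add_apply, VF.app_add, H, H']
    ring
  refine induction h (hadd c) (fun f b => pair_inv_act h a b c f) (fun i => ?_) (fun f => hd f c) b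
  refine hs _ _ (induction h (hadd _) (fun f b => pair_inv_act h a b _ f) (fun k => ?_)
    (fun f => hd f _) c)
  rw [pair_symm (D k, 0) (brMap t D a _), pair_br_basis h, pair_br_basis h]
  simp [pairMap_apply, ev_zero, tr_basis h]

/-- The failure of the Leibniz identity. -/
def jac (t : Fin n → Sec O V) (D : Fin n → VF O V) (a b c : VF O V × (Fin n → Sec O V)) :
    VF O V × (Fin n → Sec O V) :=
  brMap t D a (brMap t D b c) - brMap t D (brMap t D a b) c - brMap t D b (brMap t D a c)

/-- The symmetric part of the bracket is exact, and exact sections act by zero. -/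
theorem jac_swap_left (h : IsChart t D) (a b c : VF O V × (Fin n → Sec O V)) :
    jac t D a b c = -jac t D b a c := by
  have := br_der_left h (pairMap t D a b) c
  rw [← br_symm h, map_add, LinearMap.add_apply] at this
  rw [jac, jac, ← sub_eq_zero]
  rw [← neg_eq_zero, ← this]
  abel

/-- Expand [a, ∂⟨b, c⟩] = ∂(π(a)⟨b, c⟩): both sides become brackets, the left by symmetrization, the
right by invariance of the pairing. -/
theorem jac_swap_right (h : IsChart t D) (a b c : VF O V × (Fin n → Sec O V)) :
    jac t D a b c = -jac t D a c b := by
  have h1 := br_der h a (pairMap t D b c)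
  rw [← br_symm h, map_add, pair_inv h, map_add, ← br_symm h, ← br_symm h] at h1
  rw [jac, jac, ← sub_eq_zero]
  rw [← sub_eq_zero] at h1
  rw [← h1]
  abel

/-- The expression is linear over `*` in its last argument, although `*` is not associative, and it
vanishes on exact sections because vector fields satisfy the corresponding identity on functions. -/
theorem jac_induction (h : IsChart t D) (a b c : VF O V × (Fin n → Sec O V))
    (H : ∀ k, jac t D a b (D k, 0) = 0) : jac t D a b c = 0 := by
  refine induction h (p := fun c => jac t D a b c = 0) (fun c c' hc hc' => ?_) (fun f c hc => ?_) H
    (fun f => ?_) c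
  · have : jac t D a b (c + c') = jac t D a b c + jac t D a b c' := by
      simp only [jac, map_add]
      abel
    rw [this, hc, hc', add_zero]
  · have h1 : jac t D a b (actMap D f c) = actMap D f (jac t D a b c) := by
      simp only [jac, br_act h, map_add, map_sub]
      simp only [brMap_apply, VF.bracket_app, map_sub, LinearMap.sub_apply]
      abel
    rw [h1, hc, map_zero]
  · rw [jac, br_der h, br_der h, br_der h, br_der h, br_der h, ← map_sub, ← map_sub]
    simp [brMap_apply]

/-- By antisymmetry each argument can be moved to the last place and reduced to a coordinate field.
All brackets between the sections (Dᵢ, 0) vanish. -/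
theorem jac_eq_zero (h : IsChart t D) (a b c : VF O V × (Fin n → Sec O V)) :
    jac t D a b c = 0 := by
  refine jac_induction h a b c fun k => ?_
  rw [jac_swap_right h, jac_induction h, neg_zero]
  intro l
  rw [jac_swap_left h, jac_swap_right h, neg_neg, jac_induction h]
  intro m
  simp only [jac, br_basis h, map_zero, LinearMap.zero_apply, sub_zero]

theorem leibniz (h : IsChart t D) (a b c : VF O V × (Fin n → Sec O V)) :
    brMap t D a (brMap t D b c) = brMap t D (brMap t D a b) c + brMap t D b (brMap t D a c) := by
  have := jac_eq_zero h a b c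
  rw [jac, sub_sub, sub_eq_zero] at this
  exact this

/-- The restriction map. -/
def resMap {V W : Opens X} (n : ℕ) (h : W ≤ V) :
    VF O V × (Fin n → Sec O V) →ₗ[ℂ] VF O W × (Fin n → Sec O W) where
  toFun a := (VF.res h a.1, fun j => rs O h (a.2 j))
  map_add' _ _ := Prod.ext (map_add _ _ _) (funext fun _ => map_add _ _ _)
  map_smul' _ _ := Prod.ext (map_smul _ _ _) (funext fun j => map_smul (rs O h) _ _)

theorem resMap_apply {V W : Opens X} (h : W ≤ V) (a : VF O V × (Fin n → Sec O V)) :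
    resMap n h a = (VF.res h a.1, fun j => rs O h (a.2 j)) := rfl

section

variable {V W : Opens X} (hV : V ≤ U) (h : W ≤ V) {t : Fin n → Sec O U} {D : Fin n → VF O U}

theorem resMap_actMap (f : Sec O V) (a : VF O V × (Fin n → Sec O V)) :
    resMap n h (actMap (fun j => VF.res hV (D j)) f a) =
      actMap (fun j => VF.res (h.trans hV) (D j)) (rs O h f) (resMap n h a) := by
  simp only [resMap_apply, actMap_apply, map_sub, map_mul, VF.rs_app, VF.res_smul]
  rfl

theorem resMap_brMap (a b : VF O V × (Fin n → Sec O V)) :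
    resMap n h (brMap (fun j => rs O hV (t j)) (fun j => VF.res hV (D j)) a b) =
      brMap (fun j => rs O (h.trans hV) (t j)) (fun j => VF.res (h.trans hV) (D j))
        (resMap n h a) (resMap n h b) := by
  simp only [resMap_apply, brMap_apply, rs_brForm, rs_rs, VF.res_bracket]
  rfl

theorem rs_pairMap (a b : VF O V × (Fin n → Sec O V)) :
    rs O h (pairMap (fun j => rs O hV (t j)) (fun j => VF.res hV (D j)) a b) =
      pairMap (fun j => rs O (h.trans hV) (t j)) (fun j => VF.res (h.trans hV) (D j))
        (resMap n h a) (resMap n h b) := by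
  simp only [pairMap_apply, map_sub, map_add, rs_ev, rs_tr, rs_rs]
  rfl

theorem resMap_derMap (f : Sec O V) : resMap n h (derMap (fun j => VF.res hV (D j)) f) =
    derMap (fun j => VF.res (h.trans hV) (D j)) (rs O h f) := by
  refine Prod.ext (map_zero _) (funext fun j => ?_)
  exact VF.rs_app _ _ _

end

theorem glue (n : ℕ) {ι : Type u} (V : ι → Opens X) (hV : ∀ i, V i ≤ U)
    (s : ∀ i, VF O (V i) × (Fin n → Sec O (V i)))
    (hs : ∀ i j, resMap n (inf_le_left : V i ⊓ V j ≤ V i) (s i) =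
      resMap n (inf_le_right : V i ⊓ V j ≤ V j) (s j)) :
    ∃! a : VF O (iSup V) × (Fin n → Sec O (iSup V)), ∀ i, resMap n (le_iSup V i) a = s i := by
  obtain ⟨ξ, hξ, hξ'⟩ := (vfPsh_isSheaf O U).glue V hV (fun i => (s i).1)
    (fun i j => (Prod.ext_iff.1 (hs i j)).1)
  have hw := fun k : Fin n => (secPsh_isSheaf O U).glue V hV (fun i => (s i).2 k)
    (fun i j => congrFun (Prod.ext_iff.1 (hs i j)).2 k)
  choose w hw hw' using hw
  refine ⟨(ξ, w), fun i => Prod.ext (hξ i) (funext fun k => hw k i), fun y hy => ?_⟩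
  exact Prod.ext (hξ' _ fun i => (Prod.ext_iff.1 (hy i)).1)
    (funext fun k => hw' k _ fun i => congrFun (Prod.ext_iff.1 (hy i)).2 k)

end Chart

/-- The vertex algebroid of a coordinate system. -/
abbrev chartData {n : ℕ} (t : Fin n → Sec O U) (D : Fin n → VF O U) : AlgebroidData O U where
  sec V _ := VF O V × (Fin n → Sec O V)
  res _ h := Chart.resMap n h
  act {V} hV := Chart.actMap (V := V) fun j => VF.res hV (D j)
  br {V} hV := Chart.brMap (V := V) (fun j => rs O hV (t j)) fun j => VF.res hV (D j)
  anchor {V} _ := LinearMap.fst ℂ (VF O V) (Fin n → Sec O V)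
  pair {V} hV := Chart.pairMap (V := V) (fun j => rs O hV (t j)) fun j => VF.res hV (D j)
  der {V} hV := Chart.derMap (V := V) fun j => VF.res hV (D j)
  res_rfl _ a := Prod.ext rfl (funext fun j => rs_rfl O _ _)
  res_res _ h h' a := Prod.ext rfl (funext fun j => rs_rs O _ _ _)
  glue V hV s hs := Chart.glue n V hV s hs
  res_act hV h f a := Chart.resMap_actMap hV h f a
  res_br hV h a b := Chart.resMap_brMap hV h a b
  res_anchor _ _ _ := rfl
  res_pair hV h a b := Chart.rs_pairMap hV h a b
  res_der hV h f := Chart.resMap_derMap hV h f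

theorem chartData_isVertex {n : ℕ} {t : Fin n → Sec O U} {D : Fin n → VF O U} (h : IsChart t D) :
    (chartData t D).IsVertex where
  one_act hV a := Chart.one_act a
  leibniz hV a b c := Chart.leibniz (h.res hV) a b c
  anchor_br _ _ _ := rfl
  pair_symm _ a b := Chart.pair_symm a b
  anchor_der _ _ := rfl
  assoc _ f g a := Chart.assoc f g a
  br_act hV a b f := Chart.br_act (h.res hV) a b f
  br_symm hV a b := Chart.br_symm (h.res hV) a b
  anchor_act _ _ _ := rfl
  pair_act hV f a b := Chart.pair_act (h.res hV) f a b
  pair_inv hV a b c := Chart.pair_inv (h.res hV) a b c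
  der_mul _ f g := Chart.der_mul f g
  br_der hV a f := Chart.br_der (h.res hV) a f
  pair_der hV a f := Chart.pair_der (h.res hV) a f
  der_factors := by
    intro V hV m f g H
    simp only [Chart.actMap_derMap]
    refine Prod.ext (by simp [Prod.fst_sum]) (funext fun j => ?_)
    have := H V le_rfl (VF.res hV (D j))
    simp only [rs_rfl] at this
    simpa [Prod.snd_sum] using this

/-- The exact vertex algebroid of a coordinate system. -/
def chartExtension {n : ℕ} {t : Fin n → Sec O U} {D : Fin n → VF O U} (h : IsChart t D) :
    Extension (tangent O) U where
  E := chartData t D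
  proj {V} _ := LinearMap.fst ℂ (VF O V) (Fin n → Sec O V)
  proj_res _ _ _ := rfl
  proj_act _ _ _ := rfl
  proj_br _ _ _ := rfl
  anchor_proj _ _ := rfl
  surj hV a x hx := ⟨_, le_rfl, (a, 0), hx, rfl⟩
  ker {V} hV e := by
    constructor
    · intro he x hx
      refine ⟨V, le_rfl, hx, n, e.2, fun k => rs O hV (t k), ?_⟩
      rw [AlgebroidData.res_rfl]
      simp only [Chart.actMap_derMap]
      refine Prod.ext (he.trans (by simp [Prod.fst_sum]; rfl)) (funext fun j => ?_)
      simp [Prod.snd_sum, (h.res hV).1]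
    · intro he
      refine vf_ext (O := O) fun x hx => ?_
      obtain ⟨W, hW, hxW, m, f, g, hfg⟩ := he x hx
      refine ⟨W, hW, hxW, ?_⟩
      have := congrArg Prod.fst hfg
      simp only [Chart.actMap_derMap, Prod.fst_sum, Finset.sum_const_zero] at this
      exact this.trans (map_zero _).symm

theorem exists_isEVA (hX : HasLocalCoordinates O) (x : X) :
    ∃ (U : Opens X) (s : Extension (tangent O) U), x ∈ U ∧ isEVA O U s := by
  obtain ⟨U, _, hx, n, t, D, h⟩ := hX.exists_chart ⊤ x trivial
  exact ⟨U, chartExtension h, hx, chartData_isVertex h⟩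

end

section

variable {O : TopCat.Sheaf (CommAlgCat.{u} ℂ) X} {U : Opens X}

/-! ### Forms -/

theorem eq_zero_of_eq_neg {M : Type*} [AddCommGroup M] [Module ℂ M] {x : M} (h : x = -x) :
    x = 0 := by
  have h2 : (2 : ℂ) • x = 0 := by
    rw [two_smul]
    nth_rewrite 1 [h]
    exact neg_add_cancel x
  exact (smul_eq_zero.1 h2).resolve_left two_ne_zero

namespace Form

variable {k : ℕ} {V : Opens X}

@[ext] theorem ext_ev {ω ω' : Form O k V}
    (h : ∀ (W : Opens X) (hW : W ≤ V) ξ, ω.ev W hW ξ = ω'.ev W hW ξ) : ω = ω' :=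
  Subtype.ext (funext fun W => AlternatingMap.ext fun ξ => h W.1 W.2 ξ)

@[simp] theorem add_ev (ω ω' : Form O k V) (W : Opens X) (h : W ≤ V) (ξ : Fin k → VF O W) :
    (ω + ω').ev W h ξ = ω.ev W h ξ + ω'.ev W h ξ := rfl

theorem rs_ev (ω : Form O k V) {W W' : Opens X} (h : W ≤ V) (h' : W' ≤ W) (ξ : Fin k → VF O W) :
    rs O h' (ω.ev W h ξ) = ω.ev W' (h'.trans h) fun i => VF.res h' (ξ i) :=
  ω.2 ⟨W, h⟩ ⟨W', h'.trans h⟩ h' ξ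

/-- Restriction of forms. -/
def res {W : Opens X} (h : W ≤ V) (ω : Form O k V) : Form O k W :=
  ⟨fun Z => ω.1 ⟨Z.1, Z.2.trans h⟩, fun Z Z' hZ ξ => ω.2 ⟨Z.1, Z.2.trans h⟩ ⟨Z'.1, Z'.2.trans h⟩ hZ ξ⟩

@[simp] theorem res_ev {W : Opens X} (h : W ≤ V) (ω : Form O k V) (Z : Opens X) (hZ : Z ≤ W)
    (ξ : Fin k → VF O Z) : (ω.res h).ev Z hZ ξ = ω.ev Z (hZ.trans h) ξ := rfl

/-- A 2-form given by its values. -/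
def ofTwo (F : ∀ W : Opens X, W ≤ V → VF O W → VF O W → Sec O W)
    (add : ∀ W h ξ ξ' η, F W h (ξ + ξ') η = F W h ξ η + F W h ξ' η)
    (smul : ∀ W h (f : Sec O W) ξ η, F W h (f • ξ) η = f * F W h ξ η)
    (swap : ∀ W h ξ η, F W h ξ η = -F W h η ξ)
    (map_res : ∀ (W W' : Opens X) (h : W ≤ V) (h' : W' ≤ W) (ξ η : VF O W),
      rs O h' (F W h ξ η) = F W' (h'.trans h) (VF.res h' ξ) (VF.res h' η)) : Form O 2 V :=
  ⟨fun W =>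
    { toFun := fun ξ => F W.1 (Set.mem_Iic.1 W.2) (ξ 0) (ξ 1)
      map_update_add' := fun {inst} ξ i x y => by
        rw [Subsingleton.elim inst (instDecidableEqFin 2)]
        fin_cases i
        · simp [Function.update_apply, add]
        · simp [Function.update_apply, swap _ _ (ξ 0), add]
          ring
      map_update_smul' := fun {inst} ξ i f x => by
        rw [Subsingleton.elim inst (instDecidableEqFin 2)]
        fin_cases i
        · simp [Function.update_apply, smul]
        · simp [Function.update_apply, swap _ _ (ξ 0), smul]
      map_eq_zero_of_eq' := fun ξ i j hij hne => by
        have hs : ∀ η, F W.1 (Set.mem_Iic.1 W.2) η η = 0 := fun η => eq_zero_of_eq_neg (swap _ _ η η)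
        clear add smul swap map_res
        fin_cases i <;> fin_cases j <;> simp_all },
    fun W W' h ξ => map_res W.1 W'.1 W.2 h (ξ 0) (ξ 1)⟩

theorem fin_three : ∀ i : Fin 3, i = 0 ∨ i = 1 ∨ i = 2 := by decide

theorem one_ne_zero_three : (1 : Fin 3) ≠ 0 := by decide

theorem two_ne_zero_three : (2 : Fin 3) ≠ 0 := by decide

theorem two_ne_one_three : (2 : Fin 3) ≠ 1 := by decide

/-- A 3-form given by its values. -/
def ofThree (F : ∀ W : Opens X, W ≤ V → VF O W → VF O W → VF O W → Sec O W)
    (add : ∀ W h ξ ξ' η ζ, F W h (ξ + ξ') η ζ = F W h ξ η ζ + F W h ξ' η ζ)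
    (smul : ∀ W h (f : Sec O W) ξ η ζ, F W h (f • ξ) η ζ = f * F W h ξ η ζ)
    (swap : ∀ W h ξ η ζ, F W h ξ η ζ = -F W h η ξ ζ)
    (swap' : ∀ W h ξ η ζ, F W h ξ η ζ = -F W h ξ ζ η)
    (map_res : ∀ (W W' : Opens X) (h : W ≤ V) (h' : W' ≤ W) (ξ η ζ : VF O W),
      rs O h' (F W h ξ η ζ) = F W' (h'.trans h) (VF.res h' ξ) (VF.res h' η) (VF.res h' ζ)) :
    Form O 3 V :=
  ⟨fun W =>
    { toFun := fun ξ => F W.1 (Set.mem_Iic.1 W.2) (ξ 0) (ξ 1) (ξ 2)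
      map_update_add' := fun {inst} ξ i x y => by
        rcases fin_three i with rfl | rfl | rfl
        · simp only [Function.update_self, Function.update_of_ne one_ne_zero_three,
            Function.update_of_ne two_ne_zero_three, add]
        · simp only [Function.update_self, Function.update_of_ne one_ne_zero_three.symm,
            Function.update_of_ne two_ne_one_three, swap _ _ (ξ 0), add, neg_add]
        · simp only [Function.update_self, Function.update_of_ne two_ne_zero_three.symm,
            Function.update_of_ne two_ne_one_three.symm, swap' _ _ (ξ 0) (ξ 1), swap _ _ (ξ 0), add,
            neg_add, neg_neg]
      map_update_smul' := fun {inst} ξ i f x => by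
        rcases fin_three i with rfl | rfl | rfl
        · simp only [Function.update_self, Function.update_of_ne one_ne_zero_three,
            Function.update_of_ne two_ne_zero_three, smul, smul_eq_mul]
        · simp only [Function.update_self, Function.update_of_ne one_ne_zero_three.symm,
            Function.update_of_ne two_ne_one_three, swap _ _ (ξ 0), smul, smul_eq_mul, mul_neg]
        · simp only [Function.update_self, Function.update_of_ne two_ne_zero_three.symm,
            Function.update_of_ne two_ne_one_three.symm, swap' _ _ (ξ 0) (ξ 1), swap _ _ (ξ 0),
            smul, smul_eq_mul, mul_neg]
      map_eq_zero_of_eq' := fun ξ i j hij hne => by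
        have h1 : ∀ η ζ, F W.1 (Set.mem_Iic.1 W.2) η η ζ = 0 :=
          fun η ζ => eq_zero_of_eq_neg (swap _ _ η η ζ)
        have h2 : ∀ η ζ, F W.1 (Set.mem_Iic.1 W.2) η ζ ζ = 0 :=
          fun η ζ => eq_zero_of_eq_neg (swap' _ _ η ζ ζ)
        have h3 : ∀ η ζ, F W.1 (Set.mem_Iic.1 W.2) η ζ η = 0 :=
          fun η ζ => by rw [swap', h1, neg_zero]
        rcases fin_three i with rfl | rfl | rfl <;> rcases fin_three j with rfl | rfl | rfl <;>
          first
          | exact absurd rfl hne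
          | simp only [hij, h1, h2, h3] },
    fun W W' h ξ => map_res W.1 W'.1 W.2 h (ξ 0) (ξ 1) (ξ 2)⟩

theorem ev_swap_two (ω : Form O 2 V) (W : Opens X) (h : W ≤ V) (ξ η : VF O W) :
    ω.ev W h ![ξ, η] = -ω.ev W h ![η, ξ] := by
  have := (ω.1 ⟨W, h⟩).map_swap ![η, ξ] (i := 0) (j := 1) (by simp)
  refine Eq.trans (congrArg (ω.1 ⟨W, h⟩) ?_) this
  funext i
  fin_cases i <;> rfl

theorem ev_swap_left (ω : Form O 3 V) (W : Opens X) (h : W ≤ V) (ξ η ζ : VF O W) :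
    ω.ev W h ![ξ, η, ζ] = -ω.ev W h ![η, ξ, ζ] := by
  have := (ω.1 ⟨W, h⟩).map_swap ![η, ξ, ζ] (i := 0) (j := 1) (by simp)
  refine Eq.trans (congrArg (ω.1 ⟨W, h⟩) ?_) this
  funext i
  fin_cases i <;> rfl

theorem ev_swap_right (ω : Form O 3 V) (W : Opens X) (h : W ≤ V) (ξ η ζ : VF O W) :
    ω.ev W h ![ξ, η, ζ] = -ω.ev W h ![ξ, ζ, η] := by
  have := (ω.1 ⟨W, h⟩).map_swap ![ξ, ζ, η] (i := 1) (j := 2) (by simp)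
  refine Eq.trans (congrArg (ω.1 ⟨W, h⟩) ?_) this
  funext i
  fin_cases i <;> rfl

theorem extD_two (ω : Form O 2 V) (W : Opens X) (h : W ≤ V) (ξ : Fin 3 → VF O W) :
    extD ω W h ξ = (ξ 0).app (ω.ev W h ![ξ 1, ξ 2]) - (ξ 1).app (ω.ev W h ![ξ 0, ξ 2]) +
      (ξ 2).app (ω.ev W h ![ξ 0, ξ 1]) - ω.ev W h ![⁅ξ 0, ξ 1⁆, ξ 2] +
      ω.ev W h ![⁅ξ 0, ξ 2⁆, ξ 1] - ω.ev W h ![⁅ξ 1, ξ 2⁆, ξ 0] := by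
  have e1 : ∀ i : Fin 3, i.removeNth ξ = ![ξ (i.succAbove 0), ξ (i.succAbove 1)] := by
    intro i
    funext j
    fin_cases j <;> rfl
  have e2 : ∀ (i : Fin 3) (j : Fin 2) (x : VF O W),
      (Fin.cons x (j.removeNth (i.removeNth ξ)) : Fin 2 → VF O W) =
        ![x, ξ (i.succAbove (j.succAbove 0))] := by
    intro i j x
    funext l
    fin_cases l <;> rfl
  simp only [extD, e2]
  simp only [e1]
  simp [Fin.sum_univ_two, Fin.sum_univ_three, Fin.succAbove]
  ring

theorem extD_three (ω : Form O 3 V) (W : Opens X) (h : W ≤ V) (ξ : Fin 4 → VF O W) :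
    extD ω W h ξ = (ξ 0).app (ω.ev W h ![ξ 1, ξ 2, ξ 3]) - (ξ 1).app (ω.ev W h ![ξ 0, ξ 2, ξ 3]) +
      (ξ 2).app (ω.ev W h ![ξ 0, ξ 1, ξ 3]) - (ξ 3).app (ω.ev W h ![ξ 0, ξ 1, ξ 2]) -
      ω.ev W h ![⁅ξ 0, ξ 1⁆, ξ 2, ξ 3] + ω.ev W h ![⁅ξ 0, ξ 2⁆, ξ 1, ξ 3] -
      ω.ev W h ![⁅ξ 0, ξ 3⁆, ξ 1, ξ 2] - ω.ev W h ![⁅ξ 1, ξ 2⁆, ξ 0, ξ 3] +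
      ω.ev W h ![⁅ξ 1, ξ 3⁆, ξ 0, ξ 2] - ω.ev W h ![⁅ξ 2, ξ 3⁆, ξ 0, ξ 1] := by
  have e1 : ∀ i : Fin 4,
      i.removeNth ξ = ![ξ (i.succAbove 0), ξ (i.succAbove 1), ξ (i.succAbove 2)] := by
    intro i
    funext j
    fin_cases j <;> rfl
  have e2 : ∀ (i : Fin 4) (j : Fin 3) (x : VF O W),
      (Fin.cons x (j.removeNth (i.removeNth ξ)) : Fin 3 → VF O W) =
        ![x, ξ (i.succAbove (j.succAbove 0)), ξ (i.succAbove (j.succAbove 1))] := by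
    intro i j x
    funext l
    fin_cases l <;> rfl
  simp only [extD, e2]
  simp only [e1]
  simp [Fin.sum_univ_three, Fin.sum_univ_four, Fin.succAbove]
  ring

end Form

end

section

variable {O : TopCat.Sheaf (CommAlgCat.{u} ℂ) X} {U : Opens X}

open AlgebroidData

/-! ### Connections -/

namespace Connection

variable {Q : Extension (tangent O) U}

theorem pair_br_swap (h : Q.E.IsAlg 0) (D : Connection Q) {V : Opens X} (hV : V ≤ U)
    (ξ η ζ : VF O V) : Q.E.pair hV (D.toFun hV ξ) (Q.E.br hV (D.toFun hV η) (D.toFun hV ζ)) =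
      -Q.E.pair hV (D.toFun hV ξ) (Q.E.br hV (D.toFun hV ζ) (D.toFun hV η)) := by
  rw [eq_neg_iff_add_eq_zero, ← map_add, h.br_symm, D.isotropic, map_zero, map_zero]

theorem pair_br_swap_outer (h : Q.E.IsAlg 0) (D : Connection Q) {V : Opens X} (hV : V ≤ U)
    (ξ η ζ : VF O V) : Q.E.pair hV (D.toFun hV ξ) (Q.E.br hV (D.toFun hV η) (D.toFun hV ζ)) =
      -Q.E.pair hV (D.toFun hV ζ) (Q.E.br hV (D.toFun hV η) (D.toFun hV ξ)) := by
  have := h.pair_inv hV (D.toFun hV η) (D.toFun hV ζ) (D.toFun hV ξ)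
  rw [D.isotropic, VF.app_zero, h.pair_symm] at this
  rw [eq_neg_iff_add_eq_zero, ← this]

/-- The curvature. -/
def curvature (h : Q.E.IsAlg 0) (D : Connection Q) : Form O 3 U :=
  -- The term ⟨∇ξ, ∇[η, ζ]⟩ is zero by isotropy. Linearity over functions is needed only in ξ, where
  -- it is clear; antisymmetry transports it to the other arguments.
  Form.ofThree (fun _ hV ξ η ζ =>
      Q.E.pair hV (D.toFun hV ξ) (Q.E.br hV (D.toFun hV η) (D.toFun hV ζ)))
    (fun V hV ξ ξ' η ζ => by rw [map_add, map_add, LinearMap.add_apply])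
    (fun V hV f ξ η ζ => by rw [D.map_smul, h.pair_act, zero_smul, sub_zero])
    (fun V hV ξ η ζ => by
      rw [pair_br_swap h D hV ξ, pair_br_swap_outer h D hV ξ, pair_br_swap h D hV η, neg_neg])
    (fun V hV ξ η ζ => pair_br_swap h D hV ξ η ζ)
    (fun V W hV hW ξ η ζ => by rw [Q.E.res_pair hV, Q.E.res_br hV, D.map_res, D.map_res, D.map_res])

theorem curvature_ev (h : Q.E.IsAlg 0) (D : Connection Q) {V : Opens X} (hV : V ≤ U)
    (ξ : Fin 3 → VF O V) : (D.curvature h).ev V hV ξ =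
      Q.E.pair hV (D.toFun hV (ξ 0)) (Q.E.br hV (D.toFun hV (ξ 1)) (D.toFun hV (ξ 2))) := rfl

theorem hasCurvature_curvature (h : Q.E.IsAlg 0) (D : Connection Q) :
    D.HasCurvature (D.curvature h) := fun hV ξ => by
  rw [map_sub, D.isotropic, sub_zero]
  rfl

theorem HasCurvature.eq_curvature (h : Q.E.IsAlg 0) {D : Connection Q} {H : Form O 3 U}
    (hH : D.HasCurvature H) : H = D.curvature h :=
  Form.ext_ev fun _ hW ξ => (hH hW ξ).trans (hasCurvature_curvature h D hW ξ).symm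

/-- The sections [∇ξ, ∇η] − ∇[ξ, η] and [∇ξ', ∇η'] − ∇[ξ', η'] belong to Ω and are orthogonal.
Expanding their pairing gives the formula. -/
theorem pair_br_br (h : Q.E.IsAlg 0) (D : Connection Q) {V : Opens X} (hV : V ≤ U)
    (ξ η ξ' η' : VF O V) :
    Q.E.pair hV (Q.E.br hV (D.toFun hV ξ) (D.toFun hV η))
      (Q.E.br hV (D.toFun hV ξ') (D.toFun hV η')) =
    (D.curvature h).ev V hV ![⁅ξ, η⁆, ξ', η'] + (D.curvature h).ev V hV ![⁅ξ', η'⁆, ξ, η] := by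
  have key := Extension.pair_eq_zero h
    (Q.E.br hV (D.toFun hV ξ) (D.toFun hV η) - D.toFun hV ⁅ξ, η⁆)
    (Q.E.br hV (D.toFun hV ξ') (D.toFun hV η') - D.toFun hV ⁅ξ', η'⁆)
    (Extension.proj_tangent_eq_zero (by
      rw [map_sub, h.anchor_br, D.anchor_toFun, D.anchor_toFun, D.anchor_toFun, sub_self]))
    (by rw [map_sub, h.anchor_br, D.anchor_toFun, D.anchor_toFun, D.anchor_toFun, sub_self])
  rw [map_sub, map_sub, LinearMap.sub_apply, LinearMap.sub_apply, D.isotropic,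
    h.pair_symm hV _ (D.toFun hV ⁅ξ', η'⁆)] at key
  rw [curvature_ev, curvature_ev]
  simp only [Matrix.cons_val]
  linear_combination key

/-- The Leibniz identity for ∇ξ₀, ∇ξ₁, ∇ξ₂ is paired with ∇ξ₃. Invariance of the pairing turns
iterated brackets into derivatives of values of the curvature and pairings of two brackets; the
latter are evaluated by `pair_br_br`. The outcome is Cartan's formula for the exterior derivative.
-/
theorem curvature_isClosed (h : Q.E.IsAlg 0) (D : Connection Q) : (D.curvature h).IsClosed := by
  intro V hV ξ
  rw [Form.extD_three]
  set e := fun i => D.toFun hV (ξ i) with he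
  have hx : ∀ i, Q.E.anchor hV (e i) = ξ i := fun i => D.anchor_toFun hV _
  have hH : ∀ i j k, (D.curvature h).ev V hV ![ξ i, ξ j, ξ k] =
      Q.E.pair hV (e i) (Q.E.br hV (e j) (e k)) := fun i j k => rfl
  have hb : ∀ i j k l, Q.E.pair hV (Q.E.br hV (e i) (e j)) (Q.E.br hV (e k) (e l)) =
      (D.curvature h).ev V hV ![⁅ξ i, ξ j⁆, ξ k, ξ l] +
        (D.curvature h).ev V hV ![⁅ξ k, ξ l⁆, ξ i, ξ j] := fun i j k l => pair_br_br h D hV _ _ _ _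
  have hi : ∀ i j k l, (ξ i).app (Q.E.pair hV (e j) (Q.E.br hV (e k) (e l))) =
      Q.E.pair hV (Q.E.br hV (e i) (e j)) (Q.E.br hV (e k) (e l)) +
        Q.E.pair hV (e j) (Q.E.br hV (e i) (Q.E.br hV (e k) (e l))) := fun i j k l => by
    rw [← hx i, h.pair_inv]
  -- The bracket is not antisymmetric: exchanging the arguments adds ∂⟨e₂, [e₀, e₁]⟩, whose pairing
  -- with e₃ is a derivative along ξ₃.
  have hs : Q.E.pair hV (e 3) (Q.E.br hV (Q.E.br hV (e 0) (e 1)) (e 2)) =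
      -Q.E.pair hV (e 3) (Q.E.br hV (e 2) (Q.E.br hV (e 0) (e 1))) +
        (ξ 3).app (Q.E.pair hV (e 2) (Q.E.br hV (e 0) (e 1))) := by
    rw [← hx 3, ← h.pair_der, h.pair_symm hV (e 2), ← h.br_symm, map_add]
    ring
  have hL := congrArg (Q.E.pair hV (e 3)) (h.leibniz hV (e 0) (e 1) (e 2))
  rw [map_add, hs] at hL
  have s1 : ∀ i j k, (D.curvature h).ev V hV ![ξ i, ξ j, ξ k] =
      -(D.curvature h).ev V hV ![ξ j, ξ i, ξ k] := fun i j k => Form.ev_swap_left _ _ _ _ _ _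
  have s2 : ∀ i j k, (D.curvature h).ev V hV ![ξ i, ξ j, ξ k] =
      -(D.curvature h).ev V hV ![ξ i, ξ k, ξ j] := fun i j k => Form.ev_swap_right _ _ _ _ _ _
  have c1 : (D.curvature h).ev V hV ![ξ 1, ξ 2, ξ 3] = (D.curvature h).ev V hV ![ξ 3, ξ 1, ξ 2] := by
    rw [s2, s1, neg_neg]
  have c2 : (D.curvature h).ev V hV ![ξ 0, ξ 2, ξ 3] = (D.curvature h).ev V hV ![ξ 3, ξ 0, ξ 2] := by
    rw [s2, s1, neg_neg]
  have c3 : (D.curvature h).ev V hV ![ξ 0, ξ 1, ξ 3] = (D.curvature h).ev V hV ![ξ 3, ξ 0, ξ 1] := by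
    rw [s2, s1, neg_neg]
  have c4 : (D.curvature h).ev V hV ![ξ 0, ξ 1, ξ 2] = (D.curvature h).ev V hV ![ξ 2, ξ 0, ξ 1] := by
    rw [s2, s1, neg_neg]
  have d1 := hb 0 3 1 2
  have d2 := hb 1 3 0 2
  have d3 := hb 2 3 0 1
  have i1 := hi 0 3 1 2
  have i2 := hi 1 3 0 2
  have i3 := hi 2 3 0 1
  rw [c1, c2, c3, c4, hH, hH, hH, hH]
  linear_combination i1 - i2 + i3 + hL + d1 - d2 + d3

/-- The connection given by isotropic lifts of the coordinate vector fields. -/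
def ofLifts (h : Q.E.IsAlg 0) {n : ℕ} {t : Fin n → Sec O U} {D : Fin n → VF O U} (ht : IsChart t D)
    (d : Fin n → Q.E.sec U le_rfl) (hd : ∀ i, Q.E.anchor le_rfl (d i) = D i)
    (hdd : ∀ i j, Q.E.pair le_rfl (d i) (d j) = 0) : Connection Q where
  toFun {V} hV :=
    { toFun := fun ξ : VF O V =>
        ∑ i, Q.E.act hV (ξ.app (rs O hV (t i))) (Q.E.res le_rfl hV (d i))
      map_add' := fun ξ η => by simp [Finset.sum_add_distrib]
      map_smul' := fun c ξ => by simp [Finset.smul_sum] }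
  map_res {V W} hV hW ξ := by
    simp only [LinearMap.coe_mk, AddHom.coe_mk, map_sum, Q.E.res_act hV, Q.E.res_res, VF.rs_app,
      rs_rs]
  map_smul {V} hV f ξ := by
    simp only [LinearMap.coe_mk, AddHom.coe_mk, map_sum]
    refine Finset.sum_congr rfl fun i _ => ?_
    have := h.assoc hV f (ξ.app (rs O hV (t i))) (Q.E.res le_rfl hV (d i))
    rw [zero_smul, sub_eq_zero] at this
    rw [VF.smul_app]
    exact this.symm
  anchor_toFun {V} hV ξ := by
    simp only [LinearMap.coe_mk, AddHom.coe_mk, map_sum, h.anchor_act, ← Q.E.res_anchor, hd]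
    exact (ht.2 V hV ξ).symm
  isotropic {V} hV ξ η := by
    simp only [LinearMap.coe_mk, AddHom.coe_mk, map_sum, LinearMap.sum_apply]
    refine Finset.sum_eq_zero fun i _ => Finset.sum_eq_zero fun j _ => ?_
    rw [h.pair_act, h.pair_symm, h.pair_act, ← Q.E.res_pair le_rfl, hdd]
    simp

/-- An exact Courant algebroid has connections locally. -/
theorem exists_local (hX : HasLocalCoordinates O) (h : Q.E.IsAlg 0) {p : X} (hp : p ∈ U) :
    ∃ (W : Opens X) (hW : W ≤ U), p ∈ W ∧ Nonempty (Connection (Q.restrict hW)) := by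
  obtain ⟨Y, hY, hpY, n, t, D, ht⟩ := hX.exists_chart U p hp
  obtain ⟨W, hWY, hpW, hd⟩ := exists_common_nhd hpY (fun i (W : Opens X) => ∃ (hW : W ≤ Y)
    (d : Q.E.sec W (hW.trans hY)), Q.E.anchor _ d = VF.res hW (D i))
    (by
      rintro i W Z hZ ⟨hW, d, hd⟩
      exact ⟨hZ.trans hW, Q.E.res _ hZ d, by rw [← Q.E.res_anchor, hd, VF.res_res']⟩)
    (fun i => by
      obtain ⟨W, hW, d, hpW, hd⟩ := Extension.exists_lift (tangent_isTransitive O) Q hY (D i) p hpY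
      exact ⟨W, hW, hpW, hW, d, hd⟩)
  choose hW d hd using hd
  have ht' := ht.res hWY
  have hWU : W ≤ U := hWY.trans hY
  -- The lifts dᵢ need not be isotropic. The section wᵢ = ∑ gᵢⱼ dtⱼ of Ω is built from their Gram
  -- matrix so that ⟨wᵢ, dⱼ⟩ = gᵢⱼ, while ⟨wᵢ, wⱼ⟩ = 0. As g is symmetric, dᵢ − wᵢ/2 is isotropic.
  let g (i j : Fin n) : Sec O W := Q.E.pair hWU (d i) (d j)
  let w (i : Fin n) : Q.E.sec W hWU := Q.E.om hWU (g i) fun j => rs O hWY (t j)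
  have hw : ∀ i, Q.E.anchor hWU (w i) = 0 := fun i => h.anchor_om _ _
  have h1 : ∀ i j, Q.E.pair hWU (w i) (d j) = g i j := fun i j => by
    rw [h.pair_om, hd]
    refine (Finset.sum_eq_single j (fun k _ hk => ?_) (by simp)).trans ?_
    · rw [ht'.1, if_neg hk.symm, mul_zero]
    · rw [ht'.1, if_pos rfl, mul_one]
  have h2 : ∀ i j, Q.E.pair hWU (w i) (w j) = 0 := fun i j => by
    rw [h.pair_om, hw]
    simp
  refine ⟨W, hWU, hpW, ⟨ofLifts (Q := Q.restrict hWU) (h.restrict hWU) ht'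
    (fun i => d i - (2⁻¹ : ℂ) • w i) (fun i => ?_) fun i j => ?_⟩⟩
  · change Q.E.anchor hWU (d i - (2⁻¹ : ℂ) • w i) = _
    rw [map_sub, _root_.map_smul, hw, hd, smul_zero, sub_zero]
  · change Q.E.pair hWU (d i - (2⁻¹ : ℂ) • w i) (d j - (2⁻¹ : ℂ) • w j) = 0
    simp only [map_sub, _root_.map_smul, LinearMap.sub_apply, LinearMap.smul_apply, h1, h2,
      h.pair_symm hWU (d i) (w j)]
    have : g j i = g i j := h.pair_symm _ _ _
    rw [this, smul_zero, sub_zero]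
    change g i j - (2⁻¹ : ℂ) • g i j - (2⁻¹ : ℂ) • g i j = 0
    rw [sub_sub, ← add_smul]
    norm_num

end Connection

end

section

variable {O : TopCat.Sheaf (CommAlgCat.{u} ℂ) X}

open AlgebroidData

/-! ### Twisted morphisms -/

/-- A map of extensions over `W` which preserves the pairing and the projection, but not
necessarily the bracket. -/
structure Twist {A : LieAlgebroidData O} {U₁ U₂ W : Opens X} (h₁ : W ≤ U₁) (h₂ : W ≤ U₂)
    (E : Extension A U₁) (F : Extension A U₂) where
  toFun : ∀ {V : Opens X} (hV : V ≤ W), E.E.sec V (hV.trans h₁) →ₗ[ℂ] F.E.sec V (hV.trans h₂)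
  map_res : ∀ {V V' : Opens X} (hV : V ≤ W) (h : V' ≤ V) (x : E.E.sec V (hV.trans h₁)),
    F.E.res (hV.trans h₂) h (toFun hV x) = toFun (h.trans hV) (E.E.res (hV.trans h₁) h x)
  proj_toFun : ∀ {V : Opens X} (hV : V ≤ W) (x : E.E.sec V (hV.trans h₁)),
    F.proj (hV.trans h₂) (toFun hV x) = E.proj (hV.trans h₁) x
  pair_toFun : ∀ {V : Opens X} (hV : V ≤ W) (x y : E.E.sec V (hV.trans h₁)),
    F.E.pair (hV.trans h₂) (toFun hV x) (toFun hV y) = E.E.pair (hV.trans h₁) x y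

namespace Twist

variable {A : LieAlgebroidData O} {U₁ U₂ U₃ W : Opens X} {h₁ : W ≤ U₁} {h₂ : W ≤ U₂}
  {h₃ : W ≤ U₃} {E : Extension A U₁} {F : Extension A U₂} {G : Extension A U₃} {c : ℂ}

theorem anchor_toFun (φ : Twist h₁ h₂ E F) {V : Opens X} (hV : V ≤ W)
    (x : E.E.sec V (hV.trans h₁)) :
    F.E.anchor (hV.trans h₂) (φ.toFun hV x) = E.E.anchor (hV.trans h₁) x := by
  rw [← F.anchor_proj, φ.proj_toFun, E.anchor_proj]

/-- The composition. -/
def comp (ψ : Twist h₂ h₃ F G) (φ : Twist h₁ h₂ E F) : Twist h₁ h₃ E G where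
  toFun hV := ψ.toFun hV ∘ₗ φ.toFun hV
  map_res hV h x := by
    simp only [LinearMap.comp_apply, ψ.map_res, φ.map_res]
  proj_toFun hV x := by simp only [LinearMap.comp_apply, ψ.proj_toFun, φ.proj_toFun]
  pair_toFun hV x y := by simp only [LinearMap.comp_apply, ψ.pair_toFun, φ.pair_toFun]

theorem comp_toFun (ψ : Twist h₂ h₃ F G) (φ : Twist h₁ h₂ E F) {V : Opens X} (hV : V ≤ W)
    (x : E.E.sec V (hV.trans h₁)) : (ψ.comp φ).toFun hV x = ψ.toFun hV (φ.toFun hV x) := rfl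

/-- The restriction to a smaller open set. -/
def restrict (φ : Twist h₁ h₂ E F) {W' : Opens X} (h : W' ≤ W) :
    Twist (h.trans h₁) (h.trans h₂) E F where
  toFun hV := φ.toFun (hV.trans h)
  map_res hV := φ.map_res (hV.trans h)
  proj_toFun hV := φ.proj_toFun (hV.trans h)
  pair_toFun hV := φ.pair_toFun (hV.trans h)

/-- The failure of `φ` to preserve brackets is given by the 3-form `H`. -/
def HasTorsion (φ : Twist h₁ h₂ E F) (H : Form O 3 W) : Prop :=
  ∀ (V : Opens X) (hV : V ≤ W) (x y z : E.E.sec V (hV.trans h₁)),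
    F.E.pair (hV.trans h₂) (F.E.br (hV.trans h₂) (φ.toFun hV x) (φ.toFun hV y)) (φ.toFun hV z) -
      E.E.pair (hV.trans h₁) (E.E.br (hV.trans h₁) x y) z =
    H.ev V hV ![E.E.anchor _ z, E.E.anchor _ x, E.E.anchor _ y]

theorem HasTorsion.comp {ψ : Twist h₂ h₃ F G} {φ : Twist h₁ h₂ E F} {H H' : Form O 3 W}
    (hψ : ψ.HasTorsion H') (hφ : φ.HasTorsion H) : (ψ.comp φ).HasTorsion (H + H') := by
  intro V hV x y z
  have e1 := hψ V hV (φ.toFun hV x) (φ.toFun hV y) (φ.toFun hV z)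
  simp only [anchor_toFun] at e1
  rw [Form.add_ev, ← hφ V hV x y z, ← e1]
  simp only [comp_toFun]
  ring

theorem HasTorsion.restrict {φ : Twist h₁ h₂ E F} {H : Form O 3 W} (hφ : φ.HasTorsion H)
    {W' : Opens X} (h : W' ≤ W) : (φ.restrict h).HasTorsion (H.res h) :=
  fun V hV => hφ V (hV.trans h)

/-- The difference of `φ` and `ψ` is given by the 2-form `b`. -/
def HasDifference (φ ψ : Twist h₁ h₂ E F) (b : Form O 2 W) : Prop :=
  ∀ (V : Opens X) (hV : V ≤ W) (x : E.E.sec V (hV.trans h₁)) (e : F.E.sec V (hV.trans h₂)),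
    F.E.pair (hV.trans h₂) (φ.toFun hV x - ψ.toFun hV x) e =
      b.ev V hV ![E.E.anchor _ x, F.E.anchor _ e]

theorem HasDifference.restrict {φ ψ : Twist h₁ h₂ E F} {b : Form O 2 W} (h : HasDifference φ ψ b)
    {W' : Opens X} (h' : W' ≤ W) : HasDifference (φ.restrict h') (ψ.restrict h') (b.res h') :=
  fun V hV => h V (hV.trans h')

theorem HasDifference.trans {φ ψ χ : Twist h₁ h₂ E F} {b b' : Form O 2 W}
    (h : HasDifference φ ψ b) (h' : HasDifference ψ χ b') : HasDifference φ χ (b + b') := by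
  intro V hV x e
  rw [Form.add_ev, ← h V hV x e, ← h' V hV x e, ← LinearMap.add_apply, ← map_add, sub_add_sub_cancel]

theorem HasDifference.comp_right {φ ψ : Twist h₂ h₃ F G} {b : Form O 2 W}
    (h : HasDifference φ ψ b) (χ : Twist h₁ h₂ E F) :
    HasDifference (φ.comp χ) (ψ.comp χ) b := by
  intro V hV x e
  have := h V hV (χ.toFun hV x) e
  rwa [anchor_toFun] at this

theorem proj_sub (φ ψ : Twist h₁ h₂ E F) {V : Opens X} (hV : V ≤ W)
    (x : E.E.sec V (hV.trans h₁)) : F.proj (hV.trans h₂) (φ.toFun hV x - ψ.toFun hV x) = 0 := by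
  rw [map_sub, φ.proj_toFun, ψ.proj_toFun, sub_self]

/-- The difference takes values in Ω, so e may be replaced by χ(e') with the same anchor, and χ
preserves pairings. The 2-form is unchanged by composition on either side, which is what makes
diagrams of twists computable. -/
theorem HasDifference.comp_left (htrans : A.IsTransitive) (hG : G.E.IsAlg c)
    {φ ψ : Twist h₁ h₂ E F} {b : Form O 2 W}
    (h : HasDifference φ ψ b) (χ : Twist h₂ h₃ F G) :
    HasDifference (χ.comp φ) (χ.comp ψ) b := by
  intro V hV x e
  refine sec_ext fun p hp => ?_
  obtain ⟨Z, hZ, e', hpZ, he'⟩ := Extension.exists_lift htrans F (hV.trans h₂)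
    (G.E.anchor _ e) p hp
  refine ⟨Z, hZ, hpZ, ?_⟩
  rw [G.E.res_pair (hV.trans h₃), Form.rs_ev, map_sub, map_res, map_res]
  have h1 : G.E.anchor ((hZ.trans hV).trans h₃) (G.E.res (hV.trans h₃) hZ e) =
      G.E.anchor ((hZ.trans hV).trans h₃) (χ.toFun (hZ.trans hV) e') := by
    rw [anchor_toFun, he', ← G.E.res_anchor]
  rw [Extension.pair_congr' hG _ _ _ (proj_sub _ _ _ _) h1, comp_toFun, comp_toFun, ← map_sub,
    χ.pair_toFun, h _ (hZ.trans hV), he']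
  congr 1
  funext i
  fin_cases i
  · exact (E.E.res_anchor _ _ _).symm
  · rfl

theorem HasDifference.unique (htrans : A.IsTransitive) {φ ψ : Twist h₁ h₂ E F} {b b' : Form O 2 W}
    (h : HasDifference φ ψ b) (h' : HasDifference φ ψ b') : b = b' := by
  refine Form.ext_ev fun V hV ξ => sec_ext fun p hp => ?_
  obtain ⟨Z, hZ, x, hpZ, hx⟩ := Extension.exists_lift htrans E (hV.trans h₁) (ξ 0) p hp
  obtain ⟨Y, hY, e, hpY, he⟩ := Extension.exists_lift htrans F ((hZ.trans hV).trans h₂)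
    (VF.res hZ (ξ 1)) p hpZ
  refine ⟨Y, hY.trans hZ, hpY, ?_⟩
  have key := (h _ ((hY.trans hZ).trans hV) (E.E.res _ hY x) e).symm.trans
    (h' _ ((hY.trans hZ).trans hV) (E.E.res _ hY x) e)
  have hξ : (fun i => VF.res (hY.trans hZ) (ξ i)) =
      ![E.E.anchor (((hY.trans hZ).trans hV).trans h₁) (E.E.res _ hY x),
        F.E.anchor (((hY.trans hZ).trans hV).trans h₂) e] := by
    funext i
    fin_cases i
    · refine Eq.trans ?_ (E.E.res_anchor _ hY x)
      rw [hx, VF.res_res']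
      rfl
    · exact he.symm
  rw [Form.rs_ev, Form.rs_ev, hξ]
  exact key

/-- The anchor as an epimorphism of sheaves. -/
def anchorEpi (htrans : A.IsTransitive) (E : Extension A U₁) (h : W ≤ U₁) :
    ModPsh.Epi (E.restrict h).E.psh (vfPsh O W) where
  app hV := E.E.anchor (hV.trans h)
  app_res hV := E.E.res_anchor (hV.trans h)
  surj hV ξ p hp := by
    obtain ⟨Z, hZ, x, hpZ, hx⟩ := Extension.exists_lift htrans E (hV.trans h) ξ p hp
    exact ⟨Z, hZ, x, hpZ, hx⟩

/-- The pairing with the difference of two twisted morphisms. -/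
def pairSub (φ ψ : Twist h₁ h₂ E F) {V : Opens X} (hV : V ≤ W) :
    E.E.sec V (hV.trans h₁) →ₗ[ℂ] F.E.sec V (hV.trans h₂) →ₗ[ℂ] Sec O V :=
  F.E.pair (hV.trans h₂) ∘ₗ (φ.toFun hV - ψ.toFun hV)

theorem pairSub_apply (φ ψ : Twist h₁ h₂ E F) {V : Opens X} (hV : V ≤ W)
    (x : E.E.sec V (hV.trans h₁)) (e : F.E.sec V (hV.trans h₂)) :
    pairSub φ ψ hV x e = F.E.pair (hV.trans h₂) (φ.toFun hV x - ψ.toFun hV x) e := rfl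

theorem rs_pairSub (φ ψ : Twist h₁ h₂ E F) {V V' : Opens X} (hV : V ≤ W) (h : V' ≤ V)
    (x : E.E.sec V (hV.trans h₁)) (e : F.E.sec V (hV.trans h₂)) :
    rs O h (pairSub φ ψ hV x e) =
      pairSub φ ψ (h.trans hV) (E.E.res (hV.trans h₁) h x) (F.E.res (hV.trans h₂) h e) := by
  rw [pairSub_apply, pairSub_apply, F.E.res_pair (hV.trans h₂), map_sub, φ.map_res, ψ.map_res]

/-- Both sides are ⟨φ(x), ψ(z)⟩ − ⟨x, z⟩, since φ and ψ preserve the pairing. This is the source of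
the antisymmetry of the 2-form. -/
theorem pairSub_toFun (hF : F.E.IsAlg c) (φ ψ : Twist h₁ h₂ E F) {V : Opens X} (hV : V ≤ W)
    (x z : E.E.sec V (hV.trans h₁)) :
    pairSub φ ψ hV x (ψ.toFun hV z) = -pairSub φ ψ hV z (φ.toFun hV x) := by
  simp only [pairSub_apply, map_sub, LinearMap.sub_apply, φ.pair_toFun, ψ.pair_toFun,
    hF.pair_symm _ (ψ.toFun hV z)]
  have : F.E.pair (hV.trans h₂) (φ.toFun hV z) (φ.toFun hV x) = E.E.pair _ x z := by
    rw [hF.pair_symm, φ.pair_toFun]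
  rw [φ.pair_toFun] at this
  rw [this]
  ring

theorem pairSub_congr (hF : F.E.IsAlg c) (φ ψ : Twist h₁ h₂ E F) {V : Opens X} (hV : V ≤ W)
    (x : E.E.sec V (hV.trans h₁)) {e e' : F.E.sec V (hV.trans h₂)}
    (h : F.E.anchor _ e = F.E.anchor _ e') : pairSub φ ψ hV x e = pairSub φ ψ hV x e' :=
  Extension.pair_congr' hF _ _ _ (proj_sub _ _ _ _) h

/-- φ(x) − ψ(x) lies in Ω, so its pairing with e depends only on the anchor of e. By `pairSub_toFun`
it also depends only on the anchor of x, and thus descends to a pair of vector fields. It is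
𝒪-linear in the second one because no anomaly occurs on Ω, and in the first by antisymmetry. -/
theorem exists_difference (htrans : A.IsTransitive) (hF : F.E.IsAlg c)
    (φ ψ : Twist h₁ h₂ E F) : ∃ b, HasDifference φ ψ b := by
  obtain ⟨L, hLres, hL⟩ := (secPsh_isSheaf O W).exists_desc₂ (anchorEpi htrans E h₁)
    (anchorEpi htrans F h₂) (fun hV => pairSub φ ψ hV) (fun hV h x y => rs_pairSub φ ψ hV h x y)
    (by
      intro V hV x y hx
      refine sec_ext fun p hp => ?_
      obtain ⟨Z, hZ, z, hpZ, hz⟩ := Extension.exists_lift htrans E (hV.trans h₁)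
        (F.E.anchor (hV.trans h₂) y) p hp
      refine ⟨Z, hZ, hpZ, ?_⟩
      -- Replacing `y` by ψ(z) with the same anchor turns the pairing into one against φ(x), which
      -- has no anchor.
      rw [rs_pairSub, map_zero, pairSub_congr hF φ ψ _ _ (e' := ψ.toFun (hZ.trans hV) z),
        pairSub_toFun hF, neg_eq_zero, pairSub_congr hF φ ψ _ _ (e' := 0)]
      · exact map_zero _
      · rw [anchor_toFun, ← E.E.res_anchor, map_zero]
        exact (congrArg (VF.res hZ) hx).trans (map_zero _)
      · rw [anchor_toFun, hz, ← F.E.res_anchor])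
    (by
      intro V hV x y hy
      rw [pairSub_congr hF φ ψ hV x (e' := 0) (hy.trans (map_zero _).symm), map_zero])
  have lift : ∀ {V : Opens X} (hV : V ≤ W) (ξ η : VF O V), ∀ p ∈ V,
      ∃ (Z : Opens X) (hZ : Z ≤ V) (x y : E.E.sec Z ((hZ.trans hV).trans h₁)), p ∈ Z ∧
        E.E.anchor _ x = VF.res hZ ξ ∧ E.E.anchor _ y = VF.res hZ η := by
    intro V hV ξ η p hp
    obtain ⟨Z, hZ, x, hpZ, hx⟩ := Extension.exists_lift htrans E (hV.trans h₁) ξ p hp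
    obtain ⟨Y, hY, y, hpY, hy⟩ := Extension.exists_lift htrans E ((hZ.trans hV).trans h₁)
      (VF.res hZ η) p hpZ
    exact ⟨Y, hY.trans hZ, E.E.res _ hY x, y, hpY, by rw [← E.E.res_anchor, hx, VF.res_res'], hy⟩
  have hLr : ∀ (V V' : Opens X) (hV : V ≤ W) (h : V' ≤ V) (ξ η : VF O V),
      rs O h (L hV ξ η) = L (h.trans hV) (VF.res h ξ) (VF.res h η) := fun V V' hV h ξ η =>
    hLres hV h ξ η
  have hL' : ∀ {V : Opens X} (hV : V ≤ W) (x : E.E.sec V (hV.trans h₁))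
      (e : F.E.sec V (hV.trans h₂)), L hV (E.E.anchor _ x) (F.E.anchor _ e) =
        pairSub φ ψ hV x e := fun hV x e => hL hV x e
  have hswap : ∀ (V : Opens X) (hV : V ≤ W) (ξ η : VF O V), L hV ξ η = -L hV η ξ := by
    intro V hV ξ η
    refine sec_ext fun p hp => ?_
    obtain ⟨Z, hZ, x, y, hpZ, hx, hy⟩ := lift hV ξ η p hp
    refine ⟨Z, hZ, hpZ, ?_⟩
    rw [map_neg, hLr, hLr, ← hx, ← hy]
    have e1 := hL' (hZ.trans hV) x (ψ.toFun (hZ.trans hV) y)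
    have e2 := hL' (hZ.trans hV) y (φ.toFun (hZ.trans hV) x)
    rw [anchor_toFun] at e1 e2
    rw [e1, e2, pairSub_toFun hF]
  have hsmul : ∀ (V : Opens X) (hV : V ≤ W) (f : Sec O V) (ξ η : VF O V),
      L hV ξ (f • η) = f * L hV ξ η := by
    intro V hV f ξ η
    refine sec_ext fun p hp => ?_
    obtain ⟨Z, hZ, x, y, hpZ, hx, hy⟩ := lift hV ξ η p hp
    refine ⟨Z, hZ, hpZ, ?_⟩
    rw [map_mul, hLr, hLr, VF.res_smul, ← hx, ← hy]
    have e1 := hL' (hZ.trans hV) x (ψ.toFun (hZ.trans hV) y)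
    have e2 := hL' (hZ.trans hV) x (F.E.act _ (rs O hZ f) (ψ.toFun (hZ.trans hV) y))
    rw [hF.anchor_act, anchor_toFun] at e2
    rw [anchor_toFun] at e1
    rw [e1, e2, pairSub_apply, pairSub_apply, hF.pair_symm, hF.pair_act, hF.pair_symm,
      Extension.anchor_eq_zero _ (proj_sub φ ψ _ _), VF.zero_app, VF.app_zero, smul_zero, sub_zero]
  refine ⟨Form.ofTwo (fun V hV ξ η => L hV ξ η) (fun V hV ξ ξ' η => ?_) (fun V hV f ξ η => ?_)
    hswap hLr, fun V hV x e => (hL' hV x e).symm⟩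
  · exact (congrFun (congrArg _ ((L hV).map_add ξ ξ')) η)
  · rw [hswap, hsmul, hswap V hV η, mul_neg, neg_neg]

end Twist

end

/-! ### The exterior derivative of the difference of two twisted morphisms -/

section

variable {O : TopCat.Sheaf (CommAlgCat.{u} ℂ) X}

open AlgebroidData

theorem Form.ev_two {V W : Opens X} (ω : Form O 2 V) (h : W ≤ V) (ξ : Fin 2 → VF O W) :
    ω.ev W h ξ = ω.ev W h ![ξ 0, ξ 1] := by
  congr 1
  funext i
  fin_cases i <;> rfl

theorem Form.ev_three {V W : Opens X} (ω : Form O 3 V) (h : W ≤ V) (ξ : Fin 3 → VF O W) :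
    ω.ev W h ξ = ω.ev W h ![ξ 0, ξ 1, ξ 2] := by
  congr 1
  funext i
  fin_cases i <;> rfl

theorem Form.rs_ev_two {V W Z : Opens X} (ω : Form O 2 V) (h : W ≤ V) (h' : Z ≤ W)
    (ξ η : VF O W) : rs O h' (ω.ev W h ![ξ, η]) =
      ω.ev Z (h'.trans h) ![VF.res h' ξ, VF.res h' η] := by
  rw [Form.rs_ev, Form.ev_two]
  rfl

theorem Form.ev_smul_left {V W : Opens X} (ω : Form O 2 V) (h : W ≤ V) (f : Sec O W)
    (ξ η : VF O W) : ω.ev W h ![f • ξ, η] = f * ω.ev W h ![ξ, η] := by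
  have := (ω.1 ⟨W, h⟩).map_update_smul ![ξ, η] 0 f ξ
  have e : ∀ ζ : VF O W, Function.update ![ξ, η] 0 ζ = ![ζ, η] := by
    intro ζ
    funext i
    fin_cases i <;> rfl
  rwa [e, e] at this

/-- The sign is written as a scalar function so that 𝒪-linearity of forms applies to it. -/
theorem VF.bracket_swap {V : Opens X} (ξ η : VF O V) : ⁅ξ, η⁆ = (-1 : Sec O V) • ⁅η, ξ⁆ := by
  ext W h f
  rw [VF.smul_at, map_neg, map_one]
  simp [Derivation.commutator_apply]

theorem Form.rs_extD_two {V W Z : Opens X} (ω : Form O 2 V) (h : W ≤ V) (h' : Z ≤ W)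
    (ξ : Fin 3 → VF O W) : rs O h' (extD ω W h ξ) =
      extD ω Z (h'.trans h) fun i => VF.res h' (ξ i) := by
  simp only [Form.extD_two, map_add, map_sub, VF.rs_app, Form.rs_ev_two, VF.res_bracket]

namespace AlgebroidData.IsAlg

variable {A : LieAlgebroidData O} {U V : Opens X} {F : Extension A U} {c : ℂ} {hV : V ≤ U}

theorem pair_br_right (h : F.E.IsAlg c) (a b e : F.E.sec V hV) :
    F.E.pair hV (F.E.br hV a b) e =
      (F.E.anchor hV a).app (F.E.pair hV b e) - F.E.pair hV b (F.E.br hV a e) := by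
  rw [h.pair_inv, add_sub_cancel_right]

theorem pair_br_left (h : F.E.IsAlg c) (a b e : F.E.sec V hV) :
    F.E.pair hV (F.E.br hV b a) e = (F.E.anchor hV e).app (F.E.pair hV b a) -
      ((F.E.anchor hV a).app (F.E.pair hV b e) - F.E.pair hV b (F.E.br hV a e)) := by
  rw [← h.pair_br_right, ← h.pair_der, h.pair_symm hV e, ← h.br_symm, map_add, LinearMap.add_apply,
    add_sub_cancel_right]

/-- The change of `⟨[v₁, v₂], v₀⟩` under a change of the `vᵢ` by sections of the kernel of the
projection. -/
theorem pair_br_add (h : F.E.IsAlg c) (v w : Fin 3 → F.E.sec V hV)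
    (hw : ∀ i, F.proj hV (w i) = 0) :
    F.E.pair hV (F.E.br hV (v 1 + w 1) (v 2 + w 2)) (v 0 + w 0) -
      F.E.pair hV (F.E.br hV (v 1) (v 2)) (v 0) =
    F.E.pair hV (F.E.br hV (v 1) (w 2)) (v 0) + F.E.pair hV (F.E.br hV (w 1) (v 2)) (v 0) +
      F.E.pair hV (w 0) (F.E.br hV (v 1) (v 2)) := by
  have hw' : ∀ i, F.E.anchor hV (w i) = 0 := fun i => Extension.anchor_eq_zero _ (hw i)
  have b1 : ⁅F.E.anchor hV (v 1), (0 : VF O V)⁆ = 0 := by ext; simp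
  have b2 : ⁅(0 : VF O V), F.E.anchor hV (v 2)⁆ = 0 := by ext; simp
  have b3 : ∀ η : VF O V, ⁅(0 : VF O V), η⁆ = 0 := fun η => by ext; simp
  -- Terms containing two of the wᵢ vanish: a bracket with a section without anchor has no anchor,
  -- and Ω is orthogonal to such sections.
  have z1 : F.E.pair hV (w 0) (F.E.br hV (v 1) (w 2)) = 0 :=
    Extension.pair_eq_zero h _ _ (hw 0) (by rw [h.anchor_br, hw', b1])
  have z2 : F.E.pair hV (w 0) (F.E.br hV (w 1) (v 2)) = 0 :=
    Extension.pair_eq_zero h _ _ (hw 0) (by rw [h.anchor_br, hw', b2])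
  have z3 : F.E.pair hV (w 0) (F.E.br hV (w 1) (w 2)) = 0 :=
    Extension.pair_eq_zero h _ _ (hw 0) (by rw [h.anchor_br, hw', b3])
  have z4 : F.E.pair hV (F.E.br hV (w 1) (w 2)) (v 0) = 0 := by
    rw [h.pair_br_right, hw', VF.zero_app, zero_sub, neg_eq_zero]
    exact Extension.pair_eq_zero h _ _ (hw 2) (by rw [h.anchor_br, hw', b3])
  simp only [map_add, LinearMap.add_apply, h.pair_symm hV _ (w 0), z1, z2, z3, z4]
  ring

end AlgebroidData.IsAlg

namespace Twist

variable {A : LieAlgebroidData O} {U₁ U₂ W : Opens X} {h₁ : W ≤ U₁} {h₂ : W ≤ U₂}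
  {E : Extension A U₁} {F : Extension A U₂} {c : ℂ}

/-- Write φ = ψ + w with w valued in Ω. In ⟨[φx₁, φx₂], φx₀⟩ the terms of order two in w vanish, and
those of order one, rewritten by invariance, are Cartan's formula for db. The left side is the
difference of the two torsions, because the undeformed term ⟨[x₁, x₂], x₀⟩ cancels. -/
theorem HasDifference.extD_eq (htrans : A.IsTransitive) (hF : F.E.IsAlg c)
    {φ ψ : Twist h₁ h₂ E F} {b : Form O 2 W} {H H' : Form O 3 W} (h : HasDifference φ ψ b)
    (hφ : φ.HasTorsion H) (hψ : ψ.HasTorsion H') (V : Opens X) (hV : V ≤ W) (ξ : Fin 3 → VF O V) :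
    extD b V hV ξ = H.ev V hV ξ - H'.ev V hV ξ := by
  refine sec_ext fun p hp => ?_
  obtain ⟨Z, hZ, hpZ, hx⟩ := exists_common_nhd hp (fun i (Z : Opens X) => ∃ (hZ : Z ≤ V)
    (x : E.E.sec Z ((hZ.trans hV).trans h₁)), E.E.anchor _ x = VF.res hZ (ξ i))
    (by
      rintro i Y Z hZ ⟨hY, x, hx⟩
      exact ⟨hZ.trans hY, E.E.res _ hZ x, by rw [← E.E.res_anchor, hx, VF.res_res']⟩)
    (fun i => by
      obtain ⟨Z, hZ, x, hpZ, hx⟩ := Extension.exists_lift htrans E (hV.trans h₁) (ξ i) p hp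
      exact ⟨Z, hZ, hpZ, hZ, x, hx⟩)
  choose _ x hx using hx
  refine ⟨Z, hZ, hpZ, ?_⟩
  have hZW := hZ.trans hV
  rw [map_sub, Form.rs_extD_two, Form.rs_ev, Form.rs_ev, Form.ev_three H, Form.ev_three H']
  simp only [← hx]
  rw [← hφ Z hZW (x 1) (x 2) (x 0), ← hψ Z hZW (x 1) (x 2) (x 0), sub_sub_sub_cancel_right]
  have key := hF.pair_br_add (fun i => ψ.toFun hZW (x i))
    (fun i => φ.toFun hZW (x i) - ψ.toFun hZW (x i)) (fun i => proj_sub φ ψ hZW (x i))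
  simp only [add_sub_cancel] at key
  rw [key, hF.pair_br_right, hF.pair_br_left]
  simp only [h Z hZW, anchor_toFun, hF.anchor_br, Form.extD_two]
  set y := fun i => E.E.anchor (hZW.trans h₁) (x i)
  change (y 0).app (b.ev Z hZW ![y 1, y 2]) - (y 1).app (b.ev Z hZW ![y 0, y 2]) +
      (y 2).app (b.ev Z hZW ![y 0, y 1]) - b.ev Z hZW ![⁅y 0, y 1⁆, y 2] +
      b.ev Z hZW ![⁅y 0, y 2⁆, y 1] - b.ev Z hZW ![⁅y 1, y 2⁆, y 0] =
    (y 1).app (b.ev Z hZW ![y 2, y 0]) - b.ev Z hZW ![y 2, ⁅y 1, y 0⁆] +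
      ((y 0).app (b.ev Z hZW ![y 1, y 2]) -
        ((y 2).app (b.ev Z hZW ![y 1, y 0]) - b.ev Z hZW ![y 1, ⁅y 2, y 0⁆])) +
      b.ev Z hZW ![y 0, ⁅y 1, y 2⁆]
  have hbr : ∀ i j k, b.ev Z hZW ![y i, ⁅y j, y k⁆] = b.ev Z hZW ![⁅y k, y j⁆, y i] := by
    intro i j k
    rw [b.ev_swap_two, VF.bracket_swap (y k), Form.ev_smul_left, neg_one_mul]
  have e1 := b.ev_swap_two Z hZW (y 2) (y 0)
  have e2 := b.ev_swap_two Z hZW (y 1) (y 0)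
  rw [hbr, hbr, e1, e2, VF.app_neg, VF.app_neg, b.ev_swap_two _ _ (y 0), hbr]
  have e3 := b.ev_swap_two Z hZW (y 0) ⁅y 1, y 2⁆
  have e4 := hbr 0 1 2
  rw [← e4, e3]
  ring

end Twist

end

/-! ### Twisted morphisms given by sums and connections -/

section

variable {O : TopCat.Sheaf (CommAlgCat.{u} ℂ) X}

open AlgebroidData

namespace Twist

section Baer

variable {A : LieAlgebroidData O} {U₁ U₂ W : Opens X} {h₁ : W ≤ U₁} {h₂ : W ≤ U₂}
  {s : Extension A U₁} {s' : Extension A U₂} {Q : Extension (tangent O) W}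

theorem mem_fib_conn (D : Connection Q) {V : Opens X} (hV : V ≤ W)
    (x : s.E.sec V (hV.trans h₁)) :
    (x, D.toFun hV (s.E.anchor _ x)) ∈ fib (s.restrict h₁).E Q.E hV := by
  rw [mem_fib]
  exact (D.anchor_toFun hV _).symm

/-- The map `x ↦ x + ∇ π(x)`. -/
def ofBaer (σ : BaerMap 1 (s.restrict h₁) Q (s'.restrict h₂)) (D : Connection Q) :
    Twist h₁ h₂ s s' where
  toFun {V} hV := σ.toFun hV ∘ₗ LinearMap.codRestrict (fib (s.restrict h₁).E Q.E hV)
    (LinearMap.prod LinearMap.id (D.toFun hV ∘ₗ s.E.anchor (hV.trans h₁)))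
    fun x => mem_fib_conn D hV x
  map_res {V V'} hV h x := by
    refine σ.map_res hV h ⟨_, mem_fib_conn D hV x⟩ ⟨_, mem_fib_conn D (h.trans hV) _⟩ ?_
    refine Prod.ext rfl ?_
    exact ((D.map_res hV h _).trans (congrArg _ (s.E.res_anchor _ h x))).symm
  proj_toFun {V} hV x := σ.map_proj hV ⟨_, mem_fib_conn D hV x⟩
  pair_toFun {V} hV x y := by
    refine (σ.map_pair hV ⟨_, mem_fib_conn D hV x⟩ ⟨_, mem_fib_conn D hV y⟩).trans ?_
    have := D.isotropic hV (s.E.anchor (hV.trans h₁) x) (s.E.anchor (hV.trans h₁) y)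
    change s.E.pair (hV.trans h₁) x y + (1 : ℤ) • _ = _
    rw [this, smul_zero, add_zero]

theorem toFun_eq_ofBaer (σ : BaerMap 1 (s.restrict h₁) Q (s'.restrict h₂)) (D : Connection Q)
    {V : Opens X} (hV : V ≤ W) (x : fib (s.restrict h₁).E Q.E hV) (ξ : VF O V)
    (hx : x.1.2 = D.toFun hV ξ) : σ.toFun hV x = (ofBaer σ D).toFun hV x.1.1 := by
  refine BaerMap.toFun_eq σ rfl (hx.trans ?_)
  have h : (s.restrict h₁).E.anchor hV x.1.1 = Q.E.anchor hV x.1.2 := x.2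
  have : s.E.anchor (hV.trans h₁) x.1.1 = ξ := h.trans (by rw [hx, D.anchor_toFun])
  change _ = D.toFun hV (s.E.anchor (hV.trans h₁) x.1.1)
  rw [this]

/-- σ respects brackets, so the deviation comes only from the second component: it is ⟨[∇πx, ∇πy],
∇πz⟩, the curvature. -/
theorem hasTorsion_ofBaer {c : ℂ} (hs : s.E.IsAlg c) (hQ : Q.E.IsAlg 0)
    (σ : BaerMap 1 (s.restrict h₁) Q (s'.restrict h₂)) {D : Connection Q} {H : Form O 3 W}
    (hH : D.HasCurvature H) : (ofBaer σ D).HasTorsion H := by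
  intro V hV x y z
  rw [hH.eq_curvature hQ, D.curvature_ev]
  have hmem : (s.E.br (hV.trans h₁) x y,
      Q.E.br hV (D.toFun hV (s.E.anchor _ x)) (D.toFun hV (s.E.anchor _ y))) ∈
      fib (s.restrict h₁).E Q.E hV := by
    rw [mem_fib]
    refine (hs.anchor_br (hV.trans h₁) x y).trans ?_
    rw [hQ.anchor_br, D.anchor_toFun, D.anchor_toFun]
  have h1 := σ.map_br hV ⟨_, mem_fib_conn D hV x⟩ ⟨_, mem_fib_conn D hV y⟩ ⟨_, hmem⟩ rfl
  have h2 := σ.map_pair hV ⟨_, hmem⟩ ⟨_, mem_fib_conn D hV z⟩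
  rw [h1, one_smul] at h2
  rw [hQ.pair_symm hV (D.toFun hV _)]
  exact sub_eq_of_eq_add' h2

end Baer

section Comparison

variable {A : LieAlgebroidData O} {U₁ U₂ U₃ V₁ V₂ V₃ : Opens X} {h₁ : V₁ ≤ U₁} {h₁' : V₁ ≤ U₂}
  {h₂ : V₂ ≤ U₂} {h₂' : V₂ ≤ U₃} {h₃ : V₃ ≤ U₁} {h₃' : V₃ ≤ U₃} {s₁ : Extension A U₁}
  {s₂ : Extension A U₂} {s₃ : Extension A U₃} {Q₁ : Extension (tangent O) V₁}
  {Q₂ : Extension (tangent O) V₂} {Q₃ : Extension (tangent O) V₃}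

/-- The comparison of `∇₁ + ∇₂` with `∇₃`. -/
def Compares (σ₁ : BaerMap 1 (s₁.restrict h₁) Q₁ (s₂.restrict h₁'))
    (σ₂ : BaerMap 1 (s₂.restrict h₂) Q₂ (s₃.restrict h₂'))
    (σ₃ : BaerMap 1 (s₁.restrict h₃) Q₃ (s₃.restrict h₃'))
    (D₁ : Connection Q₁) (D₂ : Connection Q₂) (D₃ : Connection Q₃)
    (B : Form O 2 (V₁ ⊓ V₂ ⊓ V₃)) : Prop :=
  ∀ (W : Opens X) (ha : W ≤ V₁) (hb : W ≤ V₂) (hd : W ≤ V₃) (ξ : VF O W)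
    (x : fib (s₁.restrict h₁).E Q₁.E ha) (y : fib (s₂.restrict h₂).E Q₂.E hb)
    (z : fib (s₁.restrict h₃).E Q₃.E hd),
    x.1.2 = D₁.toFun ha ξ →
    y.1 = (σ₁.toFun ha x, D₂.toFun hb ξ) →
    z.1 = (x.1.1, D₃.toFun hd ξ) →
    s₃.E.IsIncl (hd.trans h₃')
      ((σ₂.toFun hb y : s₃.E.sec W _) - (σ₃.toFun hd z : s₃.E.sec W _))
      (fun Z hZ η => B.ev Z (hZ.trans (le_inf (le_inf ha hb) hd)) ![VF.res hZ ξ, η])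

theorem isOneForm_ev {V W : Opens X} (B : Form O 2 V) (h : W ≤ V) (ξ : VF O W) :
    IsOneForm (fun Z (hZ : Z ≤ W) η => B.ev Z (hZ.trans h) ![VF.res hZ ξ, η]) where
  map_add Z hZ η η' := by
    rw [B.ev_swap_two, B.ev_swap_two _ _ _ η, B.ev_swap_two _ _ _ η', ← neg_add]
    have := (B.1 ⟨Z, hZ.trans h⟩).map_update_add ![0, VF.res hZ ξ] 0 η η'
    have e : ∀ ζ ζ' : VF O Z, Function.update ![0, ζ'] 0 ζ = ![ζ, ζ'] := by
      intro ζ ζ'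
      funext i
      fin_cases i <;> rfl
    rw [e, e, e] at this
    exact congrArg Neg.neg this
  map_smul Z hZ f η := by
    rw [B.ev_swap_two, B.ev_swap_two _ _ _ η, B.ev_smul_left, mul_neg]
  map_res Z hZ Y hY η := by
    rw [B.rs_ev_two, VF.res_res']

/-- As σ(x, ∇ξ) is the twist applied to x, the comparison of connections says that φ₂φ₁(x) − φ₃(x)
is the image of the 1-form ι_ξ B. By `isIncl_iff_isOm` this can be tested on pairings. -/
theorem compares_iff (hA : A.IsLieAlgebroid) (htrans : A.IsTransitive) {c : ℂ}
    (hs₃ : s₃.E.IsAlg c) (σ₁ : BaerMap 1 (s₁.restrict h₁) Q₁ (s₂.restrict h₁'))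
    (σ₂ : BaerMap 1 (s₂.restrict h₂) Q₂ (s₃.restrict h₂'))
    (σ₃ : BaerMap 1 (s₁.restrict h₃) Q₃ (s₃.restrict h₃'))
    (D₁ : Connection Q₁) (D₂ : Connection Q₂) (D₃ : Connection Q₃)
    (B : Form O 2 (V₁ ⊓ V₂ ⊓ V₃)) : Compares σ₁ σ₂ σ₃ D₁ D₂ D₃ B ↔
      HasDifference (((ofBaer σ₂ D₂).restrict (inf_le_left.trans inf_le_right)).comp
        ((ofBaer σ₁ D₁).restrict (inf_le_left.trans inf_le_left)))
        ((ofBaer σ₃ D₃).restrict inf_le_right) B := by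
  constructor
  · intro h V hV x e
    have ha : V ≤ V₁ := hV.trans (inf_le_left.trans inf_le_left)
    have hb : V ≤ V₂ := hV.trans (inf_le_left.trans inf_le_right)
    have hd : V ≤ V₃ := hV.trans inf_le_right
    have hy := mem_fib_conn (h₁ := h₂) D₂ hb ((ofBaer σ₁ D₁).toFun ha x)
    rw [anchor_toFun] at hy
    have := h V ha hb hd (s₁.E.anchor _ x) ⟨_, mem_fib_conn (h₁ := h₁) D₁ ha x⟩ ⟨_, hy⟩
      ⟨_, mem_fib_conn (h₁ := h₃) D₃ hd x⟩ rfl rfl rfl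
    rw [Extension.isIncl_iff_isOm hA htrans hs₃ (isOneForm_ev B hV _)] at this
    have key := this.2 V le_rfl e
    rw [s₃.E.res_rfl] at key
    refine Eq.trans ?_ key
    have e1 : ((ofBaer σ₂ D₂).toFun hb ((ofBaer σ₁ D₁).toFun ha x)) = σ₂.toFun hb ⟨_, hy⟩ :=
      (toFun_eq_ofBaer σ₂ D₂ hb ⟨_, hy⟩ _ rfl).symm
    change s₃.E.pair _ (((ofBaer σ₂ D₂).toFun hb ((ofBaer σ₁ D₁).toFun ha x)) - _) e = _
    rw [e1]
    rfl
  · intro h W ha hb hd ξ x y z hx hy hz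
    rw [Extension.isIncl_iff_isOm hA htrans hs₃
      (isOneForm_ev B (le_inf (le_inf ha hb) hd) ξ)]
    have hW : W ≤ V₁ ⊓ V₂ ⊓ V₃ := le_inf (le_inf ha hb) hd
    have hξ : s₁.E.anchor (ha.trans h₁) x.1.1 = ξ := by
      have h' : (s₁.restrict h₁).E.anchor ha x.1.1 = Q₁.E.anchor ha x.1.2 := x.2
      exact h'.trans (by rw [hx, D₁.anchor_toFun])
    have e1 : σ₂.toFun hb y = (ofBaer σ₂ D₂).toFun hb ((ofBaer σ₁ D₁).toFun ha x.1.1) := by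
      rw [toFun_eq_ofBaer σ₂ D₂ hb y ξ (congrArg Prod.snd hy)]
      congr 1
      exact (congrArg Prod.fst hy).trans (toFun_eq_ofBaer σ₁ D₁ ha x ξ hx)
    have e2 : σ₃.toFun hd z = (ofBaer σ₃ D₃).toFun hd x.1.1 := by
      rw [toFun_eq_ofBaer σ₃ D₃ hd z ξ (congrArg Prod.snd hz)]
      congr 1
      exact congrArg Prod.fst hz
    rw [e1, e2]
    refine ⟨proj_sub (((ofBaer σ₂ D₂).restrict (inf_le_left.trans inf_le_right)).comp
        ((ofBaer σ₁ D₁).restrict (inf_le_left.trans inf_le_left)))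
        ((ofBaer σ₃ D₃).restrict inf_le_right) hW x.1.1, fun Z hZ e => ?_⟩
    have key := h Z (hZ.trans hW) (s₁.E.res (ha.trans h₁) hZ x.1.1) e
    have hξ' : VF.res hZ ξ = s₁.E.anchor _ (s₁.E.res (ha.trans h₁) hZ x.1.1) := by
      rw [← s₁.E.res_anchor, hξ]
    rw [← hξ'] at key
    refine Eq.trans ?_ key
    rw [map_sub, (((ofBaer σ₃ D₃).map_res hd hZ x.1.1)), ((ofBaer σ₂ D₂).map_res hb hZ _),
      ((ofBaer σ₁ D₁).map_res ha hZ _)]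
    rfl

end Comparison

end Twist

end

section

variable {O : TopCat.Sheaf (CommAlgCat.{u} ℂ) X} {A : LieAlgebroidData O}

open AlgebroidData

/-! ### The class of a torsor -/

/-- An identification `s₂ = s₁ + Q` on `W` with a connection on `Q`. -/
structure Link {U₁ U₂ : Opens X} (s₁ : Extension A U₁) (s₂ : Extension A U₂) (W : Opens X) where
  h₁ : W ≤ U₁
  h₂ : W ≤ U₂
  Q : Extension (tangent O) W
  hQ : isECA O W Q
  σ : BaerMap 1 (s₁.restrict h₁) Q (s₂.restrict h₂)
  D : Connection Q

namespace Link

variable {U₁ U₂ W : Opens X} {s₁ : Extension A U₁} {s₂ : Extension A U₂}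

/-- The twisted morphism. -/
def twist (l : Link s₁ s₂ W) : Twist l.h₁ l.h₂ s₁ s₂ := Twist.ofBaer l.σ l.D

/-- The curvature. -/
def curv (l : Link s₁ s₂ W) : Form O 3 W := l.D.curvature (isAlg_of_isECA l.hQ)

theorem hasTorsion {c : ℂ} (h : s₁.E.IsAlg c) (l : Link s₁ s₂ W) : l.twist.HasTorsion l.curv :=
  Twist.hasTorsion_ofBaer h (isAlg_of_isECA l.hQ) l.σ
    (Connection.hasCurvature_curvature (isAlg_of_isECA l.hQ) l.D)

theorem curv_isClosed (l : Link s₁ s₂ W) : l.curv.IsClosed :=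
  Connection.curvature_isClosed _ _

end Link

/-- The torsor property produces Q on the whole intersection, but a connection only after shrinking
around a point. This is the reason for hypercoverings in place of coverings. -/
theorem exists_link (hX : HasLocalCoordinates O) {S : ∀ U, ObjectProperty (Extension A U)}
    (hS : IsTorsor S)
    (hres : ∀ {U U' : Opens X} (h : U' ≤ U) (s : Extension A U), S U s → S U' (s.restrict h))
    {U₁ U₂ : Opens X} {s₁ : Extension A U₁} {s₂ : Extension A U₂} (hs₁ : S U₁ s₁) (hs₂ : S U₂ s₂)
    {p : X} (hp₁ : p ∈ U₁) (hp₂ : p ∈ U₂) :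
    ∃ W : Opens X, p ∈ W ∧ Nonempty (Link s₁ s₂ W) := by
  obtain ⟨Q, hQ, ⟨σ⟩⟩ := hS.essSurj (U₁ ⊓ U₂) _ _ (hres inf_le_left s₁ hs₁) (hres inf_le_right s₂ hs₂)
  obtain ⟨W, hW, hpW, ⟨D⟩⟩ := Connection.exists_local hX (isAlg_of_isECA hQ)
    (show p ∈ U₁ ⊓ U₂ from ⟨hp₁, hp₂⟩)
  exact ⟨W, hpW, ⟨⟨hW.trans inf_le_left, hW.trans inf_le_right, Q.restrict hW, hQ.restrict hW,
    σ.restrict hW, D⟩⟩⟩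

namespace Twist

variable {U₁ U₂ U₃ U₄ W : Opens X} {h₁ : W ≤ U₁} {h₂ : W ≤ U₂} {h₃ : W ≤ U₃} {h₄ : W ≤ U₄}
  {E₁ : Extension A U₁} {E₂ : Extension A U₂} {E₃ : Extension A U₃} {E₄ : Extension A U₄} {c : ℂ}

/-- φ₃₄φ₂₃φ₁₂ is compared with φ₁₄ through φ₃₄φ₁₃ and through φ₂₄φ₁₂; the two answers agree by
uniqueness. This is δB = 0. -/
theorem HasDifference.cocycle (htrans : A.IsTransitive) (hE : E₄.E.IsAlg c)
    {φ₁₂ : Twist h₁ h₂ E₁ E₂} {φ₁₃ : Twist h₁ h₃ E₁ E₃} {φ₁₄ : Twist h₁ h₄ E₁ E₄}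
    {φ₂₃ : Twist h₂ h₃ E₂ E₃} {φ₂₄ : Twist h₂ h₄ E₂ E₄} {φ₃₄ : Twist h₃ h₄ E₃ E₄}
    {b₁₂₃ b₁₂₄ b₁₃₄ b₂₃₄ : Form O 2 W} (h₁₂₃ : HasDifference (φ₂₃.comp φ₁₂) φ₁₃ b₁₂₃)
    (h₁₂₄ : HasDifference (φ₂₄.comp φ₁₂) φ₁₄ b₁₂₄) (h₁₃₄ : HasDifference (φ₃₄.comp φ₁₃) φ₁₄ b₁₃₄)
    (h₂₃₄ : HasDifference (φ₃₄.comp φ₂₃) φ₂₄ b₂₃₄) : b₁₂₃ + b₁₃₄ = b₂₃₄ + b₁₂₄ :=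
  ((h₁₂₃.comp_left htrans hE φ₃₄).trans h₁₃₄).unique htrans
    ((h₂₃₄.comp_right φ₁₂).trans h₁₂₄)

end Twist

section Existence

variable {c : ℂ} {I : Type u} {U : I → Opens X} (s : ∀ i, Extension A (U i))

/-- The hypercovering of all links between the `s i`. -/
def linkCover (cover : ∀ x : X, ∃ i, x ∈ U i)
    (hlink : ∀ i j (x : X), x ∈ U i → x ∈ U j →
      ∃ W : Opens X, x ∈ W ∧ Nonempty (Link (s i) (s j) W)) : Hypercover X where
  I := I
  U := U
  cover := cover
  -- The index is the open set and not the link itself, which lives in a larger universe. One link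
  -- is chosen afterwards for each such set.
  J i j := {W : Opens X // Nonempty (Link (s i) (s j) W)}
  V a := a.1
  V_le_left a := a.2.some.h₁
  V_le_right a := a.2.some.h₂
  cover₂ i j x hi hj := by
    obtain ⟨W, hW, h⟩ := hlink i j x hi hj
    exact ⟨⟨W, h⟩, hW⟩

variable {s}

theorem exists_linkForm (htrans : A.IsTransitive) {i j k : I} (hs : (s k).E.IsAlg c)
    {V₁ V₂ V₃ : Opens X} (a : Link (s i) (s j) V₁) (b : Link (s j) (s k) V₂)
    (d : Link (s i) (s k) V₃) : ∃ B : Form O 2 (V₁ ⊓ V₂ ⊓ V₃), Twist.HasDifference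
      ((b.twist.restrict (inf_le_left.trans inf_le_right)).comp
        (a.twist.restrict (inf_le_left.trans inf_le_left)))
      (d.twist.restrict inf_le_right) B :=
  Twist.exists_difference htrans hs _ _

/-- The 2-forms of the cocycle. -/
def linkForm (htrans : A.IsTransitive) (hs : ∀ i, (s i).E.IsAlg c) {i j k : I}
    {V₁ V₂ V₃ : Opens X} (a : Link (s i) (s j) V₁) (b : Link (s j) (s k) V₂)
    (d : Link (s i) (s k) V₃) : Form O 2 (V₁ ⊓ V₂ ⊓ V₃) :=
  (exists_linkForm htrans (hs k) a b d).choose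

theorem linkForm_spec (htrans : A.IsTransitive) (hs : ∀ i, (s i).E.IsAlg c) {i j k : I}
    {V₁ V₂ V₃ : Opens X} (a : Link (s i) (s j) V₁) (b : Link (s j) (s k) V₂)
    (d : Link (s i) (s k) V₃) : Twist.HasDifference
      ((b.twist.restrict (inf_le_left.trans inf_le_right)).comp
        (a.twist.restrict (inf_le_left.trans inf_le_left)))
      (d.twist.restrict inf_le_right) (linkForm htrans hs a b d) :=
  (exists_linkForm htrans (hs k) a b d).choose_spec

/-- Torsions add under composition, so dB = δH is `extD_eq` for the composite of two links and the
third. -/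
theorem extD_linkForm (htrans : A.IsTransitive) (hs : ∀ i, (s i).E.IsAlg c) {i j k : I}
    {V₁ V₂ V₃ : Opens X} (a : Link (s i) (s j) V₁) (b : Link (s j) (s k) V₂)
    (d : Link (s i) (s k) V₃) (W : Opens X) (hW : W ≤ V₁ ⊓ V₂ ⊓ V₃) (ξ : Fin 3 → VF O W) :
    extD (linkForm htrans hs a b d) W hW ξ =
      b.curv.ev W (hW.trans (inf_le_left.trans inf_le_right)) ξ -
      d.curv.ev W (hW.trans inf_le_right) ξ +
      a.curv.ev W (hW.trans (inf_le_left.trans inf_le_left)) ξ := by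
  have ha := (a.hasTorsion (hs i)).restrict
    (inf_le_left.trans inf_le_left : V₁ ⊓ V₂ ⊓ V₃ ≤ V₁)
  have hb := (b.hasTorsion (hs j)).restrict
    (inf_le_left.trans inf_le_right : V₁ ⊓ V₂ ⊓ V₃ ≤ V₂)
  have hd := (d.hasTorsion (hs i)).restrict (inf_le_right : V₁ ⊓ V₂ ⊓ V₃ ≤ V₃)
  rw [(linkForm_spec htrans hs a b d).extD_eq htrans (hs k) (hb.comp ha) hd, Form.add_ev,
    Form.res_ev, Form.res_ev, Form.res_ev]
  ring

theorem linkForm_cocycle (htrans : A.IsTransitive) (hs : ∀ i, (s i).E.IsAlg c) {i j k l : I}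
    {V₁₂ V₁₃ V₁₄ V₂₃ V₂₄ V₃₄ : Opens X} (ij : Link (s i) (s j) V₁₂) (ik : Link (s i) (s k) V₁₃)
    (il : Link (s i) (s l) V₁₄) (jk : Link (s j) (s k) V₂₃) (jl : Link (s j) (s l) V₂₄)
    (kl : Link (s k) (s l) V₃₄) (W : Opens X) (hij : W ≤ V₁₂) (hik : W ≤ V₁₃) (hil : W ≤ V₁₄)
    (hjk : W ≤ V₂₃) (hjl : W ≤ V₂₄) (hkl : W ≤ V₃₄) (ξ : Fin 2 → VF O W) :
    (linkForm htrans hs jk kl jl).ev W (le_inf (le_inf hjk hkl) hjl) ξ -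
      (linkForm htrans hs ik kl il).ev W (le_inf (le_inf hik hkl) hil) ξ +
      (linkForm htrans hs ij jl il).ev W (le_inf (le_inf hij hjl) hil) ξ -
      (linkForm htrans hs ij jk ik).ev W (le_inf (le_inf hij hjk) hik) ξ = 0 := by
  have key := Twist.HasDifference.cocycle htrans (hs l) (φ₁₂ := ij.twist.restrict hij)
    (φ₁₃ := ik.twist.restrict hik) (φ₁₄ := il.twist.restrict hil) (φ₂₃ := jk.twist.restrict hjk)
    (φ₂₄ := jl.twist.restrict hjl) (φ₃₄ := kl.twist.restrict hkl)
    ((linkForm_spec htrans hs ij jk ik).restrict (le_inf (le_inf hij hjk) hik))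
    ((linkForm_spec htrans hs ij jl il).restrict (le_inf (le_inf hij hjl) hil))
    ((linkForm_spec htrans hs ik kl il).restrict (le_inf (le_inf hik hkl) hil))
    ((linkForm_spec htrans hs jk kl jl).restrict (le_inf (le_inf hjk hkl) hjl))
  have := congrArg (fun b => b.ev W le_rfl ξ) key
  simp only [Form.add_ev, Form.res_ev] at this
  linear_combination -this

/-- The cocycle of all links. -/
def linkCocycle (htrans : A.IsTransitive) (hs : ∀ i, (s i).E.IsAlg c)
    (cover : ∀ x : X, ∃ i, x ∈ U i)
    (hlink : ∀ i j (x : X), x ∈ U i → x ∈ U j →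
      ∃ W : Opens X, x ∈ W ∧ Nonempty (Link (s i) (s j) W)) : Cocycle O where
  cov := linkCover s cover hlink
  H a := a.2.some.curv
  H_closed a := a.2.some.curv_isClosed
  B a b d := linkForm htrans hs a.2.some b.2.some d.2.some
  dB a b d W ha hb hd ξ :=
    extD_linkForm htrans hs a.2.some b.2.some d.2.some W (le_inf (le_inf ha hb) hd) ξ
  δB ij ik il jk jl kl W hij hik hil hjk hjl hkl ξ :=
    linkForm_cocycle htrans hs ij.2.some ik.2.some il.2.some jk.2.some jl.2.some kl.2.some W
      hij hik hil hjk hjl hkl ξ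

end Existence

/-- The covering is indexed by the points of X, with a chosen local object around each, and the
hypercovering consists of all sets on which two of them are linked. -/
theorem exists_classData {c : ℂ} (hX : HasLocalCoordinates O) (hA : A.IsLieAlgebroid)
    (htrans : A.IsTransitive) {S : ∀ U, ObjectProperty (Extension A U)} (hS : IsTorsor S)
    (hres : ∀ {U U' : Opens X} (h : U' ≤ U) (s : Extension A U), S U s → S U' (s.restrict h))
    (halg : ∀ {U} {s : Extension A U}, S U s → s.E.IsAlg c) :
    ∃ z : Cocycle O, Nonempty (ClassData S z) := by
  choose U s hxU hs using hS.locally_nonempty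
  refine ⟨linkCocycle (I := X) (s := s) htrans (fun i => halg (hs i)) (fun x => ⟨x, hxU x⟩)
    (fun i j x hi hj => exists_link hX hS hres (hs i) (hs j) hi hj), ⟨?_⟩⟩
  exact
    { s := s
      hs := hs
      Q := fun a => a.2.some.Q
      hQ := fun a => a.2.some.hQ
      σ := fun a => a.2.some.σ
      conn := fun a => a.2.some.D
      curv := fun a => Connection.hasCurvature_curvature (isAlg_of_isECA a.2.some.hQ) _
      comparison := fun {i j k} a b d => (Twist.compares_iff hA htrans (halg (hs k)) a.2.some.σ
        b.2.some.σ d.2.some.σ a.2.some.D b.2.some.D d.2.some.D _).2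
        (linkForm_spec htrans (fun i => halg (hs i)) a.2.some b.2.some d.2.some) }

namespace ClassData

variable {c : ℂ} {S : ∀ U, ObjectProperty (Extension A U)} {z z' : Cocycle O}

/-- The identification with connection over `V a`. -/
def link (K : ClassData S z) {i j : z.cov.I} (a : z.cov.J i j) : Link (K.s i) (K.s j) (z.cov.V a) :=
  ⟨_, _, K.Q a, K.hQ a, K.σ a, K.conn a⟩

theorem hasTorsion (K : ClassData S z) (halg : ∀ {U} {s : Extension A U}, S U s → s.E.IsAlg c)
    {i j : z.cov.I} (a : z.cov.J i j) : (K.link a).twist.HasTorsion (z.H a) :=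
  Twist.hasTorsion_ofBaer (halg (K.hs i)) (isAlg_of_isECA (K.hQ a)) (K.σ a) (K.curv a)

theorem hasDifference (hA : A.IsLieAlgebroid) (htrans : A.IsTransitive) (K : ClassData S z)
    (halg : ∀ {U} {s : Extension A U}, S U s → s.E.IsAlg c)
    {i j k : z.cov.I} (a : z.cov.J i j) (b : z.cov.J j k) (d : z.cov.J i k) :
    Twist.HasDifference
      (((K.link b).twist.restrict (inf_le_left.trans inf_le_right)).comp
        ((K.link a).twist.restrict (inf_le_left.trans inf_le_left)))
      ((K.link d).twist.restrict inf_le_right) (z.B a b d) :=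
  (Twist.compares_iff hA htrans (halg (K.hs k)) (K.σ a) (K.σ b) (K.σ d) (K.conn a) (K.conn b)
    (K.conn d) (z.B a b d)).1 (K.comparison a b d)

/-- The common refinement of the hypercoverings of two choices of local data. -/
def refinement (K : ClassData S z) (K' : ClassData S z')
    (hlink : ∀ i i' (x : X), x ∈ z.cov.U i → x ∈ z'.cov.U i' →
      ∃ W : Opens X, x ∈ W ∧ Nonempty (Link (K.s i) (K'.s i') W)) : Hypercover X where
  I := Σ i i', {W : Opens X // Nonempty (Link (K.s i) (K'.s i') W)}
  U w := w.2.2.1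
  cover x := by
    obtain ⟨i, hi⟩ := z.cov.cover x
    obtain ⟨i', hi'⟩ := z'.cov.cover x
    obtain ⟨W, hx, hW⟩ := hlink i i' x hi hi'
    exact ⟨⟨i, i', W, hW⟩, hx⟩
  J w w' := z.cov.J w.1 w'.1 × z'.cov.J w.2.1 w'.2.1
  V {w w'} a := z.cov.V a.1 ⊓ z'.cov.V a.2 ⊓ (w.2.2.1 ⊓ w'.2.2.1)
  V_le_left _ := inf_le_right.trans inf_le_left
  V_le_right _ := inf_le_right.trans inf_le_right
  cover₂ w w' x hw hw' := by
    obtain ⟨a, ha⟩ := z.cov.cover₂ w.1 w'.1 x (w.2.2.2.some.h₁ hw) (w'.2.2.2.some.h₁ hw')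
    obtain ⟨a', ha'⟩ := z'.cov.cover₂ w.2.1 w'.2.1 x (w.2.2.2.some.h₂ hw) (w'.2.2.2.some.h₂ hw')
    exact ⟨(a, a'), ⟨ha, ha'⟩, hw, hw'⟩

/-- Objects of the two choices are joined by links p_w, whose curvatures are the 3-forms h of the
coboundary. The squares formed by two such links and the two given identifications commute up to
2-forms b. Comparing torsions in a square gives H' − H = δh + db; comparing composites along three
squares gives B' − B = δb. -/
theorem cohomologous (hX : HasLocalCoordinates O) (hA : A.IsLieAlgebroid)
    (htrans : A.IsTransitive) (hS : IsTorsor S)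
    (hres : ∀ {U U' : Opens X} (h : U' ≤ U) (s : Extension A U), S U s → S U' (s.restrict h))
    (halg : ∀ {U} {s : Extension A U}, S U s → s.E.IsAlg c) (K : ClassData S z)
    (K' : ClassData S z') : Cohomologous z z' := by
  let 𝒲 := refinement K K' fun i i' x hi hi' =>
    exists_link hX hS hres (K.hs i) (K'.hs i') hi hi'
  let p (w : 𝒲.I) : Link (K.s w.1) (K'.s w.2.1) (𝒲.U w) := w.2.2.2.some
  have hb : ∀ (w w' : 𝒲.I) (a : 𝒲.J w w'), ∃ b : Form O 2 (𝒲.V a), Twist.HasDifference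
      (((K'.link a.2).twist.restrict (inf_le_left.trans inf_le_right)).comp
        ((p w).twist.restrict (𝒲.V_le_left a)))
      (((p w').twist.restrict (𝒲.V_le_right a)).comp
        ((K.link a.1).twist.restrict (inf_le_left.trans inf_le_left))) b :=
    fun w w' a => Twist.exists_difference htrans (halg (K'.hs w'.2.1)) _ _
  choose b hb using hb
  refine ⟨𝒲, ⟨fun w => w.1, fun a => a.1, fun w => (p w).h₁, fun a => inf_le_left.trans inf_le_left⟩,
    ⟨fun w => w.2.1, fun a => a.2, fun w => (p w).h₂, fun a => inf_le_left.trans inf_le_right⟩,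
    fun w => (p w).curv, b, fun w => (p w).curv_isClosed, ?_, ?_⟩
  · intro w w' a W hW ξ
    have t1 := ((K'.hasTorsion halg a.2).restrict
      (inf_le_left.trans inf_le_right : 𝒲.V a ≤ z'.cov.V a.2)).comp
      (((p w).hasTorsion (halg (K.hs w.1))).restrict (𝒲.V_le_left a))
    have t2 := (((p w').hasTorsion (halg (K.hs w'.1))).restrict (𝒲.V_le_right a)).comp
      ((K.hasTorsion halg a.1).restrict (inf_le_left.trans inf_le_left : 𝒲.V a ≤ z.cov.V a.1))
    have aux : ∀ x y f f' e : Sec O W, e = f + x - (y + f') → x - y = f' - f + e := by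
      intro x y f f' e h
      rw [h]
      ring
    exact aux _ _ _ _ _ ((hb w w' a).extD_eq htrans (halg (K'.hs w'.2.1)) t1 t2 W hW ξ)
  · intro w₁ w₂ w₃ a₁₂ a₂₃ a₁₃ W h₁₂ h₂₃ h₁₃ ξ
    have hG := halg (K'.hs w₃.2.1)
    have k₁₂ : W ≤ z.cov.V a₁₂.1 := h₁₂.trans (inf_le_left.trans inf_le_left)
    have k₂₃ : W ≤ z.cov.V a₂₃.1 := h₂₃.trans (inf_le_left.trans inf_le_left)
    have k₁₃ : W ≤ z.cov.V a₁₃.1 := h₁₃.trans (inf_le_left.trans inf_le_left)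
    have k₁₂' : W ≤ z'.cov.V a₁₂.2 := h₁₂.trans (inf_le_left.trans inf_le_right)
    have k₂₃' : W ≤ z'.cov.V a₂₃.2 := h₂₃.trans (inf_le_left.trans inf_le_right)
    have k₁₃' : W ≤ z'.cov.V a₁₃.2 := h₁₃.trans (inf_le_left.trans inf_le_right)
    have l₁ : W ≤ 𝒲.U w₁ := h₁₂.trans (𝒲.V_le_left a₁₂)
    have l₂ : W ≤ 𝒲.U w₂ := h₁₂.trans (𝒲.V_le_right a₁₂)
    have l₃ : W ≤ 𝒲.U w₃ := h₂₃.trans (𝒲.V_le_right a₂₃)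
    have d := (K.hasDifference hA htrans halg a₁₂.1 a₂₃.1 a₁₃.1).restrict
      (le_inf (le_inf k₁₂ k₂₃) k₁₃)
    have d' := (K'.hasDifference hA htrans halg a₁₂.2 a₂₃.2 a₁₃.2).restrict
      (le_inf (le_inf k₁₂' k₂₃') k₁₃')
    have e₁₂ := (hb _ _ a₁₂).restrict h₁₂
    have e₂₃ := (hb _ _ a₂₃).restrict h₂₃
    have e₁₃ := (hb _ _ a₁₃).restrict h₁₃
    -- φ'₂₃φ'₁₂p₁ is compared with p₃φ₁₃ in two ways: through φ'₁₃p₁, and through φ'₂₃p₂φ₁₂ and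
    -- p₃φ₂₃φ₁₂.
    have key := Twist.HasDifference.unique htrans
      (φ := (((K'.link a₂₃.2).twist.restrict k₂₃').comp
        (((K'.link a₁₂.2).twist.restrict k₁₂').comp ((p w₁).twist.restrict l₁))))
      (ψ := ((p w₃).twist.restrict l₃).comp ((K.link a₁₃.1).twist.restrict k₁₃))
      ((d'.comp_right ((p w₁).twist.restrict l₁)).trans e₁₃)
      (((e₁₂.comp_left htrans hG ((K'.link a₂₃.2).twist.restrict k₂₃')).trans
        (e₂₃.comp_right ((K.link a₁₂.1).twist.restrict k₁₂))).trans
        (d.comp_left htrans hG ((p w₃).twist.restrict l₃)))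
    have aux : ∀ x y f f' f'' : Sec O W, x + f = f'' + f' + y → x - y = f' - f + f'' := by
      intro x y f f' f'' h
      linear_combination h
    exact aux _ _ _ _ _ (congrArg (fun b => b.ev W le_rfl ξ) key)

end ClassData

end

/-! ### Opposite connections and the class of the Courant extensions -/

section

variable {O : TopCat.Sheaf (CommAlgCat.{u} ℂ) X} {A : LieAlgebroidData O}

open AlgebroidData

/-- The opposite connection. -/
def Connection.neg {U : Opens X} {Q : Extension (tangent O) U} (D : Connection Q) :
    Connection Q.neg where
  toFun := D.toFun
  map_res := D.map_res
  map_smul := D.map_smul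
  anchor_toFun := D.anchor_toFun
  isotropic hV ξ η := by
    change -Q.E.pair hV _ _ = 0
    rw [D.isotropic, neg_zero]

theorem Connection.HasCurvature.neg {U : Opens X} {Q : Extension (tangent O) U} {D : Connection Q}
    {H : Form O 3 U} (h : D.HasCurvature H) : D.neg.HasCurvature (-H) := by
  intro V hV ξ
  rw [Form.neg_ev, h hV ξ]
  rfl

namespace Twist

variable {Ahat : Extension A ⊤} {U₁ U₂ U₃ W : Opens X} {h₁ : W ≤ U₁} {h₂ : W ≤ U₂} {h₃ : W ≤ U₃}
  {s₁ : Extension (tangent O) U₁} {s₂ : Extension (tangent O) U₂} {s₃ : Extension (tangent O) U₃}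
  {E₁ : Extension A U₁} {E₂ : Extension A U₂} {E₃ : Extension A U₃}
  {δ₁ : BaerMap (-1) (Ahat.restrict (le_top : U₁ ≤ ⊤)) s₁ E₁}
  {δ₂ : BaerMap (-1) (Ahat.restrict (le_top : U₂ ≤ ⊤)) s₂ E₂}
  {δ₃ : BaerMap (-1) (Ahat.restrict (le_top : U₃ ≤ ⊤)) s₃ E₃}

/-- The compatibility of a twisted morphism between exact extensions with one between the
differences `Â - s`. -/
def Intertwines (δ₁ : BaerMap (-1) (Ahat.restrict (le_top : U₁ ≤ ⊤)) s₁ E₁)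
    (δ₂ : BaerMap (-1) (Ahat.restrict (le_top : U₂ ≤ ⊤)) s₂ E₂)
    (φ : Twist h₁ h₂ s₁ s₂) (ψ : Twist h₁ h₂ E₁ E₂) : Prop :=
  ∀ (V : Opens X) (hV : V ≤ W) (x : fib (Ahat.restrict (le_top : U₁ ≤ ⊤)).E s₁.E (hV.trans h₁))
    (y : fib (Ahat.restrict (le_top : U₂ ≤ ⊤)).E s₂.E (hV.trans h₂)),
    y.1.1 = x.1.1 → y.1.2 = φ.toFun hV x.1.2 →
    ψ.toFun hV (δ₁.toFun _ x) = δ₂.toFun _ y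

theorem mem_fib_toFun (φ : Twist h₁ h₂ s₁ s₂) {V : Opens X} (hV : V ≤ W)
    (x : fib (Ahat.restrict (le_top : U₁ ≤ ⊤)).E s₁.E (hV.trans h₁)) :
    (x.1.1, φ.toFun hV x.1.2) ∈ fib (Ahat.restrict (le_top : U₂ ≤ ⊤)).E s₂.E (hV.trans h₂) := by
  rw [mem_fib]
  refine Eq.trans ?_ (φ.anchor_toFun hV x.1.2).symm
  exact x.2

theorem Intertwines.comp {φ : Twist h₁ h₂ s₁ s₂} {φ' : Twist h₂ h₃ s₂ s₃} {ψ : Twist h₁ h₂ E₁ E₂}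
    {ψ' : Twist h₂ h₃ E₂ E₃} (h' : Intertwines δ₂ δ₃ φ' ψ') (h : Intertwines δ₁ δ₂ φ ψ) :
    Intertwines δ₁ δ₃ (φ'.comp φ) (ψ'.comp ψ) := by
  intro V hV x y hy hy'
  rw [comp_toFun, h V hV x ⟨_, mem_fib_toFun φ hV x⟩ rfl rfl]
  exact h' V hV _ y hy hy'

theorem Intertwines.restrict {φ : Twist h₁ h₂ s₁ s₂} {ψ : Twist h₁ h₂ E₁ E₂}
    (h : Intertwines δ₁ δ₂ φ ψ) {W' : Opens X} (h' : W' ≤ W) :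
    Intertwines δ₁ δ₂ (φ.restrict h') (ψ.restrict h') := fun V hV => h V (hV.trans h')

/-- Sections of Â − s are locally pairs (a, v), of which the twists move only v. Since v enters the
pairing with the factor −1, the 2-form changes sign. -/
theorem HasDifference.of_intertwines {φ φ' : Twist h₁ h₂ s₁ s₂} {ψ ψ' : Twist h₁ h₂ E₁ E₂}
    {b : Form O 2 W} (hb : HasDifference φ φ' b) (h : Intertwines δ₁ δ₂ φ ψ)
    (h' : Intertwines δ₁ δ₂ φ' ψ') : HasDifference ψ ψ' (-b) := by
  intro V hV x e
  refine sec_ext fun p hp => ?_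
  obtain ⟨Y, hY, y, hpY, hy⟩ := δ₁.surj (hV.trans h₁) x p hp
  obtain ⟨Z, hZ, w, hpZ, hw⟩ := δ₂.surj ((hY.trans hV).trans h₂) (E₂.E.res (hV.trans h₂) hY e) p hpY
  have hZV : Z ≤ V := hZ.trans hY
  have hZW : Z ≤ W := hZV.trans hV
  set y' := (fibPsh (Ahat.restrict (le_top : U₁ ≤ ⊤)).E s₁.E).res ((hY.trans hV).trans h₁) hZ y
    with hy'
  have hx : E₁.E.res (hV.trans h₁) hZV x = δ₁.toFun (hZW.trans h₁) y' := by
    rw [hy', ← δ₁.res_toFun, hy, E₁.E.res_res]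
  have he : E₂.E.res (hV.trans h₂) hZV e = δ₂.toFun (hZW.trans h₂) w := by
    rw [hw, E₂.E.res_res]
  refine ⟨Z, hZV, hpZ, ?_⟩
  rw [E₂.E.res_pair (hV.trans h₂), map_sub, ψ.map_res, ψ'.map_res, Form.rs_ev_two,
    E₁.E.res_anchor, E₂.E.res_anchor, hx, he,
    h Z hZW y' ⟨_, mem_fib_toFun φ hZW y'⟩ rfl rfl,
    h' Z hZW y' ⟨_, mem_fib_toFun φ' hZW y'⟩ rfl rfl, map_sub, LinearMap.sub_apply,
    δ₂.map_pair, δ₂.map_pair, δ₁.anchor_toFun, δ₂.anchor_toFun, Form.neg_ev]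
  have hy1 : (Ahat.restrict (le_top : U₁ ≤ ⊤)).E.anchor (hZW.trans h₁) y'.1.1 =
    s₁.E.anchor _ y'.1.2 := y'.2
  have hw1 : (Ahat.restrict (le_top : U₂ ≤ ⊤)).E.anchor (hZW.trans h₂) w.1.1 =
    s₂.E.anchor _ w.1.2 := w.2
  rw [hy1, hw1, ← hb Z hZW y'.1.2 w.1.2, map_sub, LinearMap.sub_apply, neg_one_smul, neg_one_smul]
  ring

end Twist

/-- The local objects sᵢ are replaced by Â − sᵢ, the algebroids and connections by their opposites.
Associativity gives (Â − sᵢ) + (−Qₐ) = Â − sⱼ by the formula on pairs, so the new twists are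
intertwined with the old ones; curvatures and comparison forms become their negatives. -/
theorem ClassData.exists_neg (hX : HasLocalCoordinates O) (hA : A.IsLieAlgebroid)
    (htrans : A.IsTransitive) {Ahat : Extension A ⊤} (hAhat : Ahat.E.IsAlg 1) {κ : A.InvPairing}
    (hκ : Ahat.Induces κ) {z : Cocycle O} (K : ClassData (isEVA O) z) :
    Nonempty (ClassData (isCEXT A κ) z.neg) := by
  have hD := fun i => exists_baer_neg hX hA htrans
    (s := Ahat.restrict (le_top : z.cov.U i ≤ ⊤)) (hAhat.restrict (le_top : z.cov.U i ≤ ⊤))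
    (hκ.restrict (le_top : z.cov.U i ≤ ⊤)) (K.hs i)
  choose D hD δ using hD
  have hDalg : ∀ i, (D i).E.IsAlg 0 := fun i =>
    isAlg_zero_iff.2 (hD i).1
  have hσ : ∀ (i j : z.cov.I) (a : z.cov.J i j), ∃ σ : BaerMap 1
      ((D i).restrict (z.cov.V_le_left a)) (K.Q a).neg ((D j).restrict (z.cov.V_le_right a)),
      Twist.Intertwines (δ i).some (δ j).some (K.link a).twist (Twist.ofBaer σ (K.conn a).neg) := by
    intro i j a
    have h1 : ((D i).restrict (z.cov.V_le_left a)).E.IsAlg (1 + -1) := by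
      rw [add_neg_cancel]
      exact (hDalg i).restrict (z.cov.V_le_left a)
    have h2 : ((D j).restrict (z.cov.V_le_right a)).E.IsAlg (1 + -1 + -0) := by
      rw [add_neg_cancel, neg_zero, add_zero]
      exact (hDalg j).restrict (z.cov.V_le_right a)
    obtain ⟨σ, hσ, -⟩ := BaerMap.exists_assoc hA htrans
      (hAhat.restrict (le_top : z.cov.V a ≤ ⊤))
      ((isAlg_of_isEVA (K.hs i)).restrict (z.cov.V_le_left a)).neg
      (isAlg_of_isECA (K.hQ a)).neg h1 h2 ((δ i).some.restrict (z.cov.V_le_left a)).negRight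
      (K.σ a).negAll ((δ j).some.restrict (z.cov.V_le_right a)).negRight
    refine ⟨σ, fun V hV x y hxy hxy' => ?_⟩
    have hm := Twist.mem_fib_conn (h₁ := z.cov.V_le_left a) (K.conn a) hV x.1.2
    refine hσ hV x ⟨_, hm⟩ _ y rfl ?_ (Prod.ext hxy hxy')
    refine Prod.ext rfl ?_
    refine congrArg ((K.conn a).toFun hV) ?_
    refine ((δ i).some.anchor_toFun (hV.trans (z.cov.V_le_left a)) x).trans ?_
    exact x.2
  choose σ hσ using hσ
  exact
    ⟨{ s := D
       hs := hD
       Q := fun a => (K.Q a).neg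
       hQ := fun a => (K.hQ a).neg
       σ := fun a => σ _ _ a
       conn := fun a => (K.conn a).neg
       curv := fun a => Connection.HasCurvature.neg (K.curv a)
       comparison := fun {i j k} a b d => (Twist.compares_iff hA htrans (hDalg k) (σ i j a) (σ j k b)
        (σ i k d) (K.conn a).neg (K.conn b).neg (K.conn d).neg (-z.B a b d)).2
        ((K.hasDifference (tangent_isLieAlgebroid O) (tangent_isTransitive O) isAlg_of_isEVA
          a b d).of_intertwines
          (((hσ j k b).restrict _).comp ((hσ i j a).restrict _)) ((hσ i k d).restrict _)) }⟩

end

end VertexAlgebroids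

end

/-! ### The main theorem -/

open VertexAlgebroids in
theorem mainTheorem3 {X : TopCat.{u}} (O : TopCat.Sheaf (CommAlgCat.{u} ℂ) X)
    (hX : HasLocalCoordinates O) (A : LieAlgebroidData O) (hA : A.IsLieAlgebroid)
    (htrans : A.IsTransitive) (hfree : A.IsLocallyFree)
    (Ahat : Extension A ⊤) (hAhat : Ahat.E.IsVertex) :
    (∃! κ : A.InvPairing, Ahat.Induces κ) ∧
    ∀ κ : A.InvPairing, Ahat.Induces κ →
      Nonempty (DifferenceFunctor Ahat κ) ∧
      (∀ D : DifferenceFunctor Ahat κ,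
        (∀ U : Opens X, (D.F U).IsEquivalence) ∧ D.CommutesWithRestriction ∧ D.AntiCommutes) ∧
      IsTorsor (isEVA O) ∧ IsTorsor (isCEXT A κ) ∧
      ∃ γ : H2 O, (∀ γ' : H2 O, HasClass (isEVA O) γ' ↔ γ' = γ) ∧
        (∀ γ' : H2 O, HasClass (isCEXT A κ) γ' ↔ γ' = -γ) := by
  have hAhat' : Ahat.E.IsAlg 1 := AlgebroidData.isAlg_one_iff.2 hAhat
  refine ⟨existsUnique_induces Ahat hAhat', fun κ hκ => ?_⟩
  have hT := tangent_isLieAlgebroid O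
  have hT' := tangent_isTransitive O
  have hV : IsTorsor (isEVA O) := isTorsor_of hX hT hT' (isEVA O) isAlg_of_isEVA
    (fun hs hs' => Extension.samePairing_tangent (isAlg_of_isEVA hs) (isAlg_of_isEVA hs'))
    (fun _ hs' _ => AlgebroidData.isAlg_one_iff.1 hs') (exists_isEVA hX)
  have hC : IsTorsor (isCEXT A κ) := isTorsor_of hX hA htrans (isCEXT A κ)
    (fun hs => AlgebroidData.isAlg_zero_iff.2 hs.1)
    (fun hs hs' => Extension.samePairing_of_induces hs.2 hs'.2)
    (fun hs hs' h => ⟨AlgebroidData.isAlg_zero_iff.1 hs', Extension.induces_of_samePairing hs.2 h⟩)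
    -- A local exact vertex algebroid V in coordinates yields the local Courant extension Â − V.
    fun x => by
      obtain ⟨U, V, hxU, hV⟩ := exists_isEVA hX x
      obtain ⟨D, hD, -⟩ := exists_baer_neg hX hA htrans (s := Ahat.restrict (le_top : U ≤ ⊤))
        (hAhat'.restrict (le_top : U ≤ ⊤)) (hκ.restrict (le_top : U ≤ ⊤)) hV
      exact ⟨U, D, hxU, hD⟩
  refine ⟨exists_differenceFunctor hX hA htrans hAhat' hκ, fun D =>
    ⟨D.isEquivalence hX hA htrans hAhat' hκ, D.commutesWithRestriction hA htrans hAhat',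
      D.antiCommutes hA htrans hAhat'⟩, hV, hC, ?_⟩
  have hVres : ∀ {U U' : Opens X} (h : U' ≤ U) (s : Extension (tangent O) U),
      isEVA O U s → isEVA O U' (s.restrict h) := fun h _ hs => AlgebroidData.IsVertex.restrict hs h
  have hCres : ∀ {U U' : Opens X} (h : U' ≤ U) (s : Extension A U),
      isCEXT A κ U s → isCEXT A κ U' (s.restrict h) := fun h _ hs =>
    ⟨AlgebroidData.IsCourant.restrict hs.1 h, Extension.Induces.restrict hs.2 h⟩
  obtain ⟨z, ⟨K⟩⟩ := exists_classData hX hT hT' hV hVres isAlg_of_isEVA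
  obtain ⟨K'⟩ := K.exists_neg hX hA htrans hAhat' hκ
  -- One cocycle `z` represents the class of the vertex side, and `z.neg` that of the Courant side
  -- for the transported data. Any other choices on either side give cohomologous cocycles.
  refine ⟨Quot.mk _ z, fun γ' => ⟨?_, fun h => ⟨z, ⟨K⟩, h.symm⟩⟩, fun γ' => ⟨?_, fun h =>
    ⟨z.neg, ⟨K'⟩, h.symm⟩⟩⟩
  · rintro ⟨z', ⟨L⟩, rfl⟩
    exact Quot.sound (ClassData.cohomologous hX hT hT' hV hVres isAlg_of_isEVA L K)
  · rintro ⟨z', ⟨L⟩, rfl⟩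
    exact Quot.sound (ClassData.cohomologous hX hA htrans hC hCres
      (fun hs => AlgebroidData.isAlg_zero_iff.2 hs.1) L K')
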